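/- Let $\omega=A\,dx+B\,dy$ be a germ at $0\in\mathbb C^2$ of a holomorphic $1$-form with at most an isolated zero at $0$, and let $\mathcal F$ be the germ of (possibly singular) foliation it defines. A germ of curve $S=(f=0)$ at $0$, with $f$ reduced (squarefree in the ring of germs of holomorphic functions) and $f(0)=0$, is called invariant by $\mathcal F$ (a separatrix, not necessarily irreducible) if $f$ divides $\omega\wedge df$. Assume that $\mathcal F$ is non-dicritical, i.e. that it has only finitely many separatrices, and let $S=(f=0)$, $f$ reduced, be a curve invariant by $\mathcal F$. Let $\pi:\widetilde{\mathbb C^2}\to(\mathbb C^2,0)$ be a resolution of the singularities of $\mathcal F$ (the minimal one or any other): $\pi$ is a composition of finitely many blow-ups of points lying over $0$, starting from an open neighbourhood of $0$, and at every point of $\pi^{-1}(0)$ the strict transform of $\mathcal F$ is either regular or has a reduced singularity, that is, it is given by a holomorphic vector field with an isolated zero whose linear part has eigenvalues $a,b$ with $b\neq0$ and $a/b\notin\mathbb Q_{>0}$. Then the meromorphic $1$-form $\pi^*(\omega/f)$ is logarithmic on a neighbourhood of $\pi^{-1}(0)$ in $\widetilde{\mathbb C^2}$: at each point $q$ of this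 neighbourhood there is a reduced germ of holomorphic function $h$ such that $h\,\pi^*(\omega/f)$ and $h\,d\big(\pi^*(\omega/f)\big)$ are holomorphic at $q$ (i.e. $\pi^*(\omega/f)$ and its differential have at most simple poles). -/

import Mathlib

open Filter Topology Set
open scoped Manifold

noncomputable section

/-! ### Germs of functions and of 1-forms on the complex plane

Germs at a point are represented by functions defined on `ℂ × ℂ`; only their values near the point
matter. A holomorphic 1-form `A dx + B dy` is a map `ω : ℂ × ℂ → (ℂ × ℂ →L[ℂ] ℂ)`, with
`A z = ω z (1, 0)` and `B z = ω z (0, 1)`. -/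

/-- Divisibility `u ∣ v` in the ring of germs at `z₀` of holomorphic functions. -/
def GermDvd (u v : ℂ × ℂ → ℂ) (z₀ : ℂ × ℂ) : Prop :=
  ∃ k : ℂ × ℂ → ℂ, AnalyticAt ℂ k z₀ ∧ ∀ᶠ z in 𝓝 z₀, v z = u z * k z

/-- `f` is a germ of holomorphic function at `z₀` which is reduced: it is squarefree in the ring of
germs at `z₀`, i.e. divisible by no square of a non-unit (in particular the germ is not zero).
Units are reduced. -/
def IsReducedGerm (f : ℂ × ℂ → ℂ) (z₀ : ℂ × ℂ) : Prop :=
  AnalyticAt ℂ f z₀ ∧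
    ∀ u : ℂ × ℂ → ℂ, AnalyticAt ℂ u z₀ → GermDvd (fun z => u z ^ 2) f z₀ → u z₀ ≠ 0

/-- The coefficient of `dx ∧ dy` in the exterior derivative of the 1-form `Ω`. -/
def dCoeff (Ω : ℂ × ℂ → (ℂ × ℂ →L[ℂ] ℂ)) (z : ℂ × ℂ) : ℂ :=
  extDeriv (fun w => ContinuousAlternatingMap.ofSubsingleton ℂ (ℂ × ℂ) ℂ (0 : Fin 1) (Ω w)) z
    ![(1, 0), (0, 1)]

/-- `d(A dx + B dy) = (∂B/∂x - ∂A/∂y) dx ∧ dy`. -/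
theorem dCoeff_eq (Ω : ℂ × ℂ → (ℂ × ℂ →L[ℂ] ℂ)) (z : ℂ × ℂ) (h : DifferentiableAt ℂ Ω z) :
    dCoeff Ω z = fderiv ℂ Ω z (1, 0) (0, 1) - fderiv ℂ Ω z (0, 1) (1, 0) := by
  have key := ((ContinuousAlternatingMap.ofSubsingletonLIE (𝕜 := ℂ) (E := ℂ × ℂ) (F := ℂ)
    (0 : Fin 1)).toContinuousLinearEquiv.toContinuousLinearMap.hasFDerivAt (x := Ω z)).comp z
    h.hasFDerivAt
  have e : fderiv ℂ (fun w => ContinuousAlternatingMap.ofSubsingleton ℂ (ℂ × ℂ) ℂ (0 : Fin 1)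
      (Ω w)) z = _ := key.fderiv
  rw [dCoeff, extDeriv, e, ContinuousAlternatingMap.alternatizeUncurryFin_apply]
  simp [Fin.sum_univ_two, Fin.removeNth, sub_eq_add_neg]

/-- The coefficient of `dx ∧ dy` in the 2-form `ω ∧ df`. -/
def wedgeCoeff (ω : ℂ × ℂ → (ℂ × ℂ →L[ℂ] ℂ)) (f : ℂ × ℂ → ℂ) (z : ℂ × ℂ) : ℂ :=
  ω z (1, 0) * fderiv ℂ f z (0, 1) - ω z (0, 1) * fderiv ℂ f z (1, 0)

/-! ### Foliation germs, invariant curves, non-dicriticity -/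

/-- `ω` is a holomorphic 1-form near `z₀` with no zero near `z₀` except possibly `z₀` itself, so
that it defines the germ at `z₀` of a (possibly singular) foliation. -/
def IsFoliationForm (ω : ℂ × ℂ → (ℂ × ℂ →L[ℂ] ℂ)) (z₀ : ℂ × ℂ) : Prop :=
  AnalyticAt ℂ ω z₀ ∧ ∀ᶠ z in 𝓝[≠] z₀, ω z ≠ 0

/-- `f = 0` is a reduced equation of a curve germ at the origin (not necessarily irreducible)
which is invariant by the foliation given by `ω`: `f` divides `ω ∧ df`. -/
def IsInvariantCurveEquation (ω : ℂ × ℂ → (ℂ × ℂ →L[ℂ] ℂ)) (f : ℂ × ℂ → ℂ) : Prop :=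
  IsReducedGerm f 0 ∧ f 0 = 0 ∧ GermDvd f (wedgeCoeff ω f) 0

/-- The set of separatrices (invariant curves) of the foliation germ at the origin given by `ω`;
a curve germ is a germ at the origin of a subset of `ℂ × ℂ`. -/
def separatrices (ω : ℂ × ℂ → (ℂ × ℂ →L[ℂ] ℂ)) : Set (Germ (𝓝 (0 : ℂ × ℂ)) Prop) :=
  {S | ∃ f : ℂ × ℂ → ℂ, IsInvariantCurveEquation ω f ∧ S = ↑(fun z : ℂ × ℂ => f z = 0)}

/-- The foliation germ at the origin given by `ω` has only finitely many separatrices. -/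
def IsNonDicritical (ω : ℂ × ℂ → (ℂ × ℂ →L[ℂ] ℂ)) : Prop :=
  (separatrices ω).Finite

/-! ### Logarithmic forms -/

/-- The germ at `z₀` of the meromorphic 1-form `Ω = η / g` is logarithmic: `Ω` and `dΩ` have at most
simple poles, i.e. there is a reduced germ `h` such that `h Ω` and `h dΩ` are holomorphic. Here `η`
is a holomorphic 1-form, `g` is a holomorphic function which is not identically zero near `z₀`, and
`h Ω`, `h dΩ` coincide with holomorphic forms on the dense open set `g ≠ 0` on which the formula
`Ω = g⁻¹ η` makes sense. -/
def IsLogarithmicAt (η : ℂ × ℂ → (ℂ × ℂ →L[ℂ] ℂ)) (g : ℂ × ℂ → ℂ) (z₀ : ℂ × ℂ) : Prop :=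
  AnalyticAt ℂ η z₀ ∧ AnalyticAt ℂ g z₀ ∧ (¬ ∀ᶠ z in 𝓝 z₀, g z = 0) ∧
    ∃ (h : ℂ × ℂ → ℂ) (α : ℂ × ℂ → (ℂ × ℂ →L[ℂ] ℂ)) (γ : ℂ × ℂ → ℂ),
      IsReducedGerm h z₀ ∧ AnalyticAt ℂ α z₀ ∧ AnalyticAt ℂ γ z₀ ∧
      ∀ᶠ z in 𝓝 z₀, g z ≠ 0 →
        h z • ((g z)⁻¹ • η z) = α z ∧ h z * dCoeff (fun w => (g w)⁻¹ • η w) z = γ z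

/-! ### Complex surfaces and blow-ups -/

/-- A (Hausdorff) complex surface: a complex analytic manifold modelled on `ℂ × ℂ`. -/
structure ComplexSurface where
  carrier : Type
  [topology : TopologicalSpace carrier]
  [hausdorff : T2Space carrier]
  [charts : ChartedSpace (ℂ × ℂ) carrier]
  [holomorphic : IsManifold 𝓘(ℂ, ℂ × ℂ) (⊤ : WithTop ℕ∞) carrier]

instance : CoeSort ComplexSurface Type := ⟨ComplexSurface.carrier⟩

attribute [instance] ComplexSurface.topology ComplexSurface.hausdorff ComplexSurface.charts
  ComplexSurface.holomorphic

/-- The holomorphic charts of a complex surface (its maximal atlas). -/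
def ComplexSurface.maxAtlas (X : ComplexSurface) : Set (OpenPartialHomeomorph X (ℂ × ℂ)) :=
  IsManifold.maximalAtlas 𝓘(ℂ, ℂ × ℂ) (⊤ : WithTop ℕ∞) X.carrier

/-- `σ : Y → X` is the blow-up of the point `p` of the surface `X`. Away from `p` it is a
biholomorphism. Over the domain of a chart `φ` of `X` centred at `p` it is the standard blow-up:
`Y` is covered there by two charts `ψ₁ = (x, t)` and `ψ₂ = (s, y)`, in which `σ` is
`(x, t) ↦ (x, x t)` and `(s, y) ↦ (s y, y)`, glued along `t ≠ 0` by `(s, y) = (t⁻¹, x t)`. -/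
structure IsBlowUp {X Y : ComplexSurface} (σ : Y → X) (p : X) : Prop where
  bijOn : BijOn σ (σ ⁻¹' {p})ᶜ {p}ᶜ
  isLocalDiffeomorphAt : ∀ q : Y, σ q ≠ p →
    IsLocalDiffeomorphAt 𝓘(ℂ, ℂ × ℂ) 𝓘(ℂ, ℂ × ℂ) (⊤ : WithTop ℕ∞) σ q
  model : ∃ φ ∈ X.maxAtlas, ∃ ψ₁ ∈ Y.maxAtlas, ∃ ψ₂ ∈ Y.maxAtlas,
    p ∈ φ.source ∧ φ p = 0 ∧
    σ ⁻¹' φ.source = ψ₁.source ∪ ψ₂.source ∧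
    ψ₁.target = {w : ℂ × ℂ | (w.1, w.1 * w.2) ∈ φ.target} ∧
    ψ₂.target = {w : ℂ × ℂ | (w.1 * w.2, w.2) ∈ φ.target} ∧
    (∀ q ∈ ψ₁.source, φ (σ q) = ((ψ₁ q).1, (ψ₁ q).1 * (ψ₁ q).2)) ∧
    (∀ q ∈ ψ₂.source, φ (σ q) = ((ψ₂ q).1 * (ψ₂ q).2, (ψ₂ q).2)) ∧
    (∀ q ∈ ψ₁.source, q ∈ ψ₂.source ↔ (ψ₁ q).2 ≠ 0) ∧
    (∀ q ∈ ψ₁.source ∩ ψ₂.source, ψ₂ q = ((ψ₁ q).2⁻¹, (ψ₁ q).1 * (ψ₁ q).2))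

/-- `π : X → (ℂ², 0)` is a composition of finitely many blow-ups of points lying over the origin:
starting with a biholomorphism from a surface onto an open neighbourhood of the origin, one
successively blows up points over the origin. -/
inductive IsBlowUpComposition : (X : ComplexSurface) → (X → ℂ × ℂ) → Prop
  | neighbourhood {X : ComplexSurface} {π : X → ℂ × ℂ}
      (hdiff : IsLocalDiffeomorph 𝓘(ℂ, ℂ × ℂ) 𝓘(ℂ, ℂ × ℂ) (⊤ : WithTop ℕ∞) π)
      (hinj : Function.Injective π) (hzero : (0 : ℂ × ℂ) ∈ range π) : IsBlowUpComposition X π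
  | blowUp {X Y : ComplexSurface} {π : X → ℂ × ℂ} {σ : Y → X} {p : X}
      (hπ : IsBlowUpComposition X π) (hp : π p = 0) (hσ : IsBlowUp σ p) :
      IsBlowUpComposition Y (π ∘ σ)

/-- The map `π` read in the preferred chart of `X` at `q`. -/
def inChart {X : ComplexSurface} (π : X → ℂ × ℂ) (q : X) (z : ℂ × ℂ) : ℂ × ℂ :=
  π ((chartAt (ℂ × ℂ) q).symm z)

/-- The coordinates of the point `q` in the preferred chart at `q`. -/
def coords {X : ComplexSurface} (q : X) : ℂ × ℂ := chartAt (ℂ × ℂ) q q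

/-- The pull-back `P* ω` of a 1-form by a map `P`. -/
def pullbackForm (P : ℂ × ℂ → ℂ × ℂ) (ω : ℂ × ℂ → (ℂ × ℂ →L[ℂ] ℂ)) (z : ℂ × ℂ) :
    ℂ × ℂ →L[ℂ] ℂ :=
  (ω (P z)).comp (fderiv ℂ P z)

/-- The germ at the point `q` of the meromorphic 1-form `π* (ω / f)` is logarithmic. -/
def IsLogarithmicPullbackAt {X : ComplexSurface} (π : X → ℂ × ℂ)
    (ω : ℂ × ℂ → (ℂ × ℂ →L[ℂ] ℂ)) (f : ℂ × ℂ → ℂ) (q : X) : Prop :=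
  IsLogarithmicAt (pullbackForm (inChart π q) ω) (fun z => f (inChart π q z)) (coords q)

/-! ### Reduced singularities and resolution -/

/-- The vector field `B ∂/∂x - A ∂/∂y`, tangent to the foliation given by `A dx + B dy`. -/
def dualField (τ : ℂ × ℂ → (ℂ × ℂ →L[ℂ] ℂ)) (z : ℂ × ℂ) : ℂ × ℂ :=
  (τ z (0, 1), -τ z (1, 0))

/-- The Jacobian matrix at `z₀` of a vector field `v`. -/
def jacobian (v : ℂ × ℂ → ℂ × ℂ) (z₀ : ℂ × ℂ) : Matrix (Fin 2) (Fin 2) ℂ :=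
  !![(fderiv ℂ v z₀ (1, 0)).1, (fderiv ℂ v z₀ (0, 1)).1;
     (fderiv ℂ v z₀ (1, 0)).2, (fderiv ℂ v z₀ (0, 1)).2]

/-- The foliation given near `z₀` by `τ` is regular at `z₀`, or has a reduced (simple) singularity
there: the linear part at `z₀` of a vector field defining it has eigenvalues `a`, `b` with `b ≠ 0`
and `a / b` not a positive rational number. -/
def IsReducedFoliation (τ : ℂ × ℂ → (ℂ × ℂ →L[ℂ] ℂ)) (z₀ : ℂ × ℂ) : Prop :=
  τ z₀ ≠ 0 ∨ ∃ a b : ℂ,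
    (jacobian (dualField τ) z₀).charpoly =
      (Polynomial.X - Polynomial.C a) * (Polynomial.X - Polynomial.C b) ∧
    b ≠ 0 ∧ ∀ r : ℚ, 0 < r → a / b ≠ (r : ℂ)

/-- `τ` defines near `z₀` the foliation underlying the holomorphic 1-form `η`: it is obtained by
dividing `η` by a holomorphic function and has at most an isolated zero at `z₀`. -/
def IsSaturation (η τ : ℂ × ℂ → (ℂ × ℂ →L[ℂ] ℂ)) (z₀ : ℂ × ℂ) : Prop :=
  IsFoliationForm τ z₀ ∧
    ∃ g : ℂ × ℂ → ℂ, AnalyticAt ℂ g z₀ ∧ ∀ᶠ z in 𝓝 z₀, η z = g z • τ z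

/-- `π` is a resolution (reduction) of the singularities of the foliation germ at the origin given
by `ω`: it is a composition of finitely many point blow-ups over the origin, and at every point of
`π⁻¹(0)` the strict transform of the foliation is regular or has a reduced singularity. -/
def IsResolution (ω : ℂ × ℂ → (ℂ × ℂ →L[ℂ] ℂ)) {X : ComplexSurface} (π : X → ℂ × ℂ) : Prop :=
  IsBlowUpComposition X π ∧
    ∀ q : X, π q = 0 → ∃ τ : ℂ × ℂ → (ℂ × ℂ →L[ℂ] ℂ),
      IsSaturation (pullbackForm (inChart π q) ω) τ (coords q) ∧ IsReducedFoliation τ (coords q)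

end

/-! Read the tower of blow-ups in local coordinates as a germ F. The pull-back of ω is g τ, where τ
has at most an isolated zero. The proof carries along a reduced curve h invariant by τ and a germ k
with g h = k (f ∘ F) (`HasReducedPullback`), so that the pull-back of ω / f is k τ / h. Such a form
is logarithmic: if τ ∧ dh = h θ dx ∧ dy, then h d(k τ / h) = dk ∧ τ + k dτ + k θ dx ∧ dy
(`isLogarithmicAt_of_invariant`). At the bottom g = k = 1 and h is f in local coordinates.

Now blow up a point where the coefficients of τ have order ν and h has order m. The exceptional
curve x = 0 is invariant, so g becomes g x^ν with no further factor x. The new reduced curve is x s,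
where s is the strict transform and h pulls back to x^m s. Hence k becomes k x^(ν + 1 - m), and
everything rests on the inequality m ≤ ν + 1 (`order_le_of_separatrixBound`).

Here m is the total order of contact of the strict transform of h with the exceptional curve, and ν
+ 1 is the degree of the tangent cone x A_ν + y B_ν, which is the restriction of the strict form to
that curve. It is therefore enough to compare the two orders at each point of the exceptional curve:
this is `SeparatrixBound`. At a regular point whose leaf is the axis no other invariant curve
passes. At a reduced singularity any further invariant curve is smooth and transverse to the axis,
because the eigenvalues have no positive rational ratio (`order_lt_two_of_nonresonant`). The bound
then descends through a blow-up (`HasSeparatrixBounds.descend`): applied to the axis together with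
the curve, the inequality above becomes m ≤ ν for the multiplicity m of the curve alone, and the
chart at the strict transform of the axis adds m to one order and ν to the other. So the bounds go
down the tower and the pulled-back data go up.

Non-dicriticity enters through `GermTower.tangentCone_ne_zero`. If a tangent cone vanished
identically, the strict foliation would be transverse to the exceptional curve at all but finitely
many of the finite slopes. A holomorphic differential equation gives a leaf through each of these
points, and the leaves push down to infinitely many separatrices of ω, their equations being built
from Weierstrass polynomials (`GermTower.exists_invariantCurve`).

Reducedness is tracked through the condition that a power of the maximal ideal lies in the ideal (h,
h_x, h_y). It is stable under coordinate changes and under passing to the strict transform together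
with the exceptional curve. A squarefree germ satisfies it by Weierstrass preparation and a Bezout
identity between a polynomial and its derivative (`IsReducedGerm.hasIsolatedCurveSing`). Away from
the fibre over 0 the map is a local biholomorphism and f = 0 is smooth near, but off, the origin. -/

noncomputable section

/-! ### Cauchy integrals and holomorphic functions of two variables -/

section CauchyIntegral
open Metric Real

open scoped Classical in
/-- The Cauchy functional `h ↦ (2πi)⁻¹ ∮ h(η) dη` on continuous functions on a circle. -/
def circleFunctional (r : ℝ) (hr : 0 < r) : C(sphere (0 : ℂ) r, ℂ) →L[ℂ] ℂ :=
  LinearMap.mkContinuous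
    { toFun := fun h => (2 * π * Complex.I : ℂ)⁻¹ •
        ∮ z in C(0, r), if hz : z ∈ sphere (0 : ℂ) r then h ⟨z, hz⟩ else 0
      map_add' := by
        intro f g
        rw [← smul_add, ← circleIntegral.integral_add]
        · congr 1
          refine circleIntegral.integral_congr hr.le fun z hz => ?_
          simp only [ContinuousMap.add_apply, dif_pos hz]
        all_goals
          refine ContinuousOn.circleIntegrable hr.le ?_
          rw [continuousOn_iff_continuous_domRestrict]
        · refine f.continuous.congr fun z => ?_
          simp only [Set.domRestrict_apply]
          rw [dif_pos z.2]
        · refine g.continuous.congr fun z => ?_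
          simp only [Set.domRestrict_apply]
          rw [dif_pos z.2]
      map_smul' := by
        intro c f
        rw [RingHom.id_apply, smul_comm c, ← circleIntegral.integral_smul c]
        congr 1
        refine circleIntegral.integral_congr hr.le fun z hz => ?_
        simp only [ContinuousMap.smul_apply, dif_pos hz] }
    r (by
      intro h
      refine circleIntegral.norm_two_pi_i_inv_smul_integral_le_of_norm_le_const hr.le fun z hz => ?_
      rw [dif_pos hz]
      exact h.norm_coe_le_norm _)

open scoped Classical in
theorem circleFunctional_apply {r : ℝ} (hr : 0 < r) (h : C(sphere (0 : ℂ) r, ℂ)) (g : ℂ → ℂ)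
    (hg : ∀ z : sphere (0 : ℂ) r, h z = g z) :
    circleFunctional r hr h = (2 * π * Complex.I : ℂ)⁻¹ • ∮ z in C(0, r), g z := by
  change (2 * π * Complex.I : ℂ)⁻¹ • (∮ z in C(0, r),
    if hz : z ∈ sphere (0 : ℂ) r then h ⟨z, hz⟩ else 0) = _
  congr 1
  refine circleIntegral.integral_congr hr.le fun z hz => ?_
  simp only [dif_pos hz]
  exact hg ⟨z, hz⟩

-- Joint holomorphy comes from regarding x ↦ u(x, ·) as a map into the Banach space of continuous
-- functions on the circle. Its vector-valued Cauchy integral is analytic, and evaluation at η turns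
-- that integral into Cauchy's formula for the slice.
open scoped Classical in
theorem exists_analyticAt_slices {u : ℂ × ℂ → ℂ} {x₀ : ℂ} {ρ r : ℝ} (hρ : 0 < ρ)
    (hc : ContinuousOn u (closedBall x₀ ρ ×ˢ sphere 0 r))
    (hd : ∀ η ∈ sphere (0 : ℂ) r, DifferentiableOn ℂ (fun x => u (x, η)) (ball x₀ ρ)) :
    ∃ V : ℂ → C(sphere (0 : ℂ) r, ℂ), AnalyticAt ℂ V x₀ ∧
      ∀ x ∈ ball x₀ ρ, ∀ η : sphere (0 : ℂ) r, V x η = u (x, η) := by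
  have hcont : Continuous (fun q : closedBall x₀ ρ × sphere (0 : ℂ) r => u (q.1, q.2)) := by
    refine hc.comp_continuous (by fun_prop) fun q => ⟨q.1.2, q.2.2⟩
  let Uc : C(closedBall x₀ ρ, C(sphere (0 : ℂ) r, ℂ)) := ContinuousMap.curry ⟨_, hcont⟩
  let U : ℂ → C(sphere (0 : ℂ) r, ℂ) := fun ξ =>
    if hξ : ξ ∈ closedBall x₀ ρ then Uc ⟨ξ, hξ⟩ else 0
  have hU : ContinuousOn U (closedBall x₀ ρ) := by
    rw [continuousOn_iff_continuous_domRestrict]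
    refine Uc.continuous.congr fun z => ?_
    simp only [Set.domRestrict_apply, U]; rw [dif_pos z.2]
  have hci : CircleIntegrable U x₀ ρ := (hU.mono sphere_subset_closedBall).circleIntegrable hρ.le
  lift ρ to NNReal using hρ.le
  -- Integrability on the circle suffices here; holomorphy of the slices is used only to identify
  -- the values.
  have hps := hasFPowerSeriesOn_cauchy_integral hci (by exact_mod_cast hρ)
  refine ⟨_, hps.analyticAt, fun x hx η => ?_⟩
  have hxs : ∀ z ∈ sphere x₀ (ρ : ℝ), z - x ≠ 0 := by
    intro z hz h
    rw [sub_eq_zero] at h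
    rw [h, mem_sphere] at hz
    rw [mem_ball] at hx
    linarith
  have hci' : CircleIntegrable (fun z => (z - x)⁻¹ • U z) x₀ ρ := by
    refine ContinuousOn.circleIntegrable hρ.le
      (ContinuousOn.fun_smul (f := fun z => (z - x)⁻¹) ?_ (hU.mono sphere_subset_closedBall))
    exact ContinuousOn.inv₀ (by fun_prop) hxs
  have e1 : ((2 * π * Complex.I : ℂ)⁻¹ • ∮ z in C(x₀, ρ), (z - x)⁻¹ • U z) η =
      (2 * π * Complex.I : ℂ)⁻¹ • ∮ z in C(x₀, ρ), (z - x)⁻¹ • u (z, η) := by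
    rw [ContinuousMap.smul_apply]
    congr 1
    have := (ContinuousMap.evalCLM (M := ℂ) ℂ η).intervalIntegral_comp_comm hci'.out
    rw [circleIntegral, ContinuousMap.evalCLM_apply] at *
    rw [← this]
    have key := circleIntegral.integral_congr (f := fun z => ((z - x)⁻¹ • U z) η)
      (g := fun z => (z - x)⁻¹ • u (z, η)) hρ.le (c := x₀) (R := ρ) (by
        intro z hz
        have hz' : z ∈ closedBall x₀ (ρ : ℝ) := sphere_subset_closedBall hz
        simp only [ContinuousMap.smul_apply, U, dif_pos hz']
        rfl)
    rw [← key]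
    rfl
  rw [e1]
  refine DiffContOnCl.two_pi_i_inv_smul_circleIntegral_sub_inv_smul (f := fun x => u (x, η))
    ⟨hd η η.2, ?_⟩ hx
  rw [closure_ball x₀ hρ.ne']
  exact hc.comp (by fun_prop) fun z hz => ⟨hz, η.2⟩

/-- Cauchy integrals depend holomorphically on the parameters. -/
theorem analyticAt_cauchyIntegral {u : ℂ × ℂ → ℂ} {x₀ : ℂ} {ρ r : ℝ} (hρ : 0 < ρ) (hr : 0 < r)
    (hc : ContinuousOn u (closedBall x₀ ρ ×ˢ sphere 0 r))
    (hd : ∀ η ∈ sphere (0 : ℂ) r, DifferentiableOn ℂ (fun x => u (x, η)) (ball x₀ ρ))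
    {y₀ : ℂ} (hy : y₀ ∈ ball (0 : ℂ) r) :
    AnalyticAt ℂ (fun z : ℂ × ℂ =>
      (2 * π * Complex.I : ℂ)⁻¹ • ∮ η in C(0, r), (η - z.2)⁻¹ • u (z.1, η)) (x₀, y₀) := by
  obtain ⟨V, hV, hVu⟩ := exists_analyticAt_slices hρ hc hd
  let ι : C(sphere (0 : ℂ) r, ℂ) := ⟨fun z => z, continuous_subtype_val⟩
  -- The Cauchy kernel 1 / (η - y) is the inverse of ι - y in the Banach algebra of functions on the
  -- circle, and inversion is analytic at units. This gives analyticity in y.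
  have hunit : ∀ y ∈ ball (0 : ℂ) r, ∃ w : (C(sphere (0 : ℂ) r, ℂ))ˣ,
      (w : C(sphere (0 : ℂ) r, ℂ)) = ι - algebraMap ℂ _ y ∧ ∀ z, (Ring.inverse
        (ι - algebraMap ℂ C(sphere (0 : ℂ) r, ℂ) y)) z = ((z : ℂ) - y)⁻¹ := by
    intro y hy
    have hne : ∀ z : sphere (0 : ℂ) r, (z : ℂ) - y ≠ 0 := by
      intro z h
      rw [sub_eq_zero] at h
      have := z.2
      rw [h, mem_sphere] at this
      rw [mem_ball] at hy
      linarith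
    let w : (C(sphere (0 : ℂ) r, ℂ))ˣ :=
      ⟨ι - algebraMap ℂ _ y, ⟨fun z => ((z : ℂ) - y)⁻¹,
        Continuous.inv₀ (by fun_prop) hne⟩, by
          ext z
          simpa [ι] using mul_inv_cancel₀ (hne z), by
          ext z
          simpa [ι] using inv_mul_cancel₀ (hne z)⟩
    refine ⟨w, rfl, fun z => ?_⟩
    change (Ring.inverse (w : C(sphere (0 : ℂ) r, ℂ))) z = _
    rw [Ring.inverse_unit]
    rfl
  have hN : AnalyticAt ℂ (fun z : ℂ × ℂ =>
      Ring.inverse (ι - algebraMap ℂ C(sphere (0 : ℂ) r, ℂ) z.2)) (x₀, y₀) := by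
    obtain ⟨w, hw, -⟩ := hunit y₀ hy
    have h1 : AnalyticAt ℂ (Ring.inverse : C(sphere (0 : ℂ) r, ℂ) → _)
      (ι - algebraMap ℂ C(sphere (0 : ℂ) r, ℂ) y₀) := by
        rw [← hw]; exact analyticAt_inverse w
    refine h1.comp_of_eq (f := fun z : ℂ × ℂ => ι - algebraMap ℂ C(sphere (0 : ℂ) r, ℂ) z.2)
      (x := (x₀, y₀)) (analyticAt_const.sub ?_) rfl
    have h2 : AnalyticAt ℂ (fun z : ℂ × ℂ => z.2 • (1 : C(sphere (0 : ℂ) r, ℂ))) (x₀, y₀) :=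
      analyticAt_snd.smul analyticAt_const
    simpa only [Algebra.algebraMap_eq_smul_one] using h2
  have hV' : AnalyticAt ℂ (fun z : ℂ × ℂ => V z.1) (x₀, y₀) :=
    hV.comp_of_eq analyticAt_fst rfl
  have hall : AnalyticAt ℂ (fun z : ℂ × ℂ => circleFunctional r hr
      (Ring.inverse (ι - algebraMap ℂ C(sphere (0 : ℂ) r, ℂ) z.2) * V z.1)) (x₀, y₀) :=
    ((circleFunctional r hr).analyticAt _).comp (hN.mul hV')
  refine hall.congr ?_
  have hmem : ∀ᶠ z : ℂ × ℂ in 𝓝 (x₀, y₀), z.1 ∈ ball x₀ ρ ∧ z.2 ∈ ball (0 : ℂ) r :=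
    prod_mem_nhds (ball_mem_nhds x₀ hρ) (isOpen_ball.mem_nhds hy)
  filter_upwards [hmem] with z hz
  obtain ⟨-, -, h2⟩ := hunit z.2 hz.2
  rw [circleFunctional_apply hr _ (fun η => (η - z.2)⁻¹ • u (z.1, η))]
  intro η
  rw [ContinuousMap.mul_apply, h2, hVu _ hz.1, smul_eq_mul]

/-- A holomorphic function on a family of circles which extends holomorphically to each disc
is holomorphic in both variables. -/
theorem analyticAt_of_forall_diffContOnCl {w : ℂ × ℂ → ℂ} {x₀ : ℂ} {ρ r : ℝ} (hρ : 0 < ρ)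
    (hr : 0 < r) (hc : ContinuousOn w (closedBall x₀ ρ ×ˢ sphere 0 r))
    (hd : ∀ η ∈ sphere (0 : ℂ) r, DifferentiableOn ℂ (fun x => w (x, η)) (ball x₀ ρ))
    (hy : ∀ x ∈ ball x₀ ρ, DiffContOnCl ℂ (fun y => w (x, y)) (ball 0 r))
    {y₀ : ℂ} (hy₀ : y₀ ∈ ball (0 : ℂ) r) : AnalyticAt ℂ w (x₀, y₀) := by
  refine (analyticAt_cauchyIntegral hρ hr hc hd hy₀).congr ?_
  have hmem : ∀ᶠ z : ℂ × ℂ in 𝓝 (x₀, y₀), z.1 ∈ ball x₀ ρ ∧ z.2 ∈ ball (0 : ℂ) r :=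
    prod_mem_nhds (ball_mem_nhds x₀ hρ) (isOpen_ball.mem_nhds hy₀)
  filter_upwards [hmem] with z hz
  exact (hy z.1 hz.1).two_pi_i_inv_smul_circleIntegral_sub_inv_smul hz.2

end CauchyIntegral

/-! ### Division by a coordinate, Hadamard's lemma, and extension across a point -/

section Division
open Metric Real

theorem AnalyticAt.curry_left₂ {f : ℂ × ℂ → ℂ} {x y : ℂ} (hf : AnalyticAt ℂ f (x, y)) :
    AnalyticAt ℂ (fun x' => f (x', y)) x :=
  hf.comp_of_eq (f := fun x' : ℂ => (x', y)) (analyticAt_id.prod analyticAt_const) rfl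

theorem AnalyticAt.curry_right₂ {f : ℂ × ℂ → ℂ} {x y : ℂ} (hf : AnalyticAt ℂ f (x, y)) :
    AnalyticAt ℂ (fun y' => f (x, y')) y :=
  hf.comp_of_eq (f := fun y' : ℂ => (x, y')) (analyticAt_const.prod analyticAt_id) rfl

/-- The difference quotient `(f(x,y) - f(x,0)) / y`. -/
def dslopeSnd (f : ℂ × ℂ → ℂ) (z : ℂ × ℂ) : ℂ := dslope (fun y => f (z.1, y)) 0 z.2

theorem eq_add_mul_dslopeSnd (f : ℂ × ℂ → ℂ) (z : ℂ × ℂ) :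
    f z = f (z.1, 0) + z.2 * dslopeSnd f z := by
  have := sub_smul_dslope (fun y => f (z.1, y)) 0 z.2
  simp only [sub_zero, smul_eq_mul] at this
  rw [dslopeSnd, this]; simp

/-- For η on a circle around 0 the quotient is explicit and holomorphic in x; for fixed x the
singularity at y = 0 is removable. The criterion on families of circles then gives joint holomorphy.
-/
theorem analyticOnNhd_dslopeSnd {f : ℂ × ℂ → ℂ} {ρ r : ℝ}
    (hf : AnalyticOnNhd ℂ f (ball 0 ρ ×ˢ ball 0 r)) :
    AnalyticOnNhd ℂ (dslopeSnd f) (ball 0 ρ ×ˢ ball 0 r) := by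
  rintro ⟨x₀, y₀⟩ ⟨hx₀, hy₀⟩
  simp only [mem_ball, dist_zero_right] at hx₀ hy₀
  obtain ⟨r', hr', hr'r⟩ := exists_between hy₀
  obtain ⟨ρ', hρ', hρ'ρ⟩ := exists_between (sub_pos.2 hx₀)
  have hr0 : 0 < r' := (norm_nonneg _).trans_lt hr'
  have hsub : closedBall x₀ ρ' ⊆ ball 0 ρ := by
    intro x hx
    rw [mem_closedBall, dist_eq_norm] at hx
    rw [mem_ball, dist_zero_right]
    calc ‖x‖ = ‖(x - x₀) + x₀‖ := by simp
      _ ≤ ‖x - x₀‖ + ‖x₀‖ := norm_add_le _ _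
      _ < ρ := by linarith
  have hmem : ∀ x ∈ closedBall x₀ ρ', ∀ y ∈ closedBall (0 : ℂ) r', AnalyticAt ℂ f (x, y) := by
    intro x hx y hy
    refine hf _ ⟨hsub hx, ?_⟩
    exact closedBall_subset_ball hr'r hy
  have heq : ∀ x : ℂ, ∀ η ∈ sphere (0 : ℂ) r', dslopeSnd f (x, η) =
      η⁻¹ * (f (x, η) - f (x, 0)) := by
    intro x η hη
    have : η ≠ 0 := by
      rintro rfl
      simp at hη
      exact hr0.ne hη
    simp [dslopeSnd, dslope_of_ne _ this, slope_def_field, div_eq_inv_mul]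
  have hη0 : ∀ η ∈ sphere (0 : ℂ) r', η ≠ 0 := by
    rintro η hη rfl
    simp at hη
    exact hr0.ne hη
  have h0 : (0 : ℂ) ∈ closedBall (0 : ℂ) r' := by simpa using hr0.le
  refine analyticAt_of_forall_diffContOnCl hρ' hr0 (ContinuousOn.congr
    (f := fun z : ℂ × ℂ => z.2⁻¹ * (f (z.1, z.2) - f (z.1, 0))) ?_ ?_) ?_ ?_ ?_
  · refine ContinuousOn.mul ?_ (ContinuousOn.sub ?_ ?_)
    · exact ContinuousOn.inv₀ (by fun_prop) fun z hz => hη0 _ hz.2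
    · intro z hz
      exact (hmem z.1 hz.1 z.2 (sphere_subset_closedBall hz.2)).continuousAt.continuousWithinAt
    · intro z hz
      exact ((hmem z.1 hz.1 0 h0).continuousAt.comp_of_eq
        (f := fun z : ℂ × ℂ => (z.1, (0 : ℂ))) (by fun_prop) rfl).continuousWithinAt
  · intro z hz
    exact heq z.1 z.2 hz.2
  · intro η hη x hx
    simp only [heq _ η hη]
    have hx' := ball_subset_closedBall hx
    refine (((hmem x hx' η (sphere_subset_closedBall hη)).curry_left₂.differentiableAt.sub
      (hmem x hx' 0 h0).curry_left₂.differentiableAt).const_mul _).differentiableWithinAt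
  · intro x hx
    have hx' := ball_subset_closedBall hx
    have hd : DifferentiableOn ℂ (fun y => f (x, y)) (ball 0 r) := fun y hy =>
      (hf (x, y) ⟨hsub hx', hy⟩).curry_right₂.differentiableAt.differentiableWithinAt
    refine DifferentiableOn.diffContOnCl (DifferentiableOn.mono (t := ball 0 r) ?_ ?_)
    · exact (Complex.differentiableOn_dslope (ball_mem_nhds _ (hr0.trans hr'r))).2 hd
    · exact closure_ball_subset_closedBall.trans (closedBall_subset_ball hr'r)
  · simpa using hr'

/-- Schwarz's lemma in y, since f moves by at most 2 M from its value at y = 0. Each division by y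
costs a factor 2 / r, uniformly in x; the Weierstrass iteration depends on this. -/
theorem norm_dslopeSnd_le {f : ℂ × ℂ → ℂ} {ρ r M : ℝ} (hr : 0 < r)
    (hf : AnalyticOnNhd ℂ f (ball 0 ρ ×ˢ ball 0 r))
    (hb : ∀ z ∈ ball (0 : ℂ) ρ ×ˢ ball (0 : ℂ) r, ‖f z‖ ≤ M) :
    ∀ z ∈ ball (0 : ℂ) ρ ×ˢ ball (0 : ℂ) r, ‖dslopeSnd f z‖ ≤ 2 * M / r := by
  intro z hz
  have hd : DifferentiableOn ℂ (fun y => f (z.1, y)) (ball 0 r) := fun y hy =>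
    (hf (z.1, y) ⟨hz.1, hy⟩).curry_right₂.differentiableAt.differentiableWithinAt
  refine Complex.norm_dslope_le_div_of_mapsTo_ball hd ?_ hz.2
  intro y hy
  have h1 := hb (z.1, y) ⟨hz.1, hy⟩
  have h2 := hb (z.1, 0) ⟨hz.1, by simpa using hr⟩
  rw [mem_closedBall, dist_eq_norm]
  have := norm_sub_le (f (z.1, y)) (f (z.1, 0))
  linarith

/-- Bidiscs on which a germ is holomorphic. -/
theorem AnalyticAt.exists_analyticOnNhd_bidisc {f : ℂ × ℂ → ℂ} (hf : AnalyticAt ℂ f 0) :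
    ∃ r > 0, AnalyticOnNhd ℂ f (ball 0 r ×ˢ ball 0 r) := by
  obtain ⟨r, hr, h⟩ := Metric.eventually_nhds_iff_ball.1 hf.eventually_analyticAt
  refine ⟨r, hr, fun z hz => h z ?_⟩
  rwa [ball_prod_same] at hz

theorem bidisc_mem_nhds {ρ r : ℝ} (hρ : 0 < ρ) (hr : 0 < r) :
    (ball (0 : ℂ) ρ ×ˢ ball (0 : ℂ) r) ∈ 𝓝 (0 : ℂ × ℂ) :=
  prod_mem_nhds (ball_mem_nhds _ hρ) (ball_mem_nhds _ hr)

theorem AnalyticAt.dslopeSnd {f : ℂ × ℂ → ℂ} (hf : AnalyticAt ℂ f 0) :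
    AnalyticAt ℂ (dslopeSnd f) 0 := by
  obtain ⟨r, hr, h⟩ := hf.exists_analyticOnNhd_bidisc
  exact analyticOnNhd_dslopeSnd h 0 (by simp [hr])

theorem analyticAt_swap {z : ℂ × ℂ} : AnalyticAt ℂ (Prod.swap : ℂ × ℂ → ℂ × ℂ) z :=
  analyticAt_snd.prod analyticAt_fst

/-- A germ vanishing on `y = 0` is divisible by `y`. -/
theorem exists_eq_snd_mul {f : ℂ × ℂ → ℂ} (hf : AnalyticAt ℂ f 0)
    (h0 : ∀ᶠ x : ℂ in 𝓝 0, f (x, 0) = 0) :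
    ∃ k, AnalyticAt ℂ k 0 ∧ ∀ᶠ z in 𝓝 0, f z = z.2 * k z := by
  refine ⟨_, hf.dslopeSnd, ?_⟩
  have : ∀ᶠ z : ℂ × ℂ in 𝓝 0, f (z.1, 0) = 0 :=
    (continuous_fst.tendsto' (0 : ℂ × ℂ) 0 rfl).eventually h0
  filter_upwards [this] with z hz
  rw [eq_add_mul_dslopeSnd f z, hz, zero_add]

/-- A germ vanishing on `x = 0` is divisible by `x`. -/
theorem exists_eq_fst_mul {f : ℂ × ℂ → ℂ} (hf : AnalyticAt ℂ f 0)
    (h0 : ∀ᶠ y : ℂ in 𝓝 0, f (0, y) = 0) :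
    ∃ k, AnalyticAt ℂ k 0 ∧ ∀ᶠ z in 𝓝 0, f z = z.1 * k z := by
  obtain ⟨k, hk, h⟩ := exists_eq_snd_mul (f := f ∘ Prod.swap)
    (hf.comp_of_eq analyticAt_swap rfl) h0
  refine ⟨k ∘ Prod.swap, hk.comp_of_eq analyticAt_swap rfl, ?_⟩
  have := (continuous_swap.tendsto' (0 : ℂ × ℂ) 0 rfl).eventually h
  filter_upwards [this] with z hz
  simpa using hz

/-- Hadamard's lemma. -/
theorem exists_eq_fst_mul_add_snd_mul {f : ℂ × ℂ → ℂ} (hf : AnalyticAt ℂ f 0) (h0 : f 0 = 0) :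
    ∃ a b, AnalyticAt ℂ a 0 ∧ AnalyticAt ℂ b 0 ∧ ∀ᶠ z in 𝓝 0, f z = z.1 * a z + z.2 * b z := by
  have h1 : AnalyticAt ℂ (fun z : ℂ × ℂ => f (z.1, 0)) 0 :=
    hf.comp_of_eq (analyticAt_fst.prod analyticAt_const) rfl
  obtain ⟨a, ha, h⟩ := exists_eq_fst_mul h1 (by
    filter_upwards with y
    exact h0)
  refine ⟨a, dslopeSnd f, ha, hf.dslopeSnd, ?_⟩
  filter_upwards [h] with z hz
  rw [← hz, ← eq_add_mul_dslopeSnd]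

/-- A function holomorphic on a punctured neighbourhood of the origin of `ℂ × ℂ` extends
holomorphically to the origin. -/
theorem exists_analyticAt_of_punctured {u : ℂ × ℂ → ℂ}
    (hu : ∀ᶠ z in 𝓝[≠] (0 : ℂ × ℂ), AnalyticAt ℂ u z) :
    ∃ v, AnalyticAt ℂ v 0 ∧ ∀ᶠ z in 𝓝[≠] 0, v z = u z := by
  rw [eventually_nhdsWithin_iff] at hu
  obtain ⟨R', hR', h⟩ := Metric.eventually_nhds_iff_ball.1 hu
  set R := R' / 2 with hRdef
  have hR : 0 < R := by positivity
  have hA : ∀ x y : ℂ, ‖x‖ ≤ R → ‖y‖ ≤ R → (x, y) ≠ 0 → AnalyticAt ℂ u (x, y) := by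
    intro x y hx hy hne
    refine h _ ?_ hne
    rw [mem_ball, dist_zero_right, Prod.norm_def]
    exact max_lt (by simp only; linarith) (by simp only; linarith)
  have hη : ∀ x : ℂ, ∀ η ∈ sphere (0 : ℂ) R, ((x, η) : ℂ × ℂ) ≠ 0 := by
    intro x η hη h0
    rw [Prod.mk_eq_zero] at h0
    rw [h0.2] at hη
    simp at hη
    exact hR.ne hη
  have hv : ∀ y₀ ∈ ball (0 : ℂ) R, AnalyticAt ℂ (fun z : ℂ × ℂ =>
      (2 * π * Complex.I : ℂ)⁻¹ • ∮ η in C(0, R), (η - z.2)⁻¹ • u (z.1, η)) (0, y₀) := by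
    intro y₀ hy₀
    refine analyticAt_cauchyIntegral hR hR ?_ ?_ hy₀
    · rintro ⟨x, y⟩ ⟨hx, hy⟩
      simp only [mem_closedBall, dist_zero_right, mem_sphere] at hx hy
      exact (hA x y hx hy.le (hη x y (by simpa using hy))).continuousAt.continuousWithinAt
    · intro η hη' x hx
      refine (hA x η ?_ ?_ (hη x η hη')).curry_left₂.differentiableAt.differentiableWithinAt
      · simpa using (mem_ball.1 hx).le
      · simp at hη'; exact hη'.le
  set v : ℂ × ℂ → ℂ := fun z : ℂ × ℂ =>
      (2 * π * Complex.I : ℂ)⁻¹ • ∮ η in C(0, R), (η - z.2)⁻¹ • u (z.1, η) with hvdef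
  -- For x ≠ 0 the whole disc in y avoids the origin, so Cauchy's formula recovers u. The integral v
  -- itself also makes sense at x = 0, where only the boundary circle has to avoid the origin.
  have hvu : ∀ x y : ℂ, x ≠ 0 → ‖x‖ < R → ‖y‖ < R → v (x, y) = u (x, y) := by
    intro x y hx0 hx hy
    refine DiffContOnCl.two_pi_i_inv_smul_circleIntegral_sub_inv_smul
      (f := fun y => u (x, y)) (DifferentiableOn.diffContOnCl ?_) (by simpa using hy)
    intro y' hy'
    have hy'' := closure_ball_subset_closedBall hy'
    simp only [mem_closedBall, dist_zero_right] at hy''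
    exact (hA x y' hx.le hy'' (by simp [hx0])).curry_right₂.differentiableAt.differentiableWithinAt
  refine ⟨v, hv 0 (by simpa using hR), ?_⟩
  rw [eventually_nhdsWithin_iff]
  filter_upwards [bidisc_mem_nhds hR hR] with z hz hz0
  obtain ⟨x, y⟩ := z
  simp only [mem_prod, mem_ball, dist_zero_right] at hz
  -- On x = 0, y ≠ 0 both functions are continuous in x and agree for x ≠ 0.
  by_cases hx : x = 0
  · subst hx
    have c1 : ContinuousAt (fun x => v (x, y)) 0 := (hv y (by simpa using hz.2)).curry_left₂.continuousAt
    have c2 : ContinuousAt (fun x => u (x, y)) 0 :=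
      (hA 0 y hz.1.le hz.2.le hz0).curry_left₂.continuousAt
    have t1 := c1.tendsto.mono_left (nhdsWithin_le_nhds (s := {0}ᶜ))
    have t2 := c2.tendsto.mono_left (nhdsWithin_le_nhds (s := {0}ᶜ))
    refine tendsto_nhds_unique t1 (t2.congr' ?_)
    rw [Filter.EventuallyEq, eventually_nhdsWithin_iff]
    filter_upwards [ball_mem_nhds (0 : ℂ) hR] with x hx hx0
    exact (hvu x y hx0 (by simpa using hx) hz.2).symm
  · exact hvu x y hx hz.1 hz.2

end Division

/-! ### Weierstrass division -/

section Weierstrass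
open Metric

/-- Uniform convergence gives joint continuity and holomorphy of each slice, which together suffice.
-/
theorem analyticAt_tsum_of_bidisc {a : ℕ → ℂ × ℂ → ℂ} {ρ r : ℝ} (hρ : 0 < ρ) (hr : 0 < r)
    {u : ℕ → ℝ} (hu : Summable u)
    (ha : ∀ j, AnalyticOnNhd ℂ (a j) (ball 0 ρ ×ˢ ball 0 r))
    (hb : ∀ j, ∀ z ∈ ball (0 : ℂ) ρ ×ˢ ball (0 : ℂ) r, ‖a j z‖ ≤ u j) :
    AnalyticAt ℂ (fun z => ∑' j, a j z) 0 := by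
  have hc : ContinuousOn (fun z => ∑' j, a j z) (ball (0 : ℂ) ρ ×ˢ ball (0 : ℂ) r) :=
    continuousOn_tsum (fun j => (ha j).continuousOn) hu hb
  have hρ2 : closedBall (0 : ℂ) (ρ / 2) ⊆ ball 0 ρ := closedBall_subset_ball (by linarith)
  have hr2 : closedBall (0 : ℂ) (r / 2) ⊆ ball 0 r := closedBall_subset_ball (by linarith)
  refine analyticAt_of_forall_diffContOnCl (x₀ := 0) (y₀ := 0) (half_pos hρ) (half_pos hr)
    (hc.mono ?_) ?_ ?_ (by simpa using hr)
  · exact prod_mono hρ2 (sphere_subset_closedBall.trans hr2)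
  · intro η hη
    refine DifferentiableOn.mono (t := ball 0 ρ) ?_ (ball_subset_closedBall.trans hρ2)
    have hη' := hr2 (sphere_subset_closedBall hη)
    refine Complex.differentiableOn_tsum_of_summable_norm hu (fun j x hx => ?_) isOpen_ball
      fun j x hx => hb j (x, η) ⟨hx, hη'⟩
    exact (ha j (x, η) ⟨hx, hη'⟩).curry_left₂.differentiableAt.differentiableWithinAt
  · intro x hx
    have hx' := hρ2 (ball_subset_closedBall hx)
    refine DifferentiableOn.diffContOnCl (DifferentiableOn.mono (t := ball 0 r) ?_
      (closure_ball_subset_closedBall.trans hr2))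
    refine Complex.differentiableOn_tsum_of_summable_norm hu (fun j y hy => ?_) isOpen_ball
      fun j y hy => hb j (x, y) ⟨hx', hy⟩
    exact (ha j (x, y) ⟨hx', hy⟩).curry_right₂.differentiableAt.differentiableWithinAt

theorem analyticOnNhd_iterate_dslopeSnd {f : ℂ × ℂ → ℂ} {ρ r : ℝ}
    (hf : AnalyticOnNhd ℂ f (ball 0 ρ ×ˢ ball 0 r)) (n : ℕ) :
    AnalyticOnNhd ℂ (dslopeSnd^[n] f) (ball 0 ρ ×ˢ ball 0 r) := by
  induction n with
  | zero => exact hf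
  | succ n ih => rw [Function.iterate_succ_apply']; exact analyticOnNhd_dslopeSnd ih

theorem norm_iterate_dslopeSnd_le {f : ℂ × ℂ → ℂ} {ρ r M : ℝ} (hr : 0 < r)
    (hf : AnalyticOnNhd ℂ f (ball 0 ρ ×ˢ ball 0 r))
    (hb : ∀ z ∈ ball (0 : ℂ) ρ ×ˢ ball (0 : ℂ) r, ‖f z‖ ≤ M) (n : ℕ) :
    ∀ z ∈ ball (0 : ℂ) ρ ×ˢ ball (0 : ℂ) r, ‖dslopeSnd^[n] f z‖ ≤ (2 / r) ^ n * M := by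
  induction n with
  | zero => simpa using hb
  | succ n ih =>
    rw [Function.iterate_succ_apply']
    intro z hz
    refine (norm_dslopeSnd_le hr (analyticOnNhd_iterate_dslopeSnd hf n) ih z hz).trans (le_of_eq ?_)
    ring

/-- Taylor's formula in y: `dslopeSnd^[n]` is the quotient in the division by y ^ n alone. -/
theorem eq_sum_add_pow_mul_iterate_dslopeSnd (f : ℂ × ℂ → ℂ) (n : ℕ) (z : ℂ × ℂ) :
    f z = ∑ i ∈ Finset.range n, dslopeSnd^[i] f (z.1, 0) * z.2 ^ i +
      z.2 ^ n * dslopeSnd^[n] f z := by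
  induction n with
  | zero => simp
  | succ n ih =>
    rw [Finset.sum_range_succ, Function.iterate_succ_apply']
    conv_lhs => rw [ih, eq_add_mul_dslopeSnd (dslopeSnd^[n] f) z]
    ring

/-- **Weierstrass division** by `y ^ n + x k(x, y)`. -/
theorem exists_weierstrass_division {k g : ℂ × ℂ → ℂ} (n : ℕ) (hk : AnalyticAt ℂ k 0)
    (hg : AnalyticAt ℂ g 0) :
    ∃ (q : ℂ × ℂ → ℂ) (c : ℕ → ℂ → ℂ), AnalyticAt ℂ q 0 ∧ (∀ i, AnalyticAt ℂ (c i) 0) ∧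
      ∀ᶠ z in 𝓝 0, g z = (z.2 ^ n + z.1 * k z) * q z +
        ∑ i ∈ Finset.range n, c i z.1 * z.2 ^ i := by
  obtain ⟨r₁, hr₁, hk₁⟩ := hk.exists_analyticOnNhd_bidisc
  obtain ⟨r₂, hr₂, hg₂⟩ := hg.exists_analyticOnNhd_bidisc
  obtain ⟨r₃, hr₃, hb₃⟩ := Metric.eventually_nhds_iff_ball.1
    ((hk.continuousAt.norm.eventually_lt_const (lt_add_one _)).and
     (hg.continuousAt.norm.eventually_lt_const (lt_add_one _)))
  set K := ‖k 0‖ + 1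
  set M := ‖g 0‖ + 1
  have hM : 0 ≤ M := by positivity
  set r := min r₁ (min r₂ r₃)
  have hr : 0 < r := lt_min hr₁ (lt_min hr₂ hr₃)
  have hrr₁ : ball (0 : ℂ) r ⊆ ball 0 r₁ := ball_subset_ball (min_le_left _ _)
  have hrr₂ : ball (0 : ℂ) r ⊆ ball 0 r₂ :=
    ball_subset_ball ((min_le_right _ _).trans (min_le_left _ _))
  have hrr₃ : ball (0 : ℂ) r ⊆ ball 0 r₃ :=
    ball_subset_ball ((min_le_right _ _).trans (min_le_right _ _))
  set C := (2 / r) ^ n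
  have hC : 0 < C := by positivity
  have hK : 0 < K := by positivity
  -- C bounds the cost of n divisions by y and K bounds k, so |x| ≤ 1 / (2 K C) makes the iteration
  -- below halve the norm.
  set ρ := min r (1 / (2 * K * C))
  have hρ : 0 < ρ := lt_min hr (by positivity)
  have hρr : ball (0 : ℂ) ρ ⊆ ball 0 r := ball_subset_ball (min_le_left _ _)
  set D := ball (0 : ℂ) ρ ×ˢ ball (0 : ℂ) r with hD
  have hkD : AnalyticOnNhd ℂ k D := hk₁.mono (prod_mono (hρr.trans hrr₁) hrr₁)
  have hgD : AnalyticOnNhd ℂ g D := hg₂.mono (prod_mono (hρr.trans hrr₂) hrr₂)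
  have hbD : ∀ z ∈ D, ‖k z‖ ≤ K ∧ ‖g z‖ ≤ M := by
    intro z hz
    have : z ∈ ball (0 : ℂ × ℂ) r₃ := by
      have h0 : (0 : ℂ × ℂ) = (0, 0) := rfl
      rw [h0, ← ball_prod_same]
      exact ⟨hrr₃ (hρr hz.1), hrr₃ hz.2⟩
    exact ⟨(hb₃ z this).1.le, (hb₃ z this).2.le⟩
  -- Let D denote division by y ^ n. If G + x k D G = g, then dividing G by y ^ n divides g by y ^ n
  -- + x k. The solution is the Neumann series of G ↦ - x k D G.
  let step : (ℂ × ℂ → ℂ) → (ℂ × ℂ → ℂ) := fun G z => -(z.1 * k z * dslopeSnd^[n] G z)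
  let G : ℕ → ℂ × ℂ → ℂ := fun j => step^[j] g
  have hG0 : G 0 = g := rfl
  have hGs : ∀ j z, G (j + 1) z = -(z.1 * k z * dslopeSnd^[n] (G j) z) := by
    intro j z
    simp only [G, Function.iterate_succ_apply']
    rfl
  have hGA : ∀ j, AnalyticOnNhd ℂ (G j) D := by
    intro j
    induction j with
    | zero => exact hgD
    | succ j ih =>
      have : G (j + 1) = fun z => -(z.1 * k z * dslopeSnd^[n] (G j) z) := funext (hGs j)
      rw [this]
      intro z hz
      exact ((analyticAt_fst.mul (hkD z hz)).mul (analyticOnNhd_iterate_dslopeSnd ih n z hz)).neg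
  have hGb : ∀ j, ∀ z ∈ D, ‖G j z‖ ≤ M * (1 / 2) ^ j := by
    intro j
    induction j with
    | zero => intro z hz; rw [hG0, pow_zero, mul_one]; exact (hbD z hz).2
    | succ j ih =>
      intro z hz
      rw [hGs, norm_neg, norm_mul, norm_mul]
      have h1 := norm_iterate_dslopeSnd_le hr (hGA j) ih n z hz
      have h2 : ‖z.1‖ ≤ 1 / (2 * K * C) := by
        have := hz.1
        rw [mem_ball, dist_zero_right] at this
        exact this.le.trans (min_le_right _ _)
      calc ‖z.1‖ * ‖k z‖ * ‖dslopeSnd^[n] (G j) z‖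
          ≤ (1 / (2 * K * C)) * K * (C * (M * (1 / 2) ^ j)) := by
            gcongr
            exact (hbD z hz).1
        _ = M * (1 / 2) ^ (j + 1) := by
          field_simp
          ring
  have hsum : ∀ i : ℕ, Summable fun j : ℕ => (2 / r) ^ i * (M * (1 / 2) ^ j) := fun i =>
    ((summable_geometric_of_lt_one (by norm_num) (by norm_num)).mul_left M).mul_left _
  have hTA : ∀ i, AnalyticAt ℂ (fun z => ∑' j, dslopeSnd^[i] (G j) z) 0 := fun i =>
    analyticAt_tsum_of_bidisc hρ hr (hsum i)
      (fun j => analyticOnNhd_iterate_dslopeSnd (hGA j) i)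
      (fun j => norm_iterate_dslopeSnd_le hr (hGA j) (hGb j) i)
  have hTs : ∀ i, ∀ z ∈ D, Summable fun j => dslopeSnd^[i] (G j) z := fun i z hz =>
    Summable.of_norm_bounded (hsum i)
      (fun j => norm_iterate_dslopeSnd_le hr (hGA j) (hGb j) i z hz)
  refine ⟨fun z => ∑' j, dslopeSnd^[n] (G j) z,
    fun i x => ∑' j, dslopeSnd^[i] (G j) (x, 0), hTA n, fun i => (hTA i).curry_left₂, ?_⟩
  filter_upwards [bidisc_mem_nhds hρ hr] with z hz
  have hz0 : ((z.1, 0) : ℂ × ℂ) ∈ D := ⟨hz.1, by simpa using hr⟩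
  have hsG : Summable fun j => G j z := hTs 0 z hz
  have e1 : ∑' j, G j z = ∑ i ∈ Finset.range n, (∑' j, dslopeSnd^[i] (G j) (z.1, 0)) * z.2 ^ i +
      z.2 ^ n * ∑' j, dslopeSnd^[n] (G j) z := by
    simp_rw [← tsum_mul_right, ← tsum_mul_left]
    rw [← Summable.tsum_finsetSum (fun i _ => (hTs i _ hz0).mul_right _),
      ← Summable.tsum_add (summable_sum fun i _ => (hTs i _ hz0).mul_right _)
        ((hTs n z hz).mul_left _)]
    exact tsum_congr fun j => eq_sum_add_pow_mul_iterate_dslopeSnd (G j) n z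
  -- Shifting the series by one index is the equation G = g - x k D G.
  have e2 : ∑' j, G j z = g z - z.1 * k z * ∑' j, dslopeSnd^[n] (G j) z := by
    rw [hsG.tsum_eq_zero_add, hG0, ← tsum_mul_left, sub_eq_add_neg, ← tsum_neg]
    congr 1
    exact tsum_congr fun j => hGs j z
  linear_combination e1 - e2

end Weierstrass

/-! ### Cancellation in the ring of germs and restriction to the axes -/

section Cancellation

/-- The ring of germs of holomorphic functions is a domain. -/
theorem eventually_eq_zero_of_mul {E : Type*} [NormedAddCommGroup E] [NormedSpace ℂ E] {a : E}
    {f g : E → ℂ} (hf : AnalyticAt ℂ f a) (hg : AnalyticAt ℂ g a)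
    (h : ∀ᶠ z in 𝓝 a, f z * g z = 0) (hf0 : ¬ ∀ᶠ z in 𝓝 a, f z = 0) :
    ∀ᶠ z in 𝓝 a, g z = 0 := by
  obtain ⟨r, hr, hb⟩ := Metric.eventually_nhds_iff_ball.1
    (hf.eventually_analyticAt.and (hg.eventually_analyticAt.and h))
  have : ∃ z ∈ Metric.ball a r, f z ≠ 0 := by
    by_contra! H
    exact hf0 (Metric.eventually_nhds_iff_ball.2 ⟨r, hr, H⟩)
  obtain ⟨z₀, hz₀, hne⟩ := this
  have hg0 : g =ᶠ[𝓝 z₀] 0 := by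
    filter_upwards [(hb z₀ hz₀).1.continuousAt.eventually_ne hne,
      Metric.isOpen_ball.mem_nhds hz₀] with z hz hzb
    exact (mul_eq_zero.1 (hb z hzb).2.2).resolve_left hz
  have hA : AnalyticOnNhd ℂ g (Metric.ball a r) := fun z hz => (hb z hz).2.1
  have hpre : IsPreconnected (Metric.ball a r) := by
    let _ : NormedSpace ℝ E := NormedSpace.restrictScalars ℝ ℂ E
    exact (convex_ball a r).isPreconnected
  have := hA.eqOn_zero_of_preconnected_of_eventuallyEq_zero hpre hz₀ hg0
  exact Metric.eventually_nhds_iff_ball.2 ⟨r, hr, this⟩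

theorem eventually_eq_of_mul_left {E : Type*} [NormedAddCommGroup E] [NormedSpace ℂ E] {a : E}
    {h f g : E → ℂ} (hh : AnalyticAt ℂ h a) (hf : AnalyticAt ℂ f a) (hg : AnalyticAt ℂ g a)
    (heq : ∀ᶠ z in 𝓝 a, h z * f z = h z * g z) (h0 : ¬ ∀ᶠ z in 𝓝 a, h z = 0) :
    ∀ᶠ z in 𝓝 a, f z = g z := by
  have := eventually_eq_zero_of_mul hh (hf.sub hg) (heq.mono fun z hz => by
    simp only [Pi.sub_apply, mul_sub, hz, sub_self]) h0
  exact this.mono fun z hz => sub_eq_zero.1 hz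

theorem not_eventually_fst_eq_zero : ¬ ∀ᶠ z : ℂ × ℂ in 𝓝 0, z.1 = 0 := by
  intro h
  have h1 : ∀ᶠ x : ℂ in 𝓝 0, x = 0 :=
    ((by fun_prop : Continuous fun x : ℂ => ((x, 0) : ℂ × ℂ)).tendsto' 0 0 rfl).eventually h
  obtain ⟨x, hx, hx0⟩ := ((h1.filter_mono nhdsWithin_le_nhds).and
    (eventually_mem_nhdsWithin (a := (0 : ℂ)) (s := {0}ᶜ))).exists
  exact hx0 hx

theorem not_eventually_snd_eq_zero : ¬ ∀ᶠ z : ℂ × ℂ in 𝓝 0, z.2 = 0 := by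
  intro h
  exact not_eventually_fst_eq_zero ((continuous_swap.tendsto' (0 : ℂ × ℂ) 0 rfl).eventually h)

theorem not_eventually_pow_eq_zero {E : Type*} [TopologicalSpace E] {a : E} {f : E → ℂ}
    (hf : ¬ ∀ᶠ z in 𝓝 a, f z = 0) (n : ℕ) : ¬ ∀ᶠ z in 𝓝 a, f z ^ n = 0 :=
  fun h => hf (h.mono fun _ hz => eq_zero_of_pow_eq_zero hz)

theorem not_eventually_mul_eq_zero {E : Type*} [NormedAddCommGroup E] [NormedSpace ℂ E] {a : E}
    {f g : E → ℂ} (hf : AnalyticAt ℂ f a) (hg : AnalyticAt ℂ g a)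
    (hf0 : ¬ ∀ᶠ z in 𝓝 a, f z = 0) (hg0 : ¬ ∀ᶠ z in 𝓝 a, g z = 0) :
    ¬ ∀ᶠ z in 𝓝 a, f z * g z = 0 :=
  fun h => hg0 (eventually_eq_zero_of_mul hf hg h hf0)

theorem eventually_slice_fst {p : ℂ × ℂ → Prop} (h : ∀ᶠ z in 𝓝 0, p z) :
    ∀ᶠ x : ℂ in 𝓝 0, p (x, 0) :=
  ((by fun_prop : Continuous fun x : ℂ => ((x, 0) : ℂ × ℂ)).tendsto' 0 0 rfl).eventually h

theorem eventually_slice_snd {p : ℂ × ℂ → Prop} (h : ∀ᶠ z in 𝓝 0, p z) :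
    ∀ᶠ y : ℂ in 𝓝 0, p (0, y) :=
  ((by fun_prop : Continuous fun y : ℂ => ((0, y) : ℂ × ℂ)).tendsto' 0 0 rfl).eventually h

theorem eventually_comp_fst {p : ℂ → Prop} (h : ∀ᶠ x in 𝓝 0, p x) :
    ∀ᶠ z : ℂ × ℂ in 𝓝 0, p z.1 :=
  (continuous_fst.tendsto' (0 : ℂ × ℂ) 0 rfl).eventually h

theorem eventually_comp_snd {p : ℂ → Prop} (h : ∀ᶠ x in 𝓝 0, p x) :
    ∀ᶠ z : ℂ × ℂ in 𝓝 0, p z.2 :=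
  (continuous_snd.tendsto' (0 : ℂ × ℂ) 0 rfl).eventually h

end Cancellation

/-! ### Uniqueness in Weierstrass division, and the preparation theorem -/

section WeierstrassPolynomials

/-- A polynomial in one variable of degree less than `n` which vanishes to order `n` is zero. -/
theorem coeff_eq_zero_of_pow_mul_eq {n : ℕ} {w : ℂ → ℂ} {c : ℕ → ℂ} (hw : ContinuousAt w 0)
    (h : ∀ᶠ y in 𝓝[≠] 0, y ^ n * w y = ∑ i ∈ Finset.range n, c i * y ^ i) :
    ∀ i < n, c i = 0 := by
  induction n generalizing c with
  | zero => intro i hi; omega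
  | succ n ih =>
    have t1 : Tendsto (fun y : ℂ => y ^ (n + 1) * w y) (𝓝[≠] 0) (𝓝 (0 ^ (n + 1) * w 0)) :=
      ((by fun_prop : ContinuousAt (fun y : ℂ => y ^ (n + 1) * w y) 0)).tendsto.mono_left
        nhdsWithin_le_nhds
    have t2 : Tendsto (fun y : ℂ => ∑ i ∈ Finset.range (n + 1), c i * y ^ i) (𝓝[≠] 0)
        (𝓝 (∑ i ∈ Finset.range (n + 1), c i * 0 ^ i)) :=
      ((by fun_prop : Continuous (fun y : ℂ => ∑ i ∈ Finset.range (n + 1), c i * y ^ i))).continuousAt.tendsto.mono_left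
        nhdsWithin_le_nhds
    have hc0 : c 0 = 0 := by
      have := tendsto_nhds_unique (t1.congr' h) t2
      rw [Finset.sum_range_succ'] at this
      simpa using this.symm
    have := ih (c := fun i => c (i + 1)) (by
      filter_upwards [h, eventually_mem_nhdsWithin] with y hy hy0
      rw [Finset.sum_range_succ', hc0] at hy
      refine mul_left_cancel₀ (a := y) hy0 ?_
      rw [Finset.mul_sum]
      calc y * (y ^ n * w y) = y ^ (n + 1) * w y := by ring
        _ = _ := by
          rw [hy, zero_mul, add_zero]
          exact Finset.sum_congr rfl fun i _ => by ring)
    intro i hi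
    cases i with
    | zero => exact hc0
    | succ i => exact this i (by omega)

theorem exists_eq_mul_of_apply_zero {f : ℂ → ℂ} (hf : AnalyticAt ℂ f 0) (h0 : f 0 = 0) :
    ∃ g, AnalyticAt ℂ g 0 ∧ ∀ᶠ x in 𝓝 0, f x = x * g x := by
  have h1 : ((1 : ℕ) : ℕ∞) ≤ analyticOrderAt f 0 := by
    rw [Nat.cast_one, Order.one_le_iff_ne_zero]
    exact hf.analyticOrderAt_ne_zero.2 h0
  obtain ⟨g, hg, h⟩ := (natCast_le_analyticOrderAt hf).1 h1
  exact ⟨g, hg, h.mono fun x hx => by simpa using hx⟩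

theorem analyticAt_comp_fst {c : ℂ → ℂ} (hc : AnalyticAt ℂ c 0) :
    AnalyticAt ℂ (fun z : ℂ × ℂ => c z.1) 0 := hc.comp_of_eq analyticAt_fst rfl

theorem analyticAt_comp_snd {c : ℂ → ℂ} (hc : AnalyticAt ℂ c 0) :
    AnalyticAt ℂ (fun z : ℂ × ℂ => c z.2) 0 := hc.comp_of_eq analyticAt_snd rfl

theorem analyticAt_polynomial_snd {n : ℕ} {c : ℕ → ℂ → ℂ} (hc : ∀ i, AnalyticAt ℂ (c i) 0) :
    AnalyticAt ℂ (fun z : ℂ × ℂ => ∑ i ∈ Finset.range n, c i z.1 * z.2 ^ i) 0 := by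
  refine Finset.analyticAt_fun_sum _ fun i _ => ?_
  exact (analyticAt_comp_fst (hc i)).mul (analyticAt_snd.pow i)

/-- A Weierstrass polynomial of degree `n` does not divide a nonzero polynomial of degree less
than `n`. -/
theorem eventually_eq_zero_of_weierstrass_mul {n : ℕ} {a r : ℕ → ℂ → ℂ} {k : ℂ × ℂ → ℂ}
    (ha : ∀ i, AnalyticAt ℂ (a i) 0) (ha0 : ∀ i, a i 0 = 0) (hr : ∀ i, AnalyticAt ℂ (r i) 0)
    (hk : AnalyticAt ℂ k 0)
    (h : ∀ᶠ z : ℂ × ℂ in 𝓝 0, (z.2 ^ n + ∑ i ∈ Finset.range n, a i z.1 * z.2 ^ i) * k z =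
      ∑ i ∈ Finset.range n, r i z.1 * z.2 ^ i) :
    ∀ i < n, ∀ᶠ x in 𝓝 0, r i x = 0 := by
  -- On x = 0 the polynomial is y ^ n, so the remainder coefficients and the quotient all vanish
  -- there. Dividing both by x reproduces the hypothesis; hence every coefficient is divisible by
  -- all powers of x.
  have key : ∀ N : ℕ, ∃ (s : ℕ → ℂ → ℂ) (l : ℂ × ℂ → ℂ), (∀ i, AnalyticAt ℂ (s i) 0) ∧
      AnalyticAt ℂ l 0 ∧ (∀ i < n, ∀ᶠ x in 𝓝 0, r i x = x ^ N * s i x) ∧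
      ∀ᶠ z : ℂ × ℂ in 𝓝 0, (z.2 ^ n + ∑ i ∈ Finset.range n, a i z.1 * z.2 ^ i) * l z =
        ∑ i ∈ Finset.range n, s i z.1 * z.2 ^ i := by
    intro N
    induction N with
    | zero => exact ⟨r, k, hr, hk, by simp, h⟩
    | succ N ih =>
      obtain ⟨s, l, hs, hl, hrs, hP⟩ := ih
      have h0 := eventually_slice_snd hP
      simp only [ha0, zero_mul, Finset.sum_const_zero, add_zero] at h0
      have hs0 : ∀ i < n, s i 0 = 0 :=
        coeff_eq_zero_of_pow_mul_eq (w := fun y => l (0, y)) (c := fun i => s i 0)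
          hl.curry_right₂.continuousAt (h0.filter_mono nhdsWithin_le_nhds)
      have hl0 : ∀ᶠ y in 𝓝 0, l (0, y) = 0 := by
        refine eventually_eq_zero_of_mul (f := fun y : ℂ => y ^ n) (analyticAt_id.pow n)
          hl.curry_right₂ ?_ ?_
        · filter_upwards [h0] with y hy
          rw [hy]
          exact Finset.sum_eq_zero fun i hi => by rw [hs0 i (Finset.mem_range.1 hi), zero_mul]
        · refine not_eventually_pow_eq_zero (f := fun y : ℂ => y) ?_ n
          exact fun h => not_eventually_fst_eq_zero (eventually_comp_fst h)
      obtain ⟨l', hl', hll'⟩ := exists_eq_fst_mul hl hl0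
      have hs' : ∀ i, ∃ s', AnalyticAt ℂ s' 0 ∧ (i < n → ∀ᶠ x in 𝓝 0, s i x = x * s' x) := by
        intro i
        by_cases hi : i < n
        · obtain ⟨s', h1, h2⟩ := exists_eq_mul_of_apply_zero (hs i) (hs0 i hi)
          exact ⟨s', h1, fun _ => h2⟩
        · exact ⟨fun _ => 0, analyticAt_const, fun h => absurd h hi⟩
      choose s' hs'A hs's using hs'
      refine ⟨s', l', hs'A, hl', ?_, ?_⟩
      · intro i hi
        filter_upwards [hrs i hi, hs's i hi] with x h1 h2
        rw [h1, h2]; ring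
      · refine eventually_eq_of_mul_left (h := fun z : ℂ × ℂ => z.1) analyticAt_fst ?_
          (analyticAt_polynomial_snd hs'A) ?_ not_eventually_fst_eq_zero
        · exact ((analyticAt_snd.pow n).add (analyticAt_polynomial_snd ha)).mul hl'
        · have hall : ∀ᶠ z : ℂ × ℂ in 𝓝 0, ∀ i ∈ Finset.range n, s i z.1 = z.1 * s' i z.1 := by
            rw [Filter.eventually_all_finset]
            exact fun i hi => eventually_comp_fst (hs's i (Finset.mem_range.1 hi))
          filter_upwards [hP, hll', hall] with z h1 h2 h3
          rw [h2] at h1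
          rw [mul_left_comm, h1, Finset.mul_sum]
          exact Finset.sum_congr rfl fun i hi => by rw [h3 i hi]; ring
  intro i hi
  rw [← analyticOrderAt_eq_top, ENat.eq_top_iff_forall_ge]
  intro N
  obtain ⟨s, l, hs, -, hrs, -⟩ := key N
  exact (natCast_le_analyticOrderAt (hr i)).2 ⟨s i, hs i, by simpa using hrs i hi⟩

/-- **Weierstrass preparation theorem**. -/
theorem exists_weierstrass_preparation {f : ℂ × ℂ → ℂ} (hf : AnalyticAt ℂ f 0) {n : ℕ}
    (hn : analyticOrderAt (fun y => f (0, y)) 0 = n) :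
    ∃ (u : ℂ × ℂ → ℂ) (a : ℕ → ℂ → ℂ), AnalyticAt ℂ u 0 ∧ u 0 ≠ 0 ∧
      (∀ i, AnalyticAt ℂ (a i) 0) ∧ (∀ i, a i 0 = 0) ∧
      ∀ᶠ z in 𝓝 0, f z = u z * (z.2 ^ n + ∑ i ∈ Finset.range n, a i z.1 * z.2 ^ i) := by
  obtain ⟨v, hv, hv0, hfv⟩ := (hf.curry_right₂.analyticOrderAt_eq_natCast).1 hn
  have hv2 : AnalyticAt ℂ (fun z : ℂ × ℂ => v z.2) 0 := analyticAt_comp_snd hv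
  have hf1 : AnalyticAt ℂ (fun z : ℂ × ℂ => f z - z.2 ^ n * v z.2) 0 :=
    hf.sub ((analyticAt_snd.pow n).mul hv2)
  obtain ⟨k', hk', hfk⟩ := exists_eq_fst_mul hf1 (by
    filter_upwards [hfv] with y hy
    simp [hy])
  have hk : AnalyticAt ℂ (fun z => k' z / v z.2) 0 := hk'.div hv2 hv0
  -- Up to the unit v(y), f is y ^ n + x k, and y ^ n is divided by it. On x = 0 the division is
  -- trivial, which forces c_i(0) = 0 and q = 1; so q is a unit and y ^ n minus the remainder is the
  -- Weierstrass polynomial.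
  obtain ⟨q, c, hq, hc, hdiv⟩ := exists_weierstrass_division n hk
    (g := fun z => z.2 ^ n) (analyticAt_snd.pow n)
  have h0 := eventually_slice_snd hdiv
  simp only [zero_mul, add_zero] at h0
  have hc0 : ∀ i < n, c i 0 = 0 := by
    refine coeff_eq_zero_of_pow_mul_eq (w := fun y => 1 - q (0, y)) (c := fun i => c i 0)
      (continuousAt_const.sub hq.curry_right₂.continuousAt) ?_
    filter_upwards [h0.filter_mono nhdsWithin_le_nhds] with y hy
    linear_combination hy
  have hq0 : q 0 = 1 := by
    have : ∀ᶠ y : ℂ in 𝓝 0, q (0, y) = 1 := by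
      refine eventually_eq_of_mul_left (h := fun y : ℂ => y ^ n) (analyticAt_id.pow n)
          hq.curry_right₂ analyticAt_const ?_ ?_
      · filter_upwards [h0] with y hy
        rw [Finset.sum_eq_zero fun i hi => by rw [hc0 i (Finset.mem_range.1 hi), zero_mul]] at hy
        linear_combination -hy
      · refine not_eventually_pow_eq_zero (f := fun y : ℂ => y) ?_ n
        exact fun h => not_eventually_fst_eq_zero (eventually_comp_fst h)
    exact this.self_of_nhds
  have hq0' : q 0 ≠ 0 := by rw [hq0]; exact one_ne_zero
  -- Nothing is known about c_i for i ≥ n; these are replaced by 0 so that all coefficients vanish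
  -- at 0.
  refine ⟨fun z => v z.2 / q z, fun i => if i < n then fun x => -c i x else fun _ => 0,
    hv2.div hq hq0', div_ne_zero hv0 hq0', ?_, ?_, ?_⟩
  · intro i
    dsimp only
    split_ifs
    · exact (hc i).neg
    · exact analyticAt_const
  · intro i
    dsimp only
    split_ifs with hi
    · simp only [hc0 i hi, neg_zero]
    · rfl
  · filter_upwards [hfk, hdiv, hq.continuousAt.eventually_ne hq0',
      hv2.continuousAt.eventually_ne hv0] with z h1 h2 h3 h4
    have e : ∑ i ∈ Finset.range n, (if i < n then fun x => -c i x else fun _ => 0) z.1 * z.2 ^ i =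
        - ∑ i ∈ Finset.range n, c i z.1 * z.2 ^ i := by
      rw [← Finset.sum_neg_distrib]
      refine Finset.sum_congr rfl fun i hi => ?_
      rw [if_pos (Finset.mem_range.1 hi)]
      ring
    rw [e]
    have e2 : z.2 ^ n + -∑ i ∈ Finset.range n, c i z.1 * z.2 ^ i =
      (z.2 ^ n + z.1 * (k' z / v z.2)) * q z := by linear_combination h2
    rw [e2]
    field_simp
    linear_combination h1

end WeierstrassPolynomials

/-! ### Calculus of 1-forms in two variables -/

section Forms

theorem form_apply (L : ℂ × ℂ →L[ℂ] ℂ) (v : ℂ × ℂ) :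
    L v = v.1 * L (1, 0) + v.2 * L (0, 1) := by
  have : v = v.1 • ((1, 0) : ℂ × ℂ) + v.2 • ((0, 1) : ℂ × ℂ) := by ext <;> simp
  refine (congrArg L this).trans ?_
  rw [map_add, map_smul, map_smul, smul_eq_mul, smul_eq_mul]

/-- The Jacobian determinant of a map of the plane. -/
def jacDet (P : ℂ × ℂ → ℂ × ℂ) (z : ℂ × ℂ) : ℂ :=
  (fderiv ℂ P z (1, 0)).1 * (fderiv ℂ P z (0, 1)).2 -
    (fderiv ℂ P z (0, 1)).1 * (fderiv ℂ P z (1, 0)).2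

/-- The 1-form with the given coefficients. -/
def mkForm (A B : ℂ × ℂ → ℂ) (z : ℂ × ℂ) : ℂ × ℂ →L[ℂ] ℂ :=
  A z • ContinuousLinearMap.fst ℂ ℂ ℂ + B z • ContinuousLinearMap.snd ℂ ℂ ℂ

@[simp] theorem mkForm_apply (A B : ℂ × ℂ → ℂ) (z v : ℂ × ℂ) :
    mkForm A B z v = A z * v.1 + B z * v.2 := by simp [mkForm]

theorem form_ext {L M : ℂ × ℂ →L[ℂ] ℂ} (h1 : L (1, 0) = M (1, 0)) (h2 : L (0, 1) = M (0, 1)) :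
    L = M := by
  ext <;> simp [h1, h2]

theorem AnalyticAt.mkForm {A B : ℂ × ℂ → ℂ} {z : ℂ × ℂ} (hA : AnalyticAt ℂ A z)
    (hB : AnalyticAt ℂ B z) : AnalyticAt ℂ (mkForm A B) z :=
  (hA.smul analyticAt_const).add (hB.smul analyticAt_const)

theorem AnalyticAt.form_apply {τ : ℂ × ℂ → (ℂ × ℂ →L[ℂ] ℂ)} {z : ℂ × ℂ}
    (hτ : AnalyticAt ℂ τ z) (v : ℂ × ℂ) : AnalyticAt ℂ (fun w => τ w v) z :=
  ((ContinuousLinearMap.apply ℂ ℂ v).analyticAt _).comp hτ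

theorem AnalyticAt.fderiv_apply {E : Type*} [NormedAddCommGroup E] [NormedSpace ℂ E]
    [CompleteSpace E] {f : ℂ × ℂ → E} {z : ℂ × ℂ}
    (hf : AnalyticAt ℂ f z) (v : ℂ × ℂ) : AnalyticAt ℂ (fun w => fderiv ℂ f w v) z :=
  ((ContinuousLinearMap.apply ℂ E v).analyticAt _).comp hf.fderiv

theorem AnalyticAt.wedgeCoeff {τ : ℂ × ℂ → (ℂ × ℂ →L[ℂ] ℂ)} {f : ℂ × ℂ → ℂ} {z : ℂ × ℂ}
    (hτ : AnalyticAt ℂ τ z) (hf : AnalyticAt ℂ f z) : AnalyticAt ℂ (wedgeCoeff τ f) z :=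
  ((hτ.form_apply _).mul (hf.fderiv_apply _)).sub ((hτ.form_apply _).mul (hf.fderiv_apply _))

theorem AnalyticAt.fst_comp {P : ℂ × ℂ → ℂ × ℂ} {z : ℂ × ℂ} (hP : AnalyticAt ℂ P z) :
    AnalyticAt ℂ (fun w => (P w).1) z := analyticAt_fst.comp hP

theorem AnalyticAt.snd_comp {P : ℂ × ℂ → ℂ × ℂ} {z : ℂ × ℂ} (hP : AnalyticAt ℂ P z) :
    AnalyticAt ℂ (fun w => (P w).2) z := analyticAt_snd.comp hP

theorem AnalyticAt.jacDet {P : ℂ × ℂ → ℂ × ℂ} {z : ℂ × ℂ} (hP : AnalyticAt ℂ P z) :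
    AnalyticAt ℂ (jacDet P) z :=
  ((hP.fderiv_apply _).fst_comp.mul (hP.fderiv_apply _).snd_comp).sub
    ((hP.fderiv_apply _).fst_comp.mul (hP.fderiv_apply _).snd_comp)

theorem AnalyticAt.pullbackForm {P : ℂ × ℂ → ℂ × ℂ} {τ : ℂ × ℂ → (ℂ × ℂ →L[ℂ] ℂ)} {z : ℂ × ℂ}
    (hP : AnalyticAt ℂ P z) (hτ : AnalyticAt ℂ τ (P z)) : AnalyticAt ℂ (pullbackForm P τ) z := by
  have h1 : AnalyticAt ℂ (fun w => τ (P w)) z := hτ.comp hP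
  exact ((ContinuousLinearMap.compL ℂ (ℂ × ℂ) (ℂ × ℂ) ℂ).analyticAt_bilinear _).comp₂ h1 hP.fderiv

theorem pullbackForm_apply (P : ℂ × ℂ → ℂ × ℂ) (τ : ℂ × ℂ → (ℂ × ℂ →L[ℂ] ℂ)) (z v : ℂ × ℂ) :
    pullbackForm P τ z v = (fderiv ℂ P z v).1 * τ (P z) (1, 0) +
      (fderiv ℂ P z v).2 * τ (P z) (0, 1) := by
  rw [pullbackForm, ContinuousLinearMap.comp_apply, _root_.form_apply]

theorem wedgeCoeff_pullbackForm {P : ℂ × ℂ → ℂ × ℂ} {τ : ℂ × ℂ → (ℂ × ℂ →L[ℂ] ℂ)}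
    {f : ℂ × ℂ → ℂ} {z : ℂ × ℂ} (hP : DifferentiableAt ℂ P z) (hf : DifferentiableAt ℂ f (P z)) :
    wedgeCoeff (pullbackForm P τ) (fun w => f (P w)) z = jacDet P z * wedgeCoeff τ f (P z) := by
  have hd : fderiv ℂ (fun w => f (P w)) z = (fderiv ℂ f (P z)).comp (fderiv ℂ P z) :=
    fderiv_comp z hf hP
  simp only [wedgeCoeff, hd, pullbackForm_apply, ContinuousLinearMap.comp_apply, jacDet]
  rw [form_apply (fderiv ℂ f (P z)) (fderiv ℂ P z (0, 1)),
    form_apply (fderiv ℂ f (P z)) (fderiv ℂ P z (1, 0))]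
  ring

theorem pullbackForm_comp {P Q : ℂ × ℂ → ℂ × ℂ} {τ : ℂ × ℂ → (ℂ × ℂ →L[ℂ] ℂ)} {z : ℂ × ℂ}
    (hQ : DifferentiableAt ℂ Q z) (hP : DifferentiableAt ℂ P (Q z)) :
    pullbackForm (fun w => P (Q w)) τ z = pullbackForm Q (pullbackForm P τ) z := by
  have hd : fderiv ℂ (fun w => P (Q w)) z = (fderiv ℂ P (Q z)).comp (fderiv ℂ Q z) :=
    fderiv_comp z hP hQ
  simp only [pullbackForm, hd]
  rfl

theorem jacDet_comp {P Q : ℂ × ℂ → ℂ × ℂ} {z : ℂ × ℂ}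
    (hQ : DifferentiableAt ℂ Q z) (hP : DifferentiableAt ℂ P (Q z)) :
    jacDet (fun w => P (Q w)) z = jacDet P (Q z) * jacDet Q z := by
  have hd : fderiv ℂ (fun w => P (Q w)) z = (fderiv ℂ P (Q z)).comp (fderiv ℂ Q z) :=
    fderiv_comp z hP hQ
  have hv : ∀ v : ℂ × ℂ, fderiv ℂ P (Q z) v = v.1 • fderiv ℂ P (Q z) (1, 0) +
      v.2 • fderiv ℂ P (Q z) (0, 1) := by
    intro v
    rw [← map_smul, ← map_smul, ← map_add]
    congr 1
    ext <;> simp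
  simp only [jacDet, hd, ContinuousLinearMap.comp_apply]
  rw [hv (fderiv ℂ Q z (1, 0)), hv (fderiv ℂ Q z (0, 1))]
  simp only [Prod.fst_add, Prod.snd_add, Prod.smul_fst, Prod.smul_snd, smul_eq_mul]
  ring

theorem pullbackForm_congr {P Q : ℂ × ℂ → ℂ × ℂ} {τ σ : ℂ × ℂ → (ℂ × ℂ →L[ℂ] ℂ)} {a : ℂ × ℂ}
    (h : P =ᶠ[𝓝 a] Q) (hτ : ∀ᶠ z in 𝓝 a, τ (P z) = σ (P z)) :
    pullbackForm P τ =ᶠ[𝓝 a] pullbackForm Q σ := by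
  filter_upwards [h.eventuallyEq_nhds, hτ] with z hz hz'
  simp only [pullbackForm]
  rw [hz', hz.fderiv_eq, hz.self_of_nhds]

theorem wedgeCoeff_congr {f g : ℂ × ℂ → ℂ} {τ σ : ℂ × ℂ → (ℂ × ℂ →L[ℂ] ℂ)} {a : ℂ × ℂ}
    (h : f =ᶠ[𝓝 a] g) (hτ : τ =ᶠ[𝓝 a] σ) :
    wedgeCoeff τ f =ᶠ[𝓝 a] wedgeCoeff σ g := by
  filter_upwards [h.eventuallyEq_nhds, hτ] with z hz hz'
  simp only [wedgeCoeff, hz', hz.fderiv_eq]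

theorem wedgeCoeff_smul (g : ℂ × ℂ → ℂ) (τ : ℂ × ℂ → (ℂ × ℂ →L[ℂ] ℂ)) (f : ℂ × ℂ → ℂ)
    (z : ℂ × ℂ) : wedgeCoeff (fun w => g w • τ w) f z = g z * wedgeCoeff τ f z := by
  simp only [wedgeCoeff, smul_apply, smul_eq_mul]; ring

theorem wedgeCoeff_mul {f g : ℂ × ℂ → ℂ} (τ : ℂ × ℂ → (ℂ × ℂ →L[ℂ] ℂ)) {z : ℂ × ℂ}
    (hf : DifferentiableAt ℂ f z) (hg : DifferentiableAt ℂ g z) :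
    wedgeCoeff τ (fun w => f w * g w) z = f z * wedgeCoeff τ g z + g z * wedgeCoeff τ f z := by
  have : fderiv ℂ (fun w => f w * g w) z = f z • fderiv ℂ g z + g z • fderiv ℂ f z :=
    fderiv_mul hf hg
  simp only [wedgeCoeff, this, add_apply, smul_apply,
    smul_eq_mul]
  ring

theorem fderiv_fst_apply' (z v : ℂ × ℂ) : fderiv ℂ (fun w : ℂ × ℂ => w.1) z v = v.1 := by
  rw [show (fun w : ℂ × ℂ => w.1) = Prod.fst from rfl, fderiv_fst]; rfl

theorem wedgeCoeff_fst (τ : ℂ × ℂ → (ℂ × ℂ →L[ℂ] ℂ)) (z : ℂ × ℂ) :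
    wedgeCoeff τ (fun w => w.1) z = -τ z (0, 1) := by
  simp [wedgeCoeff, fderiv_fst_apply']

end Forms

/-! ### Germs of biholomorphisms -/

section Bihol

/-- Germs at the origin of biholomorphisms of the plane fixing the origin. -/
structure IsGermBihol (Φ : ℂ × ℂ → ℂ × ℂ) : Prop where
  analyticAt : AnalyticAt ℂ Φ 0
  map_zero : Φ 0 = 0
  jacDet_ne_zero : jacDet Φ 0 ≠ 0

theorem IsGermBihol.tendsto {Φ : ℂ × ℂ → ℂ × ℂ} (h : IsGermBihol Φ) :
    Tendsto Φ (𝓝 0) (𝓝 0) := by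
  have := h.analyticAt.continuousAt.tendsto
  rwa [h.map_zero] at this

theorem jacDet_id (z : ℂ × ℂ) : jacDet (fun w => w) z = 1 := by
  simp [jacDet]

theorem IsGermBihol.id : IsGermBihol (fun z => z) := ⟨analyticAt_id, rfl, by simp [jacDet_id]⟩

theorem IsGermBihol.comp {Φ Ψ : ℂ × ℂ → ℂ × ℂ} (hΦ : IsGermBihol Φ) (hΨ : IsGermBihol Ψ) :
    IsGermBihol (fun z => Φ (Ψ z)) := by
  have h1 : AnalyticAt ℂ Φ (Ψ 0) := by rw [hΨ.map_zero]; exact hΦ.analyticAt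
  refine ⟨h1.comp hΨ.analyticAt, by rw [hΨ.map_zero, hΦ.map_zero], ?_⟩
  rw [jacDet_comp hΨ.analyticAt.differentiableAt h1.differentiableAt, hΨ.map_zero]
  exact mul_ne_zero hΦ.jacDet_ne_zero hΨ.jacDet_ne_zero

theorem jacDet_congr {P Q : ℂ × ℂ → ℂ × ℂ} {z : ℂ × ℂ} (h : P =ᶠ[𝓝 z] Q) :
    jacDet P z = jacDet Q z := by
  simp only [jacDet, h.fderiv_eq]

/-- A continuous linear equivalence with given nonzero determinant. -/
theorem exists_equiv_of_jacDet_ne_zero {P : ℂ × ℂ → ℂ × ℂ} {z : ℂ × ℂ} (h : jacDet P z ≠ 0) :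
    ∃ e : (ℂ × ℂ) ≃L[ℂ] (ℂ × ℂ), (e : ℂ × ℂ →L[ℂ] ℂ × ℂ) = fderiv ℂ P z := by
  have hv : ∀ v : ℂ × ℂ, fderiv ℂ P z v = v.1 • fderiv ℂ P z (1, 0) +
      v.2 • fderiv ℂ P z (0, 1) := by
    intro v
    rw [← map_smul, ← map_smul, ← map_add]
    congr 1
    ext <;> simp
  have hinj : Function.Injective (fderiv ℂ P z).toLinearMap := by
    rw [← LinearMap.ker_eq_bot, LinearMap.ker_eq_bot']
    intro v hv0
    have hv0' : fderiv ℂ P z v = 0 := hv0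
    rw [hv] at hv0'
    have e1 := congrArg Prod.fst hv0'
    have e2 := congrArg Prod.snd hv0'
    simp only [Prod.fst_add, Prod.snd_add, Prod.smul_fst, Prod.smul_snd, smul_eq_mul,
      Prod.fst_zero, Prod.snd_zero] at e1 e2
    have h1 : v.1 * jacDet P z = 0 := by
      rw [jacDet]
      linear_combination (fderiv ℂ P z (0, 1)).2 * e1 - (fderiv ℂ P z (0, 1)).1 * e2
    have h2 : v.2 * jacDet P z = 0 := by
      rw [jacDet]
      linear_combination (fderiv ℂ P z (1, 0)).1 * e2 - (fderiv ℂ P z (1, 0)).2 * e1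
    ext
    · exact (mul_eq_zero.1 h1).resolve_right h
    · exact (mul_eq_zero.1 h2).resolve_right h
  refine ⟨(LinearEquiv.ofInjectiveEndo _ hinj).toContinuousLinearEquiv, ?_⟩
  ext <;> rfl

theorem exists_openPartialHomeomorph {Φ : ℂ × ℂ → ℂ × ℂ} {a : ℂ × ℂ} (hΦ : AnalyticAt ℂ Φ a)
    (hdet : jacDet Φ a ≠ 0) :
    ∃ e : OpenPartialHomeomorph (ℂ × ℂ) (ℂ × ℂ), a ∈ e.source ∧ (∀ z, e z = Φ z) ∧
      AnalyticAt ℂ e.symm (Φ a) := by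
  obtain ⟨L, hL⟩ := exists_equiv_of_jacDet_ne_zero hdet
  have hc : ContDiffAt ℂ (⊤ : WithTop ℕ∞) Φ a := hΦ.contDiffAt
  have hd : HasFDerivAt Φ (L : ℂ × ℂ →L[ℂ] ℂ × ℂ) a := by
    rw [hL]; exact hΦ.differentiableAt.hasFDerivAt
  refine ⟨hc.toOpenPartialHomeomorph Φ hd (by simp),
    hc.mem_toOpenPartialHomeomorph_source hd (by simp), fun z => rfl, ?_⟩
  exact (hc.to_localInverse hd (by simp)).analyticAt

theorem IsGermBihol.exists_inverse {Φ : ℂ × ℂ → ℂ × ℂ} (h : IsGermBihol Φ) :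
    ∃ Ψ, IsGermBihol Ψ ∧ (∀ᶠ z in 𝓝 0, Φ (Ψ z) = z) ∧ (∀ᶠ z in 𝓝 0, Ψ (Φ z) = z) := by
  obtain ⟨e, he, heΦ, hA⟩ := exists_openPartialHomeomorph h.analyticAt h.jacDet_ne_zero
  rw [h.map_zero] at hA
  have h0 : (0 : ℂ × ℂ) ∈ e.target := by
    have := e.map_source he
    rwa [heΦ, h.map_zero] at this
  have hz : e.symm 0 = 0 := by
    have := e.left_inv he
    rwa [heΦ, h.map_zero] at this
  have hr : ∀ᶠ z in 𝓝 0, Φ (e.symm z) = z := by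
    filter_upwards [e.open_target.mem_nhds h0] with z hz
    rw [← heΦ, e.right_inv hz]
  refine ⟨e.symm, ⟨hA, hz, ?_⟩, hr, ?_⟩
  · intro hj
    have h1 : DifferentiableAt ℂ Φ (e.symm 0) := by
      rw [hz]; exact h.analyticAt.differentiableAt
    have := jacDet_comp hA.differentiableAt h1
    rw [hj, mul_zero, jacDet_congr (Q := fun w => w) hr, jacDet_id] at this
    exact one_ne_zero this
  · filter_upwards [e.open_source.mem_nhds he] with z hz
    rw [← heΦ, e.left_inv hz]

end Bihol

/-! ### The ring of germs and the ideal of a curve with its partial derivatives -/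

section Germs

/-- The ring of germs at the origin of holomorphic functions. -/
def HolGerm (E : Type) [NormedAddCommGroup E] [NormedSpace ℂ E] :
    Subring (Germ (𝓝 (0 : E)) ℂ) where
  carrier := {g | ∃ f : E → ℂ, AnalyticAt ℂ f 0 ∧ g = ↑f}
  mul_mem' := by
    rintro _ _ ⟨f, hf, rfl⟩ ⟨g, hg, rfl⟩
    exact ⟨fun z => f z * g z, hf.mul hg, rfl⟩
  one_mem' := ⟨fun _ => 1, analyticAt_const, rfl⟩
  add_mem' := by
    rintro _ _ ⟨f, hf, rfl⟩ ⟨g, hg, rfl⟩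
    exact ⟨fun z => f z + g z, hf.add hg, rfl⟩
  zero_mem' := ⟨fun _ => 0, analyticAt_const, rfl⟩
  neg_mem' := by
    rintro _ ⟨f, hf, rfl⟩
    exact ⟨fun z => -f z, hf.neg, rfl⟩

namespace HolGerm
variable {E : Type} [NormedAddCommGroup E] [NormedSpace ℂ E]

/-- The germ of a function. -/
def mk (f : E → ℂ) (hf : AnalyticAt ℂ f 0) : HolGerm E := ⟨↑f, f, hf, rfl⟩

theorem exists_rep (g : HolGerm E) : ∃ (f : E → ℂ) (hf : AnalyticAt ℂ f 0), g = mk f hf := by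
  obtain ⟨_, f, hf, rfl⟩ := g
  exact ⟨f, hf, rfl⟩

theorem mk_eq_mk {f g : E → ℂ} {hf : AnalyticAt ℂ f 0} {hg : AnalyticAt ℂ g 0} :
    mk f hf = mk g hg ↔ f =ᶠ[𝓝 0] g := by
  rw [← Germ.coe_eq]
  exact Subtype.ext_iff

theorem mk_add {f g : E → ℂ} (hf : AnalyticAt ℂ f 0) (hg : AnalyticAt ℂ g 0) :
    mk f hf + mk g hg = mk (fun z => f z + g z) (hf.add hg) := rfl

theorem mk_mul {f g : E → ℂ} (hf : AnalyticAt ℂ f 0) (hg : AnalyticAt ℂ g 0) :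
    mk f hf * mk g hg = mk (fun z => f z * g z) (hf.mul hg) := rfl

theorem mk_pow {f : E → ℂ} (hf : AnalyticAt ℂ f 0) (n : ℕ) :
    mk f hf ^ n = mk (fun z => f z ^ n) (hf.pow n) := rfl

theorem zero_eq_mk : (0 : HolGerm E) = mk (fun _ => 0) analyticAt_const := rfl

theorem one_eq_mk : (1 : HolGerm E) = mk (fun _ => 1) analyticAt_const := rfl

theorem isUnit_mk {f : E → ℂ} (hf : AnalyticAt ℂ f 0) (h0 : f 0 ≠ 0) : IsUnit (mk f hf) := by
  refine IsUnit.of_mul_eq_one (mk (fun z => (f z)⁻¹) (hf.inv h0)) ?_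
  rw [mk_mul, one_eq_mk, mk_eq_mk]
  filter_upwards [hf.continuousAt.eventually_ne h0] with z hz
  exact mul_inv_cancel₀ hz

instance : IsDomain (HolGerm E) := by
  have : NoZeroDivisors (HolGerm E) := ⟨by
    intro a b hab
    obtain ⟨f, hf, rfl⟩ := exists_rep a
    obtain ⟨g, hg, rfl⟩ := exists_rep b
    rw [mk_mul, zero_eq_mk, mk_eq_mk] at hab
    by_cases h : ∀ᶠ z in 𝓝 0, f z = 0
    · left; rw [zero_eq_mk, mk_eq_mk]; exact h
    · right; rw [zero_eq_mk, mk_eq_mk]; exact eventually_eq_zero_of_mul hf hg hab h⟩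
  have : Nontrivial (HolGerm E) := ⟨0, 1, by
    rw [zero_eq_mk, one_eq_mk, Ne, mk_eq_mk]
    intro h
    exact zero_ne_one h.self_of_nhds⟩
  exact NoZeroDivisors.to_isDomain _

/-- The rational constants; they give characteristic zero, which makes squarefree polynomials
separable. -/
instance : Algebra ℚ (HolGerm E) := by
  refine RingHom.toAlgebra (RingHom.comp
    { toFun := fun c : ℂ => mk (fun _ => c) analyticAt_const
      map_one' := rfl, map_mul' := fun _ _ => rfl, map_zero' := rfl, map_add' := fun _ _ => rfl }
    (algebraMap ℚ ℂ))

instance : CharZero (HolGerm E) := algebraRat.charZero _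

/-- The value of a germ. -/
def eval : HolGerm E →+* ℂ := (Germ.valueRingHom : Germ (𝓝 (0 : E)) ℂ →+* ℂ).comp (HolGerm E).subtype

theorem eval_mk {f : E → ℂ} (hf : AnalyticAt ℂ f 0) : eval (mk f hf) = f 0 := rfl

/-- The coordinate germ in one variable. -/
def coordX : HolGerm ℂ := mk (fun x => x) analyticAt_id

theorem exists_eq_pow_mul {a : HolGerm ℂ} (ha : a ≠ 0) : ∃ n u, IsUnit u ∧ a = coordX ^ n * u := by
  obtain ⟨f, hf, rfl⟩ := exists_rep a
  rw [Ne, zero_eq_mk, mk_eq_mk] at ha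
  obtain ⟨n, g, hg, hg0, h⟩ := hf.exists_eventuallyEq_pow_smul_nonzero_iff.2 ha
  refine ⟨n, mk g hg, isUnit_mk hg hg0, ?_⟩
  rw [coordX, mk_pow, mk_mul, mk_eq_mk]
  exact h.mono fun z hz => by simpa using hz

theorem coordX_ne_zero : coordX ≠ 0 := by
  rw [coordX, Ne, zero_eq_mk, mk_eq_mk]
  exact fun h => not_eventually_fst_eq_zero (eventually_comp_fst h)

/-- Two non-units both vanish at 0, so their product is divisible by x², which x is not. -/
theorem irreducible_coordX : Irreducible coordX := by
  have h0 : eval coordX = 0 := rfl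
  have hu : ∀ a : HolGerm ℂ, eval a ≠ 0 → IsUnit a := by
    intro a ha
    obtain ⟨f, hf, rfl⟩ := exists_rep a
    exact isUnit_mk hf ha
  refine ⟨fun h => ?_, ?_⟩
  · have := h.map (eval (E := ℂ))
    rw [h0] at this
    exact not_isUnit_zero this
  · intro a b hab
    by_contra! hcon
    have ha : eval a = 0 := by by_contra h; exact hcon.1 (hu a h)
    have hb : eval b = 0 := by by_contra h; exact hcon.2 (hu b h)
    obtain ⟨f, hf, rfl⟩ := exists_rep a
    obtain ⟨g, hg, rfl⟩ := exists_rep b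
    obtain ⟨f', hf', h1⟩ := exists_eq_mul_of_apply_zero hf ha
    obtain ⟨g', hg', h2⟩ := exists_eq_mul_of_apply_zero hg hb
    have e : coordX * mk (fun _ => 1) analyticAt_const =
        coordX * (coordX * mk (fun x => f' x * g' x) (hf'.mul hg')) := by
      rw [← one_eq_mk, mul_one]
      conv_lhs => rw [hab]
      rw [coordX, mk_mul, mk_mul, mk_mul, mk_eq_mk]
      filter_upwards [h1, h2] with x h1 h2
      rw [h1, h2]; ring
    have e' := congrArg eval (mul_left_cancel₀ coordX_ne_zero e)
    rw [map_mul, h0, zero_mul, eval_mk] at e'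
    exact one_ne_zero e'

/-- The valuation is the order of vanishing. It makes the ring integrally closed, as needed to
descend monic factors from the fraction field. -/
instance : IsDiscreteValuationRing (HolGerm ℂ) :=
  IsDiscreteValuationRing.ofHasUnitMulPowIrreducibleFactorization
    ⟨coordX, irreducible_coordX, fun {a} ha => by
      obtain ⟨n, u, hu, h⟩ := exists_eq_pow_mul ha
      exact ⟨n, hu.unit, h.symm⟩⟩

end HolGerm

/-- The ideal generated by a germ and its partial derivatives. -/
def jacIdeal (h : ℂ × ℂ → ℂ) : Ideal (HolGerm (ℂ × ℂ)) where
  carrier := {g | ∃ a b c : ℂ × ℂ → ℂ, AnalyticAt ℂ a 0 ∧ AnalyticAt ℂ b 0 ∧ AnalyticAt ℂ c 0 ∧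
    (g : Germ (𝓝 (0 : ℂ × ℂ)) ℂ) =
      ↑(fun z => a z * h z + b z * fderiv ℂ h z (1, 0) + c z * fderiv ℂ h z (0, 1))}
  add_mem' := by
    rintro g g' ⟨a, b, c, ha, hb, hc, e⟩ ⟨a', b', c', ha', hb', hc', e'⟩
    refine ⟨a + a', b + b', c + c', ha.add ha', hb.add hb', hc.add hc', ?_⟩
    rw [Subring.coe_add, e, e', ← Germ.coe_add, Germ.coe_eq]
    exact Eventually.of_forall fun z => by simp only [Pi.add_apply]; ring
  zero_mem' := by
    refine ⟨0, 0, 0, analyticAt_const, analyticAt_const, analyticAt_const, ?_⟩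
    rw [HolGerm.zero_eq_mk]
    exact Germ.coe_eq.2 (Eventually.of_forall fun z => by simp)
  smul_mem' := by
    rintro g g' ⟨a, b, c, ha, hb, hc, e⟩
    obtain ⟨f, hf, rfl⟩ := HolGerm.exists_rep g
    refine ⟨f * a, f * b, f * c, hf.mul ha, hf.mul hb, hf.mul hc, ?_⟩
    rw [smul_eq_mul, Subring.coe_mul, e]
    exact Germ.coe_eq.2 (Eventually.of_forall fun z => by
      simp only [Pi.mul_apply]; ring)

theorem mk_mem_jacIdeal {h g : ℂ × ℂ → ℂ} {hg : AnalyticAt ℂ g 0} :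
    HolGerm.mk g hg ∈ jacIdeal h ↔ ∃ a b c : ℂ × ℂ → ℂ, AnalyticAt ℂ a 0 ∧ AnalyticAt ℂ b 0 ∧
      AnalyticAt ℂ c 0 ∧ ∀ᶠ z in 𝓝 0,
        g z = a z * h z + b z * fderiv ℂ h z (1, 0) + c z * fderiv ℂ h z (0, 1) := by
  constructor
  · rintro ⟨a, b, c, ha, hb, hc, e⟩
    exact ⟨a, b, c, ha, hb, hc, Germ.coe_eq.1 e⟩
  · rintro ⟨a, b, c, ha, hb, hc, e⟩
    exact ⟨a, b, c, ha, hb, hc, Germ.coe_eq.2 e⟩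

/-- The coordinate germs on the plane. -/
def germX : HolGerm (ℂ × ℂ) := HolGerm.mk (fun z => z.1) analyticAt_fst

/-- The coordinate germs on the plane. -/
def germY : HolGerm (ℂ × ℂ) := HolGerm.mk (fun z => z.2) analyticAt_snd

/-- The curve `h = 0` has at most an isolated singularity: the ideal generated by `h` and its
partial derivatives contains a power of the maximal ideal. -/
structure HasIsolatedCurveSing (h : ℂ × ℂ → ℂ) : Prop where
  analyticAt : AnalyticAt ℂ h 0
  germX_mem : germX ∈ (jacIdeal h).radical
  germY_mem : germY ∈ (jacIdeal h).radical

theorem self_mem_jacIdeal {h : ℂ × ℂ → ℂ} (hh : AnalyticAt ℂ h 0) :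
    HolGerm.mk h hh ∈ jacIdeal h :=
  mk_mem_jacIdeal.2 ⟨fun _ => 1, 0, 0, analyticAt_const, analyticAt_const, analyticAt_const,
    Eventually.of_forall fun z => by simp⟩

theorem HasIsolatedCurveSing.exists_pow {h : ℂ × ℂ → ℂ} (H : HasIsolatedCurveSing h) :
    (∃ (N : ℕ) (a b c : ℂ × ℂ → ℂ), AnalyticAt ℂ a 0 ∧ AnalyticAt ℂ b 0 ∧
      AnalyticAt ℂ c 0 ∧ ∀ᶠ z in 𝓝 0,
        z.1 ^ N = a z * h z + b z * fderiv ℂ h z (1, 0) + c z * fderiv ℂ h z (0, 1)) ∧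
    (∃ (N : ℕ) (a b c : ℂ × ℂ → ℂ), AnalyticAt ℂ a 0 ∧ AnalyticAt ℂ b 0 ∧
      AnalyticAt ℂ c 0 ∧ ∀ᶠ z in 𝓝 0,
        z.2 ^ N = a z * h z + b z * fderiv ℂ h z (1, 0) + c z * fderiv ℂ h z (0, 1)) := by
  obtain ⟨N, hN⟩ := H.germX_mem
  obtain ⟨M, hM⟩ := H.germY_mem
  rw [germX, HolGerm.mk_pow, mk_mem_jacIdeal] at hN
  rw [germY, HolGerm.mk_pow, mk_mem_jacIdeal] at hM
  exact ⟨⟨N, hN⟩, ⟨M, hM⟩⟩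

theorem fderiv_mul_apply {f g : ℂ × ℂ → ℂ} {z : ℂ × ℂ} (hf : DifferentiableAt ℂ f z)
    (hg : DifferentiableAt ℂ g z) (v : ℂ × ℂ) :
    fderiv ℂ (fun w => f w * g w) z v = f z * fderiv ℂ g z v + g z * fderiv ℂ f z v := by
  have : fderiv ℂ (fun w => f w * g w) z = f z • fderiv ℂ g z + g z • fderiv ℂ f z :=
    fderiv_mul hf hg
  rw [this, add_apply, smul_apply, smul_apply, smul_eq_mul, smul_eq_mul]

/-- The ideal of a multiple of `k` is contained in that of `k`. -/
theorem jacIdeal_le_of_eq_mul {h w k : ℂ × ℂ → ℂ} (hw : AnalyticAt ℂ w 0) (hk : AnalyticAt ℂ k 0)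
    (e : ∀ᶠ z in 𝓝 0, h z = w z * k z) : jacIdeal h ≤ jacIdeal k := by
  intro g hg
  obtain ⟨f, hf, rfl⟩ := HolGerm.exists_rep g
  obtain ⟨a, b, c, ha, hb, hc, H⟩ := mk_mem_jacIdeal.1 hg
  refine mk_mem_jacIdeal.2 ⟨fun z => a z * w z + b z * fderiv ℂ w z (1, 0) +
    c z * fderiv ℂ w z (0, 1), fun z => b z * w z, fun z => c z * w z,
    ((ha.mul hw).add (hb.mul (hw.fderiv_apply _))).add (hc.mul (hw.fderiv_apply _)),
    hb.mul hw, hc.mul hw, ?_⟩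
  have e' : h =ᶠ[𝓝 0] fun z => w z * k z := e
  filter_upwards [H, e'.eventuallyEq_nhds, hw.eventually_analyticAt, hk.eventually_analyticAt] with
    z h1 h2 h3 h4
  rw [h1, h2.self_of_nhds, h2.fderiv_eq, fderiv_mul_apply h3.differentiableAt h4.differentiableAt,
    fderiv_mul_apply h3.differentiableAt h4.differentiableAt]
  ring

theorem HasIsolatedCurveSing.of_eq_mul {h w k : ℂ × ℂ → ℂ} (H : HasIsolatedCurveSing h)
    (hw : AnalyticAt ℂ w 0) (hk : AnalyticAt ℂ k 0)
    (e : ∀ᶠ z in 𝓝 0, h z = w z * k z) : HasIsolatedCurveSing k :=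
  ⟨hk, Ideal.radical_mono (jacIdeal_le_of_eq_mul hw hk e) H.germX_mem,
    Ideal.radical_mono (jacIdeal_le_of_eq_mul hw hk e) H.germY_mem⟩

/-- Since u is not divisible by x, each factor x can be removed from k, until 1 = u k remains. -/
theorem ne_zero_of_mul_eq_fst_pow {u : ℂ × ℂ → ℂ} (hu : AnalyticAt ℂ u 0)
    (hu0 : ¬ ∀ᶠ y in 𝓝 0, u (0, y) = 0) (N : ℕ) {k : ℂ × ℂ → ℂ} (hk : AnalyticAt ℂ k 0)
    (h : ∀ᶠ z in 𝓝 0, z.1 ^ N = u z * k z) : u 0 ≠ 0 := by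
  induction N generalizing k with
  | zero =>
    intro h0
    have := h.self_of_nhds
    simp [h0] at this
  | succ N ih =>
    have h1 := eventually_slice_snd h
    have hk0 : ∀ᶠ y in 𝓝 0, k (0, y) = 0 := by
      refine eventually_eq_zero_of_mul hu.curry_right₂ hk.curry_right₂ ?_ hu0
      filter_upwards [h1] with y hy
      rw [← hy]; simp
    obtain ⟨k', hk', e⟩ := exists_eq_fst_mul hk hk0
    refine ih hk' (eventually_eq_of_mul_left analyticAt_fst (analyticAt_fst.pow N) (hu.mul hk') ?_
      not_eventually_fst_eq_zero)
    filter_upwards [h, e] with z h1 h2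
    rw [h2] at h1
    linear_combination h1

/-- If u² divides h, then h and both its partial derivatives are multiples of u, hence so are a
power of x and a power of y. A common divisor of these is a unit. -/
theorem HasIsolatedCurveSing.isReducedGerm {h : ℂ × ℂ → ℂ} (H : HasIsolatedCurveSing h) :
    IsReducedGerm h 0 := by
  refine ⟨H.analyticAt, fun u hu hdvd => ?_⟩
  obtain ⟨w, hw, e⟩ := hdvd
  have key : ∀ {g : ℂ × ℂ → ℂ} {hg : AnalyticAt ℂ g 0}, HolGerm.mk g hg ∈ jacIdeal h →
      ∃ k, AnalyticAt ℂ k 0 ∧ ∀ᶠ z in 𝓝 0, g z = u z * k z := by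
    intro g hg hmem
    have hle : jacIdeal h ≤ jacIdeal fun z => u z * u z :=
      jacIdeal_le_of_eq_mul hw (hu.mul hu) (e.mono fun z hz => by rw [hz]; ring)
    obtain ⟨a, b, c, ha, hb, hc, H⟩ := mk_mem_jacIdeal.1 (hle hmem)
    refine ⟨fun z => a z * u z + 2 * b z * fderiv ℂ u z (1, 0) + 2 * c z * fderiv ℂ u z (0, 1),
      ((ha.mul hu).add ((analyticAt_const.mul hb).mul (hu.fderiv_apply _))).add
        ((analyticAt_const.mul hc).mul (hu.fderiv_apply _)), ?_⟩
    filter_upwards [H, hu.eventually_analyticAt] with z h1 h2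
    rw [h1, fderiv_mul_apply h2.differentiableAt h2.differentiableAt,
      fderiv_mul_apply h2.differentiableAt h2.differentiableAt]
    ring
  obtain ⟨N, hN⟩ := H.germX_mem
  obtain ⟨M, hM⟩ := H.germY_mem
  rw [germX, HolGerm.mk_pow] at hN
  rw [germY, HolGerm.mk_pow] at hM
  obtain ⟨k, hk, ek⟩ := key hN
  obtain ⟨l, hl, el⟩ := key hM
  refine ne_zero_of_mul_eq_fst_pow hu (fun h0 => ?_) N hk ek
  refine not_eventually_pow_eq_zero (f := fun y : ℂ => y) (a := 0)
    (fun h => not_eventually_fst_eq_zero (eventually_comp_fst h)) M ?_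
  filter_upwards [h0, eventually_slice_snd el] with y h1 h2
  rw [h1, zero_mul] at h2
  exact h2

end Germs

/-! ### Coordinate changes and reducedness -/

section Invariance

theorem GermDvd.comp {u v : ℂ × ℂ → ℂ} {a b : ℂ × ℂ} {Φ : ℂ × ℂ → ℂ × ℂ} (h : GermDvd u v b)
    (hΦ : AnalyticAt ℂ Φ a) (hab : Φ a = b) :
    GermDvd (fun z => u (Φ z)) (fun z => v (Φ z)) a := by
  subst hab
  obtain ⟨k, hk, e⟩ := h
  exact ⟨fun z => k (Φ z), hk.comp hΦ, hΦ.continuousAt.eventually e⟩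

theorem GermDvd.congr {u v u' v' : ℂ × ℂ → ℂ} {a : ℂ × ℂ} (h : GermDvd u v a)
    (hu : u =ᶠ[𝓝 a] u') (hv : v =ᶠ[𝓝 a] v') : GermDvd u' v' a := by
  obtain ⟨k, hk, e⟩ := h
  refine ⟨k, hk, ?_⟩
  filter_upwards [hu, hv, e] with z h1 h2 h3
  rw [← h1, ← h2, h3]

theorem IsReducedGerm.comp_bihol {f : ℂ × ℂ → ℂ} {Φ : ℂ × ℂ → ℂ × ℂ} (h : IsReducedGerm f 0)
    (hΦ : IsGermBihol Φ) : IsReducedGerm (fun z => f (Φ z)) 0 := by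
  obtain ⟨Ψ, hΨ, h1, h2⟩ := hΦ.exists_inverse
  have hA : AnalyticAt ℂ f (Φ 0) := by rw [hΦ.map_zero]; exact h.1
  refine ⟨hA.comp hΦ.analyticAt, fun u hu hd => ?_⟩
  have huΨ : AnalyticAt ℂ (fun z => u (Ψ z)) 0 := by
    have : AnalyticAt ℂ u (Ψ 0) := by rw [hΨ.map_zero]; exact hu
    exact this.comp hΨ.analyticAt
  have := h.2 (fun z => u (Ψ z)) huΨ ((hd.comp hΨ.analyticAt hΨ.map_zero).congr
    (Eventually.of_forall fun _ => rfl) (h1.mono fun z hz => by simp only [hz]))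
  simpa [hΨ.map_zero] using this

theorem IsReducedGerm.of_mul {f u P : ℂ × ℂ → ℂ} {a : ℂ × ℂ} (h : IsReducedGerm f a)
    (hu : AnalyticAt ℂ u a) (hP : AnalyticAt ℂ P a) (e : ∀ᶠ z in 𝓝 a, f z = u z * P z) :
    IsReducedGerm P a := by
  refine ⟨hP, fun v hv hd => h.2 v hv ?_⟩
  obtain ⟨k, hk, e'⟩ := hd
  refine ⟨fun z => u z * k z, hu.mul hk, ?_⟩
  filter_upwards [e, e'] with z h1 h2
  rw [h1, h2]; ring

theorem IsReducedGerm.not_eventually_zero {f : ℂ × ℂ → ℂ} {a : ℂ × ℂ} (h : IsReducedGerm f a) :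
    ¬ ∀ᶠ z in 𝓝 a, f z = 0 := by
  intro h0
  refine h.2 (fun _ => 0) analyticAt_const ⟨fun _ => 0, analyticAt_const, ?_⟩ rfl
  filter_upwards [h0] with z hz
  rw [hz]; simp

theorem fderiv_comp_apply₂ {h : ℂ × ℂ → ℂ} {Φ : ℂ × ℂ → ℂ × ℂ} {z : ℂ × ℂ}
    (hh : DifferentiableAt ℂ h (Φ z)) (hΦ : DifferentiableAt ℂ Φ z) (v : ℂ × ℂ) :
    fderiv ℂ (fun w => h (Φ w)) z v = (fderiv ℂ Φ z v).1 * fderiv ℂ h (Φ z) (1, 0) +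
      (fderiv ℂ Φ z v).2 * fderiv ℂ h (Φ z) (0, 1) := by
  have : fderiv ℂ (fun w => h (Φ w)) z = (fderiv ℂ h (Φ z)).comp (fderiv ℂ Φ z) :=
    fderiv_comp z hh hΦ
  rw [this, ContinuousLinearMap.comp_apply, form_apply]

theorem AnalyticAt.comp_zero {F : Type*} [NormedAddCommGroup F] [NormedSpace ℂ F]
    {f : ℂ × ℂ → F} {Φ : ℂ × ℂ → ℂ × ℂ} (hf : AnalyticAt ℂ f 0)
    (hΦ : AnalyticAt ℂ Φ 0) (h0 : Φ 0 = 0) : AnalyticAt ℂ (fun z => f (Φ z)) 0 := by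
  have : AnalyticAt ℂ f (Φ 0) := by rwa [h0]
  exact this.comp hΦ

theorem jacIdeal_comp_bihol {h g : ℂ × ℂ → ℂ} {Φ : ℂ × ℂ → ℂ × ℂ} (hΦ : IsGermBihol Φ)
    (hh : AnalyticAt ℂ h 0) {hg : AnalyticAt ℂ g 0} (hgm : HolGerm.mk g hg ∈ jacIdeal h) :
    HolGerm.mk (fun z => g (Φ z)) (hg.comp_zero hΦ.analyticAt hΦ.map_zero) ∈
      jacIdeal fun z => h (Φ z) := by
  obtain ⟨a, b, c, ha, hb, hc, H⟩ := mk_mem_jacIdeal.1 hgm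
  have hA := hΦ.analyticAt
  have h0 := hΦ.map_zero
  have hJ := hA.jacDet
  -- Cramer's rule solves the chain rule for the partial derivatives of h at Φ(z), since the
  -- Jacobian is a unit.
  refine mk_mem_jacIdeal.2 ⟨fun z => a (Φ z),
    fun z => (b (Φ z) * (fderiv ℂ Φ z (0, 1)).2 - c (Φ z) * (fderiv ℂ Φ z (0, 1)).1) / jacDet Φ z,
    fun z => (c (Φ z) * (fderiv ℂ Φ z (1, 0)).1 - b (Φ z) * (fderiv ℂ Φ z (1, 0)).2) / jacDet Φ z,
    ha.comp_zero hA h0, ?_, ?_, ?_⟩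
  · exact (((hb.comp_zero hA h0).mul (hA.fderiv_apply _).snd_comp).sub
      ((hc.comp_zero hA h0).mul (hA.fderiv_apply _).fst_comp)).div hJ hΦ.jacDet_ne_zero
  · exact (((hc.comp_zero hA h0).mul (hA.fderiv_apply _).fst_comp).sub
      ((hb.comp_zero hA h0).mul (hA.fderiv_apply _).snd_comp)).div hJ hΦ.jacDet_ne_zero
  filter_upwards [hΦ.tendsto.eventually H, hΦ.tendsto.eventually hh.eventually_analyticAt,
    hA.eventually_analyticAt, hJ.continuousAt.eventually_ne hΦ.jacDet_ne_zero] with z h1 h2 h3 h4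
  rw [h1, fderiv_comp_apply₂ h2.differentiableAt h3.differentiableAt,
    fderiv_comp_apply₂ h2.differentiableAt h3.differentiableAt, div_mul_eq_mul_div,
    div_mul_eq_mul_div]
  field_simp
  rw [jacDet]
  ring

theorem HasIsolatedCurveSing.comp_bihol {h : ℂ × ℂ → ℂ} (H : HasIsolatedCurveSing h)
    {Φ : ℂ × ℂ → ℂ × ℂ} (hΦ : IsGermBihol Φ) : HasIsolatedCurveSing fun z => h (Φ z) := by
  obtain ⟨Ψ, hΨ, -, hinv⟩ := hΦ.exists_inverse
  have hA := hΦ.analyticAt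
  have h0 := hΦ.map_zero
  have m1 : HolGerm.mk _ hA.fst_comp ∈ (jacIdeal fun z => h (Φ z)).radical := by
    obtain ⟨N, hN⟩ := H.germX_mem
    rw [germX, HolGerm.mk_pow] at hN
    exact ⟨N, by rw [HolGerm.mk_pow]; exact jacIdeal_comp_bihol hΦ H.analyticAt hN⟩
  have m2 : HolGerm.mk _ hA.snd_comp ∈ (jacIdeal fun z => h (Φ z)).radical := by
    obtain ⟨N, hN⟩ := H.germY_mem
    rw [germY, HolGerm.mk_pow] at hN
    exact ⟨N, by rw [HolGerm.mk_pow]; exact jacIdeal_comp_bihol hΦ H.analyticAt hN⟩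
  -- The two components of Φ lie in the radical. A coordinate is a component k of the inverse
  -- composed with Φ, and by Hadamard's lemma k ∘ Φ is a combination of those components.
  have key : ∀ (g : ℂ × ℂ → ℂ) (hg : AnalyticAt ℂ g 0) (k : ℂ × ℂ → ℂ) (hk : AnalyticAt ℂ k 0),
      k 0 = 0 → (∀ᶠ z in 𝓝 0, g z = k (Φ z)) →
      HolGerm.mk g hg ∈ (jacIdeal fun z => h (Φ z)).radical := by
    intro g hg k hk hk0 e
    obtain ⟨a, b, ha, hb, eab⟩ := exists_eq_fst_mul_add_snd_mul hk hk0
    have : HolGerm.mk g hg = HolGerm.mk _ (ha.comp_zero hA h0) * HolGerm.mk _ hA.fst_comp +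
        HolGerm.mk _ (hb.comp_zero hA h0) * HolGerm.mk _ hA.snd_comp := by
      rw [HolGerm.mk_mul, HolGerm.mk_mul, HolGerm.mk_add, HolGerm.mk_eq_mk]
      filter_upwards [e, hΦ.tendsto.eventually eab] with z h1 h2
      rw [h1, h2]; ring
    rw [this]
    exact Ideal.add_mem _ (Ideal.mul_mem_left _ _ m1) (Ideal.mul_mem_left _ _ m2)
  refine ⟨H.analyticAt.comp_zero hA h0, ?_, ?_⟩
  · exact key _ _ _ hΨ.analyticAt.fst_comp (by rw [hΨ.map_zero]; rfl)
      (hinv.mono fun z hz => by rw [hz])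
  · exact key _ _ _ hΨ.analyticAt.snd_comp (by rw [hΨ.map_zero]; rfl)
      (hinv.mono fun z hz => by rw [hz])

/-- An isolated curve singularity is smooth at the nearby points. -/
theorem HasIsolatedCurveSing.eventually_smooth {h : ℂ × ℂ → ℂ} (H : HasIsolatedCurveSing h) :
    ∀ᶠ z in 𝓝 0, z ≠ 0 → h z ≠ 0 ∨ fderiv ℂ h z ≠ 0 := by
  obtain ⟨⟨N, a, b, c, -, -, -, e⟩, ⟨M, a', b', c', -, -, -, e'⟩⟩ := H.exists_pow
  filter_upwards [e, e'] with z h1 h2 hz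
  by_contra! hcon
  rw [hcon.1, hcon.2] at h1 h2
  simp only [mul_zero, zero_apply, add_zero] at h1 h2
  exact hz (Prod.ext (eq_zero_of_pow_eq_zero h1) (eq_zero_of_pow_eq_zero h2))

/-- A product u² k and its differential both vanish wherever u does. -/
theorem isReducedGerm_of_smooth {h : ℂ × ℂ → ℂ} {a : ℂ × ℂ} (hh : AnalyticAt ℂ h a)
    (hs : h a ≠ 0 ∨ fderiv ℂ h a ≠ 0) : IsReducedGerm h a := by
  refine ⟨hh, fun u hu hd hu0 => ?_⟩
  obtain ⟨k, hk, e⟩ := hd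
  have e' : h =ᶠ[𝓝 a] fun z => u z * (u z * k z) := e.mono fun z hz => by rw [hz]; ring
  have h0 : h a = 0 := by rw [e'.self_of_nhds]; simp [hu0]
  have hm : ∀ v, fderiv ℂ (fun z => u z * (u z * k z)) a v = 0 := by
    intro v
    have := fderiv_mul_apply (g := fun z => u z * k z) hu.differentiableAt
      (hu.mul hk).differentiableAt v
    rw [this, fderiv_mul_apply hu.differentiableAt hk.differentiableAt]
    simp [hu0]
  refine hs.elim (fun H => H h0) fun H => H ?_
  rw [e'.fderiv_eq]
  exact form_ext (hm _) (hm _)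

end Invariance

/-! ### Bezout identity between a squarefree polynomial and its derivative -/

section SquarefreePolynomial
open Polynomial

/-- A monic polynomial over a discrete valuation ring of characteristic zero with residual
polynomial `X ^ n`, all of whose repeated monic factors are constant, satisfies a Bezout relation
with its derivative. -/
theorem exists_bezout_derivative {R : Type*} [CommRing R] [IsDomain R]
    [IsIntegrallyClosed R] [CharZero R] {p : R[X]} (hp : p.Monic)
    (hsq : ∀ q : R[X], q.Monic → q * q ∣ p → q = 1) :
    ∃ (a b : R[X]) (d : R), d ≠ 0 ∧ a * p + b * derivative p = C d := by
  let K := FractionRing R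
  have hinj : Function.Injective (algebraMap R K) := IsFractionRing.injective R K
  have : CharZero K := charZero_of_injective_algebraMap hinj
  have hpK : p.map (algebraMap R K) ≠ 0 := (hp.map _).ne_zero
  -- A repeated factor over the fraction field is, up to a constant, a monic polynomial over R, as R
  -- is integrally closed. The hypothesis over R then makes it constant.
  have hsqK : Squarefree (p.map (algebraMap R K)) := by
    intro g hg
    have hg0 : g ≠ 0 := by
      rintro rfl
      rw [zero_mul] at hg
      exact hpK (zero_dvd_iff.1 hg)
    obtain ⟨q, hq⟩ := IsIntegrallyClosed.eq_map_mul_C_of_dvd K hp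
      ((dvd_mul_right g g).trans hg)
    have hlc : g.leadingCoeff ≠ 0 := leadingCoeff_ne_zero.2 hg0
    have hqm : q.Monic := by
      have h1 : (q.map (algebraMap R K)).leadingCoeff = 1 := by
        have := congrArg leadingCoeff hq
        rw [leadingCoeff_mul, leadingCoeff_C] at this
        exact mul_right_cancel₀ hlc (by rw [this, one_mul])
      rw [leadingCoeff_map_of_injective hinj] at h1
      exact hinj (by rw [h1, map_one])
    have hdvd : (q * q).map (algebraMap R K) ∣ p.map (algebraMap R K) := by
      refine dvd_trans ?_ hg
      rw [Polynomial.map_mul]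
      conv_rhs => rw [← hq]
      exact mul_dvd_mul (dvd_mul_right _ _) (dvd_mul_right _ _)
    have := hsq q hqm ((Polynomial.map_dvd_map _ hinj (hqm.mul hqm)).1 hdvd)
    rw [← hq, this, Polynomial.map_one, one_mul]
    exact isUnit_C.2 hlc.isUnit
  have hsep : (p.map (algebraMap R K)).Separable := PerfectField.separable_iff_squarefree.2 hsqK
  obtain ⟨a, b, hab⟩ := hsep
  -- Clearing the denominators of the two Bezout coefficients produces the constant d = d1 d2.
  obtain ⟨d1, hd1, h1⟩ := IsLocalization.integerNormalization_spec (nonZeroDivisors R) a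
  obtain ⟨d2, hd2, h2⟩ := IsLocalization.integerNormalization_spec (nonZeroDivisors R) b
  set a' := IsLocalization.integerNormalization (nonZeroDivisors R) a
  set b' := IsLocalization.integerNormalization (nonZeroDivisors R) b
  refine ⟨C d2 * a', C d1 * b', d1 * d2, mul_ne_zero (nonZeroDivisors.ne_zero hd1)
    (nonZeroDivisors.ne_zero hd2), ?_⟩
  apply Polynomial.map_injective _ hinj
  simp only [Polynomial.map_add, Polynomial.map_mul, map_C, h1, h2, ← derivative_map]
  rw [Algebra.smul_def, Algebra.smul_def, map_mul, C_mul]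
  simp only [IsScalarTower.algebraMap_apply R K K[X]]
  simp only [Polynomial.algebraMap_apply, Algebra.algebraMap_self, RingHom.id_apply]
  linear_combination C ((algebraMap R K) d1) * C ((algebraMap R K) d2) * hab

/-- A nonconstant monic factor keeps its degree under `ev` and divides X ^ n there, so it has the
root 0. Thus it suffices to control repeated factors at the residual point, which is what
reducedness of a germ provides. -/
theorem exists_bezout_derivative_of_eval {R : Type*} [CommRing R] [IsDomain R]
    [IsIntegrallyClosed R] [CharZero R] (ev : R →+* ℂ) {p : R[X]} (hp : p.Monic) {n : ℕ}
    (hpn : p.map ev = X ^ n) (hsq : ∀ q : R[X], q * q ∣ p → (q.map ev).eval 0 ≠ 0) :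
    ∃ (a b : R[X]) (d : R), d ≠ 0 ∧ a * p + b * derivative p = C d := by
  refine exists_bezout_derivative hp fun q hq hdvd => ?_
  by_contra hne
  have hdeg : (q.map ev).degree ≠ 0 := by
    rw [hq.degree_map]
    intro h
    exact hne (hq.degree_le_zero_iff_eq_one.1 h.le)
  obtain ⟨r, hr⟩ := IsAlgClosed.exists_root _ hdeg
  have h1 : q.map ev ∣ X ^ n := by
    rw [← hpn]
    exact Polynomial.map_dvd _ ((dvd_mul_right q q).trans hdvd)
  have h2 : r ^ n = 0 := by
    have := (hr.dvd h1)
    simpa using this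
  have h3 : r = 0 := eq_zero_of_pow_eq_zero h2
  rw [h3] at hr
  exact hsq q hdvd hr

end SquarefreePolynomial

/-! ### Reduced curves have isolated singularities -/

section ReducedIsolated
open Polynomial

/-- Polynomials in `y` with coefficients holomorphic in `x`, as germs on the plane. -/
def polyToGerm : (HolGerm ℂ)[X] →+* HolGerm (ℂ × ℂ) :=
  eval₂RingHom
    { toFun := fun g => ⟨(g : Germ (𝓝 (0 : ℂ)) ℂ).compTendsto (fun z : ℂ × ℂ => z.1)
          (continuous_fst.tendsto' 0 0 rfl), by
        obtain ⟨f, hf, rfl⟩ := HolGerm.exists_rep g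
        exact ⟨fun z => f z.1, analyticAt_comp_fst hf, rfl⟩⟩
      map_one' := rfl
      map_mul' := by
        intro a b
        obtain ⟨f, hf, rfl⟩ := HolGerm.exists_rep a
        obtain ⟨g, hg, rfl⟩ := HolGerm.exists_rep b
        rfl
      map_zero' := rfl
      map_add' := by
        intro a b
        obtain ⟨f, hf, rfl⟩ := HolGerm.exists_rep a
        obtain ⟨g, hg, rfl⟩ := HolGerm.exists_rep b
        rfl }
    germY

theorem polyToGerm_C {f : ℂ → ℂ} (hf : AnalyticAt ℂ f 0) :
    polyToGerm (C (HolGerm.mk f hf)) = HolGerm.mk _ (analyticAt_comp_fst hf) := by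
  rw [polyToGerm, coe_eval₂RingHom, eval₂_C]
  rfl

theorem polyToGerm_X : polyToGerm X = germY := by
  rw [polyToGerm, coe_eval₂RingHom, eval₂_X]

theorem eval_polyToGerm (q : (HolGerm ℂ)[X]) :
    HolGerm.eval (polyToGerm q) = (q.map HolGerm.eval).eval 0 := by
  have : (HolGerm.eval.comp polyToGerm) = (evalRingHom 0).comp (mapRingHom HolGerm.eval) := by
    apply Polynomial.ringHom_ext
    · intro a
      obtain ⟨f, hf, rfl⟩ := HolGerm.exists_rep a
      simp only [RingHom.comp_apply, polyToGerm_C, coe_mapRingHom, map_C, coe_evalRingHom, eval_C]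
      rfl
    · simp only [RingHom.comp_apply, polyToGerm_X, coe_mapRingHom, map_X, coe_evalRingHom, eval_X]
      rfl
  exact RingHom.congr_fun this q

theorem polyToGerm_weierstrass {n : ℕ} {a : ℕ → ℂ → ℂ} (ha : ∀ i, AnalyticAt ℂ (a i) 0) :
    polyToGerm (X ^ n + ∑ i ∈ Finset.range n, C (HolGerm.mk (a i) (ha i)) * X ^ i) =
      HolGerm.mk (fun z : ℂ × ℂ => z.2 ^ n + ∑ i ∈ Finset.range n, a i z.1 * z.2 ^ i)
        ((analyticAt_snd.pow n).add (analyticAt_polynomial_snd ha)) := by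
  have : ∀ m : ℕ, polyToGerm (∑ i ∈ Finset.range m, C (HolGerm.mk (a i) (ha i)) * X ^ i) =
      HolGerm.mk (fun z : ℂ × ℂ => ∑ i ∈ Finset.range m, a i z.1 * z.2 ^ i)
        (analyticAt_polynomial_snd ha) := by
    intro m
    induction m with
    | zero => simp; rfl
    | succ m ih =>
      rw [Finset.sum_range_succ, map_add, ih, map_mul, map_pow, polyToGerm_C, polyToGerm_X, germY,
        HolGerm.mk_pow, HolGerm.mk_mul, HolGerm.mk_add, HolGerm.mk_eq_mk]
      exact Eventually.of_forall fun z => (Finset.sum_range_succ _ _).symm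
  rw [map_add, this, map_pow, polyToGerm_X]
  rfl

theorem fderiv_weierstrass {n : ℕ} {a : ℕ → ℂ → ℂ} {z : ℂ × ℂ}
    (ha : ∀ i, DifferentiableAt ℂ (a i) z.1) :
    fderiv ℂ (fun z : ℂ × ℂ => z.2 ^ n + ∑ i ∈ Finset.range n, a i z.1 * z.2 ^ i) z (0, 1) =
      n * z.2 ^ (n - 1) + ∑ i ∈ Finset.range n, a i z.1 * (i * z.2 ^ (i - 1)) := by
  have hline : HasDerivAt (fun y : ℂ => ((z.1, y) : ℂ × ℂ)) (0, 1) z.2 :=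
    (hasDerivAt_const z.2 z.1).prodMk (hasDerivAt_id z.2)
  have hd : DifferentiableAt ℂ
      (fun z : ℂ × ℂ => z.2 ^ n + ∑ i ∈ Finset.range n, a i z.1 * z.2 ^ i) (z.1, z.2) := by
    have h1 : ∀ i, DifferentiableAt ℂ (fun w : ℂ × ℂ => a i w.1) (z.1, z.2) := fun i =>
      DifferentiableAt.comp (z.1, z.2) (f := Prod.fst) (ha i) differentiableAt_fst
    refine (differentiableAt_snd.pow n).add (DifferentiableAt.fun_sum fun i _ => ?_)
    exact (h1 i).mul (differentiableAt_snd.pow i)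
  have h1 := hd.hasFDerivAt.comp_hasDerivAt z.2 hline
  have h2 : HasDerivAt (fun y : ℂ => y ^ n + ∑ i ∈ Finset.range n, a i z.1 * y ^ i)
      (n * z.2 ^ (n - 1) + ∑ i ∈ Finset.range n, a i z.1 * (i * z.2 ^ (i - 1))) z.2 :=
    (hasDerivAt_pow n z.2).add (HasDerivAt.fun_sum fun i _ => (hasDerivAt_pow i z.2).const_mul _)
  exact h1.unique h2

/-- The formal derivative becomes ∂/∂y, so the Bezout identity becomes a membership in `jacIdeal`.
-/
theorem polyToGerm_derivative_weierstrass {n : ℕ} {a : ℕ → ℂ → ℂ}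
    (ha : ∀ i, AnalyticAt ℂ (a i) 0) :
    polyToGerm (derivative (X ^ n + ∑ i ∈ Finset.range n, C (HolGerm.mk (a i) (ha i)) * X ^ i)) =
      HolGerm.mk (fun z : ℂ × ℂ => fderiv ℂ
        (fun z : ℂ × ℂ => z.2 ^ n + ∑ i ∈ Finset.range n, a i z.1 * z.2 ^ i) z (0, 1))
        (((analyticAt_snd.pow n).add (analyticAt_polynomial_snd ha)).fderiv_apply _) := by
  have hterm : ∀ i : ℕ, polyToGerm (derivative (X ^ i)) =
      HolGerm.mk (fun z : ℂ × ℂ => (i : ℂ) * z.2 ^ (i - 1))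
        (analyticAt_const.mul (analyticAt_snd.pow _)) := by
    intro i
    rw [derivative_X_pow, map_mul, map_pow, polyToGerm_X, map_natCast, map_natCast]
    rfl
  have hAi : ∀ i, AnalyticAt ℂ (fun z : ℂ × ℂ => a i z.1 * (i * z.2 ^ (i - 1))) 0 := fun i =>
    (analyticAt_comp_fst (ha i)).mul (analyticAt_const.mul (analyticAt_snd.pow _))
  have : ∀ m : ℕ, polyToGerm (derivative
      (∑ i ∈ Finset.range m, C (HolGerm.mk (a i) (ha i)) * X ^ i)) =
      HolGerm.mk (fun z : ℂ × ℂ => ∑ i ∈ Finset.range m, a i z.1 * (i * z.2 ^ (i - 1)))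
        (Finset.analyticAt_fun_sum _ fun i _ => hAi i) := by
    intro m
    induction m with
    | zero => simp; rfl
    | succ m ih =>
      rw [Finset.sum_range_succ, derivative_add, map_add, ih, derivative_C_mul, map_mul, hterm,
        polyToGerm_C, HolGerm.mk_mul, HolGerm.mk_add, HolGerm.mk_eq_mk]
      exact Eventually.of_forall fun z => (Finset.sum_range_succ _ _).symm
  rw [derivative_add, map_add, this, hterm, HolGerm.mk_add, HolGerm.mk_eq_mk]
  have hall : ∀ᶠ z : ℂ × ℂ in 𝓝 0, ∀ i ∈ Finset.range n, DifferentiableAt ℂ (a i) z.1 := by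
    rw [Filter.eventually_all_finset]
    exact fun i _ => eventually_comp_fst
      ((ha i).eventually_analyticAt.mono fun x hx => hx.differentiableAt)
  filter_upwards [hall] with z hz
  -- Near 0 only finitely many coefficients can be differentiable simultaneously, so those outside
  -- the range are set to 0.
  have e1 : ∀ z' : ℂ × ℂ, ∑ i ∈ Finset.range n, a i z'.1 * z'.2 ^ i = ∑ i ∈ Finset.range n,
      (if i ∈ Finset.range n then a i else 0) z'.1 * z'.2 ^ i := fun z' =>
    Finset.sum_congr rfl fun i hi => by rw [if_pos hi]
  simp_rw [e1]
  rw [fderiv_weierstrass]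
  · congr 1
    exact Finset.sum_congr rfl fun i hi => by rw [if_pos hi]
  · intro i
    split_ifs with hi
    · exact hz i hi
    · exact differentiableAt_const _

/-- Reduced Weierstrass polynomials have isolated singularities. -/
theorem hasIsolatedCurveSing_weierstrass {n : ℕ} {a : ℕ → ℂ → ℂ} (ha : ∀ i, AnalyticAt ℂ (a i) 0)
    (ha0 : ∀ i, a i 0 = 0)
    (hred : IsReducedGerm (fun z : ℂ × ℂ => z.2 ^ n + ∑ i ∈ Finset.range n, a i z.1 * z.2 ^ i) 0) :
    HasIsolatedCurveSing (fun z : ℂ × ℂ => z.2 ^ n + ∑ i ∈ Finset.range n, a i z.1 * z.2 ^ i) := by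
  set P := fun z : ℂ × ℂ => z.2 ^ n + ∑ i ∈ Finset.range n, a i z.1 * z.2 ^ i with hP
  set p : (HolGerm ℂ)[X] := X ^ n + ∑ i ∈ Finset.range n, C (HolGerm.mk (a i) (ha i)) * X ^ i
    with hp
  have hPA : AnalyticAt ℂ P 0 := hred.1
  have hpm : p.Monic := by
    refine monic_X_pow_add ?_
    refine mem_degreeLT.1 (Submodule.sum_mem _ fun i hi => mem_degreeLT.2 ?_)
    refine (degree_C_mul_X_pow_le _ _).trans_lt ?_
    exact_mod_cast Finset.mem_range.1 hi
  have hpn : p.map HolGerm.eval = X ^ n := by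
    rw [hp, Polynomial.map_add, Polynomial.map_pow, map_X, Polynomial.map_sum,
      Finset.sum_eq_zero, add_zero]
    intro i _
    rw [Polynomial.map_mul, map_C, HolGerm.eval_mk, ha0, C_0, zero_mul]
  have hPp : polyToGerm p = HolGerm.mk P hPA := polyToGerm_weierstrass ha
  obtain ⟨A, B, d, hd, hbez⟩ := exists_bezout_derivative_of_eval HolGerm.eval hpm hpn (by
    rintro q ⟨w, hw⟩
    obtain ⟨u, hu, eu⟩ := HolGerm.exists_rep (polyToGerm q)
    obtain ⟨v, hv, ev⟩ := HolGerm.exists_rep (polyToGerm w)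
    rw [← eval_polyToGerm, eu]
    refine hred.2 u hu ⟨v, hv, ?_⟩
    have := congrArg polyToGerm hw
    rw [map_mul, map_mul, hPp, eu, ev, HolGerm.mk_mul, HolGerm.mk_mul, HolGerm.mk_eq_mk] at this
    exact this.mono fun z hz => by rw [hz]; ring)
  have hdJ : polyToGerm (C d) ∈ jacIdeal P := by
    rw [← hbez, map_add, map_mul, map_mul]
    refine Ideal.add_mem _ (Ideal.mul_mem_left _ _ ?_) (Ideal.mul_mem_left _ _ ?_)
    · rw [hPp]; exact self_mem_jacIdeal hPA
    · rw [hp, polyToGerm_derivative_weierstrass ha]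
      exact mk_mem_jacIdeal.2 ⟨0, 0, fun _ => 1, analyticAt_const, analyticAt_const,
        analyticAt_const, Eventually.of_forall fun z => by simp [hP]⟩
  -- The Bezout constant d(x) lies in the ideal and is a unit times x ^ N.
  obtain ⟨N, u, hu, hdu⟩ := HolGerm.exists_eq_pow_mul hd
  have hX : germX ∈ (jacIdeal P).radical := by
    refine ⟨N, ?_⟩
    have hXX : polyToGerm (C HolGerm.coordX) = germX := polyToGerm_C _
    rw [hdu, C_mul, C_pow, map_mul, map_pow, hXX] at hdJ
    have hu' : IsUnit (polyToGerm (C u)) := (hu.map C).map polyToGerm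
    exact (Ideal.mul_unit_mem_iff_mem _ hu').1 hdJ
  refine ⟨hPA, hX, ?_⟩
  refine Ideal.mem_radical_of_pow_mem (m := n) ?_
  -- The lower coefficients vanish at x = 0, so y ^ n differs from P by a multiple of x.
  have hsum : HolGerm.mk _ (analyticAt_polynomial_snd (n := n) ha) ∈ (jacIdeal P).radical := by
    obtain ⟨k, hk, ek⟩ := exists_eq_fst_mul (analyticAt_polynomial_snd (n := n) ha)
      (Eventually.of_forall fun y => by simp [ha0])
    have : HolGerm.mk _ (analyticAt_polynomial_snd (n := n) ha) = germX * HolGerm.mk k hk := by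
      rw [germX, HolGerm.mk_mul, HolGerm.mk_eq_mk]; exact ek
    rw [this]
    exact Ideal.mul_mem_right _ _ hX
  have : germY ^ n = HolGerm.mk P hPA - HolGerm.mk _ (analyticAt_polynomial_snd (n := n) ha) := by
    rw [eq_sub_iff_add_eq, germY, HolGerm.mk_pow, HolGerm.mk_add]
  rw [this]
  exact Ideal.sub_mem _ (Ideal.le_radical (self_mem_jacIdeal hPA)) hsum

/-- The shear `(x, y) ↦ (x + c y, y)`. -/
theorem isGermBihol_shearFst (c : ℂ) : IsGermBihol (fun z => (z.1 + c * z.2, z.2)) := by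
  have hL : ∀ z : ℂ × ℂ, HasFDerivAt (fun z : ℂ × ℂ => (z.1 + c * z.2, z.2))
      (((ContinuousLinearMap.fst ℂ ℂ ℂ) + c • (ContinuousLinearMap.snd ℂ ℂ ℂ)).prod
        (ContinuousLinearMap.snd ℂ ℂ ℂ)) z := fun z =>
    (hasFDerivAt_fst.add (hasFDerivAt_snd.const_mul c)).prodMk hasFDerivAt_snd
  refine ⟨(analyticAt_fst.add (analyticAt_const.mul analyticAt_snd)).prod analyticAt_snd,
    by simp, ?_⟩
  rw [jacDet, (hL 0).fderiv]
  simp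

/-- A nonzero germ does not vanish identically on the line `x = 0` after a generic shear. -/
theorem exists_shear_regular {f : ℂ × ℂ → ℂ} (hf : AnalyticAt ℂ f 0)
    (h0 : ¬ ∀ᶠ z in 𝓝 0, f z = 0) :
    ∃ c : ℂ, ¬ ∀ᶠ y in 𝓝 (0 : ℂ), f (c * y, y) = 0 := by
  obtain ⟨r, hr, hb⟩ := Metric.eventually_nhds_iff_ball.1 hf.eventually_analyticAt
  have hne := not_eventually_mul_eq_zero analyticAt_snd hf not_eventually_snd_eq_zero h0
  have : ∃ z ∈ Metric.ball (0 : ℂ × ℂ) r, z.2 * f z ≠ 0 := by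
    by_contra! H
    exact hne (Metric.eventually_nhds_iff_ball.2 ⟨r, hr, H⟩)
  obtain ⟨z, hz, hne⟩ := this
  have hz2 : z.2 ≠ 0 := left_ne_zero_of_mul hne
  -- The line is taken through 0 and a point z of the ball with y ≠ 0 and f ≠ 0. The radius below is
  -- exactly the one for which the line stays in the ball, and it reaches z, so the identity
  -- principle applies.
  refine ⟨z.1 / z.2, fun H => right_ne_zero_of_mul hne ?_⟩
  have hmap : ∀ y ∈ Metric.ball (0 : ℂ) (r * ‖z.2‖ / ‖z‖),
      ((z.1 / z.2 * y, y) : ℂ × ℂ) ∈ Metric.ball (0 : ℂ × ℂ) r := by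
    intro y hy
    rw [Metric.mem_ball, dist_zero_right] at hy ⊢
    have e : ((z.1 / z.2 * y, y) : ℂ × ℂ) = (y / z.2) • z := by
      ext <;> simp <;> field_simp
    have hzn : 0 < ‖z‖ := by
      rw [norm_pos_iff]; rintro rfl; exact hz2 rfl
    have hz2n : 0 < ‖z.2‖ := norm_pos_iff.2 hz2
    rw [e, norm_smul, norm_div, div_mul_eq_mul_div, div_lt_iff₀ hz2n]
    rwa [lt_div_iff₀ hzn] at hy
  have hA : AnalyticOnNhd ℂ (fun y : ℂ => f (z.1 / z.2 * y, y))
      (Metric.ball 0 (r * ‖z.2‖ / ‖z‖)) := fun y hy =>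
    (hb _ (hmap y hy)).comp_of_eq (f := fun y : ℂ => ((z.1 / z.2 * y, y) : ℂ × ℂ))
      ((analyticAt_const.mul analyticAt_id).prod analyticAt_id) rfl
  have hzn : 0 < ‖z‖ := by
    rw [norm_pos_iff]; rintro rfl; exact hz2 rfl
  have hz2n : 0 < ‖z.2‖ := norm_pos_iff.2 hz2
  have := hA.eqOn_zero_of_preconnected_of_eventuallyEq_zero (convex_ball _ _).isPreconnected
    (Metric.mem_ball_self (by positivity)) H
  have hmem : z.2 ∈ Metric.ball (0 : ℂ) (r * ‖z.2‖ / ‖z‖) := by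
    rw [Metric.mem_ball, dist_zero_right] at hz ⊢
    rw [lt_div_iff₀ hzn, mul_comm]
    gcongr
  have h2 := this hmem
  simpa [div_mul_cancel₀ _ hz2] using h2

/-- Reduced curves in the plane have isolated singularities. -/
theorem IsReducedGerm.hasIsolatedCurveSing {f : ℂ × ℂ → ℂ} (hf : IsReducedGerm f 0) :
    HasIsolatedCurveSing f := by
  obtain ⟨c, hc⟩ := exists_shear_regular hf.1 hf.not_eventually_zero
  have hs := isGermBihol_shearFst c
  have hf1 := hf.comp_bihol hs
  have hord : analyticOrderAt (fun y => f (0 + c * y, y)) 0 ≠ ⊤ := by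
    rw [Ne, analyticOrderAt_eq_top]
    simpa using hc
  obtain ⟨n, hn⟩ := ENat.ne_top_iff_exists.1 hord
  obtain ⟨u, a, hu, hu0, ha, ha0, e⟩ := exists_weierstrass_preparation hf1.1 hn.symm
  have hPA := (analyticAt_snd.pow n).add (analyticAt_polynomial_snd (n := n) ha)
  have hP := hasIsolatedCurveSing_weierstrass ha ha0 (hf1.of_mul hu hPA e)
  -- The Weierstrass polynomial is a unit times the sheared germ, which therefore occurs as a factor
  -- of it.
  have h1 := hP.of_eq_mul (hu.inv hu0) hf1.1 (by
    filter_upwards [e, hu.continuousAt.eventually_ne hu0] with z hz hz0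
    rw [hz, Pi.inv_apply, inv_mul_cancel_left₀ hz0])
  obtain ⟨Ψ, hΨ, h2, -⟩ := hs.exists_inverse
  have h3 := h1.comp_bihol hΨ
  refine h3.of_eq_mul (w := fun _ => 1) analyticAt_const hf.1 ?_
  filter_upwards [h2] with z hz
  rw [one_mul, hz]

end ReducedIsolated

/-! ### Charts of the blow-up of the origin -/

section BlowUpMap

/-- The standard chart `(x, t) ↦ (x, x t)` of the blow-up of the origin. -/
def blowUpMap (z : ℂ × ℂ) : ℂ × ℂ := (z.1, z.1 * z.2)

/-- A linear change of coordinates. -/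
def linMap (α β γ δ : ℂ) (z : ℂ × ℂ) : ℂ × ℂ := (α * z.1 + β * z.2, γ * z.1 + δ * z.2)

/-- The chart `(x, t) ↦ (x (α + β t), x (γ + δ t))` of the blow-up of the origin. -/
def chartBlowUp (α β γ δ : ℂ) (z : ℂ × ℂ) : ℂ × ℂ :=
  (z.1 * (α + β * z.2), z.1 * (γ + δ * z.2))

theorem linMap_blowUpMap (α β γ δ : ℂ) (z : ℂ × ℂ) :
    linMap α β γ δ (blowUpMap z) = chartBlowUp α β γ δ z := by
  simp only [linMap, blowUpMap, chartBlowUp]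
  ext <;> ring

theorem hasFDerivAt_linMap (α β γ δ : ℂ) (z : ℂ × ℂ) :
    HasFDerivAt (linMap α β γ δ)
      ((α • ContinuousLinearMap.fst ℂ ℂ ℂ + β • ContinuousLinearMap.snd ℂ ℂ ℂ).prod
        (γ • ContinuousLinearMap.fst ℂ ℂ ℂ + δ • ContinuousLinearMap.snd ℂ ℂ ℂ)) z :=
  ((hasFDerivAt_fst.const_mul α).add (hasFDerivAt_snd.const_mul β)).prodMk
    ((hasFDerivAt_fst.const_mul γ).add (hasFDerivAt_snd.const_mul δ))

theorem isGermBihol_linMap {α β γ δ : ℂ} (h : α * δ - β * γ ≠ 0) :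
    IsGermBihol (linMap α β γ δ) := by
  refine ⟨?_, by simp [linMap], ?_⟩
  · exact ((analyticAt_const.mul analyticAt_fst).add (analyticAt_const.mul analyticAt_snd)).prod
      ((analyticAt_const.mul analyticAt_fst).add (analyticAt_const.mul analyticAt_snd))
  · rw [jacDet, (hasFDerivAt_linMap α β γ δ 0).fderiv]
    simpa using h

theorem isGermBihol_swap : IsGermBihol Prod.swap := by
  have : (Prod.swap : ℂ × ℂ → ℂ × ℂ) = linMap 0 1 1 0 := by
    funext z; simp [linMap, Prod.swap]
  rw [this]
  exact isGermBihol_linMap (by norm_num)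

theorem analyticAt_chartBlowUp (α β γ δ : ℂ) (z : ℂ × ℂ) :
    AnalyticAt ℂ (chartBlowUp α β γ δ) z :=
  (analyticAt_fst.mul (analyticAt_const.add (analyticAt_const.mul analyticAt_snd))).prod
    (analyticAt_fst.mul (analyticAt_const.add (analyticAt_const.mul analyticAt_snd)))

theorem chartBlowUp_zero_left (α β γ δ t : ℂ) : chartBlowUp α β γ δ (0, t) = 0 := by
  simp [chartBlowUp]

theorem chartBlowUp_zero (α β γ δ : ℂ) : chartBlowUp α β γ δ 0 = 0 :=
  chartBlowUp_zero_left α β γ δ 0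

theorem tendsto_chartBlowUp (α β γ δ : ℂ) : Tendsto (chartBlowUp α β γ δ) (𝓝 0) (𝓝 0) := by
  have := (analyticAt_chartBlowUp α β γ δ 0).continuousAt.tendsto
  rwa [chartBlowUp_zero] at this

theorem blowUpMap_eq : blowUpMap = chartBlowUp 1 0 0 1 := by
  funext z; simp [blowUpMap, chartBlowUp]

theorem fderiv_chartBlowUp (α β γ δ : ℂ) (z v : ℂ × ℂ) :
    fderiv ℂ (chartBlowUp α β γ δ) z v =
      (v.1 * (α + β * z.2) + z.1 * (β * v.2), v.1 * (γ + δ * z.2) + z.1 * (δ * v.2)) := by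
  have h1 : ∀ p q : ℂ, HasFDerivAt (fun z : ℂ × ℂ => z.1 * (p + q * z.2))
      (z.1 • (q • ContinuousLinearMap.snd ℂ ℂ ℂ) + (p + q * z.2) • ContinuousLinearMap.fst ℂ ℂ ℂ)
      z := fun p q => hasFDerivAt_fst.mul ((hasFDerivAt_snd.const_mul q).const_add p)
  have := (h1 α β).prodMk (h1 γ δ)
  rw [show chartBlowUp α β γ δ = fun z : ℂ × ℂ => (z.1 * (α + β * z.2), z.1 * (γ + δ * z.2))
    from rfl, this.fderiv]
  ext <;> simp <;> ring

theorem jacDet_chartBlowUp (α β γ δ : ℂ) (z : ℂ × ℂ) :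
    jacDet (chartBlowUp α β γ δ) z = z.1 * (α * δ - β * γ) := by
  simp only [jacDet, fderiv_chartBlowUp]
  ring

theorem pullbackForm_chartBlowUp (α β γ δ : ℂ) (τ : ℂ × ℂ → (ℂ × ℂ →L[ℂ] ℂ)) (z : ℂ × ℂ) :
    pullbackForm (chartBlowUp α β γ δ) τ z = mkForm
      (fun z => (α + β * z.2) * τ (chartBlowUp α β γ δ z) (1, 0) +
        (γ + δ * z.2) * τ (chartBlowUp α β γ δ z) (0, 1))
      (fun z => z.1 * (β * τ (chartBlowUp α β γ δ z) (1, 0) +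
        δ * τ (chartBlowUp α β γ δ z) (0, 1))) z := by
  refine form_ext ?_ ?_ <;>
  · rw [pullbackForm_apply, fderiv_chartBlowUp, mkForm_apply]
    simp
    try ring

end BlowUpMap

/-! ### Orders, leading forms and strict transforms of germs -/

section LeadingForms

/-- `h = ∑ x ^ (m - i) y ^ i c i` with holomorphic coefficients: `h` has order at least `m`. -/
def HasExpansion (h : ℂ × ℂ → ℂ) (m : ℕ) (c : ℕ → ℂ × ℂ → ℂ) : Prop :=
  (∀ i, AnalyticAt ℂ (c i) 0) ∧
    ∀ᶠ z in 𝓝 0, h z = ∑ i ∈ Finset.range (m + 1), z.1 ^ (m - i) * z.2 ^ i * c i z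

/-- By Hadamard's lemma c_i = x a_i + y b_i; the coefficient of x ^ (m + 1 - i) y ^ i is then a_i +
b_(i - 1), with the two end terms missing one summand. -/
theorem HasExpansion.succ {h : ℂ × ℂ → ℂ} {m : ℕ} {c : ℕ → ℂ × ℂ → ℂ} (H : HasExpansion h m c)
    (h0 : ∀ i ≤ m, c i 0 = 0) : ∃ c', HasExpansion h (m + 1) c' := by
  have : ∀ i, ∃ a b : ℂ × ℂ → ℂ, AnalyticAt ℂ a 0 ∧ AnalyticAt ℂ b 0 ∧
      (i ≤ m → ∀ᶠ z in 𝓝 0, c i z = z.1 * a z + z.2 * b z) := by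
    intro i
    by_cases hi : i ≤ m
    · obtain ⟨a, b, ha, hb, e⟩ := exists_eq_fst_mul_add_snd_mul (H.1 i) (h0 i hi)
      exact ⟨a, b, ha, hb, fun _ => e⟩
    · exact ⟨0, 0, analyticAt_const, analyticAt_const, fun h => absurd h hi⟩
  choose a b ha hb e using this
  let a' : ℕ → ℂ × ℂ → ℂ := fun i => if i ≤ m then a i else 0
  let b' : ℕ → ℂ × ℂ → ℂ := fun i => Nat.casesOn i 0 fun j => b j
  refine ⟨fun i z => a' i z + b' i z, ?_, ?_⟩
  · intro i
    refine AnalyticAt.add ?_ ?_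
    · dsimp only [a']
      split_ifs
      · exact ha i
      · exact analyticAt_const
    · cases i with
      | zero => exact analyticAt_const
      | succ j => exact hb j
  · have hall : ∀ᶠ z in 𝓝 (0 : ℂ × ℂ), ∀ i ∈ Finset.range (m + 1),
        c i z = z.1 * a i z + z.2 * b i z := by
      rw [Filter.eventually_all_finset]
      exact fun i hi => e i (Nat.lt_succ_iff.1 (Finset.mem_range.1 hi))
    filter_upwards [H.2, hall] with z h1 h2
    rw [h1]
    simp_rw [mul_add, Finset.sum_add_distrib]
    rw [Finset.sum_range_succ _ (m + 1), Finset.sum_range_succ' _ (m + 1)]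
    have e1 : a' (m + 1) z = 0 := by simp [a']
    have e2 : b' 0 z = 0 := rfl
    rw [e1, e2, mul_zero, mul_zero, add_zero, add_zero, ← Finset.sum_add_distrib]
    refine Finset.sum_congr rfl fun i hi => ?_
    have hi' := Nat.lt_succ_iff.1 (Finset.mem_range.1 hi)
    have e3 : a' i z = a i z := by simp [a', hi']
    have e4 : b' (i + 1) z = b i z := rfl
    rw [h2 i hi, e3, e4, Nat.add_sub_add_right,
      Nat.succ_sub hi', Nat.succ_eq_add_one, pow_succ]
    ring

/-- On the line x = d y every monomial of degree m gives y ^ m. A germ with expansions of all orders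
thus vanishes on all these lines, hence is zero. -/
theorem HasExpansion.le_order {h : ℂ × ℂ → ℂ} {m : ℕ} {c : ℕ → ℂ × ℂ → ℂ}
    (H : HasExpansion h m c) (hh : AnalyticAt ℂ h 0) (d : ℂ) :
    (m : ℕ∞) ≤ analyticOrderAt (fun y => h (d * y, y)) 0 := by
  have hline : AnalyticAt ℂ (fun y : ℂ => ((d * y, y) : ℂ × ℂ)) 0 :=
    (analyticAt_const.mul analyticAt_id).prod analyticAt_id
  have h0 : (fun y : ℂ => ((d * y, y) : ℂ × ℂ)) 0 = 0 := by simp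
  have hA : AnalyticAt ℂ (fun y => h (d * y, y)) 0 :=
    hh.comp_of_eq (f := fun y : ℂ => ((d * y, y) : ℂ × ℂ)) hline h0
  refine (natCast_le_analyticOrderAt hA).2
    ⟨fun y => ∑ i ∈ Finset.range (m + 1), d ^ (m - i) * c i (d * y, y), ?_, ?_⟩
  · refine Finset.analyticAt_fun_sum _ fun i _ => analyticAt_const.mul ?_
    exact (H.1 i).comp_of_eq (f := fun y : ℂ => ((d * y, y) : ℂ × ℂ)) hline h0
  · have ht : Tendsto (fun y : ℂ => ((d * y, y) : ℂ × ℂ)) (𝓝 0) (𝓝 0) :=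
      (by fun_prop : Continuous fun y : ℂ => ((d * y, y) : ℂ × ℂ)).tendsto' 0 0 (by simp)
    filter_upwards [ht.eventually H.2] with y hy
    rw [hy, sub_zero, smul_eq_mul, Finset.mul_sum]
    refine Finset.sum_congr rfl fun i hi => ?_
    have hi' := Nat.lt_succ_iff.1 (Finset.mem_range.1 hi)
    obtain ⟨k, rfl⟩ := Nat.exists_eq_add_of_le hi'
    rw [Nat.add_sub_cancel_left]
    ring

/-- The expansion of a pair of germs, not both zero, at the minimum of their orders. -/
theorem exists_expansion_pair {A B : ℂ × ℂ → ℂ} (hA : AnalyticAt ℂ A 0) (hB : AnalyticAt ℂ B 0)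
    (h0 : ¬ ((∀ᶠ z in 𝓝 0, A z = 0) ∧ ∀ᶠ z in 𝓝 0, B z = 0)) :
    ∃ m a b, HasExpansion A m a ∧ HasExpansion B m b ∧ ∃ i ≤ m, a i 0 ≠ 0 ∨ b i 0 ≠ 0 := by
  by_contra! hcon
  have key : ∀ m, ∃ a b, HasExpansion A m a ∧ HasExpansion B m b := by
    intro m
    induction m with
    | zero =>
      exact ⟨fun _ => A, fun _ => B, ⟨fun _ => hA, by simp⟩, ⟨fun _ => hB, by simp⟩⟩
    | succ m ih =>
      obtain ⟨a, b, ha, hb⟩ := ih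
      have := hcon m a b ha hb
      obtain ⟨a', ha'⟩ := ha.succ fun i hi => (this i hi).1
      obtain ⟨b', hb'⟩ := hb.succ fun i hi => (this i hi).2
      exact ⟨a', b', ha', hb'⟩
  have aux : ∀ f : ℂ × ℂ → ℂ, AnalyticAt ℂ f 0 → (∀ m, ∃ c, HasExpansion f m c) →
      ∀ᶠ z in 𝓝 0, f z = 0 := by
    intro f hf hm
    by_contra hf0
    obtain ⟨d, hd⟩ := exists_shear_regular hf hf0
    refine hd (analyticOrderAt_eq_top.1 (ENat.eq_top_iff_forall_ge.2 fun m => ?_))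
    obtain ⟨c, hc⟩ := hm m
    exact hc.le_order hf d
  exact h0 ⟨aux A hA fun m => let ⟨a, b, h, _⟩ := key m; ⟨a, h⟩,
    aux B hB fun m => let ⟨a, b, _, h⟩ := key m; ⟨b, h⟩⟩

/-- The expansion of a nonzero germ at its order. -/
theorem exists_expansion {h : ℂ × ℂ → ℂ} (hh : AnalyticAt ℂ h 0)
    (h0 : ¬ ∀ᶠ z in 𝓝 0, h z = 0) :
    ∃ m c, HasExpansion h m c ∧ ∃ i ≤ m, c i 0 ≠ 0 := by
  obtain ⟨m, a, b, ha, hb, i, hi, hne⟩ := exists_expansion_pair hh hh fun H => h0 H.1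
  rcases hne with hne | hne
  · exact ⟨m, a, ha, i, hi, hne⟩
  · exact ⟨m, b, hb, i, hi, hne⟩

/-- The strict transform in a chart of the blow-up. -/
def strictTransform (α β γ δ : ℂ) (m : ℕ) (c : ℕ → ℂ × ℂ → ℂ) (z : ℂ × ℂ) : ℂ :=
  ∑ i ∈ Finset.range (m + 1), (α + β * z.2) ^ (m - i) * (γ + δ * z.2) ^ i *
    c i (chartBlowUp α β γ δ z)

theorem HasExpansion.analyticAt_strictTransform {h : ℂ × ℂ → ℂ} {m : ℕ} {c : ℕ → ℂ × ℂ → ℂ}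
    (H : HasExpansion h m c) (α β γ δ : ℂ) :
    AnalyticAt ℂ (strictTransform α β γ δ m c) 0 := by
  refine Finset.analyticAt_fun_sum _ fun i _ => ((AnalyticAt.pow ?_ _).mul (AnalyticAt.pow ?_ _)).mul
    ((H.1 i).comp_zero (analyticAt_chartBlowUp α β γ δ 0) (chartBlowUp_zero α β γ δ))
  · exact analyticAt_const.add (analyticAt_const.mul analyticAt_snd)
  · exact analyticAt_const.add (analyticAt_const.mul analyticAt_snd)

theorem HasExpansion.comp_chartBlowUp {h : ℂ × ℂ → ℂ} {m : ℕ} {c : ℕ → ℂ × ℂ → ℂ}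
    (H : HasExpansion h m c) (α β γ δ : ℂ) :
    ∀ᶠ z in 𝓝 0, h (chartBlowUp α β γ δ z) = z.1 ^ m * strictTransform α β γ δ m c z := by
  filter_upwards [(tendsto_chartBlowUp α β γ δ).eventually H.2] with z hz
  rw [hz, strictTransform, Finset.mul_sum]
  refine Finset.sum_congr rfl fun i hi => ?_
  have hi' := Nat.lt_succ_iff.1 (Finset.mem_range.1 hi)
  obtain ⟨k, rfl⟩ := Nat.exists_eq_add_of_le hi'
  generalize c i (chartBlowUp α β γ δ z) = w
  simp only [Nat.add_sub_cancel_left, chartBlowUp, mul_pow, pow_add]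
  ring

/-- The leading form of an expansion, dehomogenized. -/
def leadPoly (m : ℕ) (c : ℕ → ℂ × ℂ → ℂ) : Polynomial ℂ :=
  ∑ i ∈ Finset.range (m + 1), Polynomial.C (c i 0) * Polynomial.X ^ i

theorem leadPoly_coeff (m : ℕ) (c : ℕ → ℂ × ℂ → ℂ) (i : ℕ) :
    (leadPoly m c).coeff i = if i ≤ m then c i 0 else 0 := by
  simp only [leadPoly, Polynomial.finsetSum_coeff, Polynomial.coeff_C_mul, Polynomial.coeff_X_pow,
    mul_ite, mul_one, mul_zero]
  rw [Finset.sum_ite_eq]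
  simp

theorem leadPoly_ne_zero {m : ℕ} {c : ℕ → ℂ × ℂ → ℂ} (h : ∃ i ≤ m, c i 0 ≠ 0) :
    leadPoly m c ≠ 0 := by
  obtain ⟨i, hi, hne⟩ := h
  intro h0
  have := leadPoly_coeff m c i
  rw [h0, if_pos hi, Polynomial.coeff_zero] at this
  exact hne this.symm

theorem natDegree_leadPoly_le (m : ℕ) (c : ℕ → ℂ × ℂ → ℂ) : (leadPoly m c).natDegree ≤ m := by
  rw [Polynomial.natDegree_le_iff_coeff_eq_zero]
  intro i hi
  rw [leadPoly_coeff, if_neg (by omega)]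

/-- Values of the homogenization of a polynomial of degree at most `m`. -/
def homEval (m : ℕ) (p : Polynomial ℂ) (a b : ℂ) : ℂ :=
  ∑ i ∈ Finset.range (m + 1), p.coeff i * a ^ (m - i) * b ^ i

/-- The exceptional curve is collapsed to the origin, so only the values c_i(0), that is the leading
form, survive. -/
theorem strictTransform_zero_left (α β γ δ : ℂ) (m : ℕ) (c : ℕ → ℂ × ℂ → ℂ) (t : ℂ) :
    strictTransform α β γ δ m c (0, t) = homEval m (leadPoly m c) (α + β * t) (γ + δ * t) := by
  rw [strictTransform, homEval]
  refine Finset.sum_congr rfl fun i hi => ?_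
  rw [leadPoly_coeff, if_pos (Nat.lt_succ_iff.1 (Finset.mem_range.1 hi)), chartBlowUp_zero_left]
  ring

theorem homEval_one {m : ℕ} {p : Polynomial ℂ} (hp : p.natDegree ≤ m) (t : ℂ) :
    homEval m p 1 t = p.eval t := by
  rw [homEval, Polynomial.eval_eq_sum_range' (Nat.lt_succ_iff.2 hp)]
  simp

end LeadingForms

/-! ### The strict transform together with the exceptional curve is reduced -/

section TransformCurves

/-- If `x ^ N a = h K` where `h` does not vanish identically on `x = 0`, then `h` divides `a`. -/
theorem exists_eq_mul_of_fst_pow_mul {h a : ℂ × ℂ → ℂ} (hh : AnalyticAt ℂ h 0)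
    (hh0 : ¬ ∀ᶠ y in 𝓝 0, h (0, y) = 0) (ha : AnalyticAt ℂ a 0) (N : ℕ) {K : ℂ × ℂ → ℂ}
    (hK : AnalyticAt ℂ K 0) (e : ∀ᶠ z in 𝓝 0, z.1 ^ N * a z = h z * K z) :
    ∃ k, AnalyticAt ℂ k 0 ∧ ∀ᶠ z in 𝓝 0, a z = h z * k z := by
  induction N generalizing K with
  | zero => exact ⟨K, hK, by simpa using e⟩
  | succ N ih =>
    have hK0 : ∀ᶠ y in 𝓝 0, K (0, y) = 0 := by
      refine eventually_eq_zero_of_mul hh.curry_right₂ hK.curry_right₂ ?_ hh0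
      filter_upwards [eventually_slice_snd e] with y hy
      rw [← hy]; simp
    obtain ⟨K', hK', e'⟩ := exists_eq_fst_mul hK hK0
    refine ih hK' (eventually_eq_of_mul_left analyticAt_fst ((analyticAt_fst.pow N).mul ha)
      (hh.mul hK') ?_ not_eventually_fst_eq_zero)
    filter_upwards [e, e'] with z h1 h2
    rw [h2] at h1
    linear_combination h1

/-- By the chain rule, the relation x ^ N = a h + b h_x + c h_y pulled back and multiplied by x
places x ^ (N + 1) in the ideal of h ∘ b, hence in that of k; one more factor x² passes to the ideal
of x k. Moreover k² = k (x k)_x - k_x (x k), and modulo x the germ k² is a unit times a power of y,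
so y also lies in the radical. -/
theorem HasIsolatedCurveSing.strictTransform {h k : ℂ × ℂ → ℂ} (H : HasIsolatedCurveSing h)
    {m : ℕ} (hk : AnalyticAt ℂ k 0) (hk0 : ¬ ∀ᶠ t in 𝓝 0, k (0, t) = 0)
    (e : ∀ᶠ z in 𝓝 0, h (blowUpMap z) = z.1 ^ m * k z) :
    HasIsolatedCurveSing fun z => z.1 * k z := by
  have hbA : AnalyticAt ℂ blowUpMap 0 := by rw [blowUpMap_eq]; exact analyticAt_chartBlowUp _ _ _ _ _
  have hb0 : blowUpMap 0 = 0 := by simp [blowUpMap]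
  have hbt : Tendsto blowUpMap (𝓝 0) (𝓝 0) := by rw [blowUpMap_eq]; exact tendsto_chartBlowUp _ _ _ _
  have hh := H.analyticAt
  have hgA : AnalyticAt ℂ (fun z : ℂ × ℂ => z.1 * k z) 0 := analyticAt_fst.mul hk
  -- powers of `x` in the ideal of the strict transform
  have hX1 : ∃ N : ℕ, germX ^ N ∈ jacIdeal k := by
    obtain ⟨⟨N, a, b, c, ha, hb, hc, E⟩, -⟩ := H.exists_pow
    have hle : jacIdeal (fun z => h (blowUpMap z)) ≤ jacIdeal k :=
      jacIdeal_le_of_eq_mul (analyticAt_fst.pow m) hk e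
    refine ⟨N + 1, hle ?_⟩
    rw [germX, HolGerm.mk_pow, mk_mem_jacIdeal]
    refine ⟨fun z => z.1 * a (blowUpMap z), fun z => z.1 * b (blowUpMap z),
      fun z => c (blowUpMap z) - z.2 * b (blowUpMap z),
      analyticAt_fst.mul (ha.comp_zero hbA hb0), analyticAt_fst.mul (hb.comp_zero hbA hb0),
      (hc.comp_zero hbA hb0).sub (analyticAt_snd.mul (hb.comp_zero hbA hb0)), ?_⟩
    filter_upwards [hbt.eventually E, hbt.eventually hh.eventually_analyticAt,
      hbA.eventually_analyticAt] with z h1 h2 h3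
    rw [fderiv_comp_apply₂ h2.differentiableAt h3.differentiableAt,
      fderiv_comp_apply₂ h2.differentiableAt h3.differentiableAt]
    have e1 : (blowUpMap z).1 = z.1 := rfl
    rw [e1] at h1
    have e2 : ∀ v, fderiv ℂ blowUpMap z v = (v.1, v.1 * z.2 + z.1 * v.2) := by
      intro v
      rw [blowUpMap_eq, fderiv_chartBlowUp]
      ext <;> simp
    simp only [e2]
    rw [pow_succ, h1]
    ring
  have hd : ∀ᶠ z in 𝓝 (0 : ℂ × ℂ), ∀ v : ℂ × ℂ, fderiv ℂ (fun z : ℂ × ℂ => z.1 * k z) z v =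
      z.1 * fderiv ℂ k z v + k z * v.1 := by
    filter_upwards [hk.eventually_analyticAt] with z hz v
    rw [fderiv_mul_apply differentiableAt_fst hz.differentiableAt, fderiv_fst_apply']
  have hX : germX ∈ (jacIdeal fun z => z.1 * k z).radical := by
    obtain ⟨N, hN⟩ := hX1
    refine ⟨N + 2, ?_⟩
    rw [germX, HolGerm.mk_pow, mk_mem_jacIdeal] at hN
    obtain ⟨a, b, c, ha, hb, hc, E⟩ := hN
    rw [germX, HolGerm.mk_pow, mk_mem_jacIdeal]
    refine ⟨fun z => a z * z.1 - b z, fun z => b z * z.1, fun z => c z * z.1,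
      (ha.mul analyticAt_fst).sub hb, hb.mul analyticAt_fst, hc.mul analyticAt_fst, ?_⟩
    filter_upwards [E, hd] with z h1 h2
    rw [h2, h2, pow_add, h1]
    ring
  refine ⟨hgA, hX, ?_⟩
  have hord : analyticOrderAt (fun t => k (0, t)) 0 ≠ ⊤ := by
    rwa [Ne, analyticOrderAt_eq_top]
  obtain ⟨n, hn⟩ := ENat.ne_top_iff_exists.1 hord
  obtain ⟨v, hv, hv0, hkv⟩ := (hk.curry_right₂.analyticOrderAt_eq_natCast).1 hn.symm
  have hkk : HolGerm.mk _ (hk.mul hk) ∈ jacIdeal fun z => z.1 * k z := by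
    rw [mk_mem_jacIdeal]
    refine ⟨fun z => -fderiv ℂ k z (1, 0), k, 0, (hk.fderiv_apply _).neg, hk, analyticAt_const, ?_⟩
    filter_upwards [hd] with z h2
    rw [h2]
    simp
    ring
  have hv2 := analyticAt_comp_snd hv
  have hdiff : AnalyticAt ℂ (fun z : ℂ × ℂ => k z * k z - (z.2 ^ (2 * n)) * (v z.2 * v z.2)) 0 :=
    (hk.mul hk).sub ((analyticAt_snd.pow _).mul (hv2.mul hv2))
  obtain ⟨l, hl, el⟩ := exists_eq_fst_mul hdiff (by
    filter_upwards [hkv] with t ht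
    rw [ht]
    simp
    ring)
  have hY : germY ^ (2 * n) * HolGerm.mk _ (hv2.mul hv2) =
      HolGerm.mk _ (hk.mul hk) - germX * HolGerm.mk l hl := by
    rw [eq_sub_iff_add_eq, germY, germX, HolGerm.mk_pow, HolGerm.mk_mul, HolGerm.mk_mul,
      HolGerm.mk_add, HolGerm.mk_eq_mk]
    filter_upwards [el] with z hz
    simp only [Pi.mul_apply] at hz ⊢
    linear_combination -hz
  have hu : IsUnit (HolGerm.mk _ (hv2.mul hv2)) :=
    HolGerm.isUnit_mk _ (mul_ne_zero hv0 hv0)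
  refine Ideal.mem_radical_of_pow_mem (m := 2 * n) ((Ideal.mul_unit_mem_iff_mem _ hu).1 ?_)
  rw [hY]
  exact Ideal.sub_mem _ (Ideal.le_radical hkk) (Ideal.mul_mem_right _ _ hX)

end TransformCurves

/-! ### Picard iteration for holomorphic differential equations -/

section HolomorphicODE
open Metric

theorem exists_bounds {w : ℂ × ℂ → ℂ} (hw : AnalyticAt ℂ w 0) :
    ∃ R > 0, ∃ M > 0, ∃ L > 0, AnalyticOnNhd ℂ w (ball 0 R ×ˢ ball 0 R) ∧
      (∀ z ∈ ball (0 : ℂ) R ×ˢ ball (0 : ℂ) R, ‖w z‖ ≤ M) ∧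
      ∀ x ∈ ball (0 : ℂ) R, ∀ y ∈ ball (0 : ℂ) R, ∀ y' ∈ ball (0 : ℂ) R,
        ‖w (x, y) - w (x, y')‖ ≤ L * ‖y - y'‖ := by
  have hc : ContDiffAt ℂ 1 w 0 := hw.contDiffAt
  obtain ⟨K, t, ht, hK⟩ := hc.exists_lipschitzOnWith
  obtain ⟨R, hR, hb⟩ := Metric.eventually_nhds_iff_ball.1 (hw.eventually_analyticAt.and
    ((hw.continuousAt.norm.eventually_lt_const (lt_add_one _)).and ht))
  have hmem : ∀ z ∈ ball (0 : ℂ) R ×ˢ ball (0 : ℂ) R, z ∈ ball (0 : ℂ × ℂ) R := by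
    intro z hz
    rwa [ball_prod_same] at hz
  refine ⟨R, hR, ‖w 0‖ + 1, by positivity, K + 1, by positivity, fun z hz => (hb z (hmem z hz)).1,
    fun z hz => (hb z (hmem z hz)).2.1.le, fun x hx y hy y' hy' => ?_⟩
  have h1 := hK.norm_sub_le (hb _ (hmem (x, y) ⟨hx, hy⟩)).2.2 (hb _ (hmem (x, y') ⟨hx, hy'⟩)).2.2
  have h2 : ‖((x, y) : ℂ × ℂ) - (x, y')‖ = ‖y - y'‖ := by
    rw [Prod.mk_sub_mk, sub_self, Prod.norm_def]
    simp
  rw [h2] at h1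
  refine h1.trans ?_
  gcongr
  linarith

/-- Existence of holomorphic solutions of holomorphic ordinary differential equations. -/
theorem exists_holomorphic_ode_solution {w : ℂ × ℂ → ℂ} (hw : AnalyticAt ℂ w 0) :
    ∃ φ : ℂ → ℂ, AnalyticAt ℂ φ 0 ∧ φ 0 = 0 ∧ ∀ᶠ x in 𝓝 0, HasDerivAt φ (w (x, φ x)) x := by
  obtain ⟨R, hR, M, hM, L, hL, hA, hbd, hlip⟩ := exists_bounds hw
  -- M r < R keeps the graphs in the domain of w, and L r ≤ 1 / 2 makes each Picard step contract.
  obtain ⟨r, hr, hr'⟩ : ∃ r > 0, r ≤ R ∧ M * r < R ∧ L * r ≤ 1 / 2 := by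
    refine ⟨min R (min (R / (2 * M)) (1 / (2 * L))), lt_min hR (lt_min (by positivity)
      (by positivity)), min_le_left _ _, ?_, ?_⟩
    · have h1 : min R (min (R / (2 * M)) (1 / (2 * L))) ≤ R / (2 * M) :=
        (min_le_right _ _).trans (min_le_left _ _)
      calc M * min R (min (R / (2 * M)) (1 / (2 * L))) ≤ M * (R / (2 * M)) := by gcongr
        _ = R / 2 := by field_simp
        _ < R := by linarith
    · have h1 : min R (min (R / (2 * M)) (1 / (2 * L))) ≤ 1 / (2 * L) :=
        (min_le_right _ _).trans (min_le_right _ _)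
      calc L * min R (min (R / (2 * M)) (1 / (2 * L))) ≤ L * (1 / (2 * L)) := by gcongr
        _ = 1 / 2 := by field_simp
  obtain ⟨hrR, hMr, hLr⟩ := hr'
  have hsub : ball (0 : ℂ) r ⊆ ball 0 R := ball_subset_ball hrR
  let S := {φ : ℂ → ℂ // DifferentiableOn ℂ φ (ball 0 r) ∧ ∀ x ∈ ball (0 : ℂ) r, ‖φ x‖ ≤ M * r}
  have hSR : ∀ φ : S, ∀ x ∈ ball (0 : ℂ) r, φ.1 x ∈ ball (0 : ℂ) R := fun φ x hx => by
    rw [mem_ball, dist_zero_right]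
    exact (φ.2.2 x hx).trans_lt hMr
  have hstep : ∀ φ : S, ∃ ψ : S, ψ.1 0 = 0 ∧
      ∀ x ∈ ball (0 : ℂ) r, HasDerivAt ψ.1 (w (x, φ.1 x)) x := by
    intro φ
    have hd : DifferentiableOn ℂ (fun x => w (x, φ.1 x)) (ball 0 r) := by
      intro x hx
      have h1 := (hA (x, φ.1 x) ⟨hsub hx, hSR φ x hx⟩).differentiableAt
      exact h1.comp_differentiableWithinAt x
        (differentiableWithinAt_id.prodMk (φ.2.1 x hx))
    -- The integral in the Picard step is a holomorphic primitive on the disc.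
    obtain ⟨ψ, hψ0, hψ⟩ := hd.isExactOn_ball.with_val_at 0 0
    refine ⟨⟨ψ, fun x hx => (hψ x hx).differentiableAt.differentiableWithinAt, fun x hx => ?_⟩,
      hψ0, hψ⟩
    have h1 := (convex_ball (0 : ℂ) r).norm_image_sub_le_of_norm_hasDerivWithin_le (C := M)
      (fun x hx => (hψ x hx).hasDerivWithinAt)
      (fun x hx => hbd _ ⟨hsub hx, hSR φ x hx⟩) (mem_ball_self hr) hx
    rw [hψ0, sub_zero, sub_zero] at h1
    rw [mem_ball, dist_zero_right] at hx
    exact h1.trans (by gcongr)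
  choose next hnext0 hnext using hstep
  let φ : ℕ → S := fun n => next^[n] ⟨fun _ => 0, differentiableOn_const _, fun x _ => by
    simpa using by positivity⟩
  have hφs : ∀ n, φ (n + 1) = next (φ n) := fun n => Function.iterate_succ_apply' _ _ _
  have hφ00 : ∀ n, (φ n).1 0 = 0 := by
    intro n
    cases n with
    | zero => rfl
    | succ n => rw [hφs]; exact hnext0 _
  have hdiff : ∀ n, ∀ x ∈ ball (0 : ℂ) r, ‖(φ (n + 1)).1 x - (φ n).1 x‖ ≤
      (2 * (M * r)) * (1 / 2) ^ n := by
    intro n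
    induction n with
    | zero =>
      intro x hx
      have := norm_sub_le ((φ 1).1 x) ((φ 0).1 x)
      have h1 := (φ 1).2.2 x hx
      have h2 := (φ 0).2.2 x hx
      rw [pow_zero, mul_one, zero_add]
      linarith
    | succ n ih =>
      intro x hx
      have h1 := (convex_ball (0 : ℂ) r).norm_image_sub_le_of_norm_hasDerivWithin_le
        (f := fun x => (φ (n + 2)).1 x - (φ (n + 1)).1 x)
        (f' := fun x => w (x, (φ (n + 1)).1 x) - w (x, (φ n).1 x))
        (C := L * ((2 * (M * r)) * (1 / 2) ^ n))
        (fun x hx => by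
          have e1 := hnext (φ (n + 1)) x hx
          have e2 := hnext (φ n) x hx
          rw [← hφs (n + 1)] at e1
          rw [← hφs n] at e2
          exact (e1.sub e2).hasDerivWithinAt)
        (fun x hx => (hlip x (hsub hx) _ (hSR _ x hx) _ (hSR _ x hx)).trans (by
          gcongr; exact ih x hx)) (mem_ball_self hr) hx
      simp only [hφ00, sub_zero] at h1
      rw [mem_ball, dist_zero_right] at hx
      calc _ ≤ _ := h1
        _ ≤ L * ((2 * (M * r)) * (1 / 2) ^ n) * r := by gcongr
        _ = (L * r) * ((2 * (M * r)) * (1 / 2) ^ n) := by ring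
        _ ≤ 1 / 2 * ((2 * (M * r)) * (1 / 2) ^ n) := by gcongr
        _ = _ := by ring
  have hsumm : Summable fun n : ℕ => (2 * (M * r)) * (1 / 2 : ℝ) ^ n :=
    (summable_geometric_of_lt_one (by norm_num) (by norm_num)).mul_left _
  set Φ : ℂ → ℂ := fun x => ∑' n, ((φ (n + 1)).1 x - (φ n).1 x) with hΦ
  have hpart : ∀ n, (fun x => ∑ k ∈ Finset.range n, ((φ (k + 1)).1 x - (φ k).1 x)) =
      fun x => (φ n).1 x := by
    intro n
    funext x
    rw [Finset.sum_range_sub (fun k => (φ k).1 x)]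
    exact sub_zero _
  have hunif : TendstoUniformlyOn (fun n x => (φ n).1 x) Φ atTop (ball 0 r) :=
    (tendstoUniformlyOn_tsum_nat hsumm hdiff).congr
      (Eventually.of_forall fun n x _ => congrFun (hpart n) x)
  have hloc : TendstoLocallyUniformlyOn (fun n x => (φ n).1 x) Φ atTop (ball 0 r) :=
    hunif.tendstoLocallyUniformlyOn
  have hd : DifferentiableOn ℂ Φ (ball 0 r) :=
    hloc.differentiableOn (Eventually.of_forall fun n => (φ n).2.1) isOpen_ball
  have hder := hloc.deriv (Eventually.of_forall fun n => (φ n).2.1) isOpen_ball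
  refine ⟨Φ, hd.analyticAt (ball_mem_nhds _ hr), ?_, ?_⟩
  · have := hunif.tendsto_at (mem_ball_self hr)
    simp only [hφ00] at this
    exact tendsto_nhds_unique this tendsto_const_nhds
  · filter_upwards [ball_mem_nhds (0 : ℂ) hr] with x hx
    have hΦd : HasDerivAt Φ (deriv Φ x) x :=
      (hd.differentiableAt (isOpen_ball.mem_nhds hx)).hasDerivAt
    -- Locally uniform limits commute with differentiation; the shift by one matches φ_(n+1)' = w(x,
    -- φ_n).
    have t1 : Tendsto (fun n => deriv (fun x => (φ (n + 1)).1 x) x) atTop (𝓝 (deriv Φ x)) :=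
      (hder.tendsto_at hx).comp (tendsto_add_atTop_nat 1)
    have t2 : Tendsto (fun n => (φ n).1 x) atTop (𝓝 (Φ x)) := hunif.tendsto_at hx
    have hΦR : ‖Φ x‖ ≤ M * r :=
      le_of_tendsto t2.norm (Eventually.of_forall fun n => (φ n).2.2 x hx)
    have hcont : ContinuousAt w (x, Φ x) := (hA (x, Φ x) ⟨hsub hx, by
      rw [mem_ball, dist_zero_right]; exact hΦR.trans_lt hMr⟩).continuousAt
    have t3 : Tendsto (fun n => w (x, (φ n).1 x)) atTop (𝓝 (w (x, Φ x))) :=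
      hcont.tendsto.comp (tendsto_const_nhds.prodMk_nhds t2)
    have t4 : deriv Φ x = w (x, Φ x) := by
      refine tendsto_nhds_unique t1 (t3.congr fun n => ?_)
      have := hnext (φ n) x hx
      rw [← hφs n] at this
      exact this.deriv.symm
    rw [← t4]
    exact hΦd

end HolomorphicODE

/-! ### Towers of blow-ups as classes of germs of maps -/

section Towers

/-- Classes of germs of maps obtained by reading a composition of point blow-ups in all charts. -/
inductive GermTower : Set (ℂ × ℂ → ℂ × ℂ) → Prop
  | base {𝒢 : Set (ℂ × ℂ → ℂ × ℂ)} (h : ∀ F ∈ 𝒢, IsGermBihol F) : GermTower 𝒢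
  | step {𝒢 𝒢' : Set (ℂ × ℂ → ℂ × ℂ)} (h : GermTower 𝒢)
      -- Going down, a new germ either is an old one or factors through a standard chart over an old
      -- germ F' at the centre; going up, an old germ either survives or is blown up. In both cases
      -- all charts over a blown-up germ are present: κ changes coordinates at the centre and Φ
      -- upstairs.
      (hdown : ∀ F ∈ 𝒢', F ∈ 𝒢 ∨ ∃ F' ∈ 𝒢,
        (∀ κ Φ, IsGermBihol κ → IsGermBihol Φ → (fun z => F' (κ (blowUpMap (Φ z)))) ∈ 𝒢') ∧
        ∃ Φ, IsGermBihol Φ ∧ F =ᶠ[𝓝 0] fun z => F' (blowUpMap (Φ z)))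
      (hup : ∀ F' ∈ 𝒢, F' ∈ 𝒢' ∨
        ∀ κ Φ, IsGermBihol κ → IsGermBihol Φ → (fun z => F' (κ (blowUpMap (Φ z)))) ∈ 𝒢') :
      GermTower 𝒢'

theorem analyticAt_blowUpMap (z : ℂ × ℂ) : AnalyticAt ℂ blowUpMap z := by
  rw [blowUpMap_eq]; exact analyticAt_chartBlowUp _ _ _ _ _

theorem blowUpMap_zero : blowUpMap 0 = 0 := by simp [blowUpMap]

theorem tendsto_blowUpMap : Tendsto blowUpMap (𝓝 0) (𝓝 0) :=
  (analyticAt_blowUpMap 0).continuousAt.tendsto.trans (by rw [blowUpMap_zero])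

theorem GermTower.analyticAt_and_map_zero {𝒢 : Set (ℂ × ℂ → ℂ × ℂ)} (h : GermTower 𝒢) :
    ∀ F ∈ 𝒢, AnalyticAt ℂ F 0 ∧ F 0 = 0 := by
  induction h with
  | base h => exact fun F hF => ⟨(h F hF).analyticAt, (h F hF).map_zero⟩
  | step _ hdown _ ih =>
    intro F hF
    obtain hF | ⟨F', hF', -, Φ, hΦ, e⟩ := hdown F hF
    · exact ih F hF
    · obtain ⟨hA, h0⟩ := ih F' hF'
      refine ⟨AnalyticAt.congr ?_ e.symm, ?_⟩
      · exact (hA.comp_zero (analyticAt_blowUpMap 0) blowUpMap_zero).comp_zero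
          hΦ.analyticAt hΦ.map_zero
      · rw [e.self_of_nhds]
        simp only [hΦ.map_zero, blowUpMap_zero, h0]

theorem GermDvd.wedgeCoeff_pullbackForm {τ : ℂ × ℂ → (ℂ × ℂ →L[ℂ] ℂ)} {g : ℂ × ℂ → ℂ}
    {Φ : ℂ × ℂ → ℂ × ℂ} (hg : AnalyticAt ℂ g 0) (hd : GermDvd g (wedgeCoeff τ g) 0)
    (hΦ : AnalyticAt ℂ Φ 0) (h0 : Φ 0 = 0) :
    GermDvd (fun z => g (Φ z)) (wedgeCoeff (pullbackForm Φ τ) fun z => g (Φ z)) 0 := by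
  obtain ⟨k, hk, e⟩ := hd
  refine ⟨fun z => jacDet Φ z * k (Φ z), hΦ.jacDet.mul (hk.comp_zero hΦ h0), ?_⟩
  have ht : Tendsto Φ (𝓝 0) (𝓝 0) := by
    have := hΦ.continuousAt.tendsto
    rwa [h0] at this
  filter_upwards [ht.eventually e, ht.eventually hg.eventually_analyticAt,
    hΦ.eventually_analyticAt] with z h1 h2 h3
  rw [_root_.wedgeCoeff_pullbackForm h3.differentiableAt h2.differentiableAt, h1]
  ring

/-- A factor `P` of an invariant curve is invariant. -/
theorem GermDvd.wedgeCoeff_of_mul {τ : ℂ × ℂ → (ℂ × ℂ →L[ℂ] ℂ)} {g u P : ℂ × ℂ → ℂ}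
    (hτ : AnalyticAt ℂ τ 0) (hu : AnalyticAt ℂ u 0) (hP : AnalyticAt ℂ P 0) (hu0 : u 0 ≠ 0)
    (e : ∀ᶠ z in 𝓝 0, g z = u z * P z) (hd : GermDvd g (wedgeCoeff τ g) 0) :
    GermDvd P (wedgeCoeff τ P) 0 := by
  obtain ⟨k, hk, e'⟩ := hd
  refine ⟨fun z => k z - (u z)⁻¹ * wedgeCoeff τ u z,
    hk.sub ((hu.inv hu0).mul (hτ.wedgeCoeff hu)), ?_⟩
  filter_upwards [e, e', wedgeCoeff_congr e (EventuallyEq.refl _ τ), hu.eventually_analyticAt,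
    hP.eventually_analyticAt, hu.continuousAt.eventually_ne hu0] with z h1 h2 h3 h4 h5 h6
  rw [h3, wedgeCoeff_mul τ h4.differentiableAt h5.differentiableAt, h1] at h2
  field_simp
  linear_combination h2

/-- The exponents and the cofactors agree in `x ^ M a = x ^ N b` if `a`, `b` do not vanish
identically on `x = 0`. -/
theorem eq_of_fst_pow_mul_eq {a b : ℂ × ℂ → ℂ} (ha : AnalyticAt ℂ a 0) (hb : AnalyticAt ℂ b 0)
    (ha0 : ¬ ∀ᶠ y in 𝓝 0, a (0, y) = 0) (hb0 : ¬ ∀ᶠ y in 𝓝 0, b (0, y) = 0) {M N : ℕ}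
    (e : ∀ᶠ z in 𝓝 0, z.1 ^ M * a z = z.1 ^ N * b z) : M = N ∧ ∀ᶠ z in 𝓝 0, a z = b z := by
  wlog h : M ≤ N generalizing a b M N
  · obtain ⟨h1, h2⟩ := this hb ha hb0 ha0 (e.mono fun z hz => hz.symm) (le_of_not_ge h)
    exact ⟨h1.symm, h2.mono fun z hz => hz.symm⟩
  obtain ⟨k, rfl⟩ := Nat.exists_eq_add_of_le h
  have h1 : ∀ᶠ z in 𝓝 0, a z = z.1 ^ k * b z := by
    refine eventually_eq_of_mul_left (h := fun z : ℂ × ℂ => z.1 ^ M) (analyticAt_fst.pow M) ha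
      ((analyticAt_fst.pow k).mul hb) ?_ (not_eventually_pow_eq_zero not_eventually_fst_eq_zero M)
    filter_upwards [e] with z hz
    rw [hz]; ring
  rcases Nat.eq_zero_or_pos k with rfl | hk
  · simpa using h1
  · refine absurd ?_ ha0
    filter_upwards [eventually_slice_snd h1] with y hy
    rw [hy]; simp [hk.ne']

end Towers

/-! ### Images of curves under the blow-down -/

section PushDown

/-- The curve whose strict transform is given by a Weierstrass polynomial. -/
def weierstrassImage (n : ℕ) (a : ℕ → ℂ → ℂ) (z : ℂ × ℂ) : ℂ :=
  z.2 ^ n + ∑ i ∈ Finset.range n, a i z.1 * z.1 ^ (n - i) * z.2 ^ i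

theorem analyticAt_weierstrassImage {n : ℕ} {a : ℕ → ℂ → ℂ} (ha : ∀ i, AnalyticAt ℂ (a i) 0) :
    AnalyticAt ℂ (weierstrassImage n a) 0 :=
  (analyticAt_snd.pow n).add (Finset.analyticAt_fun_sum _ fun i _ =>
    ((analyticAt_comp_fst (ha i)).mul (analyticAt_fst.pow _)).mul (analyticAt_snd.pow i))

theorem weierstrassImage_blowUpMap (n : ℕ) (a : ℕ → ℂ → ℂ) (z : ℂ × ℂ) :
    weierstrassImage n a (blowUpMap z) =
      z.1 ^ n * (z.2 ^ n + ∑ i ∈ Finset.range n, a i z.1 * z.2 ^ i) := by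
  simp only [weierstrassImage, blowUpMap, mul_pow, mul_add, Finset.mul_sum]
  congr 1
  refine Finset.sum_congr rfl fun i hi => ?_
  obtain ⟨k, rfl⟩ := Nat.exists_eq_add_of_lt (Finset.mem_range.1 hi)
  rw [show i + k + 1 - i = k + 1 by omega]
  ring

/-- Let the image be u² w with u, w of orders p, q and strict transforms U, W. Comparing powers of x
after the blow-up gives n = 2 p + q and U² W = P, so U(0) ≠ 0. On x = 0 the leading polynomial of u
divides t ^ n and is nonzero at 0, hence is constant; that of w then has degree n ≤ q. So p = 0 and
u is a unit. -/
theorem isReducedGerm_weierstrassImage {n : ℕ} {a : ℕ → ℂ → ℂ} (ha : ∀ i, AnalyticAt ℂ (a i) 0)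
    (ha0 : ∀ i, a i 0 = 0)
    (hP : IsReducedGerm (fun z => z.2 ^ n + ∑ i ∈ Finset.range n, a i z.1 * z.2 ^ i) 0) :
    IsReducedGerm (weierstrassImage n a) 0 := by
  set P : ℂ × ℂ → ℂ := fun z => z.2 ^ n + ∑ i ∈ Finset.range n, a i z.1 * z.2 ^ i with hPdef
  have hP0t : ∀ t, P (0, t) = t ^ n := by intro t; simp [hPdef, ha0]
  refine ⟨analyticAt_weierstrassImage ha, fun u hu hd => ?_⟩
  obtain ⟨w, hw, e⟩ := hd
  have hne : ¬ ∀ᶠ z in 𝓝 0, weierstrassImage n a z = 0 := by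
    intro h0
    refine hP.not_eventually_zero (eventually_eq_zero_of_mul (f := fun z : ℂ × ℂ => z.1 ^ n)
      (analyticAt_fst.pow n) hP.1 ?_ (not_eventually_pow_eq_zero not_eventually_fst_eq_zero n))
    filter_upwards [tendsto_blowUpMap.eventually h0] with z hz
    rw [weierstrassImage_blowUpMap] at hz
    exact hz
  have hu0 : ¬ ∀ᶠ z in 𝓝 0, u z = 0 := fun h => hne <| by
    filter_upwards [h, e] with z h1 h2
    rw [h2, h1]; simp
  have hw0 : ¬ ∀ᶠ z in 𝓝 0, w z = 0 := fun h => hne <| by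
    filter_upwards [h, e] with z h1 h2
    rw [h2, h1]; simp
  obtain ⟨p, c, hc, i, hi, hci⟩ := exists_expansion hu hu0
  obtain ⟨q, d, hd, j, hj, hdj⟩ := exists_expansion hw hw0
  have hpc := leadPoly_ne_zero ⟨i, hi, hci⟩
  have hpd := leadPoly_ne_zero ⟨j, hj, hdj⟩
  have hU := hc.analyticAt_strictTransform 1 0 0 1
  have hW := hd.analyticAt_strictTransform 1 0 0 1
  have hUt : ∀ t, strictTransform 1 0 0 1 p c (0, t) = (leadPoly p c).eval t := fun t => by
    rw [strictTransform_zero_left]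
    simpa using homEval_one (natDegree_leadPoly_le p c) t
  have hWt : ∀ t, strictTransform 1 0 0 1 q d (0, t) = (leadPoly q d).eval t := fun t => by
    rw [strictTransform_zero_left]
    simpa using homEval_one (natDegree_leadPoly_le q d) t
  have hpoly : ∀ r : Polynomial ℂ, (∀ᶠ t in 𝓝 (0 : ℂ), r.eval t = 0) → r = 0 := fun r hr => by
    refine Polynomial.eq_zero_of_infinite_isRoot r ?_
    exact infinite_of_mem_nhds 0 hr
  have hprod : ¬ ∀ᶠ t in 𝓝 (0 : ℂ), strictTransform 1 0 0 1 p c (0, t) ^ 2 *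
      strictTransform 1 0 0 1 q d (0, t) = 0 := by
    intro h
    have := hpoly (leadPoly p c ^ 2 * leadPoly q d) (h.mono fun t ht => by
      rw [hUt, hWt] at ht
      simpa using ht)
    exact mul_ne_zero (pow_ne_zero 2 hpc) hpd this
  have hP0 : ¬ ∀ᶠ t in 𝓝 (0 : ℂ), P (0, t) = 0 := by
    intro h
    have := hpoly (Polynomial.X ^ n) (h.mono fun t ht => by rw [hP0t] at ht; simpa using ht)
    exact pow_ne_zero n Polynomial.X_ne_zero this
  have hE : ∀ᶠ z in 𝓝 (0 : ℂ × ℂ), z.1 ^ (2 * p + q) * (strictTransform 1 0 0 1 p c z ^ 2 *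
      strictTransform 1 0 0 1 q d z) = z.1 ^ n * P z := by
    filter_upwards [hc.comp_chartBlowUp 1 0 0 1, hd.comp_chartBlowUp 1 0 0 1,
      tendsto_blowUpMap.eventually e] with z h1 h2 h3
    rw [weierstrassImage_blowUpMap, blowUpMap_eq, h1, h2] at h3
    rw [hPdef]
    simp only
    rw [h3]
    ring
  obtain ⟨hn, hE'⟩ := eq_of_fst_pow_mul_eq ((hU.pow 2).mul hW) hP.1 hprod hP0 hE
  have hU0 := hP.2 _ hU ⟨_, hW, hE'.mono fun z hz => hz.symm⟩
  have hpolyeq : leadPoly p c ^ 2 * leadPoly q d = Polynomial.X ^ n := by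
    rw [← sub_eq_zero]
    refine hpoly _ ?_
    filter_upwards [eventually_slice_snd hE'] with t ht
    simp only [hP0t, Pi.mul_apply, Pi.pow_apply, hUt, hWt] at ht
    simp [ht]
  have hc0 : (leadPoly p c).natDegree = 0 := by
    have hdvd : leadPoly p c ∣ Polynomial.X ^ n :=
      ⟨leadPoly p c * leadPoly q d, by rw [← hpolyeq]; ring⟩
    obtain ⟨s, -, hs⟩ := (dvd_prime_pow Polynomial.prime_X n).1 hdvd
    have h0 : (leadPoly p c).eval 0 ≠ 0 := by
      have := hUt 0
      rw [← this]
      exact hU0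
    rw [Polynomial.natDegree_eq_of_degree_eq (Polynomial.degree_eq_degree_of_associated hs),
      Polynomial.natDegree_X_pow]
    by_contra hs0
    obtain ⟨v, hv⟩ := hs.symm
    apply h0
    rw [← hv]
    simp [hs0]
  have hdeg := congrArg Polynomial.natDegree hpolyeq
  rw [Polynomial.natDegree_mul (pow_ne_zero 2 hpc) hpd, Polynomial.natDegree_pow, hc0,
    Polynomial.natDegree_X_pow] at hdeg
  have := natDegree_leadPoly_le q d
  have hp0 : p = 0 := by omega
  subst hp0
  have hi0 : i = 0 := by omega
  subst hi0
  have := hc.2.self_of_nhds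
  rw [this]
  simpa using hci

/-- Invariance of the image of an invariant curve under a blow-up. -/
theorem germDvd_weierstrassImage {n : ℕ} (hn : n ≠ 0) {a : ℕ → ℂ → ℂ}
    (ha : ∀ i, AnalyticAt ℂ (a i) 0) (ha0 : ∀ i, a i 0 = 0) {η : ℂ × ℂ → (ℂ × ℂ →L[ℂ] ℂ)}
    (hη : AnalyticAt ℂ η 0)
    (hd : GermDvd (fun z => z.2 ^ n + ∑ i ∈ Finset.range n, a i z.1 * z.2 ^ i)
      (wedgeCoeff (pullbackForm blowUpMap η)
        fun z => z.2 ^ n + ∑ i ∈ Finset.range n, a i z.1 * z.2 ^ i) 0) :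
    GermDvd (weierstrassImage n a) (wedgeCoeff η (weierstrassImage n a)) 0 := by
  have hG := analyticAt_weierstrassImage (n := n) ha
  have hW := hη.wedgeCoeff hG
  -- The image has the shape y ^ n + x k because every exponent n - i is positive. It remains to
  -- show that the remainder of ω ∧ dG vanishes.
  obtain ⟨Q, c, hQ, hc, e⟩ := exists_weierstrass_division n
    (k := fun z : ℂ × ℂ => ∑ i ∈ Finset.range n, a i z.1 * z.1 ^ (n - i - 1) * z.2 ^ i)
    (Finset.analyticAt_fun_sum _ fun i _ =>
      ((analyticAt_comp_fst (ha i)).mul (analyticAt_fst.pow _)).mul (analyticAt_snd.pow i)) hW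
  have hGk : ∀ z : ℂ × ℂ, z.2 ^ n + z.1 * ∑ i ∈ Finset.range n, a i z.1 * z.1 ^ (n - i - 1) *
      z.2 ^ i = weierstrassImage n a z := by
    intro z
    rw [weierstrassImage, Finset.mul_sum]
    congr 1
    refine Finset.sum_congr rfl fun i hi => ?_
    obtain ⟨k, rfl⟩ := Nat.exists_eq_add_of_lt (Finset.mem_range.1 hi)
    rw [show i + k + 1 - i = k + 1 by omega, Nat.add_sub_cancel]
    ring
  refine ⟨Q, hQ, ?_⟩
  simp only [hGk] at e
  obtain ⟨k, hk, ek⟩ := hd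
  set P : ℂ × ℂ → ℂ := fun z => z.2 ^ n + ∑ i ∈ Finset.range n, a i z.1 * z.2 ^ i with hPdef
  have hPA : AnalyticAt ℂ P 0 := (analyticAt_snd.pow n).add (analyticAt_polynomial_snd ha)
  obtain ⟨n', rfl⟩ := Nat.exists_eq_succ_of_ne_zero hn
  rw [Nat.succ_eq_add_one] at *
  have hηb : AnalyticAt ℂ (pullbackForm blowUpMap η) 0 :=
    (analyticAt_blowUpMap 0).pullbackForm (by rw [blowUpMap_zero]; exact hη)
  -- Upstairs G is x ^ n P and the 2-form acquires the Jacobian x, so the remainder turns into the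
  -- polynomial ∑ x ^ (i + 1) c_i t ^ i. By the product rule and the invariance of P it is P times
  -- the germ given here, hence zero.
  have key := eventually_eq_zero_of_weierstrass_mul (n := n' + 1) (a := a)
    (r := fun i x => x ^ (i + 1) * c i x)
    (k := fun z => z.1 ^ (n' + 1) * k z +
      (n' + 1 : ℂ) * z.1 ^ n' * wedgeCoeff (pullbackForm blowUpMap η) (fun w => w.1) z -
      z.1 ^ (n' + 2) * Q (blowUpMap z)) ha ha0
    (fun i => (analyticAt_id.pow _).mul (hc i)) ?_ ?_
  · have hc0 : ∀ᶠ x in 𝓝 (0 : ℂ), ∀ i ∈ Finset.range (n' + 1), c i x = 0 := by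
      rw [Filter.eventually_all_finset]
      intro i hi
      have h1 := key i (Finset.mem_range.1 hi)
      refine eventually_eq_zero_of_mul (f := fun x : ℂ => x ^ (i + 1)) (analyticAt_id.pow _)
        (hc i) h1 (not_eventually_pow_eq_zero ?_ _)
      intro h
      exact not_eventually_fst_eq_zero (eventually_comp_fst h)
    filter_upwards [e, eventually_comp_fst hc0] with z h1 h2
    rw [h1, Finset.sum_eq_zero fun i hi => by rw [h2 i hi, zero_mul], add_zero]
  · exact (((analyticAt_fst.pow _).mul hk).add ((analyticAt_const.mul (analyticAt_fst.pow _)).mul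
      (hηb.wedgeCoeff analyticAt_fst))).sub
      ((analyticAt_fst.pow _).mul (hQ.comp_zero (analyticAt_blowUpMap 0) blowUpMap_zero))
  · filter_upwards [tendsto_blowUpMap.eventually e, ek, hPA.eventually_analyticAt,
      tendsto_blowUpMap.eventually hG.eventually_analyticAt] with z h1 h2 h3 h4
    have e1 := wedgeCoeff_pullbackForm (τ := η) (analyticAt_blowUpMap z).differentiableAt
      h4.differentiableAt
    have e2 : (fun w => weierstrassImage (n' + 1) a (blowUpMap w)) =
        fun w => w.1 ^ (n' + 1) * P w := funext fun w => weierstrassImage_blowUpMap _ _ _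
    have e3 : jacDet blowUpMap z = z.1 := by rw [blowUpMap_eq, jacDet_chartBlowUp]; ring
    have e4 : wedgeCoeff (pullbackForm blowUpMap η) (fun w => w.1 ^ (n' + 1)) z =
        (n' + 1 : ℂ) * z.1 ^ n' * wedgeCoeff (pullbackForm blowUpMap η) (fun w => w.1) z := by
      have : fderiv ℂ (fun w : ℂ × ℂ => w.1 ^ (n' + 1)) z =
          ((n' + 1 : ℂ) * z.1 ^ n') • fderiv ℂ (fun w : ℂ × ℂ => w.1) z := by
        rw [fderiv_fun_pow _ differentiableAt_fst]
        simp
      simp only [wedgeCoeff, this, smul_apply, smul_eq_mul]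
      ring
    have h5 : ∑ i ∈ Finset.range (n' + 1), c i (blowUpMap z).1 * (blowUpMap z).2 ^ i * z.1 =
        ∑ i ∈ Finset.range (n' + 1), z.1 ^ (i + 1) * c i z.1 * z.2 ^ i := by
      refine Finset.sum_congr rfl fun i _ => ?_
      simp only [blowUpMap]
      ring
    have e6 : DifferentiableAt ℂ (fun w : ℂ × ℂ => w.1 ^ (n' + 1)) z := differentiableAt_fst.pow _
    rw [e2, wedgeCoeff_mul _ e6 h3.differentiableAt, e3, e4, h1,
      weierstrassImage_blowUpMap, h2] at e1
    rw [← h5, ← Finset.sum_mul]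
    have e5 : P z = z.2 ^ (n' + 1) + ∑ i ∈ Finset.range (n' + 1), a i z.1 * z.2 ^ i := rfl
    rw [← e5] at e1 ⊢
    linear_combination e1

/-- A nonzero point of the image curve has x ≠ 0, and its slope y / x is a root of a monic
polynomial with small lower coefficients, so it is small: the point lifts near the origin of the
chart. -/
theorem eventually_of_weierstrassImage_eq_zero {n : ℕ} (hn : n ≠ 0) {a : ℕ → ℂ → ℂ}
    (ha : ∀ i, AnalyticAt ℂ (a i) 0) (ha0 : ∀ i, a i 0 = 0) {p : ℂ × ℂ → Prop}
    (hp : ∀ᶠ z in 𝓝 0, p z) :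
    ∀ᶠ z in 𝓝 0, weierstrassImage n a z = 0 → z ≠ 0 → ∃ w, blowUpMap w = z ∧ w ≠ 0 ∧ p w ∧
      w.2 ^ n + ∑ i ∈ Finset.range n, a i w.1 * w.2 ^ i = 0 := by
  obtain ⟨ε, hε, hball⟩ := Metric.eventually_nhds_iff_ball.1 hp
  set δ := min ε 1 / 2 with hδ
  have hδ0 : 0 < δ := by positivity
  have hδε : δ < ε := by
    have := min_le_left ε 1
    rw [hδ]; linarith [lt_min hε one_pos]
  have hδ1 : δ ≤ 1 := by
    have := min_le_right ε 1
    rw [hδ]; linarith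
  -- With coefficients below δ ^ n / n and δ ≤ 1, a root of modulus at least δ would make |s| ^ n
  -- less than itself.
  have hsmall : ∀ᶠ x in 𝓝 (0 : ℂ), ∀ i ∈ Finset.range n, ‖a i x‖ < δ ^ n / n := by
    rw [Filter.eventually_all_finset]
    intro i _
    have : Tendsto (fun x => ‖a i x‖) (𝓝 0) (𝓝 ‖a i 0‖) := (ha i).continuousAt.norm
    rw [ha0, norm_zero] at this
    exact this.eventually_lt_const (by positivity)
  have hxs : ∀ᶠ x in 𝓝 (0 : ℂ), ‖x‖ < ε := by
    filter_upwards [Metric.ball_mem_nhds (0 : ℂ) hε] with x hx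
    simpa using hx
  filter_upwards [eventually_comp_fst hsmall, eventually_comp_fst hxs] with z h1 h2 hz hz0
  have hx : z.1 ≠ 0 := by
    intro hx
    rw [weierstrassImage, Finset.sum_eq_zero, add_zero] at hz
    · exact hz0 (Prod.ext hx (eq_zero_of_pow_eq_zero hz))
    · intro i hi
      rw [hx, ha0]; simp
  have hbz : blowUpMap (z.1, z.2 / z.1) = z := by
    simp only [blowUpMap]
    ext
    · rfl
    · simp only; field_simp
  have hP : (z.2 / z.1) ^ n + ∑ i ∈ Finset.range n, a i z.1 * (z.2 / z.1) ^ i = 0 := by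
    rw [← hbz, weierstrassImage_blowUpMap] at hz
    exact (mul_eq_zero.1 hz).resolve_left (pow_ne_zero n hx)
  refine ⟨(z.1, z.2 / z.1), hbz, fun h => hx (congrArg Prod.fst h), ?_, hP⟩
  refine hball _ ?_
  rw [mem_ball_zero_iff, Prod.norm_def, max_lt_iff]
  refine ⟨h2, lt_of_lt_of_le ?_ hδε.le⟩
  by_contra! hcon
  simp only at hcon
  set s := z.2 / z.1
  have hs0 : 0 < ‖s‖ := hδ0.trans_le hcon
  have hne : (Finset.range n).Nonempty := Finset.nonempty_range_iff.2 hn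
  have hb : ‖s‖ ^ n < ‖s‖ ^ n := by
    calc ‖s‖ ^ n = ‖∑ i ∈ Finset.range n, a i z.1 * s ^ i‖ := by
          rw [← norm_pow, eq_neg_of_add_eq_zero_left hP, norm_neg]
      _ ≤ ∑ i ∈ Finset.range n, ‖a i z.1‖ * ‖s‖ ^ i := by
          refine (norm_sum_le _ _).trans (Finset.sum_le_sum fun i _ => ?_)
          rw [norm_mul, norm_pow]
      _ < ∑ i ∈ Finset.range n, ‖s‖ ^ n / n := by
          refine Finset.sum_lt_sum_of_nonempty hne fun i hi => ?_
          have hin := (Finset.mem_range.1 hi).le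
          calc ‖a i z.1‖ * ‖s‖ ^ i < δ ^ n / n * ‖s‖ ^ i := by
                gcongr
                exact h1 i hi
            _ ≤ (δ ^ (n - i) * ‖s‖ ^ i) / n := by
                rw [div_mul_eq_mul_div]
                have := pow_le_pow_of_le_one hδ0.le hδ1 (Nat.sub_le n i)
                gcongr ?_ * _ / _
            _ ≤ (‖s‖ ^ (n - i) * ‖s‖ ^ i) / n := by gcongr
            _ = ‖s‖ ^ n / n := by rw [← pow_add, Nat.sub_add_cancel hin]
      _ = ‖s‖ ^ n := by
          rw [Finset.sum_const, Finset.card_range, nsmul_eq_mul]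
          field_simp
  exact lt_irrefl _ hb

end PushDown

/-! ### Pushing down separatrices; the exceptional curves are invariant -/

section Separatrices

/-- Invariant curves of the pull-back of a foliation come from invariant curves of the
foliation. -/
theorem GermTower.exists_invariantCurve {ω : ℂ × ℂ → (ℂ × ℂ →L[ℂ] ℂ)} (hω : AnalyticAt ℂ ω 0)
    {𝒢 : Set (ℂ × ℂ → ℂ × ℂ)} (h : GermTower 𝒢) :
    ∀ F ∈ 𝒢, ∀ g : ℂ × ℂ → ℂ, IsReducedGerm g 0 → g 0 = 0 →
      GermDvd g (wedgeCoeff (pullbackForm F ω) g) 0 →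
      (∀ᶠ z in 𝓝 0, g z = 0 → z ≠ 0 → F z ≠ 0) →
      ∃ G, IsInvariantCurveEquation ω G ∧ ∀ᶠ z in 𝓝 0, F z ≠ 0 → (G (F z) = 0 ↔ g z = 0) := by
  induction h with
  | base h =>
    intro F hF g hg hg0 hd _
    have hFb := h F hF
    obtain ⟨Ψ, hΨ, h1, h2⟩ := hFb.exists_inverse
    refine ⟨fun z => g (Ψ z), ⟨hg.comp_bihol hΨ, by simp only [hΨ.map_zero, hg0], ?_⟩, ?_⟩
    · refine (hd.wedgeCoeff_pullbackForm hg.1 hΨ.analyticAt hΨ.map_zero).congr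
        (EventuallyEq.refl _ _) (wedgeCoeff_congr (EventuallyEq.refl _ _) ?_)
      have hFA := hFb.analyticAt
      have e1 : (fun z => F (Ψ z)) =ᶠ[𝓝 0] fun z => z := h1
      have e2 := pullbackForm_congr (τ := ω) e1 (by filter_upwards [h1] with z hz; rw [hz])
      filter_upwards [e2, hΨ.analyticAt.eventually_analyticAt,
        hΨ.tendsto.eventually hFA.eventually_analyticAt] with z h3 h4 h5
      rw [← pullbackForm_comp h4.differentiableAt h5.differentiableAt, h3]
      simp [pullbackForm, fderiv_fun_id]
    · filter_upwards [h2] with z hz _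
      simp only [hz]
  | step h hdown _ ih =>
    intro F hF g hg hg0 hd hne
    obtain hF | ⟨F', hF', -, Φ, hΦ, e⟩ := hdown F hF
    · exact ih F hF g hg hg0 hd hne
    obtain ⟨hF'A, hF'0⟩ := h.analyticAt_and_map_zero F' hF'
    obtain ⟨Ψ, hΨ, h1, h2⟩ := hΦ.exists_inverse
    set g1 : ℂ × ℂ → ℂ := fun z => g (Ψ z) with hg1
    have hbl := analyticAt_blowUpMap 0
    have eΨ : (fun z => F (Ψ z)) =ᶠ[𝓝 0] fun z => F' (blowUpMap z) := by
      filter_upwards [hΨ.tendsto.eventually e, h1] with z h3 h4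
      rw [h3, h4]
    have hη : AnalyticAt ℂ (pullbackForm F' ω) 0 :=
      hF'A.pullbackForm (by rw [hF'0]; exact hω)
    have hηb : AnalyticAt ℂ (pullbackForm blowUpMap (pullbackForm F' ω)) 0 :=
      hbl.pullbackForm (by rw [blowUpMap_zero]; exact hη)
    have hFA : AnalyticAt ℂ F 0 := ((hF'A.comp_zero hbl blowUpMap_zero).comp_zero
      hΦ.analyticAt hΦ.map_zero).congr e.symm
    have hF0 : F 0 = 0 := by
      rw [e.self_of_nhds]; simp only [hΦ.map_zero, blowUpMap_zero, hF'0]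
    have hg1r : IsReducedGerm g1 0 := hg.comp_bihol hΨ
    have hg1d : GermDvd g1 (wedgeCoeff (pullbackForm blowUpMap (pullbackForm F' ω)) g1) 0 := by
      refine (hd.wedgeCoeff_pullbackForm hg.1 hΨ.analyticAt hΨ.map_zero).congr
        (EventuallyEq.refl _ _) (wedgeCoeff_congr (EventuallyEq.refl _ _) ?_)
      have e2 := pullbackForm_congr (τ := ω) eΨ (by filter_upwards [eΨ] with z hz; rw [hz])
      filter_upwards [e2, hΨ.analyticAt.eventually_analyticAt,
        hΨ.tendsto.eventually hFA.eventually_analyticAt,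
        tendsto_blowUpMap.eventually hF'A.eventually_analyticAt] with z h3 h4 h5 h6
      rw [← pullbackForm_comp h4.differentiableAt h5.differentiableAt, h3,
        pullbackForm_comp (analyticAt_blowUpMap z).differentiableAt h6.differentiableAt]
    have hΨne : ∀ᶠ z in 𝓝 0, Ψ z = 0 → z = 0 := by
      filter_upwards [h1] with z h3 h4
      rw [← h3, h4, hΦ.map_zero]
    have hne1 : ∀ᶠ z in 𝓝 0, g1 z = 0 → z ≠ 0 → F' (blowUpMap z) ≠ 0 := by
      filter_upwards [hΨ.tendsto.eventually hne, eΨ, hΨne] with z h3 h4 h5 h6 h7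
      rw [← h4]
      exact h3 h6 fun h => h7 (h5 h)
    -- The curve does not contain the exceptional line, which is mapped to 0, whereas F ≠ 0 on the
    -- curve off its base point.
    have hord : ¬ ∀ᶠ t in 𝓝 (0 : ℂ), g1 (0, t) = 0 := by
      intro hz
      obtain ⟨t, ht, ht0⟩ := (((hz.and (eventually_slice_snd hne1)).filter_mono
        nhdsWithin_le_nhds).and (eventually_mem_nhdsWithin (a := (0 : ℂ)) (s := {0}ᶜ))).exists
      refine ht.2 ht.1 (fun h => ht0 (congrArg Prod.snd h)) ?_
      simp only [blowUpMap, zero_mul]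
      exact hF'0
    have hord' : analyticOrderAt (fun t => g1 (0, t)) 0 ≠ ⊤ := by
      rwa [Ne, analyticOrderAt_eq_top]
    obtain ⟨n, hn⟩ := ENat.ne_top_iff_exists.1 hord'
    obtain ⟨u, a, hu, hu0, ha, ha0, eP⟩ := exists_weierstrass_preparation hg1r.1 hn.symm
    have hPA : AnalyticAt ℂ (fun z : ℂ × ℂ => z.2 ^ n + ∑ i ∈ Finset.range n, a i z.1 * z.2 ^ i)
        0 := (analyticAt_snd.pow n).add (analyticAt_polynomial_snd ha)
    have hn0 : n ≠ 0 := by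
      rintro rfl
      have := eP.self_of_nhds
      simp only [hg1, hΨ.map_zero, hg0] at this
      exact hu0 (by simpa using this.symm)
    obtain ⟨G, hG, hGz⟩ := ih F' hF' (weierstrassImage n a)
      (isReducedGerm_weierstrassImage ha ha0 (hg1r.of_mul hu hPA eP))
      (by simp [weierstrassImage, ha0, hn0])
      (germDvd_weierstrassImage hn0 ha ha0 hη (GermDvd.wedgeCoeff_of_mul hηb hu hPA hu0 eP hg1d))
      (by
        filter_upwards [eventually_of_weierstrassImage_eq_zero hn0 ha ha0 (hne1.and eP)]
          with z h3 h4 h5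
        obtain ⟨w, rfl, hw0, ⟨hw1, hw2⟩, hw3⟩ := h3 h4 h5
        refine hw1 ?_ hw0
        rw [hw2, hw3, mul_zero])
    refine ⟨G, hG, ?_⟩
    filter_upwards [e, h2, hΦ.tendsto.eventually eP,
      hΦ.tendsto.eventually (tendsto_blowUpMap.eventually hGz),
      hΦ.tendsto.eventually (hu.continuousAt.eventually_ne hu0)] with z h3 h4 h5 h6 h7 h8
    rw [h3] at h8 ⊢
    rw [h6 h8, weierstrassImage_blowUpMap, mul_eq_zero]
    -- Where F ≠ 0 the point is off the exceptional line, so the factor x ^ n of the total transform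
    -- can be dropped.
    have hx : (Φ z).1 ≠ 0 := by
      intro hx
      apply h8
      rw [show blowUpMap (Φ z) = 0 by simp [blowUpMap, hx], hF'0]
    rw [or_iff_right (pow_ne_zero n hx)]
    simp only [hg1, h4] at h5
    rw [h5, mul_eq_zero, or_iff_right h7]

/-- A germ vanishing on the graph `y = ψ x` is divisible by `y - ψ x`. -/
theorem exists_eq_sub_mul {H : ℂ × ℂ → ℂ} {ψ : ℂ → ℂ} (hH : AnalyticAt ℂ H 0)
    (hψ : AnalyticAt ℂ ψ 0) (hψ0 : ψ 0 = 0) (h : ∀ᶠ x in 𝓝 0, H (x, ψ x) = 0) :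
    ∃ k, AnalyticAt ℂ k 0 ∧ ∀ᶠ z in 𝓝 0, H z = (z.2 - ψ z.1) * k z := by
  have hψ1 := analyticAt_comp_fst hψ
  have hs : AnalyticAt ℂ (fun z : ℂ × ℂ => (z.1, z.2 + ψ z.1)) 0 :=
    analyticAt_fst.prod (analyticAt_snd.add hψ1)
  have hs' : AnalyticAt ℂ (fun z : ℂ × ℂ => (z.1, z.2 - ψ z.1)) 0 :=
    analyticAt_fst.prod (analyticAt_snd.sub hψ1)
  obtain ⟨k, hk, e⟩ := exists_eq_snd_mul (hH.comp_zero hs (by simp [hψ0]))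
    (by filter_upwards [h] with x hx; simpa using hx)
  refine ⟨fun z => k (z.1, z.2 - ψ z.1), hk.comp_zero hs' (by simp [hψ0]), ?_⟩
  have ht : Tendsto (fun z : ℂ × ℂ => (z.1, z.2 - ψ z.1)) (𝓝 0) (𝓝 0) := by
    have := hs'.continuousAt.tendsto
    simpa [hψ0, ← Prod.zero_eq_mk] using this
  filter_upwards [ht.eventually e] with z hz
  simpa using hz

/-- Separatrix through the point of the exceptional curve with slope `t₀`, in the dicritical
case. -/
theorem exists_separatrix_of_slope {τ : ℂ × ℂ → (ℂ × ℂ →L[ℂ] ℂ)} (hτ : AnalyticAt ℂ τ 0) {ν : ℕ}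
    {a b : ℕ → ℂ × ℂ → ℂ} (ha : HasExpansion (fun z => τ z (1, 0)) ν a)
    (hb : HasExpansion (fun z => τ z (0, 1)) ν b)
    (hP : leadPoly ν a + Polynomial.X * leadPoly ν b = 0) {t₀ : ℂ}
    (ht₀ : (leadPoly ν b).eval t₀ ≠ 0) :
    ∃ φ : ℂ → ℂ, AnalyticAt ℂ φ 0 ∧ φ 0 = 0 ∧
      IsReducedGerm (fun z => z.2 - z.1 * (t₀ + φ z.1)) 0 ∧
      GermDvd (fun z => z.2 - z.1 * (t₀ + φ z.1))
        (wedgeCoeff τ fun z => z.2 - z.1 * (t₀ + φ z.1)) 0 := by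
  have hAs := ha.analyticAt_strictTransform 1 0 t₀ 1
  have hBs := hb.analyticAt_strictTransform 1 0 t₀ 1
  set As := strictTransform 1 0 t₀ 1 ν a
  set Bs := strictTransform 1 0 t₀ 1 ν b
  have hA0 : ∀ t, As (0, t) = (leadPoly ν a).eval (t₀ + t) := fun t => by
    simp only [As]
    rw [strictTransform_zero_left]
    simpa using homEval_one (natDegree_leadPoly_le ν a) (t₀ + t)
  have hB0 : ∀ t, Bs (0, t) = (leadPoly ν b).eval (t₀ + t) := fun t => by
    simp only [Bs]
    rw [strictTransform_zero_left]
    simpa using homEval_one (natDegree_leadPoly_le ν b) (t₀ + t)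
  have hCA : AnalyticAt ℂ (fun z : ℂ × ℂ => As z + (t₀ + z.2) * Bs z) 0 :=
    hAs.add ((analyticAt_const.add analyticAt_snd).mul hBs)
  -- With y = x (t₀ + t) the form pulls back to x ^ ν ((As + (t₀ + t) Bs) dx + x Bs dt). Vanishing
  -- of the tangent cone makes the first coefficient x C, so the foliation is given by C dx + Bs dt,
  -- transverse to x = 0.
  obtain ⟨C, hC, eC⟩ := exists_eq_fst_mul hCA (Eventually.of_forall fun t => by
    have := congrArg (Polynomial.eval (t₀ + t)) hP
    simp only [hA0, hB0]
    simpa using this)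
  have hB00 : Bs 0 ≠ 0 := by
    have := hB0 0
    rw [add_zero] at this
    change Bs (0, 0) ≠ 0
    rwa [this]
  -- The leaf t = φ(x) solves dt/dx = - C / Bs; downstairs it is the curve y = x (t₀ + φ(x)).
  obtain ⟨φ, hφ, hφ0, hode⟩ := exists_holomorphic_ode_solution (hC.neg.mul (hBs.inv hB00))
  have hφ1 := analyticAt_comp_fst hφ
  have hgA : AnalyticAt ℂ (fun z : ℂ × ℂ => z.2 - z.1 * (t₀ + φ z.1)) 0 :=
    analyticAt_snd.sub (analyticAt_fst.mul (analyticAt_const.add hφ1))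
  have hfd : ∀ᶠ x in 𝓝 (0 : ℂ), ∀ (y : ℂ) (v : ℂ × ℂ),
      fderiv ℂ (fun z : ℂ × ℂ => z.2 - z.1 * (t₀ + φ z.1)) (x, y) v =
        v.2 - v.1 * (t₀ + φ x + x * deriv φ x) := by
    filter_upwards [hφ.eventually_analyticAt] with x hx y v
    have h1 : HasFDerivAt (fun z : ℂ × ℂ => φ z.1)
        (deriv φ x • ContinuousLinearMap.fst ℂ ℂ ℂ) (x, y) := by
      have := HasFDerivAt.comp (x, y) (g := φ) (f := Prod.fst)
        hx.differentiableAt.hasDerivAt.hasFDerivAt hasFDerivAt_fst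
      refine this.congr_fderiv ?_
      ext <;> simp
    have h2 := (hasFDerivAt_snd (𝕜 := ℂ) (E := ℂ) (F := ℂ) (p := (x, y))).sub
      ((hasFDerivAt_fst (𝕜 := ℂ) (E := ℂ) (F := ℂ) (p := (x, y))).mul (h1.const_add t₀))
    have h3 : fderiv ℂ (fun z : ℂ × ℂ => z.2 - z.1 * (t₀ + φ z.1)) (x, y) = _ := h2.fderiv
    rw [h3]
    simp
    ring
  refine ⟨φ, hφ, hφ0, isReducedGerm_of_smooth hgA (Or.inr fun h => ?_), ?_⟩
  · have := hfd.self_of_nhds 0 (0, 1)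
    rw [show ((0 : ℂ), (0 : ℂ)) = 0 from rfl, h] at this
    simp at this
  · refine exists_eq_sub_mul (ψ := fun x => x * (t₀ + φ x)) (hτ.wedgeCoeff hgA)
      (analyticAt_id.mul (analyticAt_const.add hφ)) (by simp) ?_
    have htφ : Tendsto (fun x => (x, φ x)) (𝓝 0) (𝓝 (0 : ℂ × ℂ)) := by
      have := (continuousAt_id.prodMk hφ.continuousAt).tendsto
      simpa [hφ0, ← Prod.zero_eq_mk] using this
    filter_upwards [hfd, hode, htφ.eventually (ha.comp_chartBlowUp 1 0 t₀ 1),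
      htφ.eventually (hb.comp_chartBlowUp 1 0 t₀ 1), htφ.eventually eC,
      htφ.eventually (hBs.continuousAt.eventually_ne hB00)] with x h1 h2 h3 h4 h5 h6
    have e1 : chartBlowUp 1 0 t₀ 1 (x, φ x) = (x, x * (t₀ + φ x)) := by simp [chartBlowUp]
    rw [e1] at h3 h4
    simp only [wedgeCoeff, h1]
    rw [h3, h4, h2.deriv]
    simp only [Pi.mul_apply, Pi.neg_apply, Pi.inv_apply]
    simp only [As, Bs] at h5 h6 ⊢
    linear_combination x ^ ν * h5 - x ^ ν * x * C (x, φ x) * mul_inv_cancel₀ h6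

/-- For a non-dicritical foliation, exceptional curves are invariant: the tangent cone of the
strict transform at the centre of a blow-up does not vanish identically. -/
theorem GermTower.tangentCone_ne_zero {ω : ℂ × ℂ → (ℂ × ℂ →L[ℂ] ℂ)} (hω : AnalyticAt ℂ ω 0)
    (hnd : IsNonDicritical ω) {𝒢 : Set (ℂ × ℂ → ℂ × ℂ)} (h : GermTower 𝒢) {F : ℂ × ℂ → ℂ × ℂ}
    (hF : F ∈ 𝒢) (hF0 : ¬ ∀ᶠ z in 𝓝 0, F z = 0) {τ : ℂ × ℂ → (ℂ × ℂ →L[ℂ] ℂ)}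
    (hτ : AnalyticAt ℂ τ 0) {g : ℂ × ℂ → ℂ} (hg : AnalyticAt ℂ g 0)
    (e : ∀ᶠ z in 𝓝 0, pullbackForm F ω z = g z • τ z) {ν : ℕ}
    {a b : ℕ → ℂ × ℂ → ℂ} (ha : HasExpansion (fun z => τ z (1, 0)) ν a)
    (hb : HasExpansion (fun z => τ z (0, 1)) ν b) (hab : ∃ i ≤ ν, a i 0 ≠ 0 ∨ b i 0 ≠ 0) :
    leadPoly ν a + Polynomial.X * leadPoly ν b ≠ 0 := by
  intro hP
  have hb0 : leadPoly ν b ≠ 0 := by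
    intro hb0
    rw [hb0, mul_zero, add_zero] at hP
    obtain ⟨i, hi, h1 | h1⟩ := hab
    · exact leadPoly_ne_zero ⟨i, hi, h1⟩ hP
    · exact leadPoly_ne_zero ⟨i, hi, h1⟩ hb0
  obtain ⟨hFA, hFz⟩ := h.analyticAt_and_map_zero F hF
  obtain ⟨p, c, d, hc, hd, i, hi, hcd⟩ := exists_expansion_pair hFA.fst_comp hFA.snd_comp
    fun H => hF0 ((H.1.and H.2).mono fun z hz => Prod.ext hz.1 hz.2)
  -- Outside finitely many slopes, a component of F has nonvanishing leading form, so the new curve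
  -- is not contracted by F. This is required in order to push it down.
  obtain ⟨q, hq, hqF⟩ : ∃ q : Polynomial ℂ, q ≠ 0 ∧ ∀ t₀, q.eval t₀ ≠ 0 →
      ∀ φ : ℂ → ℂ, ContinuousAt φ 0 → φ 0 = 0 →
        ∀ᶠ x in 𝓝 0, x ≠ 0 → F (x, x * (t₀ + φ x)) ≠ 0 := by
    have key : ∀ (f : ℂ × ℂ → ℂ) (c : ℕ → ℂ × ℂ → ℂ), HasExpansion f p c → ∀ t₀,
        (leadPoly p c).eval t₀ ≠ 0 → ∀ φ : ℂ → ℂ, ContinuousAt φ 0 → φ 0 = 0 →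
        ∀ᶠ x in 𝓝 0, x ≠ 0 → f (x, x * (t₀ + φ x)) ≠ 0 := by
      intro f c hc t₀ ht₀ φ hφ hφ0
      have hS := hc.analyticAt_strictTransform 1 0 t₀ 1
      have hS0 : strictTransform 1 0 t₀ 1 p c 0 ≠ 0 := by
        have := strictTransform_zero_left 1 0 t₀ 1 p c 0
        simp only [mul_zero, add_zero, homEval_one (natDegree_leadPoly_le p c)] at this
        change strictTransform 1 0 t₀ 1 p c (0, 0) ≠ 0
        rwa [this]
      have htφ : Tendsto (fun x => (x, φ x)) (𝓝 0) (𝓝 (0 : ℂ × ℂ)) := by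
        have := (continuousAt_id.prodMk hφ).tendsto
        simpa [hφ0, ← Prod.zero_eq_mk] using this
      filter_upwards [htφ.eventually (hc.comp_chartBlowUp 1 0 t₀ 1),
        htφ.eventually (hS.continuousAt.eventually_ne hS0)] with x h1 h2 hx
      have e1 : chartBlowUp 1 0 t₀ 1 (x, φ x) = (x, x * (t₀ + φ x)) := by simp [chartBlowUp]
      rw [← e1, h1]
      exact mul_ne_zero (pow_ne_zero _ hx) h2
    rcases hcd with h1 | h1
    · refine ⟨leadPoly p c, leadPoly_ne_zero ⟨i, hi, h1⟩, fun t₀ ht₀ φ hφ hφ0 => ?_⟩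
      filter_upwards [key _ c hc t₀ ht₀ φ hφ hφ0] with x hx hx0 h0
      exact hx hx0 (congrArg Prod.fst h0)
    · refine ⟨leadPoly p d, leadPoly_ne_zero ⟨i, hi, h1⟩, fun t₀ ht₀ φ hφ hφ0 => ?_⟩
      filter_upwards [key _ d hd t₀ ht₀ φ hφ hφ0] with x hx hx0 h0
      exact hx hx0 (congrArg Prod.snd h0)
  set T : Set ℂ := {t | (leadPoly ν b * q).IsRoot t}ᶜ with hT
  have hTinf : T.Infinite := (Polynomial.finite_setOfPred_isRoot (mul_ne_zero hb0 hq)).infinite_compl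
  have main : ∀ t ∈ T, ∃ (φ : ℂ → ℂ) (G : ℂ × ℂ → ℂ), ContinuousAt φ 0 ∧ φ 0 = 0 ∧
      IsInvariantCurveEquation ω G ∧ (∀ᶠ x in 𝓝 0, x ≠ 0 → F (x, x * (t + φ x)) ≠ 0) ∧
      ∀ᶠ z in 𝓝 0, F z ≠ 0 → (G (F z) = 0 ↔ z.2 - z.1 * (t + φ z.1) = 0) := by
    intro t ht
    simp only [hT, mem_compl_iff, mem_ofPred_eq, Polynomial.IsRoot, Polynomial.eval_mul,
      mul_eq_zero, not_or] at ht
    obtain ⟨φ, hφ, hφ0, hr, hdv⟩ := exists_separatrix_of_slope hτ ha hb hP ht.1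
    have hFn := hqF t ht.2 φ hφ.continuousAt hφ0
    obtain ⟨G, hG, hGF⟩ := h.exists_invariantCurve hω F hF _ hr (by simp) (by
      obtain ⟨k, hk, ek⟩ := hdv
      refine ⟨fun z => g z * k z, hg.mul hk, ?_⟩
      filter_upwards [wedgeCoeff_congr (EventuallyEq.refl _ _) e, ek] with z h1 h2
      rw [h1, wedgeCoeff_smul, h2]
      ring) (by
      filter_upwards [eventually_comp_fst hFn] with z h1 h2 h3
      have h4 : z.2 = z.1 * (t + φ z.1) := sub_eq_zero.1 h2
      have h5 : z = (z.1, z.1 * (t + φ z.1)) := Prod.ext rfl h4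
      rw [h5]
      refine h1 fun h6 => h3 (Prod.ext h6 ?_)
      rw [h4, h6]; simp)
    exact ⟨φ, G, hφ.continuousAt, hφ0, hG, hFn, hGF⟩
  choose! φ G hφ hφ0 hG hFn hGF using main
  -- The images lie in the finite set of separatrices, and the slope is recovered from the image
  -- germ as the limit of y / x; so the infinite set T would be finite.
  refine hTinf ((Set.Finite.subset hnd (t := (fun t => (↑(fun z : ℂ × ℂ => G t z = 0) :
    Germ (𝓝 (0 : ℂ × ℂ)) Prop)) '' T) ?_).of_finite_image ?_)
  · rintro _ ⟨t, ht, rfl⟩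
    exact ⟨G t, hG t ht, rfl⟩
  · intro s hs t ht hst
    have hst' : ∀ᶠ z in 𝓝 (0 : ℂ × ℂ), (G s z = 0) = (G t z = 0) := Germ.coe_eq.1 hst
    have hFt : Tendsto F (𝓝 0) (𝓝 0) := by
      have := hFA.continuousAt.tendsto
      rwa [hFz] at this
    have htl : Tendsto (fun x => (x, x * (s + φ s x))) (𝓝 0) (𝓝 (0 : ℂ × ℂ)) := by
      have : ContinuousAt (fun x => (x, x * (s + φ s x))) 0 :=
        continuousAt_id.prodMk (continuousAt_id.mul (continuousAt_const.add (hφ s hs)))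
      have := this.tendsto
      simpa [hφ0 s hs, ← Prod.zero_eq_mk] using this
    have hev : ∀ᶠ x in 𝓝[≠] (0 : ℂ), s + φ s x = t + φ t x := by
      filter_upwards [(hFn s hs).filter_mono nhdsWithin_le_nhds,
        (htl.eventually (hGF s hs)).filter_mono nhdsWithin_le_nhds,
        (htl.eventually (hGF t ht)).filter_mono nhdsWithin_le_nhds,
        (htl.eventually (hFt.eventually hst')).filter_mono nhdsWithin_le_nhds,
        eventually_mem_nhdsWithin] with x h1 h2 h3 h4 (hx : x ≠ 0)
      have h5 := (h3 (h1 hx)).1 (h4 ▸ (h2 (h1 hx)).2 (by simp))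
      exact mul_left_cancel₀ hx (sub_eq_zero.1 h5)
    have l1 : Tendsto (fun x => s + φ s x) (𝓝[≠] 0) (𝓝 s) := by
      have : ContinuousAt (fun x => s + φ s x) 0 := continuousAt_const.add (hφ s hs)
      have := this.tendsto
      simp only [hφ0 s hs, add_zero] at this
      exact this.mono_left nhdsWithin_le_nhds
    have l2 : Tendsto (fun x => t + φ t x) (𝓝[≠] 0) (𝓝 t) := by
      have : ContinuousAt (fun x => t + φ t x) 0 := continuousAt_const.add (hφ t ht)
      have := this.tendsto
      simp only [hφ0 t ht, add_zero] at this
      exact this.mono_left nhdsWithin_le_nhds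
    exact tendsto_nhds_unique (l1.congr' hev) l2

end Separatrices

/-! ### Vanishing orders and Fuchsian equations -/

section VanishingOrder

/-- `u` vanishes to order at least `N` at `0`. -/
def VanishesToOrder (N : ℕ) (u : ℂ → ℂ) : Prop :=
  ∃ w, AnalyticAt ℂ w 0 ∧ ∀ᶠ x in 𝓝 0, u x = x ^ N * w x

variable {N : ℕ} {u v : ℂ → ℂ}

theorem VanishesToOrder.add (hu : VanishesToOrder N u) (hv : VanishesToOrder N v) :
    VanishesToOrder N fun x => u x + v x := by
  obtain ⟨a, ha, ea⟩ := hu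
  obtain ⟨b, hb, eb⟩ := hv
  refine ⟨fun x => a x + b x, ha.add hb, ?_⟩
  filter_upwards [ea, eb] with x h1 h2
  rw [h1, h2]; ring

theorem VanishesToOrder.mul_left {g : ℂ → ℂ} (hg : AnalyticAt ℂ g 0)
    (hu : VanishesToOrder N u) : VanishesToOrder N fun x => g x * u x := by
  obtain ⟨a, ha, ea⟩ := hu
  refine ⟨fun x => g x * a x, hg.mul ha, ?_⟩
  filter_upwards [ea] with x h1
  rw [h1]; ring

theorem VanishesToOrder.sub (hu : VanishesToOrder N u) (hv : VanishesToOrder N v) :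
    VanishesToOrder N fun x => u x - v x := by
  simpa [sub_eq_add_neg] using hu.add (hv.mul_left (g := fun _ => -1) analyticAt_const)

theorem VanishesToOrder.congr (hu : VanishesToOrder N u) (h : ∀ᶠ x in 𝓝 0, u x = v x) :
    VanishesToOrder N v := by
  obtain ⟨a, ha, ea⟩ := hu
  refine ⟨a, ha, ?_⟩
  filter_upwards [ea, h] with x h1 h2
  rw [← h2, h1]

theorem VanishesToOrder.mul_deriv (hu : VanishesToOrder N u) :
    VanishesToOrder N fun x => x * deriv u x := by
  obtain ⟨a, ha, ea⟩ := hu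
  refine ⟨fun x => N * a x + x * deriv a x,
    (analyticAt_const.mul ha).add (analyticAt_id.mul ha.deriv), ?_⟩
  filter_upwards [eventually_eventually_nhds.2 ea, ha.eventually_analyticAt] with x h1 h2
  have h3 : deriv u x = _ :=
    (EventuallyEq.deriv_eq h1).trans (((hasDerivAt_pow N x).mul h2.differentiableAt.hasDerivAt).deriv)
  rw [h3]
  rcases N with _ | n
  · simp
  · simp only [Nat.add_sub_cancel]
    ring

theorem not_eventually_id_pow_eq_zero (n : ℕ) : ¬ ∀ᶠ x : ℂ in 𝓝 0, x ^ n = 0 :=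
  not_eventually_pow_eq_zero (fun h => not_eventually_fst_eq_zero (eventually_comp_fst h)) n

/-- Solutions of `α x u' + β u = O(x ^ N)` in the absence of resonances. -/
theorem VanishesToOrder.of_fuchsian {α β : ℂ → ℂ} (hα : AnalyticAt ℂ α 0) (hβ : AnalyticAt ℂ β 0)
    (hu : AnalyticAt ℂ u 0) (hu0 : u 0 = 0) (hres : ∀ j : ℕ, 0 < j → β 0 + j * α 0 ≠ 0)
    (h : VanishesToOrder N fun x => α x * (x * deriv u x) + β x * u x) : VanishesToOrder N u := by
  have key : ∀ j ≤ N, VanishesToOrder j u := by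
    intro j
    induction j with
    | zero => exact fun _ => ⟨u, hu, by simp⟩
    | succ j ih =>
      intro hj
      -- The index 0 is covered by u(0) = 0 instead of the non-resonance condition.
      rcases Nat.eq_zero_or_pos j with rfl | hj0
      · obtain ⟨g, hg, e⟩ := exists_eq_mul_of_apply_zero hu hu0
        exact ⟨g, hg, by simpa using e⟩
      obtain ⟨v, hv, ev⟩ := ih (by omega)
      obtain ⟨w, hw, ew⟩ := h
      have hL : AnalyticAt ℂ (fun x => α x * (j * v x + x * deriv v x) + β x * v x) 0 :=
        (hα.mul ((analyticAt_const.mul hv).add (analyticAt_id.mul hv.deriv))).add (hβ.mul hv)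
      have hR : AnalyticAt ℂ (fun x => x ^ (N - j) * w x) 0 := (analyticAt_id.pow _).mul hw
      have e := eventually_eq_of_mul_left (h := fun x : ℂ => x ^ j) (analyticAt_id.pow j) hL hR ?_
        (not_eventually_id_pow_eq_zero j)
      · have h0 := e.self_of_nhds
        simp only [zero_mul, add_zero, zero_pow (by omega : N - j ≠ 0)] at h0
        -- The coefficient of x ^ j in the equation is the indicial value β(0) + j α(0) times the
        -- leading coefficient of u.
        have hv0 : v 0 = 0 := by
          have : (β 0 + j * α 0) * v 0 = 0 := by linear_combination h0
          exact (mul_eq_zero.1 this).resolve_left (hres j hj0)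
        obtain ⟨g, hg, eg⟩ := exists_eq_mul_of_apply_zero hv hv0
        refine ⟨g, hg, ?_⟩
        filter_upwards [ev, eg] with x h1 h2
        rw [h1, h2]; ring
      · filter_upwards [ew, ev, eventually_eventually_nhds.2 ev, hv.eventually_analyticAt]
          with x h1 h2 h3 h4
        have h5 : deriv u x = _ := (EventuallyEq.deriv_eq h3).trans
          (((hasDerivAt_pow j x).mul h4.differentiableAt.hasDerivAt).deriv)
        rw [h2, h5] at h1
        rw [← mul_assoc, ← pow_add, Nat.add_sub_cancel' (by omega : j ≤ N), ← h1]
        obtain ⟨i, rfl⟩ := Nat.exists_eq_succ_of_ne_zero hj0.ne'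
        simp only [Nat.succ_eq_add_one, Nat.add_sub_cancel]
        ring
  exact key N le_rfl

end VanishingOrder

/-! ### Formal separatrices to finite order -/

section Graphs

/-- Restriction of a function to the graph `y = φ x`. -/
theorem AnalyticAt.graph {f : ℂ × ℂ → ℂ} {φ : ℂ → ℂ} (hf : AnalyticAt ℂ f 0)
    (hφ : AnalyticAt ℂ φ 0) (hφ0 : φ 0 = 0) : AnalyticAt ℂ (fun x => f (x, φ x)) 0 := by
  have h : AnalyticAt ℂ f (0, φ 0) := by rw [hφ0]; exact hf
  exact AnalyticAt.comp (f := fun x => (x, φ x)) h (analyticAt_id.prod hφ)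

theorem tendsto_graph {φ : ℂ → ℂ} (hφ : ContinuousAt φ 0) (hφ0 : φ 0 = 0) :
    Tendsto (fun x => (x, φ x)) (𝓝 0) (𝓝 (0 : ℂ × ℂ)) := by
  have := (continuousAt_id.prodMk hφ).tendsto
  simpa [hφ0, ← Prod.zero_eq_mk] using this

theorem eventually_deriv_graph {f : ℂ × ℂ → ℂ} {φ : ℂ → ℂ} (hf : AnalyticAt ℂ f 0)
    (hφ : AnalyticAt ℂ φ 0) (hφ0 : φ 0 = 0) :
    ∀ᶠ x in 𝓝 0, deriv (fun x => f (x, φ x)) x =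
      fderiv ℂ f (x, φ x) (1, 0) + deriv φ x * fderiv ℂ f (x, φ x) (0, 1) := by
  filter_upwards [hφ.eventually_analyticAt,
    (tendsto_graph hφ.continuousAt hφ0).eventually hf.eventually_analyticAt] with x h1 h2
  have h3 := h2.differentiableAt.hasFDerivAt.comp_hasDerivAt x
    ((hasDerivAt_id x).prodMk h1.differentiableAt.hasDerivAt)
  have h4 : deriv (fun x => f (x, φ x)) x = _ := h3.deriv
  rw [h4, form_apply]
  simp

theorem hasDerivAt_slice_snd {f : ℂ × ℂ → ℂ} {x y : ℂ} (hf : DifferentiableAt ℂ f (x, y)) :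
    HasDerivAt (fun y => f (x, y)) (fderiv ℂ f (x, y) (0, 1)) y :=
  hf.hasFDerivAt.comp_hasDerivAt y ((hasDerivAt_const y x).prodMk (hasDerivAt_id y))

/-- Approximate separatrices `y = φ x` transverse to `x = 0`. -/
theorem exists_approx_separatrix {A B : ℂ × ℂ → ℂ} (hA : AnalyticAt ℂ A 0) (hB : AnalyticAt ℂ B 0)
    (hA0 : A 0 = 0) (hres : ∀ j : ℕ, 0 < j → fderiv ℂ A 0 (0, 1) + j * B 0 ≠ 0) (N : ℕ) :
    ∃ φ : ℂ → ℂ, AnalyticAt ℂ φ 0 ∧ φ 0 = 0 ∧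
      VanishesToOrder (N + 1) fun x => A (x, φ x) + B (x, φ x) * (x * deriv φ x) := by
  induction N with
  | zero =>
    have h1 : AnalyticAt ℂ (fun x => A (x, 0)) 0 := hA.graph (φ := fun _ => 0) analyticAt_const rfl
    obtain ⟨w, hw, e⟩ := exists_eq_mul_of_apply_zero h1 hA0
    exact ⟨fun _ => 0, analyticAt_const, rfl, w, hw, by simpa using e⟩
  | succ N ih =>
    obtain ⟨φ, hφ, hφ0, w, hw, ew⟩ := ih
    have hs : AnalyticAt ℂ (fun z : ℂ × ℂ => (z.1, φ z.1 + z.2)) 0 :=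
      analyticAt_fst.prod ((analyticAt_comp_fst hφ).add analyticAt_snd)
    have hs' : AnalyticAt ℂ (fun z : ℂ × ℂ => (z.1, φ z.1)) 0 :=
      analyticAt_fst.prod (analyticAt_comp_fst hφ)
    have hdd : ∀ C : ℂ × ℂ → ℂ, AnalyticAt ℂ C 0 → ∃ D, AnalyticAt ℂ D 0 ∧
        ∀ᶠ z : ℂ × ℂ in 𝓝 0, C (z.1, φ z.1 + z.2) = C (z.1, φ z.1) + z.2 * D z := by
      intro C hC
      obtain ⟨D, hD, e⟩ := exists_eq_snd_mul
        (f := fun z : ℂ × ℂ => C (z.1, φ z.1 + z.2) - C (z.1, φ z.1))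
        ((hC.comp_zero hs (by simp [hφ0])).sub (hC.comp_zero hs' (by simp [hφ0])))
        (Eventually.of_forall fun x => by simp)
      exact ⟨D, hD, e.mono fun z hz => by rw [← hz]; ring⟩
    obtain ⟨D, hD, eD⟩ := hdd A hA
    obtain ⟨D', hD', eD'⟩ := hdd B hB
    have hD0 : D 0 = fderiv ℂ A 0 (0, 1) := by
      have h1 : HasDerivAt (fun y => A (0, y)) (fderiv ℂ A 0 (0, 1)) 0 :=
        hasDerivAt_slice_snd (x := 0) (y := 0) hA.differentiableAt
      have h2 := (hasDerivAt_id (0 : ℂ)).mul hD.curry_right₂.differentiableAt.hasDerivAt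
      have h3 := h2.congr_of_eventuallyEq (f₁ := fun y => A (0, y)) (by
        filter_upwards [eventually_slice_snd eD] with y hy
        simpa [hφ0, hA0, ← Prod.zero_eq_mk] using hy)
      have := h1.unique h3
      simp at this
      rw [this]
      rfl
    -- The next Taylor coefficient c of φ solves a linear equation whose coefficient is nonzero by
    -- non-resonance. Only finite order is needed, so convergence of the formal separatrix is never
    -- discussed.
    obtain ⟨c, hc⟩ : ∃ c, w 0 + c * (fderiv ℂ A 0 (0, 1) + ((N + 1 : ℕ) : ℂ) * B 0) = 0 :=
      ⟨-w 0 / (fderiv ℂ A 0 (0, 1) + ((N + 1 : ℕ) : ℂ) * B 0), by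
        rw [div_mul_cancel₀ _ (hres (N + 1) N.succ_pos), add_neg_cancel]⟩
    have hsm : AnalyticAt ℂ (fun x : ℂ => c * x ^ (N + 1)) 0 :=
      analyticAt_const.mul (analyticAt_id.pow _)
    have hsm0 : c * (0 : ℂ) ^ (N + 1) = 0 := by simp
    set w' : ℂ → ℂ := fun x => w x + c * D (x, c * x ^ (N + 1)) + (N + 1) * c * B (x, φ x) +
      c * D' (x, c * x ^ (N + 1)) * (x * deriv φ x + (N + 1) * c * x ^ (N + 1)) with hw'def
    have hw' : AnalyticAt ℂ w' 0 :=
      ((hw.add (analyticAt_const.mul (hD.graph hsm hsm0))).add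
        (analyticAt_const.mul (hB.graph hφ hφ0))).add
        ((analyticAt_const.mul (hD'.graph hsm hsm0)).mul ((analyticAt_id.mul hφ.deriv).add
          (analyticAt_const.mul (analyticAt_id.pow _))))
    have hw'0 : w' 0 = 0 := by
      simp only [hw'def]
      rw [hsm0, hφ0, ← Prod.zero_eq_mk, hD0]
      push_cast at hc
      simp
      linear_combination hc
    obtain ⟨w'', hw'', e''⟩ := exists_eq_mul_of_apply_zero hw' hw'0
    refine ⟨fun x => φ x + c * x ^ (N + 1), hφ.add hsm, by simp [hφ0], w'', hw'', ?_⟩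
    have htg := tendsto_graph hsm.continuousAt hsm0
    filter_upwards [ew, e'', htg.eventually eD, htg.eventually eD', hφ.eventually_analyticAt]
      with x h1 h2 h3 h4 h5
    have h6 : deriv (fun x => φ x + c * x ^ (N + 1)) x = deriv φ x + c * ((N + 1) * x ^ N) := by
      have := h5.differentiableAt.hasDerivAt.add ((hasDerivAt_pow (N + 1) x).const_mul c)
      have h7 : deriv (fun x => φ x + c * x ^ (N + 1)) x = _ := this.deriv
      rw [h7]
      simp
    rw [h6, h3, h4]
    simp only [hw'def] at h2
    linear_combination h1 + x ^ (N + 1) * h2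

end Graphs

/-! ### Invariant curves at a reduced singularity -/

section SimpleSingularities

/-- Near a simple singularity with invariant axis `x = 0`, another invariant curve is smooth and
transverse to the axis. -/
theorem order_lt_two_of_nonresonant {A B f K : ℂ × ℂ → ℂ} (hA : AnalyticAt ℂ A 0)
    (hB : AnalyticAt ℂ B 0) (hK : AnalyticAt ℂ K 0) (hf : HasIsolatedCurveSing f)
    (hA0 : A 0 = 0) (hres : ∀ i j : ℕ, 0 < i → 0 < j → i * fderiv ℂ A 0 (0, 1) + j * B 0 ≠ 0)
    (e : ∀ᶠ z in 𝓝 0, A z * fderiv ℂ f z (0, 1) - z.1 * B z * fderiv ℂ f z (1, 0) = K z * f z)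
    {m : ℕ} (hm : analyticOrderAt (fun y => f (0, y)) 0 = m) : m < 2 := by
  -- If m ≥ 2, then f and f_y vanish at 0. Along an approximate separatrix they satisfy non-resonant
  -- Fuchsian equations, so they vanish there to high order, and so does x f_x. This contradicts the
  -- relation expressing a power of x through f and its partial derivatives.
  by_contra! hm2
  have hfA := hf.analyticAt
  obtain ⟨v, hv, hv0, ev⟩ := (hfA.curry_right₂.analyticOrderAt_eq_natCast).1 hm
  simp only [sub_zero, smul_eq_mul] at ev
  -- the cofactor at the origin
  have hfy : ∀ᶠ y in 𝓝 0, fderiv ℂ f (0, y) (0, 1) = y ^ (m - 1) * (m * v y + y * deriv v y) := by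
    filter_upwards [eventually_eventually_nhds.2 ev, hv.eventually_analyticAt,
      eventually_slice_snd hfA.eventually_analyticAt] with y h1 h2 h3
    have h4 := (hasDerivAt_slice_snd h3.differentiableAt).deriv
    have h5 : deriv (fun y => f (0, y)) y = _ := (EventuallyEq.deriv_eq h1).trans
      (((hasDerivAt_pow m y).mul h2.differentiableAt.hasDerivAt).deriv)
    rw [← h4, h5]
    obtain ⟨i, rfl⟩ := Nat.exists_eq_add_of_le hm2
    rw [show 2 + i - 1 = i + 1 by omega]
    push_cast
    ring
  have hf0 : f 0 = 0 := by
    have := ev.self_of_nhds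
    rwa [zero_pow (by omega : m ≠ 0), zero_mul] at this
  have hfy0 : fderiv ℂ f 0 (0, 1) = 0 := by
    have := hfy.self_of_nhds
    rwa [zero_pow (by omega : m - 1 ≠ 0), zero_mul] at this
  obtain ⟨A1, hA1, eA1⟩ := exists_eq_mul_of_apply_zero hA.curry_right₂ hA0
  have hA10 : A1 0 = fderiv ℂ A 0 (0, 1) := by
    have h1 : HasDerivAt (fun y => A (0, y)) (fderiv ℂ A 0 (0, 1)) 0 :=
      hasDerivAt_slice_snd (x := 0) (y := 0) hA.differentiableAt
    have h2 := ((hasDerivAt_id (0 : ℂ)).mul hA1.differentiableAt.hasDerivAt).congr_of_eventuallyEq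
      eA1
    simpa using (h1.unique h2).symm
  have hK0 : K 0 = m * fderiv ℂ A 0 (0, 1) := by
    have e1 := eventually_eq_of_mul_left (h := fun y : ℂ => y ^ m)
      (f := fun y => A1 y * (m * v y + y * deriv v y)) (g := fun y => K (0, y) * v y)
      (analyticAt_id.pow m) (hA1.mul ((analyticAt_const.mul hv).add (analyticAt_id.mul hv.deriv)))
      (hK.curry_right₂.mul hv) ?_ (not_eventually_id_pow_eq_zero m)
    · have := e1.self_of_nhds
      simp only [zero_mul, add_zero, hA10, ← Prod.zero_eq_mk] at this
      have h2 : (K 0 - m * fderiv ℂ A 0 (0, 1)) * v 0 = 0 := by linear_combination -this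
      exact sub_eq_zero.1 ((mul_eq_zero.1 h2).resolve_right hv0)
    · filter_upwards [eventually_slice_snd e, ev, eA1, hfy] with y h1 h2 h3 h4
      simp only [h2, h3, h4, zero_mul, sub_zero] at h1
      obtain ⟨i, rfl⟩ := Nat.exists_eq_add_of_le hm2
      rw [show 2 + i - 1 = i + 1 by omega] at h1
      rw [pow_add] at h1 ⊢
      linear_combination h1
  -- an approximate separatrix
  obtain ⟨⟨M, a, b, c, ha, hb, hc, eJ⟩, -⟩ := hf.exists_pow
  obtain ⟨φ, hφ, hφ0, hres'⟩ := exists_approx_separatrix hA hB hA0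
    (fun j hj => by simpa using hres 1 j one_pos hj) (M + 1)
  set N := M + 1 + 1 with hN
  set u : ℂ → ℂ := fun x => f (x, φ x) with hu_def
  set w : ℂ → ℂ := fun x => fderiv ℂ f (x, φ x) (0, 1) with hw_def
  have hu : AnalyticAt ℂ u 0 := hfA.graph hφ hφ0
  have hfyA := hfA.fderiv_apply (0, 1)
  have hfxA := hfA.fderiv_apply (1, 0)
  have hw : AnalyticAt ℂ w 0 := hfyA.graph hφ hφ0
  have htg := tendsto_graph hφ.continuousAt hφ0
  have hBφ := hB.graph hφ hφ0
  have hKφ := hK.graph hφ hφ0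
  have du := eventually_deriv_graph hfA hφ hφ0
  have dw := eventually_deriv_graph hfyA hφ hφ0
  -- Along y = φ(x) the invariance equation reads B x u' + K u = (A + B x φ') f_y, with indicial
  -- values m A_y(0) + j B(0).
  have hu' : VanishesToOrder N u := by
    refine VanishesToOrder.of_fuchsian hBφ hKφ hu (by simp [hu_def, hφ0, ← Prod.zero_eq_mk, hf0])
      (fun j hj => ?_) ((hres'.mul_left hw).congr ?_)
    · simp only [hφ0, ← Prod.zero_eq_mk, hK0]
      exact hres m j (by omega) hj
    · filter_upwards [htg.eventually e, du] with x h1 h2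
      simp only [hu_def, hw_def] at h1 h2 ⊢
      rw [h2]
      linear_combination h1
  -- Differentiating the invariance equation in y lowers the indicial values to (m - 1) A_y(0) + j
  -- B(0). These are non-resonant precisely because m ≥ 2.
  have hw' : VanishesToOrder N w := by
    have hyy := (hfyA.fderiv_apply (0, 1)).graph hφ hφ0
    have hBy := (hB.fderiv_apply (0, 1)).graph hφ hφ0
    have hKy := (hK.fderiv_apply (0, 1)).graph hφ hφ0
    have hAy := (hA.fderiv_apply (0, 1)).graph hφ hφ0
    refine VanishesToOrder.of_fuchsian hBφ
      (β := fun x => K (x, φ x) - fderiv ℂ A (x, φ x) (0, 1) -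
        x * deriv φ x * fderiv ℂ B (x, φ x) (0, 1))
      ((hKφ.sub hAy).sub ((analyticAt_id.mul hφ.deriv).mul hBy)) hw
      (by simp [hw_def, hφ0, ← Prod.zero_eq_mk, hfy0]) (fun j hj => ?_)
      ((((hres'.mul_left hyy).sub (hu'.mul_deriv.mul_left hBy)).sub
        (hu'.mul_left hKy)).congr ?_)
    · simp only [hφ0, ← Prod.zero_eq_mk, hK0, zero_mul, sub_zero]
      have := hres (m - 1) j (by omega) hj
      rw [Nat.cast_sub (by omega)] at this
      intro h
      apply this
      push_cast
      linear_combination h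
    · have eL : ∀ᶠ z in 𝓝 0, fderiv ℂ (fun z => A z * fderiv ℂ f z (0, 1) -
          z.1 * B z * fderiv ℂ f z (1, 0)) z (0, 1) = fderiv ℂ (fun z => K z * f z) z (0, 1) := by
        filter_upwards [eventually_eventually_nhds.2 e] with z hz
        rw [EventuallyEq.fderiv_eq hz]
      filter_upwards [htg.eventually eL, htg.eventually hA.eventually_analyticAt,
        htg.eventually hB.eventually_analyticAt, htg.eventually hK.eventually_analyticAt,
        htg.eventually hfA.eventually_analyticAt, du, dw] with x h1 h2 h3 h4 h5 h6 h7
      have h8 := h5.fderiv_apply (0, 1)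
      have h9 := h5.fderiv_apply (1, 0)
      have hsym : fderiv ℂ (fun z => fderiv ℂ f z (1, 0)) (x, φ x) (0, 1) =
          fderiv ℂ (fun z => fderiv ℂ f z (0, 1)) (x, φ x) (1, 0) := by
        have hs : IsSymmSndFDerivAt ℂ f (x, φ x) :=
          (h5.contDiffAt (n := 2)).isSymmSndFDerivAt (by simp)
        have hd : DifferentiableAt ℂ (fderiv ℂ f) (x, φ x) := h5.fderiv.differentiableAt
        have h10 : ∀ p q : ℂ × ℂ, fderiv ℂ (fun z => fderiv ℂ f z p) (x, φ x) q =
            fderiv ℂ (fderiv ℂ f) (x, φ x) q p := by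
          intro p q
          rw [fderiv_clm_apply hd (differentiableAt_const p)]
          simp
        rw [h10, h10]
        exact hs _ _
      have hxB : DifferentiableAt ℂ (fun z : ℂ × ℂ => z.1 * B z) (x, φ x) :=
        differentiableAt_fst.mul h3.differentiableAt
      have h11 : DifferentiableAt ℂ (fun z => A z * fderiv ℂ f z (0, 1)) (x, φ x) :=
        (h2.mul h8).differentiableAt
      have h12 : DifferentiableAt ℂ (fun z => z.1 * B z * fderiv ℂ f z (1, 0)) (x, φ x) :=
        hxB.mul h9.differentiableAt
      rw [fderiv_fun_sub h11 h12] at h1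
      rw [sub_apply, fderiv_mul_apply h2.differentiableAt h8.differentiableAt,
        fderiv_mul_apply hxB h9.differentiableAt,
        fderiv_mul_apply differentiableAt_fst h3.differentiableAt, fderiv_fst_apply',
        fderiv_mul_apply h4.differentiableAt h5.differentiableAt, hsym] at h1
      simp only [hu_def, hw_def] at h6 h7 ⊢
      rw [h6, h7]
      simp only at h1
      linear_combination h1
  -- contradiction with the isolated singularity
  have hx : VanishesToOrder N fun x => x ^ (M + 1) := by
    refine ((((hu'.mul_left (analyticAt_id.mul (ha.graph hφ hφ0))).add
      (hu'.mul_deriv.mul_left (hb.graph hφ hφ0))).sub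
      (hw'.mul_left ((hb.graph hφ hφ0).mul (analyticAt_id.mul hφ.deriv)))).add
      (hw'.mul_left (analyticAt_id.mul (hc.graph hφ hφ0)))).congr ?_
    filter_upwards [htg.eventually eJ, du] with x h1 h2
    simp only [hu_def, hw_def, Pi.mul_apply, id] at h1 h2 ⊢
    rw [h2, pow_succ, h1]
    ring
  -- The exponent M + 1 instead of M appears because only x f_x, and not f_x, is controlled. Since N
  -- = M + 2, vanishing to order N is absurd.
  obtain ⟨g, hg, eg⟩ := hx
  have := eventually_eq_of_mul_left (h := fun x : ℂ => x ^ (M + 1)) (f := fun _ => 1)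
    (g := fun x => x * g x) (analyticAt_id.pow _) analyticAt_const (analyticAt_id.mul hg)
    (eg.mono fun x hx => by
      simp only [hN] at hx
      linear_combination hx) (not_eventually_id_pow_eq_zero _)
  simpa using this.self_of_nhds

end SimpleSingularities

/-! ### Invariance of reduced singularities; uniqueness of saturations -/

section Saturations

/-- A two by two characteristic polynomial is determined by trace and determinant, which transform
simply under coordinate changes and multiplication by units. -/
theorem IsReducedFoliation.iff_trace_det {τ : ℂ × ℂ → (ℂ × ℂ →L[ℂ] ℂ)} {z₀ : ℂ × ℂ}
    (hτ : DifferentiableAt ℂ τ z₀) : IsReducedFoliation τ z₀ ↔ τ z₀ ≠ 0 ∨ ∃ a b : ℂ,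
      fderiv ℂ τ z₀ (1, 0) (0, 1) - fderiv ℂ τ z₀ (0, 1) (1, 0) = a + b ∧
      fderiv ℂ τ z₀ (1, 0) (1, 0) * fderiv ℂ τ z₀ (0, 1) (0, 1) -
        fderiv ℂ τ z₀ (1, 0) (0, 1) * fderiv ℂ τ z₀ (0, 1) (1, 0) = a * b ∧
      b ≠ 0 ∧ ∀ r : ℚ, 0 < r → a / b ≠ (r : ℂ) := by
  have hJ : jacobian (dualField τ) z₀ =
      !![fderiv ℂ τ z₀ (1, 0) (0, 1), fderiv ℂ τ z₀ (0, 1) (0, 1);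
        -fderiv ℂ τ z₀ (1, 0) (1, 0), -fderiv ℂ τ z₀ (0, 1) (1, 0)] := by
    have hv : ∀ v : ℂ × ℂ, HasFDerivAt (fun z => τ z v)
        ((ContinuousLinearMap.apply ℂ ℂ v).comp (fderiv ℂ τ z₀)) z₀ := fun v =>
      (ContinuousLinearMap.apply ℂ ℂ v).hasFDerivAt.comp z₀ hτ.hasFDerivAt
    have h1 : fderiv ℂ (dualField τ) z₀ = _ := ((hv (0, 1)).prodMk (hv (1, 0)).neg).fderiv
    rw [jacobian, h1]
    simp
  rw [IsReducedFoliation, hJ]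
  refine or_congr Iff.rfl (exists₂_congr fun a b => ?_)
  rw [← and_assoc (b := _ = a * b)]
  refine and_congr ?_ Iff.rfl
  rw [Matrix.charpoly_fin_two, Matrix.trace_fin_two_of, Matrix.det_fin_two_of]
  have e : (Polynomial.X - Polynomial.C a) * (Polynomial.X - Polynomial.C b) =
      Polynomial.X ^ 2 - Polynomial.C (a + b) * Polynomial.X + Polynomial.C (a * b) := by
    rw [Polynomial.C_add, Polynomial.C_mul]; ring
  rw [e]
  constructor
  · intro h
    have h0 := congrArg (fun p => Polynomial.coeff p 0) h
    have h1 := congrArg (fun p => Polynomial.coeff p 1) h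
    simp [Polynomial.coeff_X_pow] at h0 h1
    exact ⟨by linear_combination -h1, by linear_combination h0⟩
  · rintro ⟨h1, h2⟩
    rw [← sub_eq_add_neg, h1, ← h2]
    congr 2
    ring

/-- Reduced singularities are preserved by changes of coordinates and multiplication by units. -/
theorem IsReducedFoliation.pullbackForm {τ σ : ℂ × ℂ → (ℂ × ℂ →L[ℂ] ℂ)} {a : ℂ × ℂ}
    {Φ : ℂ × ℂ → ℂ × ℂ} (hΦ : AnalyticAt ℂ Φ a) (hdet : jacDet Φ a ≠ 0)
    (hτ : AnalyticAt ℂ τ (Φ a)) {u : ℂ × ℂ → ℂ} (hu : AnalyticAt ℂ u a) (hu0 : u a ≠ 0)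
    (e : ∀ᶠ z in 𝓝 a, σ z = u z • pullbackForm Φ τ z) (h : IsReducedFoliation τ (Φ a)) :
    IsReducedFoliation σ a := by
  have hσ : AnalyticAt ℂ σ a :=
    (hu.smul (hΦ.pullbackForm hτ)).congr (e.mono fun z hz => hz.symm)
  rw [iff_trace_det hσ.differentiableAt]
  rw [iff_trace_det hτ.differentiableAt] at h
  by_cases h0 : τ (Φ a) = 0
  · obtain ⟨p, q, h1, h2, hq, hpq⟩ := h.resolve_left (not_not_intro h0)
    right
    -- Since τ vanishes at the image point, the derivatives of u and of dΦ do not contribute. The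
    -- trace is then multiplied by u det dΦ and the determinant by its square, so the eigenvalues
    -- have the same ratio.
    have hd : ∀ v w, fderiv ℂ σ a v w =
        u a * fderiv ℂ τ (Φ a) (fderiv ℂ Φ a v) (fderiv ℂ Φ a w) := by
      intro v w
      have h3 := hu.differentiableAt.hasFDerivAt.smul
        ((hτ.differentiableAt.hasFDerivAt.comp a hΦ.differentiableAt.hasFDerivAt).clm_comp
          hΦ.fderiv.differentiableAt.hasFDerivAt)
      have h4 : HasFDerivAt σ _ a := h3.congr_of_eventuallyEq e
      rw [h4.fderiv]
      simp [h0]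
    have hb : ∀ v w : ℂ × ℂ, fderiv ℂ τ (Φ a) v w =
        v.1 * (w.1 * fderiv ℂ τ (Φ a) (1, 0) (1, 0) + w.2 * fderiv ℂ τ (Φ a) (1, 0) (0, 1)) +
        v.2 * (w.1 * fderiv ℂ τ (Φ a) (0, 1) (1, 0) + w.2 * fderiv ℂ τ (Φ a) (0, 1) (0, 1)) := by
      intro v w
      have h5 : v = v.1 • ((1, 0) : ℂ × ℂ) + v.2 • ((0, 1) : ℂ × ℂ) := by ext <;> simp
      conv_lhs => rw [h5, map_add, map_smul, map_smul]
      rw [add_apply, smul_apply, smul_apply, smul_eq_mul, smul_eq_mul,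
        form_apply (fderiv ℂ τ (Φ a) (1, 0)) w, form_apply (fderiv ℂ τ (Φ a) (0, 1)) w]
    have hδ : u a * jacDet Φ a ≠ 0 := mul_ne_zero hu0 hdet
    refine ⟨u a * jacDet Φ a * p, u a * jacDet Φ a * q, ?_, ?_, mul_ne_zero hδ hq, fun r hr => ?_⟩
    · rw [← mul_add, ← h1]
      simp only [hd, hb (fderiv ℂ Φ a _), jacDet]
      ring
    · rw [mul_mul_mul_comm, ← h2]
      simp only [hd, hb (fderiv ℂ Φ a _), jacDet]
      ring
    · rw [mul_div_mul_left _ _ hδ]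
      exact hpq r hr
  · left
    intro h3
    apply h0
    rw [e.self_of_nhds] at h3
    have h4 : ∀ v, _root_.pullbackForm Φ τ a v = 0 := fun v => by
      have := congrArg (fun M : ℂ × ℂ →L[ℂ] ℂ => M v) h3
      rw [smul_apply, smul_eq_mul, zero_apply] at this
      exact (mul_eq_zero.1 this).resolve_left hu0
    obtain ⟨L, hL⟩ := exists_equiv_of_jacDet_ne_zero hdet
    ext1
    · refine ContinuousLinearMap.ext fun x => ?_
      have := h4 (L.symm (x, 0))
      simp only [_root_.pullbackForm, ← hL] at this
      simpa using this
    · refine ContinuousLinearMap.ext fun x => ?_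
      have := h4 (L.symm (0, x))
      simp only [_root_.pullbackForm, ← hL] at this
      simpa using this

/-- If two 1-forms are proportional and the second has an isolated zero, the first is a holomorphic
multiple of the second. -/
theorem IsFoliationForm.exists_eq_smul {σ τ : ℂ × ℂ → (ℂ × ℂ →L[ℂ] ℂ)} (hσ : AnalyticAt ℂ σ 0)
    (hτ : IsFoliationForm τ 0)
    (h : ∀ᶠ z in 𝓝 0, σ z (1, 0) * τ z (0, 1) = σ z (0, 1) * τ z (1, 0)) :
    ∃ u : ℂ × ℂ → ℂ, AnalyticAt ℂ u 0 ∧ ∀ᶠ z in 𝓝 0, σ z = u z • τ z := by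
  set w : ℂ × ℂ → ℂ := fun z => if τ z (1, 0) = 0 then σ z (0, 1) / τ z (0, 1) else
    σ z (1, 0) / τ z (1, 0) with hw
  have hne : ∀ᶠ z in 𝓝[≠] 0, τ z ≠ 0 := hτ.2
  have hform : ∀ z, τ z ≠ 0 → τ z (1, 0) = 0 → τ z (0, 1) ≠ 0 := by
    intro z hz h1 h2
    exact hz (form_ext h1 h2)
  have hw1 : ∀ z, σ z (1, 0) * τ z (0, 1) = σ z (0, 1) * τ z (1, 0) → τ z (0, 1) ≠ 0 →
      w z = σ z (0, 1) / τ z (0, 1) := by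
    intro z h1 h2
    simp only [hw]
    split_ifs with h3
    · rfl
    · rw [div_eq_div_iff h3 h2, h1]
  have hσw : ∀ z, σ z (1, 0) * τ z (0, 1) = σ z (0, 1) * τ z (1, 0) → τ z ≠ 0 →
      σ z = w z • τ z := by
    intro z h1 h2
    by_cases h3 : τ z (1, 0) = 0
    · have h4 := hform z h2 h3
      rw [hw1 z h1 h4]
      rw [h3, mul_zero] at h1
      refine form_ext ?_ ?_
      · rw [smul_apply, h3, smul_zero]
        exact (mul_eq_zero.1 h1).resolve_right h4
      · rw [smul_apply, smul_eq_mul, div_mul_cancel₀ _ h4]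
    · have h4 : w z = σ z (1, 0) / τ z (1, 0) := if_neg h3
      rw [h4]
      refine form_ext ?_ ?_
      · rw [smul_apply, smul_eq_mul, div_mul_cancel₀ _ h3]
      · rw [smul_apply, smul_eq_mul, div_mul_eq_mul_div, h1, mul_div_cancel_right₀ _ h3]
  -- Off the origin one coefficient of τ is nonzero and the quotient by it is holomorphic; it
  -- extends across the isolated zero.
  obtain ⟨u, hu, eu⟩ := exists_analyticAt_of_punctured (u := w) (by
    filter_upwards [hne, (eventually_eventually_nhds.2 h).filter_mono nhdsWithin_le_nhds,
      hσ.eventually_analyticAt.filter_mono nhdsWithin_le_nhds,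
      hτ.1.eventually_analyticAt.filter_mono nhdsWithin_le_nhds] with z h1 h2 h3 h4
    by_cases h5 : τ z (1, 0) = 0
    · have h6 := hform z h1 h5
      refine ((h3.form_apply (0, 1)).div (h4.form_apply (0, 1)) h6).congr ?_
      filter_upwards [h2, (h4.form_apply (0, 1)).continuousAt.eventually_ne h6] with y h7 h8
      exact (hw1 y h7 h8).symm
    · refine ((h3.form_apply (1, 0)).div (h4.form_apply (1, 0)) h5).congr ?_
      filter_upwards [(h4.form_apply (1, 0)).continuousAt.eventually_ne h5] with y h7
      exact (if_neg h7).symm)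
  refine ⟨u, hu, ?_⟩
  have hp : ∀ᶠ z in 𝓝[≠] 0, σ z = u z • τ z := by
    filter_upwards [eu, hne, h.filter_mono nhdsWithin_le_nhds] with z h1 h2 h3
    rw [h1]
    exact hσw z h3 h2
  have h0 : σ 0 = u 0 • τ 0 := by
    have t1 : Tendsto σ (𝓝[≠] 0) (𝓝 (σ 0)) := hσ.continuousAt.tendsto.mono_left nhdsWithin_le_nhds
    have t2 : Tendsto (fun z => u z • τ z) (𝓝[≠] 0) (𝓝 (u 0 • τ 0)) :=
      (hu.continuousAt.smul hτ.1.continuousAt).tendsto.mono_left nhdsWithin_le_nhds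
    exact tendsto_nhds_unique (t1.congr' hp) t2
  rw [eventually_nhdsWithin_iff] at hp
  filter_upwards [hp] with z hz
  by_cases hz0 : z = 0
  · rw [hz0]; exact h0
  · exact hz hz0

/-- Two saturations of the same 1-form differ by a unit. -/
theorem IsFoliationForm.exists_unit {σ τ : ℂ × ℂ → (ℂ × ℂ →L[ℂ] ℂ)} (hσ : IsFoliationForm σ 0)
    (hτ : IsFoliationForm τ 0) {g₁ g₂ : ℂ × ℂ → ℂ} (hg₁ : AnalyticAt ℂ g₁ 0)
    (hg₁0 : ¬ ∀ᶠ z in 𝓝 0, g₁ z = 0) (e : ∀ᶠ z in 𝓝 0, g₁ z • σ z = g₂ z • τ z) :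
    ∃ u : ℂ × ℂ → ℂ, AnalyticAt ℂ u 0 ∧ u 0 ≠ 0 ∧ ∀ᶠ z in 𝓝 0, σ z = u z • τ z := by
  have hprop : ∀ᶠ z in 𝓝 0, σ z (1, 0) * τ z (0, 1) = σ z (0, 1) * τ z (1, 0) := by
    refine eventually_eq_of_mul_left hg₁ ((hσ.1.form_apply _).mul (hτ.1.form_apply _))
      ((hσ.1.form_apply _).mul (hτ.1.form_apply _)) ?_ hg₁0
    filter_upwards [e] with z hz
    have h1 := congrArg (fun M : ℂ × ℂ →L[ℂ] ℂ => M (1, 0)) hz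
    have h2 := congrArg (fun M : ℂ × ℂ →L[ℂ] ℂ => M (0, 1)) hz
    simp only [smul_apply, smul_eq_mul] at h1 h2
    linear_combination τ z (0, 1) * h1 - τ z (1, 0) * h2
  obtain ⟨u, hu, eu⟩ := hτ.exists_eq_smul hσ.1 hprop
  obtain ⟨v, hv, ev⟩ := hσ.exists_eq_smul hτ.1 (hprop.mono fun z hz => by linear_combination -hz)
  refine ⟨u, hu, fun hu0 => ?_, eu⟩
  -- The two quotients are inverse to each other off the origin, and by continuity at it.
  have hp : ∀ᶠ z in 𝓝[≠] 0, u z * v z = 1 := by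
    filter_upwards [hσ.2, eu.filter_mono nhdsWithin_le_nhds,
      ev.filter_mono nhdsWithin_le_nhds] with z h1 h2 h3
    by_contra h4
    refine h1 (ContinuousLinearMap.ext fun x => ?_)
    have h5 := congrArg (fun M : ℂ × ℂ →L[ℂ] ℂ => M x) h2
    rw [h3] at h5
    simp only [smul_apply, smul_eq_mul] at h5
    have h6 : (u z * v z - 1) * σ z x = 0 := by linear_combination -h5
    exact (mul_eq_zero.1 h6).resolve_left (sub_ne_zero.2 h4)
  have t1 : Tendsto (fun z => u z * v z) (𝓝[≠] 0) (𝓝 (u 0 * v 0)) :=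
    (hu.continuousAt.mul hv.continuousAt).tendsto.mono_left nhdsWithin_le_nhds
  have := tendsto_nhds_unique t1 (tendsto_const_nhds.congr' (hp.mono fun z hz => hz.symm))
  rw [hu0, zero_mul] at this
  exact zero_ne_one this

theorem IsSaturation.not_eventually_zero {η τ : ℂ × ℂ → (ℂ × ℂ →L[ℂ] ℂ)} {g : ℂ × ℂ → ℂ}
    (hη : ¬ ∀ᶠ z in 𝓝 (0 : ℂ × ℂ), η z = 0) (e : ∀ᶠ z in 𝓝 0, η z = g z • τ z) :
    ¬ ∀ᶠ z in 𝓝 0, g z = 0 := fun h => hη <| by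
  filter_upwards [h, e] with z h1 h2
  rw [h2, h1]
  exact form_ext (by simp) (by simp)

end Saturations

/-! ### The bound on separatrices at reduced points -/

section SeparatrixBound

/-- The order at the origin of an invariant curve relative to the axis `x = 0` is at most that of
the foliation. -/
def SeparatrixBound (τ : ℂ × ℂ → (ℂ × ℂ →L[ℂ] ℂ)) : Prop :=
  ∀ f : ℂ × ℂ → ℂ, AnalyticAt ℂ f 0 → HasIsolatedCurveSing (fun z => z.1 * f z) →
    GermDvd (fun z => z.1 * f z) (wedgeCoeff τ fun z => z.1 * f z) 0 →
    analyticOrderAt (fun y => f (0, y)) 0 ≤ analyticOrderAt (fun y => τ (0, y) (1, 0)) 0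

/-- If f vanished on the axis, x² would divide the reduced germ x f. -/
theorem HasIsolatedCurveSing.not_eventually_axis {f : ℂ × ℂ → ℂ} (hf : AnalyticAt ℂ f 0)
    (H : HasIsolatedCurveSing fun z => z.1 * f z) : ¬ ∀ᶠ y in 𝓝 0, f (0, y) = 0 := by
  intro h
  obtain ⟨k, hk, e⟩ := exists_eq_fst_mul hf h
  refine H.isReducedGerm.2 (fun z => z.1) analyticAt_fst ⟨k, hk, ?_⟩ rfl
  filter_upwards [e] with z hz
  rw [hz]; ring

/-- Equations of the invariance of `x = 0` and of `f = 0`. -/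
theorem exists_cofactor_of_invariant_axis {τ : ℂ × ℂ → (ℂ × ℂ →L[ℂ] ℂ)} (hτ : AnalyticAt ℂ τ 0)
    {f : ℂ × ℂ → ℂ} (hf : AnalyticAt ℂ f 0) (hf0 : ¬ ∀ᶠ y in 𝓝 0, f (0, y) = 0)
    (hd : GermDvd (fun z => z.1 * f z) (wedgeCoeff τ fun z => z.1 * f z) 0) :
    ∃ B K : ℂ × ℂ → ℂ, AnalyticAt ℂ B 0 ∧ AnalyticAt ℂ K 0 ∧
      (∀ᶠ z in 𝓝 0, τ z (0, 1) = z.1 * B z) ∧ ∀ᶠ z in 𝓝 0, wedgeCoeff τ f z = K z * f z := by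
  obtain ⟨k, hk, e⟩ := hd
  have e1 : ∀ᶠ z in 𝓝 0, z.1 * f z * k z = z.1 * wedgeCoeff τ f z - f z * τ z (0, 1) := by
    filter_upwards [e, hf.eventually_analyticAt] with z h1 h2
    rw [← h1, wedgeCoeff_mul τ differentiableAt_fst h2.differentiableAt, wedgeCoeff_fst]
    ring
  have hB := hτ.form_apply (0, 1)
  obtain ⟨B, hB', eB⟩ := exists_eq_fst_mul hB (by
    refine eventually_eq_zero_of_mul hf.curry_right₂ hB.curry_right₂ ?_ hf0
    filter_upwards [eventually_slice_snd e1] with y hy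
    simp only [zero_mul, zero_sub] at hy
    exact neg_eq_zero.1 hy.symm)
  refine ⟨B, fun z => k z + B z, hB', hk.add hB', eB, ?_⟩
  refine eventually_eq_of_mul_left analyticAt_fst (hτ.wedgeCoeff hf) ((hk.add hB').mul hf) ?_
    not_eventually_fst_eq_zero
  filter_upwards [e1, eB] with z h1 h2
  rw [h2] at h1
  linear_combination -h1

/-- Since the axis is invariant, the form is A dx + x B dy. If A(0) = 0, the eigenvalues are B(0)
and - A_y(0), and reducedness excludes the resonances, so f has order at most 1 on the axis while A
has order at least 1. If A(0) ≠ 0, then A f_y = K f on the axis, which is impossible for an f of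
finite positive order there. -/
theorem IsReducedFoliation.separatrixBound {τ : ℂ × ℂ → (ℂ × ℂ →L[ℂ] ℂ)} (hτ : AnalyticAt ℂ τ 0)
    (h : IsReducedFoliation τ 0) : SeparatrixBound τ := by
  intro f hf H hd
  have hf0 := H.not_eventually_axis hf
  obtain ⟨B, K, hB, hK, eB, eK⟩ := exists_cofactor_of_invariant_axis hτ hf hf0 hd
  have hA := hτ.form_apply (1, 0)
  obtain ⟨m, hm⟩ := ENat.ne_top_iff_exists.1 (by
    rwa [Ne, analyticOrderAt_eq_top] : analyticOrderAt (fun y => f (0, y)) 0 ≠ ⊤)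
  rw [← hm]
  by_cases hA0 : τ 0 (1, 0) = 0
  · have h1 : ((1 : ℕ) : ℕ∞) ≤ analyticOrderAt (fun y => τ (0, y) (1, 0)) 0 := by
      rw [Nat.cast_one, Order.one_le_iff_ne_zero]
      exact hA.curry_right₂.analyticOrderAt_ne_zero.2 hA0
    refine le_trans ?_ h1
    have hB0 : τ 0 (0, 1) = 0 := by
      rw [eB.self_of_nhds]; simp
    have hτ0 : τ 0 = 0 := form_ext hA0 hB0
    rw [iff_trace_det hτ.differentiableAt] at h
    obtain ⟨a, b, htr, hdet, hb, hab⟩ := h.resolve_left (not_not_intro hτ0)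
    have hv : ∀ v w : ℂ × ℂ, fderiv ℂ (fun z => τ z v) 0 w = fderiv ℂ τ 0 w v := by
      intro v w
      have : HasFDerivAt (fun z => τ z v)
          ((ContinuousLinearMap.apply ℂ ℂ v).comp (fderiv ℂ τ 0)) 0 :=
        (ContinuousLinearMap.apply ℂ ℂ v).hasFDerivAt.comp 0 hτ.differentiableAt.hasFDerivAt
      rw [this.fderiv]; simp
    have hBd : ∀ w : ℂ × ℂ, fderiv ℂ τ 0 w (0, 1) = B 0 * w.1 := by
      intro w
      rw [← hv, EventuallyEq.fderiv_eq eB, fderiv_mul_apply differentiableAt_fst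
        hB.differentiableAt, fderiv_fst_apply']
      simp
    rw [hBd, hBd, ← hv (1, 0) (0, 1)] at hdet
    rw [hBd, ← hv (1, 0) (0, 1)] at htr
    simp only [mul_one, mul_zero, zero_sub] at hdet htr
    set l := fderiv ℂ (fun z => τ z (1, 0)) 0 (0, 1) with hl
    have hm2 := order_lt_two_of_nonresonant hA hB hK (H.of_eq_mul analyticAt_fst hf
      (Eventually.of_forall fun z => rfl)) hA0 (fun i j hi hj hij => ?_) (by
        filter_upwards [eK, eB] with z h1 h2
        rw [wedgeCoeff, h2] at h1
        exact h1) hm.symm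
    · exact_mod_cast Nat.lt_succ_iff.1 hm2
    · rw [← hl] at hij
      have hi' : (i : ℂ) ≠ 0 := Nat.cast_ne_zero.2 hi.ne'
      have hj' : (j : ℂ) ≠ 0 := Nat.cast_ne_zero.2 hj.ne'
      -- The pair a, b is B(0), - l in one of the two orders; a relation i l + j B(0) = 0 makes the
      -- ratio a / b equal to i / j or j / i.
      have hcase : (a - B 0) * (a + l) = 0 := by linear_combination -a * htr + hdet
      rcases mul_eq_zero.1 hcase with h2 | h2
      · have ha : a = B 0 := sub_eq_zero.1 h2
        have hbl : b = -l := by linear_combination -htr - h2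
        refine hab (i / j) (by positivity) ?_
        rw [div_eq_iff hb, hbl, ha]
        push_cast
        field_simp
        linear_combination hij
      · have ha : a = -l := eq_neg_of_add_eq_zero_left h2
        have hbl : b = B 0 := by linear_combination -htr - h2
        refine hab (j / i) (by positivity) ?_
        rw [div_eq_iff hb, hbl, ha]
        push_cast
        field_simp
        linear_combination -hij
  · -- transverse to the axis
    suffices m = 0 by simp [this]
    by_contra hm0
    obtain ⟨v, hv, hv0, ev⟩ := (hf.curry_right₂.analyticOrderAt_eq_natCast).1 hm.symm
    simp only [sub_zero, smul_eq_mul] at ev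
    obtain ⟨i, rfl⟩ := Nat.exists_eq_succ_of_ne_zero hm0
    have e2 := eventually_eq_of_mul_left (h := fun y : ℂ => y ^ i)
      (f := fun y => τ (0, y) (1, 0) * (((i + 1 : ℕ) : ℂ) * v y + y * deriv v y))
      (g := fun y => K (0, y) * (y * v y)) (analyticAt_id.pow i)
      (hA.curry_right₂.mul ((analyticAt_const.mul hv).add (analyticAt_id.mul hv.deriv)))
      (hK.curry_right₂.mul (analyticAt_id.mul hv)) (by
        filter_upwards [eventually_slice_snd eK, eventually_slice_snd eB, ev,
          eventually_eventually_nhds.2 ev, hv.eventually_analyticAt,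
          eventually_slice_snd hf.eventually_analyticAt] with y h1 h2 h3 h4 h5 h6
        have h7 := (hasDerivAt_slice_snd h6.differentiableAt).deriv
        have h8 : deriv (fun y => f (0, y)) y = _ := (EventuallyEq.deriv_eq h4).trans
          (((hasDerivAt_pow (i + 1) y).mul h5.differentiableAt.hasDerivAt).deriv)
        rw [wedgeCoeff, h2, ← h7, h8, h3] at h1
        simp only [Nat.add_sub_cancel, Nat.succ_eq_add_one] at h1
        linear_combination h1) (not_eventually_id_pow_eq_zero i)
    have h0 := e2.self_of_nhds
    simp only [zero_mul, add_zero, mul_zero, ← Prod.zero_eq_mk] at h0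
    exact mul_ne_zero hA0 (mul_ne_zero (Nat.cast_ne_zero.2 (Nat.succ_ne_zero i)) hv0) h0

end SeparatrixBound

/-! ### Orders of homogeneous forms at the points of the exceptional curve -/

section BlowUpCharts

/-- The charts `(x, t) ↦ (x, x (t₀ + t))` and `(x, t) ↦ (x t, x)`, centred at the points of the
exceptional curve. -/
def IsBlowUpChart (α β γ δ : ℂ) : Prop :=
  (α = 1 ∧ β = 0 ∧ δ = 1) ∨ (α = 0 ∧ β = 1 ∧ γ = 1 ∧ δ = 0)

theorem isBlowUpChart_shear (t₀ : ℂ) : IsBlowUpChart 1 0 t₀ 1 := Or.inl ⟨rfl, rfl, rfl⟩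

theorem isBlowUpChart_swap : IsBlowUpChart 0 1 1 0 := Or.inr ⟨rfl, rfl, rfl, rfl⟩

theorem IsBlowUpChart.det_ne_zero {α β γ δ : ℂ} (h : IsBlowUpChart α β γ δ) :
    α * δ - β * γ ≠ 0 := by
  rcases h with ⟨rfl, rfl, rfl⟩ | ⟨rfl, rfl, rfl, rfl⟩ <;> norm_num

theorem analyticOrderAt_homEval_shear {m : ℕ} {p : Polynomial ℂ} (hp : p ≠ 0)
    (hm : p.natDegree ≤ m) (t₀ : ℂ) :
    analyticOrderAt (fun t => homEval m p (1 + 0 * t) (t₀ + 1 * t)) 0 = p.rootMultiplicity t₀ := by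
  have e : (fun t => homEval m p (1 + 0 * t) (t₀ + 1 * t)) = fun t => p.eval (t₀ + t) := by
    funext t
    rw [zero_mul, add_zero, one_mul, homEval_one hm]
  obtain ⟨q, hq, hq0⟩ := Polynomial.exists_eq_pow_rootMultiplicity_mul_and_not_dvd p hp t₀
  have hA : ∀ r : Polynomial ℂ, AnalyticAt ℂ (fun t => r.eval (t₀ + t)) 0 := fun r => by
    have h1 : AnalyticAt ℂ (fun x => r.eval x) (t₀ + 0) :=
      (AnalyticOnNhd.eval_polynomial r) _ (mem_univ _)
    exact AnalyticAt.comp (f := fun t => t₀ + t) h1 (analyticAt_const.add analyticAt_id)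
  rw [e, (hA p).analyticOrderAt_eq_natCast]
  refine ⟨fun t => q.eval (t₀ + t), hA q, ?_, Eventually.of_forall fun t => ?_⟩
  · intro h
    simp only [add_zero] at h
    exact hq0 (Polynomial.dvd_iff_isRoot.2 h)
  · conv_lhs => rw [hq]
    simp

/-- The point at infinite slope carries the roots that the dehomogenized polynomial is missing. -/
theorem analyticOrderAt_homEval_swap {m : ℕ} {p : Polynomial ℂ} (hp : p ≠ 0)
    (hm : p.natDegree ≤ m) :
    analyticOrderAt (fun t => homEval m p (0 + 1 * t) (1 + 0 * t)) 0 =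
      ((m - p.natDegree : ℕ) : ℕ∞) := by
  have e : (fun t => homEval m p (0 + 1 * t) (1 + 0 * t)) =
      fun t => ∑ i ∈ Finset.range (m + 1), p.coeff i * t ^ (m - i) := by
    funext t
    simp [homEval]
  have hA : ∀ N, AnalyticAt ℂ (fun t => ∑ i ∈ Finset.range (N + 1), p.coeff i * t ^ (N - i)) 0 :=
    fun N => Finset.analyticAt_fun_sum _ fun i _ => analyticAt_const.mul (analyticAt_id.pow _)
  rw [e, (hA m).analyticOrderAt_eq_natCast]
  refine ⟨_, hA p.natDegree, ?_, Eventually.of_forall fun t => ?_⟩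
  · rw [Finset.sum_range_succ, Finset.sum_eq_zero, zero_add, Nat.sub_self, pow_zero, mul_one]
    · exact Polynomial.leadingCoeff_ne_zero.2 hp
    · intro i hi
      rw [zero_pow (by have := Finset.mem_range.1 hi; omega), mul_zero]
  · rw [sub_zero, smul_eq_mul, Finset.mul_sum]
    obtain ⟨k, rfl⟩ := Nat.exists_eq_add_of_le hm
    refine (Finset.sum_subset (Finset.range_mono (by omega)) fun i _ hi => ?_).symm.trans
      (Finset.sum_congr rfl fun i hi => ?_)
    · rw [Polynomial.coeff_eq_zero_of_natDegree_lt (by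
        have := Finset.mem_range.not.1 hi; omega), zero_mul]
    · have := Finset.mem_range.1 hi
      rw [show p.natDegree + k - i = k + (p.natDegree - i) by omega, Nat.add_sub_cancel_left,
        pow_add]
      ring

theorem IsBlowUpChart.not_eventually_homEval {α β γ δ : ℂ} (h : IsBlowUpChart α β γ δ) {m : ℕ}
    {p : Polynomial ℂ} (hp : p ≠ 0) (hm : p.natDegree ≤ m) :
    ¬ ∀ᶠ t in 𝓝 0, homEval m p (α + β * t) (γ + δ * t) = 0 := by
  rw [← analyticOrderAt_eq_top]
  rcases h with ⟨rfl, rfl, rfl⟩ | ⟨rfl, rfl, rfl, rfl⟩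
  · rw [analyticOrderAt_homEval_shear hp hm]; exact ENat.natCast_ne_top _
  · rw [analyticOrderAt_homEval_swap hp hm]; exact ENat.natCast_ne_top _

theorem homEval_add_mul {ν : ℕ} {p q : Polynomial ℂ} (hp : p.natDegree ≤ ν)
    (x y : ℂ) :
    homEval (ν + 1) (p + Polynomial.X * q) x y = x * homEval ν p x y + y * homEval ν q x y := by
  simp only [homEval, Polynomial.coeff_add, add_mul, Finset.sum_add_distrib]
  congr 1
  · rw [Finset.sum_range_succ, Polynomial.coeff_eq_zero_of_natDegree_lt (Nat.lt_succ_of_le hp),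
      zero_mul, zero_mul, add_zero, Finset.mul_sum]
    refine Finset.sum_congr rfl fun i hi => ?_
    rw [Nat.succ_sub (Nat.lt_succ_iff.1 (Finset.mem_range.1 hi)), pow_succ]
    ring
  · rw [Finset.sum_range_succ', Polynomial.coeff_X_mul_zero, zero_mul, zero_mul, add_zero,
      Finset.mul_sum]
    refine Finset.sum_congr rfl fun i hi => ?_
    rw [Polynomial.coeff_X_mul, Nat.add_sub_add_right, pow_succ]
    ring

/-- The strict transform of a germ which is not zero does not vanish identically on the exceptional
curve. -/
theorem IsBlowUpChart.not_eventually_strictTransform {α β γ δ : ℂ} (h : IsBlowUpChart α β γ δ)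
    {m : ℕ} {c : ℕ → ℂ × ℂ → ℂ} (hc : ∃ i ≤ m, c i 0 ≠ 0) :
    ¬ ∀ᶠ t in 𝓝 0, strictTransform α β γ δ m c (0, t) = 0 := by
  simp only [strictTransform_zero_left]
  exact h.not_eventually_homEval (leadPoly_ne_zero hc) (natDegree_leadPoly_le m c)

theorem not_eventually_zero_of_slice {f : ℂ × ℂ → ℂ} (h : ¬ ∀ᶠ t in 𝓝 0, f (0, t) = 0) :
    ¬ ∀ᶠ z in 𝓝 0, f z = 0 := fun h' => h (eventually_slice_snd h')

theorem not_eventually_comp_blowUpMap {u : ℂ × ℂ → ℂ} (hu : AnalyticAt ℂ u 0)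
    (hu0 : ¬ ∀ᶠ z in 𝓝 0, u z = 0) : ¬ ∀ᶠ z in 𝓝 0, u (blowUpMap z) = 0 := by
  obtain ⟨m, c, hc, hc0⟩ := exists_expansion hu hu0
  intro h
  refine not_eventually_zero_of_slice
    ((isBlowUpChart_shear 0).not_eventually_strictTransform hc0) ?_
  refine eventually_eq_zero_of_mul (f := fun z : ℂ × ℂ => z.1 ^ m) (analyticAt_fst.pow m)
    (hc.analyticAt_strictTransform 1 0 0 1) ?_
    (not_eventually_pow_eq_zero not_eventually_fst_eq_zero m)
  filter_upwards [h, hc.comp_chartBlowUp 1 0 0 1] with z h1 h2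
  rw [← h2, ← blowUpMap_eq, h1]

theorem IsGermBihol.not_eventually_comp {Φ : ℂ × ℂ → ℂ × ℂ} (hΦ : IsGermBihol Φ)
    {p : ℂ × ℂ → Prop} (h : ¬ ∀ᶠ z in 𝓝 0, p z) : ¬ ∀ᶠ z in 𝓝 0, p (Φ z) := by
  obtain ⟨Ψ, hΨ, h1, -⟩ := hΦ.exists_inverse
  intro h2
  refine h ?_
  filter_upwards [hΨ.tendsto.eventually h2, h1] with z h3 h4
  rwa [h4] at h3

end BlowUpCharts

/-! ### Strict transform of the foliation and the multiplicity inequality -/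

section StrictForm

/-- The strict transform of the foliation given by a 1-form with expansions `a`, `b` of order `ν`
of its coefficients, in a chart of the blow-up. -/
def strictForm (α β γ δ : ℂ) (ν : ℕ) (a b : ℕ → ℂ × ℂ → ℂ) : ℂ × ℂ → (ℂ × ℂ →L[ℂ] ℂ) :=
  mkForm (fun z => (α + β * z.2) * strictTransform α β γ δ ν a z +
      (γ + δ * z.2) * strictTransform α β γ δ ν b z)
    (fun z => z.1 * (β * strictTransform α β γ δ ν a z + δ * strictTransform α β γ δ ν b z))

variable {τ : ℂ × ℂ → (ℂ × ℂ →L[ℂ] ℂ)} {ν : ℕ} {a b : ℕ → ℂ × ℂ → ℂ}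

theorem analyticAt_strictForm (ha : HasExpansion (fun z => τ z (1, 0)) ν a)
    (hb : HasExpansion (fun z => τ z (0, 1)) ν b) (α β γ δ : ℂ) :
    AnalyticAt ℂ (strictForm α β γ δ ν a b) 0 := by
  have h1 := ha.analyticAt_strictTransform α β γ δ
  have h2 := hb.analyticAt_strictTransform α β γ δ
  exact AnalyticAt.mkForm
    (((analyticAt_const.add (analyticAt_const.mul analyticAt_snd)).mul h1).add
      ((analyticAt_const.add (analyticAt_const.mul analyticAt_snd)).mul h2))
    (analyticAt_fst.mul ((analyticAt_const.mul h1).add (analyticAt_const.mul h2)))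

theorem pullbackForm_eq_strictForm (ha : HasExpansion (fun z => τ z (1, 0)) ν a)
    (hb : HasExpansion (fun z => τ z (0, 1)) ν b) (α β γ δ : ℂ) :
    ∀ᶠ z in 𝓝 0, pullbackForm (chartBlowUp α β γ δ) τ z =
      z.1 ^ ν • strictForm α β γ δ ν a b z := by
  filter_upwards [ha.comp_chartBlowUp α β γ δ, hb.comp_chartBlowUp α β γ δ] with z h1 h2
  rw [pullbackForm_chartBlowUp]
  refine form_ext ?_ ?_ <;>
  · rw [smul_apply, strictForm, mkForm_apply, mkForm_apply, h1, h2, smul_eq_mul]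
    ring

/-- On the exceptional curve the strict form reduces to the tangent cone x A_ν + y B_ν, of degree ν
+ 1. Its order at a point is the right-hand side of the separatrix bound there. -/
theorem strictForm_zero_left (α β γ δ t : ℂ) :
    strictForm α β γ δ ν a b (0, t) (1, 0) =
      homEval (ν + 1) (leadPoly ν a + Polynomial.X * leadPoly ν b) (α + β * t) (γ + δ * t) := by
  rw [homEval_add_mul (natDegree_leadPoly_le ν a), strictForm,
    mkForm_apply, strictTransform_zero_left, strictTransform_zero_left]
  simp

theorem natDegree_tangentCone_le :
    (leadPoly ν a + Polynomial.X * leadPoly ν b).natDegree ≤ ν + 1 := by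
  refine (Polynomial.natDegree_add_le _ _).trans (max_le ?_ ?_)
  · exact (natDegree_leadPoly_le ν a).trans (Nat.le_succ ν)
  · refine Polynomial.natDegree_mul_le.trans ?_
    rw [Polynomial.natDegree_X, add_comm]
    exact Nat.add_le_add_right (natDegree_leadPoly_le ν b) 1

/-- Off x = 0 the chart is a local biholomorphism, so zeros come from zeros of τ. On x = 0 the
nonzero tangent cone has isolated zeros; this is why no factor beyond x ^ ν splits off. -/
theorem isFoliationForm_strictForm (hτ : IsFoliationForm τ 0)
    (ha : HasExpansion (fun z => τ z (1, 0)) ν a) (hb : HasExpansion (fun z => τ z (0, 1)) ν b)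
    (hP : leadPoly ν a + Polynomial.X * leadPoly ν b ≠ 0) {α β γ δ : ℂ}
    (hch : IsBlowUpChart α β γ δ) : IsFoliationForm (strictForm α β γ δ ν a b) 0 := by
  have hA := analyticAt_strictForm ha hb α β γ δ
  refine ⟨hA, ?_⟩
  have hslice : ∀ᶠ t in 𝓝[≠] (0 : ℂ), strictForm α β γ δ ν a b (0, t) (1, 0) ≠ 0 := by
    refine ((hA.form_apply (1, 0)).curry_right₂.eventually_eq_zero_or_eventually_ne_zero).resolve_left ?_
    simp only [strictForm_zero_left]
    exact hch.not_eventually_homEval hP natDegree_tangentCone_le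
  have hτ2 := hτ.2
  rw [eventually_nhdsWithin_iff] at hslice hτ2 ⊢
  filter_upwards [eventually_comp_snd hslice, pullbackForm_eq_strictForm ha hb α β γ δ,
    (tendsto_chartBlowUp α β γ δ).eventually hτ2] with z h1 h2 h3 hz h0
  by_cases hx : z.1 = 0
  · have hz2 : z.2 ≠ 0 := fun h => hz (Prod.ext hx h)
    refine h1 hz2 ?_
    rw [show ((0, z.2) : ℂ × ℂ) = z from Prod.ext hx.symm rfl, h0, zero_apply]
  · have hj : jacDet (chartBlowUp α β γ δ) z ≠ 0 := by
      rw [jacDet_chartBlowUp]; exact mul_ne_zero hx hch.det_ne_zero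
    refine h3 (fun h4 => ?_) ?_
    · have h5 : z.1 * (α + β * z.2) = 0 := congrArg Prod.fst h4
      have h6 : z.1 * (γ + δ * z.2) = 0 := congrArg Prod.snd h4
      have h7 := (mul_eq_zero.1 h5).resolve_left hx
      have h8 := (mul_eq_zero.1 h6).resolve_left hx
      refine hch.det_ne_zero ?_
      rcases hch with ⟨rfl, rfl, rfl⟩ | ⟨rfl, rfl, rfl, rfl⟩
      · simp at h7
      · simp at h8
    · rw [h0] at h2
      obtain ⟨L, hL⟩ := exists_equiv_of_jacDet_ne_zero hj
      have h4 : ∀ v, pullbackForm (chartBlowUp α β γ δ) τ z v = 0 := fun v => by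
        rw [h2, smul_apply, zero_apply, smul_zero]
      refine ContinuousLinearMap.ext fun x => ?_
      have := h4 (L.symm x)
      rw [pullbackForm, ← hL] at this
      simpa using this

/-- The product rule, multiplied by x so as to avoid the exponent m - 1. -/
theorem wedgeCoeff_fst_pow_mul {σ : ℂ × ℂ → (ℂ × ℂ →L[ℂ] ℂ)} {h : ℂ × ℂ → ℂ} {z : ℂ × ℂ} (m : ℕ)
    (hh : DifferentiableAt ℂ h z) :
    z.1 * wedgeCoeff σ (fun w => w.1 ^ m * h w) z =
      z.1 ^ m * (z.1 * wedgeCoeff σ h z - m * h z * σ z (0, 1)) := by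
  have h1 : DifferentiableAt ℂ (fun w : ℂ × ℂ => w.1 ^ m) z := differentiableAt_fst.pow m
  have h2 : wedgeCoeff σ (fun w => w.1 ^ m) z = -(m * z.1 ^ (m - 1) * σ z (0, 1)) := by
    have : fderiv ℂ (fun w : ℂ × ℂ => w.1 ^ m) z =
        (m * z.1 ^ (m - 1)) • fderiv ℂ (fun w : ℂ × ℂ => w.1) z := by
      rw [fderiv_fun_pow _ differentiableAt_fst]
      simp
    simp only [wedgeCoeff, this, smul_apply, smul_eq_mul, fderiv_fst_apply']
    ring
  rw [wedgeCoeff_mul _ h1 hh, h2]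
  rcases m with _ | m
  · simp
  · simp only [Nat.add_sub_cancel]
    ring

/-- The strict transform of an invariant curve, together with the exceptional curve, is reduced and
invariant. -/
theorem invariant_strictTransform (ha : HasExpansion (fun z => τ z (1, 0)) ν a)
    (hb : HasExpansion (fun z => τ z (0, 1)) ν b) {α β γ δ : ℂ} (hch : IsBlowUpChart α β γ δ)
    {h : ℂ × ℂ → ℂ} (hR : HasIsolatedCurveSing h) (hd : GermDvd h (wedgeCoeff τ h) 0) {m : ℕ}
    {c : ℕ → ℂ × ℂ → ℂ} (hc : HasExpansion h m c) (hc0 : ∃ i ≤ m, c i 0 ≠ 0) :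
    HasIsolatedCurveSing (fun z => z.1 * strictTransform α β γ δ m c z) ∧
    GermDvd (fun z => z.1 * strictTransform α β γ δ m c z)
      (wedgeCoeff (strictForm α β γ δ ν a b) fun z => z.1 * strictTransform α β γ δ m c z) 0 := by
  have hS := hc.analyticAt_strictTransform α β γ δ
  have hS0 := hch.not_eventually_strictTransform hc0
  set s := strictTransform α β γ δ m c with hs
  have hF := analyticAt_strictForm ha hb α β γ δ
  set σ := strictForm α β γ δ ν a b with hσ
  have hcs := hc.comp_chartBlowUp α β γ δ
  refine ⟨(hR.comp_bihol (isGermBihol_linMap hch.det_ne_zero)).strictTransform (m := m) hS hS0 ?_,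
    ?_⟩
  · simpa only [linMap_blowUpMap] using hcs
  obtain ⟨k, hk, ek⟩ := hd
  have hkσ := hk.comp_zero (analyticAt_chartBlowUp α β γ δ 0) (chartBlowUp_zero α β γ δ)
  -- Pulling back the invariance of h shows that s divides a power of x times σ ∧ ds; the power
  -- cancels since s is not divisible by x.
  obtain ⟨l, hl, el⟩ := exists_eq_mul_of_fst_pow_mul hS hS0 (hF.wedgeCoeff hS) (ν + m + 1)
    (K := fun z => z.1 * (z.1 * (α * δ - β * γ) * (z.1 ^ m * k (chartBlowUp α β γ δ z))) +
      z.1 ^ (ν + m) * m * σ z (0, 1))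
    ((analyticAt_fst.mul ((analyticAt_fst.mul analyticAt_const).mul
      ((analyticAt_fst.pow m).mul hkσ))).add
      (((analyticAt_fst.pow _).mul analyticAt_const).mul (hF.form_apply _))) (by
      filter_upwards [(tendsto_chartBlowUp α β γ δ).eventually ek,
        (tendsto_chartBlowUp α β γ δ).eventually hR.analyticAt.eventually_analyticAt, hcs,
        wedgeCoeff_congr (f := fun z => h (chartBlowUp α β γ δ z)) hcs
          (pullbackForm_eq_strictForm ha hb α β γ δ), hS.eventually_analyticAt]
        with z h1 h2 h3 h4 h5
      have h6 := wedgeCoeff_pullbackForm (τ := τ)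
        (analyticAt_chartBlowUp α β γ δ z).differentiableAt h2.differentiableAt
      rw [h4, h1, h3, jacDet_chartBlowUp, wedgeCoeff_smul] at h6
      have h7 := wedgeCoeff_fst_pow_mul (σ := σ) m h5.differentiableAt
      simp only [← hσ, ← hs] at h6 h7 ⊢
      linear_combination z.1 * h6 - z.1 ^ ν * h7)
  -- The axis contributes - s times the second coefficient of σ, which is divisible by x because the
  -- exceptional curve is invariant.
  refine ⟨fun z => l z - (β * strictTransform α β γ δ ν a z + δ * strictTransform α β γ δ ν b z),
    hl.sub ((analyticAt_const.mul (ha.analyticAt_strictTransform α β γ δ)).add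
      (analyticAt_const.mul (hb.analyticAt_strictTransform α β γ δ))), ?_⟩
  filter_upwards [el, hS.eventually_analyticAt] with z h1 h2
  rw [wedgeCoeff_mul _ differentiableAt_fst h2.differentiableAt, h1, wedgeCoeff_fst]
  simp only [hσ, strictForm, mkForm_apply]
  ring

/-- If the relative orders of the strict transform of an invariant curve are bounded at all points
of the exceptional curve, the order of the curve is bounded. -/
theorem order_le_of_separatrixBound (ha : HasExpansion (fun z => τ z (1, 0)) ν a)
    (hb : HasExpansion (fun z => τ z (0, 1)) ν b)
    (hP : leadPoly ν a + Polynomial.X * leadPoly ν b ≠ 0)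
    (hbd : ∀ α β γ δ, IsBlowUpChart α β γ δ → SeparatrixBound (strictForm α β γ δ ν a b))
    {h : ℂ × ℂ → ℂ} (hR : HasIsolatedCurveSing h) (hd : GermDvd h (wedgeCoeff τ h) 0) {m : ℕ}
    {c : ℕ → ℂ × ℂ → ℂ} (hc : HasExpansion h m c) (hc0 : ∃ i ≤ m, c i 0 ≠ 0) : m ≤ ν + 1 := by
  have hp := leadPoly_ne_zero hc0
  have hpd := natDegree_leadPoly_le m c
  have key : ∀ α β γ δ, IsBlowUpChart α β γ δ →
      analyticOrderAt (fun t => homEval m (leadPoly m c) (α + β * t) (γ + δ * t)) 0 ≤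
      analyticOrderAt (fun t => homEval (ν + 1) (leadPoly ν a + Polynomial.X * leadPoly ν b)
        (α + β * t) (γ + δ * t)) 0 := by
    intro α β γ δ hch
    obtain ⟨h1, h2⟩ := invariant_strictTransform ha hb hch hR hd hc hc0
    have := hbd α β γ δ hch _ (hc.analyticAt_strictTransform α β γ δ) h1 h2
    simpa only [strictTransform_zero_left, strictForm_zero_left] using this
  -- The bounds at finite slopes compare root multiplicities, which amounts to divisibility over the
  -- complex numbers. The bound at infinite slope compares the degree defects, and the two add up to
  -- m ≤ ν + 1.
  have h1 : leadPoly m c ∣ leadPoly ν a + Polynomial.X * leadPoly ν b := by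
    rw [(IsAlgClosed.splits (leadPoly m c)).dvd_iff_roots_le_roots hp hP,
      Multiset.le_iff_count]
    intro t₀
    rw [Polynomial.count_roots, Polynomial.count_roots]
    have := key 1 0 t₀ 1 (isBlowUpChart_shear t₀)
    rw [analyticOrderAt_homEval_shear hp hpd, analyticOrderAt_homEval_shear hP
      natDegree_tangentCone_le] at this
    exact_mod_cast this
  have h2 := key 0 1 1 0 isBlowUpChart_swap
  rw [analyticOrderAt_homEval_swap hp hpd, analyticOrderAt_homEval_swap hP
      natDegree_tangentCone_le] at h2
  have h3 := Polynomial.natDegree_le_of_dvd h1 hP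
  have h4 : m - (leadPoly m c).natDegree ≤
      ν + 1 - (leadPoly ν a + Polynomial.X * leadPoly ν b).natDegree := by exact_mod_cast h2
  have h5 : (leadPoly ν a + Polynomial.X * leadPoly ν b).natDegree ≤ ν + 1 :=
    natDegree_tangentCone_le
  omega

end StrictForm

/-! ### Descent of the bounds and ascent of the pulled-back data -/

section Induction

variable {ω : ℂ × ℂ → (ℂ × ℂ →L[ℂ] ℂ)} {𝒢 𝒢' : Set (ℂ × ℂ → ℂ × ℂ)}

/-- A nonzero germ pulls back to a nonzero germ under a composition of blow-ups. -/
theorem GermTower.not_eventually_comp (h : GermTower 𝒢) : ∀ F ∈ 𝒢, ∀ u : ℂ × ℂ → ℂ,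
    AnalyticAt ℂ u 0 → (¬ ∀ᶠ z in 𝓝 0, u z = 0) → ¬ ∀ᶠ z in 𝓝 0, u (F z) = 0 := by
  induction h with
  | base h => exact fun F hF u _ hu0 => (h F hF).not_eventually_comp hu0
  | step h hdown _ ih =>
    intro F hF u hu hu0
    obtain hF | ⟨F', hF', -, Φ, hΦ, e⟩ := hdown F hF
    · exact ih F hF u hu hu0
    obtain ⟨hA, h0⟩ := h.analyticAt_and_map_zero F' hF'
    have h1 := hΦ.not_eventually_comp (not_eventually_comp_blowUpMap (hu.comp_zero hA h0)
      (ih F' hF' u hu hu0))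
    intro h2
    refine h1 ?_
    filter_upwards [h2, e] with z h3 h4
    rwa [h4] at h3

theorem GermTower.not_eventually_zero (h : GermTower 𝒢) {F : ℂ × ℂ → ℂ × ℂ} (hF : F ∈ 𝒢) :
    ¬ ∀ᶠ z in 𝓝 0, F z = 0 := fun h0 =>
  h.not_eventually_comp F hF (fun z => z.1) analyticAt_fst not_eventually_fst_eq_zero
    (h0.mono fun z hz => by rw [hz]; rfl)

theorem GermTower.not_eventually_jacDet (h : GermTower 𝒢) : ∀ F ∈ 𝒢,
    ¬ ∀ᶠ z in 𝓝 0, jacDet F z = 0 := by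
  induction h with
  | base h => exact fun F hF h0 => (h F hF).jacDet_ne_zero h0.self_of_nhds
  | step h hdown _ ih =>
    intro F hF
    obtain hF | ⟨F', hF', -, Φ, hΦ, e⟩ := hdown F hF
    · exact ih F hF
    obtain ⟨hA, h0⟩ := h.analyticAt_and_map_zero F' hF'
    have h1 := not_eventually_comp_blowUpMap hA.jacDet (ih F' hF')
    have h2 : ¬ ∀ᶠ z in 𝓝 0, jacDet (fun w => F' (blowUpMap w)) z = 0 := by
      intro h3
      refine not_eventually_mul_eq_zero (hA.jacDet.comp_zero (analyticAt_blowUpMap 0)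
        blowUpMap_zero) analyticAt_fst h1 not_eventually_fst_eq_zero ?_
      filter_upwards [h3, tendsto_blowUpMap.eventually hA.eventually_analyticAt] with z h4 h5
      rw [jacDet_comp (analyticAt_blowUpMap z).differentiableAt h5.differentiableAt, blowUpMap_eq,
        jacDet_chartBlowUp] at h4
      rw [blowUpMap_eq]
      simpa using h4
    have h3 := hΦ.not_eventually_comp h2
    intro h4
    refine h3 ?_
    have hbA : AnalyticAt ℂ (fun w => F' (blowUpMap w)) 0 :=
      hA.comp_zero (analyticAt_blowUpMap 0) blowUpMap_zero
    filter_upwards [h4, e.eventuallyEq_nhds, hΦ.analyticAt.eventually_analyticAt,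
      hΦ.tendsto.eventually hbA.eventually_analyticAt,
      hΦ.analyticAt.jacDet.continuousAt.eventually_ne hΦ.jacDet_ne_zero] with z h5 h6 h7 h8 h9
    rw [jacDet_congr h6, jacDet_comp (P := fun w => F' (blowUpMap w)) h7.differentiableAt
      h8.differentiableAt] at h5
    exact (mul_eq_zero.1 h5).resolve_right h9

/-- Where the Jacobian of F is nonzero and F ≠ 0, the pull-back is nonzero because ω is; such points
are dense. -/
theorem GermTower.pullbackForm_not_eventually_zero (hω : IsFoliationForm ω 0) (h : GermTower 𝒢)
    {F : ℂ × ℂ → ℂ × ℂ} (hF : F ∈ 𝒢) : ¬ ∀ᶠ z in 𝓝 0, pullbackForm F ω z = 0 := by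
  intro h0
  obtain ⟨hA, hF0⟩ := h.analyticAt_and_map_zero F hF
  refine not_eventually_mul_eq_zero hA.jacDet hA.fst_comp (h.not_eventually_jacDet F hF)
    (h.not_eventually_comp F hF (fun z => z.1) analyticAt_fst not_eventually_fst_eq_zero) ?_
  have ht : Tendsto F (𝓝 0) (𝓝 0) := by
    have := hA.continuousAt.tendsto
    rwa [hF0] at this
  have h2 := hω.2
  rw [eventually_nhdsWithin_iff] at h2
  filter_upwards [h0, ht.eventually h2] with z h3 h4
  by_contra hne
  obtain ⟨hj, h1⟩ := mul_ne_zero_iff.1 hne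
  refine h4 (fun h5 => h1 (congrArg Prod.fst h5)) ?_
  obtain ⟨L, hL⟩ := exists_equiv_of_jacDet_ne_zero hj
  refine ContinuousLinearMap.ext fun x => ?_
  have := congrArg (fun M : ℂ × ℂ →L[ℂ] ℂ => M (L.symm x)) h3
  simp only [pullbackForm, ← hL] at this
  simpa using this

theorem tendsto_of_map_zero {Φ : ℂ × ℂ → ℂ × ℂ} (hΦ : AnalyticAt ℂ Φ 0) (h0 : Φ 0 = 0) :
    Tendsto Φ (𝓝 0) (𝓝 0) := by
  have := hΦ.continuousAt.tendsto
  rwa [h0] at this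

theorem eventually_pullbackForm_comp {τ : ℂ × ℂ → (ℂ × ℂ →L[ℂ] ℂ)} {g : ℂ × ℂ → ℂ}
    {F Φ : ℂ × ℂ → ℂ × ℂ} (hF : AnalyticAt ℂ F 0) (hΦ : AnalyticAt ℂ Φ 0) (h0 : Φ 0 = 0)
    (e : ∀ᶠ z in 𝓝 0, pullbackForm F ω z = g z • τ z) :
    ∀ᶠ z in 𝓝 0, pullbackForm (fun w => F (Φ w)) ω z = g (Φ z) • pullbackForm Φ τ z := by
  have ht := tendsto_of_map_zero hΦ h0
  filter_upwards [ht.eventually e, ht.eventually hF.eventually_analyticAt,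
    hΦ.eventually_analyticAt] with z h1 h2 h3
  rw [pullbackForm_comp h3.differentiableAt h2.differentiableAt]
  refine form_ext ?_ ?_ <;>
  · simp only [pullbackForm_apply, h1, smul_apply, smul_eq_mul]
    ring

theorem IsFoliationForm.pullbackForm {τ : ℂ × ℂ → (ℂ × ℂ →L[ℂ] ℂ)} (hτ : IsFoliationForm τ 0)
    {Φ : ℂ × ℂ → ℂ × ℂ} (hΦ : IsGermBihol Φ) : IsFoliationForm (pullbackForm Φ τ) 0 := by
  refine ⟨hΦ.analyticAt.pullbackForm (by rw [hΦ.map_zero]; exact hτ.1), ?_⟩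
  obtain ⟨Ψ, hΨ, -, hinv⟩ := hΦ.exists_inverse
  have h1 := hτ.2
  rw [eventually_nhdsWithin_iff] at h1 ⊢
  filter_upwards [hΦ.tendsto.eventually h1, hinv,
    hΦ.analyticAt.jacDet.continuousAt.eventually_ne hΦ.jacDet_ne_zero] with z h2 h3 hj hz h4
  refine h2 (fun h5 => hz ?_) ?_
  · rw [mem_singleton_iff, ← h3, h5, hΨ.map_zero]
  · obtain ⟨L, hL⟩ := exists_equiv_of_jacDet_ne_zero hj
    refine ContinuousLinearMap.ext fun x => ?_
    have := congrArg (fun M : ℂ × ℂ →L[ℂ] ℂ => M (L.symm x)) h4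
    simp only [_root_.pullbackForm, ← hL] at this
    simpa using this

/-- All saturated pull-backs of the foliation by maps of the class satisfy the separatrix bound. -/
def HasSeparatrixBounds (ω : ℂ × ℂ → (ℂ × ℂ →L[ℂ] ℂ)) (𝒢 : Set (ℂ × ℂ → ℂ × ℂ)) : Prop :=
  ∀ F ∈ 𝒢, ∀ τ, IsSaturation (pullbackForm F ω) τ 0 → SeparatrixBound τ

theorem eventually_pullbackForm_chartBlowUp {τ : ℂ × ℂ → (ℂ × ℂ →L[ℂ] ℂ)} {g : ℂ × ℂ → ℂ}
    {F : ℂ × ℂ → ℂ × ℂ} (hF : AnalyticAt ℂ F 0)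
    (e : ∀ᶠ z in 𝓝 0, pullbackForm F ω z = g z • τ z) {ν : ℕ} {a b : ℕ → ℂ × ℂ → ℂ}
    (ha : HasExpansion (fun z => τ z (1, 0)) ν a) (hb : HasExpansion (fun z => τ z (0, 1)) ν b)
    (α β γ δ : ℂ) :
    ∀ᶠ z in 𝓝 0, pullbackForm (fun w => F (chartBlowUp α β γ δ w)) ω z =
      (g (chartBlowUp α β γ δ z) * z.1 ^ ν) • strictForm α β γ δ ν a b z := by
  filter_upwards [eventually_pullbackForm_comp hF (analyticAt_chartBlowUp α β γ δ 0)
    (chartBlowUp_zero α β γ δ) e, pullbackForm_eq_strictForm ha hb α β γ δ] with z h1 h2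
  rw [h1, h2]
  refine form_ext ?_ ?_ <;>
  · simp only [smul_apply, smul_eq_mul]
    ring

/-- Each strict form is a saturation of the pull-back by a map of the upper class, one linear κ for
each point of the exceptional curve. -/
theorem HasSeparatrixBounds.of_blowUp (hQ : HasSeparatrixBounds ω 𝒢')
    {τ : ℂ × ℂ → (ℂ × ℂ →L[ℂ] ℂ)} (hτ : IsFoliationForm τ 0) {g : ℂ × ℂ → ℂ}
    (hg : AnalyticAt ℂ g 0) {F : ℂ × ℂ → ℂ × ℂ} (hF : AnalyticAt ℂ F 0)
    (hF' : ∀ κ Φ, IsGermBihol κ → IsGermBihol Φ → (fun z => F (κ (blowUpMap (Φ z)))) ∈ 𝒢')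
    (e : ∀ᶠ z in 𝓝 0, pullbackForm F ω z = g z • τ z) {ν : ℕ} {a b : ℕ → ℂ × ℂ → ℂ}
    (ha : HasExpansion (fun z => τ z (1, 0)) ν a) (hb : HasExpansion (fun z => τ z (0, 1)) ν b)
    (hP : leadPoly ν a + Polynomial.X * leadPoly ν b ≠ 0) (α β γ δ : ℂ)
    (hch : IsBlowUpChart α β γ δ) : SeparatrixBound (strictForm α β γ δ ν a b) := by
  refine hQ _ (hF' _ _ (isGermBihol_linMap hch.det_ne_zero) IsGermBihol.id) _
    ⟨isFoliationForm_strictForm hτ ha hb hP hch, fun z => g (chartBlowUp α β γ δ z) * z.1 ^ ν,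
      (hg.comp_zero (analyticAt_chartBlowUp α β γ δ 0) (chartBlowUp_zero α β γ δ)).mul
        (analyticAt_fst.pow ν), ?_⟩
  simp only [linMap_blowUpMap]
  exact eventually_pullbackForm_chartBlowUp hF e ha hb α β γ δ

theorem exists_expansion_form {τ : ℂ × ℂ → (ℂ × ℂ →L[ℂ] ℂ)} (hτ : IsFoliationForm τ 0) :
    ∃ ν a b, HasExpansion (fun z => τ z (1, 0)) ν a ∧ HasExpansion (fun z => τ z (0, 1)) ν b ∧
      ∃ i ≤ ν, a i 0 ≠ 0 ∨ b i 0 ≠ 0 := by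
  refine exists_expansion_pair (hτ.1.form_apply _) (hτ.1.form_apply _) fun H => ?_
  obtain ⟨z, hz, h1, h2⟩ := (hτ.2.and ((H.1.and H.2).filter_mono nhdsWithin_le_nhds)).exists
  exact hz (form_ext h1 h2)

/-- Descent of the separatrix bounds along a blow-up. -/
theorem HasSeparatrixBounds.descend (hω : AnalyticAt ℂ ω 0) (hnd : IsNonDicritical ω)
    (h : GermTower 𝒢) (hup : ∀ F' ∈ 𝒢, F' ∈ 𝒢' ∨
        ∀ κ Φ, IsGermBihol κ → IsGermBihol Φ → (fun z => F' (κ (blowUpMap (Φ z)))) ∈ 𝒢')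
    (hQ : HasSeparatrixBounds ω 𝒢') : HasSeparatrixBounds ω 𝒢 := by
  intro F hF τ hsat
  obtain hF' | hF' := hup F hF
  · exact hQ F hF' τ hsat
  obtain ⟨hτ, g, hg, e⟩ := hsat
  obtain ⟨hFA, hF0⟩ := h.analyticAt_and_map_zero F hF
  obtain ⟨ν, a, b, ha, hb, hab⟩ := exists_expansion_form hτ
  have hP := h.tangentCone_ne_zero hω hnd hF (h.not_eventually_zero hF) hτ.1 hg e ha hb hab
  have hbd := hQ.of_blowUp hτ hg hFA hF' e ha hb hP
  intro f hf hR hd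
  have hf0 := hR.not_eventually_axis hf
  obtain ⟨m, c, hc, i, hi, hci⟩ := exists_expansion hf (not_eventually_zero_of_slice hf0)
  -- expansion of the total curve
  set c' : ℕ → ℂ × ℂ → ℂ := fun i => if i ≤ m then c i else 0 with hc'
  have hc'E : HasExpansion (fun z => z.1 * f z) (m + 1) c' := by
    refine ⟨fun i => ?_, ?_⟩
    · simp only [hc']
      split_ifs
      · exact hc.1 i
      · exact analyticAt_const
    · filter_upwards [hc.2] with z hz
      rw [Finset.sum_range_succ, hz, Finset.mul_sum]
      have h1 : c' (m + 1) z = 0 := by simp [hc']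
      rw [h1, mul_zero, add_zero]
      refine Finset.sum_congr rfl fun i hi => ?_
      have hi' := Nat.lt_succ_iff.1 (Finset.mem_range.1 hi)
      simp only [hc', if_pos hi']
      rw [Nat.succ_sub hi', pow_succ]
      ring
  have hc'0 : ∃ i ≤ m + 1, c' i 0 ≠ 0 := ⟨i, by omega, by simpa only [hc', if_pos hi] using hci⟩
  have hmν := order_le_of_separatrixBound ha hb hP hbd hR hd hc'E hc'0
  -- The reduced curve is x f, of multiplicity m + 1; the axis takes up the extra unit in ν + 1.
  have hmν' : m ≤ ν := by omega
  obtain ⟨hR1, hd1⟩ := invariant_strictTransform ha hb isBlowUpChart_swap hR hd hc'E hc'0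
  set s' := strictTransform 0 1 1 0 (m + 1) c' with hs'
  set s := strictTransform 0 1 1 0 m c with hs
  have hsA : AnalyticAt ℂ s 0 := hc.analyticAt_strictTransform 0 1 1 0
  have hs'A : AnalyticAt ℂ s' 0 := hc'E.analyticAt_strictTransform 0 1 1 0
  -- In the chart (x, t) ↦ (x t, x) the old axis has strict transform t = 0.
  have hss : ∀ᶠ z in 𝓝 0, s' z = z.2 * s z := by
    refine eventually_eq_of_mul_left (h := fun z : ℂ × ℂ => z.1 ^ (m + 1))
      (analyticAt_fst.pow _) hs'A (analyticAt_snd.mul hsA) ?_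
      (not_eventually_pow_eq_zero not_eventually_fst_eq_zero _)
    filter_upwards [hc.comp_chartBlowUp 0 1 1 0, hc'E.comp_chartBlowUp 0 1 1 0] with z h1 h2
    rw [← h2, h1]
    simp only [chartBlowUp]
    ring
  have hsw := isGermBihol_swap
  set σ := strictForm 0 1 1 0 ν a b with hσ
  have hswA : AnalyticAt ℂ (Prod.swap : ℂ × ℂ → ℂ × ℂ) 0 := hsw.analyticAt
  have hσF : IsFoliationForm σ 0 := isFoliationForm_strictForm hτ ha hb hP isBlowUpChart_swap
  -- The bound is applied upstairs along the strict transform of the old axis, not along the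
  -- exceptional curve. The swap puts it in the position x = 0, and the remaining invariant curve is
  -- the exceptional curve together with s.
  have hsat' : IsSaturation (pullbackForm (fun z => F (Prod.swap (blowUpMap z.swap))) ω)
      (pullbackForm Prod.swap σ) 0 := by
    refine ⟨hσF.pullbackForm hsw, fun z => g (chartBlowUp 0 1 1 0 z.swap) * z.swap.1 ^ ν,
      ((hg.comp_zero (analyticAt_chartBlowUp 0 1 1 0 0) (chartBlowUp_zero 0 1 1 0)).comp_zero
        hswA rfl).mul ((analyticAt_fst.pow ν).comp_zero (f := fun z : ℂ × ℂ => z.1 ^ ν) hswA rfl),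
        ?_⟩
    have e1 : (fun z : ℂ × ℂ => F (Prod.swap (blowUpMap z.swap))) =
        fun z => F (chartBlowUp 0 1 1 0 z.swap) := by
      funext z; simp [blowUpMap, chartBlowUp]
    rw [e1]
    exact eventually_pullbackForm_comp (F := fun z => F (chartBlowUp 0 1 1 0 z))
      (g := fun z => g (chartBlowUp 0 1 1 0 z) * z.1 ^ ν) (hFA.comp_zero
      (analyticAt_chartBlowUp 0 1 1 0 0) (chartBlowUp_zero 0 1 1 0)) hswA rfl
      (eventually_pullbackForm_chartBlowUp hFA e ha hb 0 1 1 0)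
  have hcongr : (fun z : ℂ × ℂ => z.swap.1 * s' z.swap) =ᶠ[𝓝 0]
      fun z => z.1 * (z.2 * s z.swap) := by
    filter_upwards [hsw.tendsto.eventually hss] with z hz
    rw [hz]
    simp only [Prod.fst_swap, Prod.snd_swap]
    ring
  have hs2 : AnalyticAt ℂ (fun z : ℂ × ℂ => z.2 * s z.swap) 0 :=
    analyticAt_snd.mul (hsA.comp_zero hswA rfl)
  have hB := hQ _ (hF' _ _ hsw hsw) _ hsat' (fun z => z.2 * s z.swap) hs2
    ((hR1.comp_bihol hsw).of_eq_mul (w := fun _ => 1) analyticAt_const (analyticAt_fst.mul hs2)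
      (by filter_upwards [hcongr] with z hz; rw [one_mul]; exact hz))
    ((hd1.wedgeCoeff_pullbackForm hR1.analyticAt hswA rfl).congr hcongr
      (wedgeCoeff_congr hcongr (EventuallyEq.refl _ _)))
  -- comparison of orders
  have hsA0 : AnalyticAt ℂ (fun y => s (y, 0)) 0 := hsA.curry_left₂
  have hAs := ha.analyticAt_strictTransform 0 1 1 0
  set As := strictTransform 0 1 1 0 ν a with hAs_def
  have hAs0 : AnalyticAt ℂ (fun y => As (y, 0)) 0 := hAs.curry_left₂
  have e1 : (fun y => (fun z : ℂ × ℂ => z.2 * s z.swap) (0, y)) = id * fun y => s (y, 0) := rfl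
  have e2 : (fun y => pullbackForm Prod.swap σ (0, y) (1, 0)) = id * fun y => As (y, 0) := by
    funext y
    have hd : fderiv ℂ (Prod.swap : ℂ × ℂ → ℂ × ℂ) (0, y) (1, 0) = (0, 1) := by
      have : (Prod.swap : ℂ × ℂ → ℂ × ℂ) = linMap 0 1 1 0 := by
        funext z; simp [linMap, Prod.swap]
      rw [this, (hasFDerivAt_linMap 0 1 1 0 _).fderiv]
      simp
    rw [pullbackForm_apply, hd]
    simp [hσ, strictForm, hAs_def]
  rw [e1, e2, analyticOrderAt_mul analyticAt_id hsA0, analyticOrderAt_mul analyticAt_id hAs0] at hB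
  have hid : analyticOrderAt (id : ℂ → ℂ) 0 = (1 : ℕ) :=
    analyticAt_id.analyticOrderAt_eq_natCast.2 ⟨fun _ => 1, analyticAt_const, one_ne_zero, by simp⟩
  have hpow : ∀ n : ℕ, analyticOrderAt (id ^ n : ℂ → ℂ) 0 = n := fun n =>
    ((analyticAt_id (𝕜 := ℂ)).pow n).analyticOrderAt_eq_natCast.2
      ⟨fun _ => 1, analyticAt_const, one_ne_zero, by simp⟩
  -- The exceptional curve adds 1 to both sides, which cancels.
  have hB' : analyticOrderAt (fun y => s (y, 0)) 0 ≤ analyticOrderAt (fun y => As (y, 0)) 0 := by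
    rw [hid] at hB
    exact (ENat.add_le_add_iff_left (ENat.natCast_ne_top 1)).1 hB
  have e3 : analyticOrderAt (fun y => f (0, y)) 0 = m + analyticOrderAt (fun y => s (y, 0)) 0 := by
    rw [← hpow m, ← analyticOrderAt_mul (analyticAt_id.pow m) hsA0]
    refine analyticOrderAt_congr ?_
    filter_upwards [eventually_slice_fst (hc.comp_chartBlowUp 0 1 1 0)] with y hy
    simpa [chartBlowUp] using hy
  have e4 : analyticOrderAt (fun y => τ (0, y) (1, 0)) 0 =
      ν + analyticOrderAt (fun y => As (y, 0)) 0 := by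
    rw [← hpow ν, ← analyticOrderAt_mul (analyticAt_id.pow ν) hAs0]
    refine analyticOrderAt_congr ?_
    filter_upwards [eventually_slice_fst (ha.comp_chartBlowUp 0 1 1 0)] with y hy
    simpa [chartBlowUp] using hy
  rw [e3, e4]
  exact add_le_add (by exact_mod_cast hmν') hB'

/-- The pull-back by `F` of `ω / f` is, up to a holomorphic factor, the quotient of a form by a
reduced equation of an invariant curve. -/
def HasReducedPullback (ω : ℂ × ℂ → (ℂ × ℂ →L[ℂ] ℂ)) (f : ℂ × ℂ → ℂ) (F : ℂ × ℂ → ℂ × ℂ) :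
    Prop :=
  ∃ (τ : ℂ × ℂ → (ℂ × ℂ →L[ℂ] ℂ)) (g h k : ℂ × ℂ → ℂ), IsFoliationForm τ 0 ∧
    AnalyticAt ℂ g 0 ∧ AnalyticAt ℂ k 0 ∧ HasIsolatedCurveSing h ∧
    GermDvd h (wedgeCoeff τ h) 0 ∧ (∀ᶠ z in 𝓝 0, pullbackForm F ω z = g z • τ z) ∧
    ∀ᶠ z in 𝓝 0, g z * h z = k z * f (F z)

theorem HasReducedPullback.congr {f : ℂ × ℂ → ℂ} {F F' : ℂ × ℂ → ℂ × ℂ}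
    (H : HasReducedPullback ω f F) (h : F =ᶠ[𝓝 0] F') : HasReducedPullback ω f F' := by
  obtain ⟨τ, g, h', k, hτ, hg, hk, hR, hd, e, e'⟩ := H
  refine ⟨τ, g, h', k, hτ, hg, hk, hR, hd, ?_, ?_⟩
  · filter_upwards [e, pullbackForm_congr (τ := ω) (σ := ω) h (h.mono fun z hz => by rw [hz])]
      with z h1 h2
    rw [← h2, h1]
  · filter_upwards [e', h] with z h1 h2
    rw [← h2, h1]

theorem HasReducedPullback.comp_bihol {f : ℂ × ℂ → ℂ} {F : ℂ × ℂ → ℂ × ℂ}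
    (hF : AnalyticAt ℂ F 0) (H : HasReducedPullback ω f F) {Φ : ℂ × ℂ → ℂ × ℂ}
    (hΦ : IsGermBihol Φ) : HasReducedPullback ω f fun z => F (Φ z) := by
  obtain ⟨τ, g, h, k, hτ, hg, hk, hR, hd, e, e'⟩ := H
  exact ⟨pullbackForm Φ τ, fun z => g (Φ z), fun z => h (Φ z), fun z => k (Φ z),
    hτ.pullbackForm hΦ, hg.comp_zero hΦ.analyticAt hΦ.map_zero,
    hk.comp_zero hΦ.analyticAt hΦ.map_zero, hR.comp_bihol hΦ,
    hd.wedgeCoeff_pullbackForm hR.analyticAt hΦ.analyticAt hΦ.map_zero,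
    eventually_pullbackForm_comp hF hΦ.analyticAt hΦ.map_zero e, hΦ.tendsto.eventually e'⟩

/-- The new data are g x ^ ν, x s and k x ^ (ν + 1 - m), with s the strict transform of h; the last
exponent makes sense by the multiplicity inequality. Slope 0 suffices, other slopes being reached by
coordinate changes at the centre. -/
theorem HasReducedPullback.blowUp (hω : AnalyticAt ℂ ω 0) (hnd : IsNonDicritical ω)
    (h : GermTower 𝒢) (hQ : HasSeparatrixBounds ω 𝒢') {f : ℂ × ℂ → ℂ} {F : ℂ × ℂ → ℂ × ℂ}
    (hF : F ∈ 𝒢)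
    (hF' : ∀ κ Φ, IsGermBihol κ → IsGermBihol Φ → (fun z => F (κ (blowUpMap (Φ z)))) ∈ 𝒢')
    (H : HasReducedPullback ω f F) : HasReducedPullback ω f fun z => F (blowUpMap z) := by
  obtain ⟨τ, g, h', k, hτ, hg, hk, hR, hd, e, e'⟩ := H
  obtain ⟨hFA, hF0⟩ := h.analyticAt_and_map_zero F hF
  obtain ⟨ν, a, b, ha, hb, hab⟩ := exists_expansion_form hτ
  have hP := h.tangentCone_ne_zero hω hnd hF (h.not_eventually_zero hF) hτ.1 hg e ha hb hab
  have hbd := hQ.of_blowUp hτ hg hFA hF' e ha hb hP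
  obtain ⟨m, c, hc, hc0⟩ := exists_expansion hR.analyticAt hR.isReducedGerm.not_eventually_zero
  have hmν := order_le_of_separatrixBound ha hb hP hbd hR hd hc hc0
  have hch := isBlowUpChart_shear 0
  obtain ⟨hR', hd'⟩ := invariant_strictTransform ha hb hch hR hd hc hc0
  have hbA := analyticAt_chartBlowUp 1 0 0 1 0
  have hb0 := chartBlowUp_zero 1 0 0 1
  rw [blowUpMap_eq]
  refine ⟨_, fun z => g (chartBlowUp 1 0 0 1 z) * z.1 ^ ν, _,
    fun z => k (chartBlowUp 1 0 0 1 z) * z.1 ^ (ν + 1 - m),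
    isFoliationForm_strictForm hτ ha hb hP hch, (hg.comp_zero hbA hb0).mul (analyticAt_fst.pow ν),
    (hk.comp_zero hbA hb0).mul (analyticAt_fst.pow _), hR', hd',
    eventually_pullbackForm_chartBlowUp hFA e ha hb 1 0 0 1, ?_⟩
  filter_upwards [(tendsto_chartBlowUp 1 0 0 1).eventually e', hc.comp_chartBlowUp 1 0 0 1]
    with z h1 h2
  rw [h2] at h1
  obtain ⟨j, hj⟩ := Nat.exists_eq_add_of_le hmν
  have h3 : z.1 ^ ν * z.1 = z.1 ^ m * z.1 ^ j := by rw [← pow_succ, hj, pow_add]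
  rw [hj, Nat.add_sub_cancel_left]
  linear_combination z.1 ^ j * h1 +
    g (chartBlowUp 1 0 0 1 z) * strictTransform 1 0 0 1 m c z * h3

/-- The bounds are known on the last class only, so they stay a hypothesis inside the induction:
each step first brings them down one level, then lifts the data by one blow-up. The tower starts
with g = k = 1 and h the pull-back of f. -/
theorem GermTower.hasReducedPullback (hω : IsFoliationForm ω 0) (hnd : IsNonDicritical ω)
    {f : ℂ × ℂ → ℂ} (hf : IsInvariantCurveEquation ω f) (h : GermTower 𝒢) :
    HasSeparatrixBounds ω 𝒢 → ∀ F ∈ 𝒢, HasReducedPullback ω f F := by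
  induction h with
  | base h =>
    intro _ F hF
    have hFb := h F hF
    have hR := hf.1.hasIsolatedCurveSing
    exact ⟨pullbackForm F ω, fun _ => 1, fun z => f (F z), fun _ => 1, hω.pullbackForm hFb,
      analyticAt_const, analyticAt_const, hR.comp_bihol hFb,
      hf.2.2.wedgeCoeff_pullbackForm hf.1.1 hFb.analyticAt hFb.map_zero,
      Eventually.of_forall fun z => (form_ext (by simp) (by simp)),
      Eventually.of_forall fun z => rfl⟩
  | step h hdown hup ih =>
    intro hQ F hF
    have hQ' := hQ.descend hω.1 hnd h hup
    obtain hF | ⟨F', hF', hbl, Φ, hΦ, e⟩ := hdown F hF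
    · exact ih hQ' F hF
    · refine HasReducedPullback.congr ?_ e.symm
      exact ((ih hQ' F' hF').blowUp hω.1 hnd h hQ hF' hbl).comp_bihol
        ((h.analyticAt_and_map_zero F' hF').1.comp_zero (analyticAt_blowUpMap 0) blowUpMap_zero) hΦ

end Induction

/-! ### Local biholomorphisms of surfaces -/

section LocalIso

variable {M N P : Type*} [TopologicalSpace M] [ChartedSpace (ℂ × ℂ) M]
  [TopologicalSpace N] [ChartedSpace (ℂ × ℂ) N] [TopologicalSpace P] [ChartedSpace (ℂ × ℂ) P]

/-- `f` is biholomorphic near `x`, with a holomorphic inverse near `f x`. -/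
def IsLocalIso (f : M → N) (x : M) : Prop :=
  ContMDiffAt 𝓘(ℂ, ℂ × ℂ) 𝓘(ℂ, ℂ × ℂ) (⊤ : WithTop ℕ∞) f x ∧ ∃ g : N → M,
    ContMDiffAt 𝓘(ℂ, ℂ × ℂ) 𝓘(ℂ, ℂ × ℂ) (⊤ : WithTop ℕ∞) g (f x) ∧
    (∀ᶠ y in 𝓝 (f x), f (g y) = y) ∧ ∀ᶠ y in 𝓝 x, g (f y) = y

theorem IsLocalIso.continuousAt {f : M → N} {x : M} (hf : IsLocalIso f x) : ContinuousAt f x :=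
  hf.1.continuousAt

theorem IsLocalIso.congr {f f' : M → N} {x : M} (hf : IsLocalIso f x) (h : f' =ᶠ[𝓝 x] f) :
    IsLocalIso f' x := by
  obtain ⟨h1, g, h2, h3, h4⟩ := hf
  have hx := h.self_of_nhds
  have hg : Tendsto g (𝓝 (f x)) (𝓝 x) := by
    have := h2.continuousAt.tendsto
    rwa [h4.self_of_nhds] at this
  refine ⟨h1.congr_of_eventuallyEq h, g, by rwa [hx], ?_, ?_⟩
  · rw [hx]
    filter_upwards [hg.eventually h, h3] with y h5 h6
    rw [h5, h6]
  · filter_upwards [h, h4] with y h5 h6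
    rw [h5, h6]

theorem IsLocalIso.comp {f : M → N} {g : N → P} {x : M} {y : N} (hg : IsLocalIso g y)
    (hf : IsLocalIso f x) (hy : f x = y) : IsLocalIso (fun z => g (f z)) x := by
  subst hy
  obtain ⟨hf1, f', hf2, hf3, hf4⟩ := hf
  obtain ⟨hg1, g', hg2, hg3, hg4⟩ := hg
  have e : g' (g (f x)) = f x := hg4.self_of_nhds
  have hg' : Tendsto g' (𝓝 (g (f x))) (𝓝 (f x)) := by
    have := hg2.continuousAt.tendsto
    rwa [e] at this
  refine ⟨hg1.comp x hf1, fun z => f' (g' z), ?_, ?_, ?_⟩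
  · exact ContMDiffAt.comp (g := f') (g (f x)) (by rwa [e]) hg2
  · filter_upwards [hg3, hg'.eventually hf3] with z h1 h2
    rw [h2, h1]
  · filter_upwards [hf4, hf1.continuousAt.tendsto.eventually hg4] with z h1 h2
    rw [h2, h1]

theorem IsLocalIso.exists_inverse {f : M → N} {x : M} (hf : IsLocalIso f x) :
    ∃ g : N → M, IsLocalIso g (f x) ∧ g (f x) = x ∧ (∀ᶠ y in 𝓝 (f x), f (g y) = y) ∧
      ∀ᶠ y in 𝓝 x, g (f y) = y := by
  obtain ⟨h1, g, h2, h3, h4⟩ := hf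
  have e : g (f x) = x := h4.self_of_nhds
  exact ⟨g, ⟨h2, f, by rwa [e], by rwa [e], h3⟩, e, h3, h4⟩

theorem IsLocalDiffeomorphAt.isLocalIso {f : M → N} {x : M}
    (hf : IsLocalDiffeomorphAt 𝓘(ℂ, ℂ × ℂ) 𝓘(ℂ, ℂ × ℂ) (⊤ : WithTop ℕ∞) f x) : IsLocalIso f x :=
  ⟨hf.contMDiffAt, hf.localInverse, hf.localInverse_contMDiffAt,
    hf.localInverse_eventuallyEq_right, hf.localInverse_eventuallyEq_left⟩

theorem isLocalIso_of_analyticAt {Φ Ψ : ℂ × ℂ → ℂ × ℂ} {a : ℂ × ℂ} (hΦ : AnalyticAt ℂ Φ a)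
    (hΨ : AnalyticAt ℂ Ψ (Φ a)) (h1 : ∀ᶠ y in 𝓝 (Φ a), Φ (Ψ y) = y)
    (h2 : ∀ᶠ y in 𝓝 a, Ψ (Φ y) = y) : IsLocalIso Φ a :=
  ⟨contMDiffAt_iff_contDiffAt.2 hΦ.contDiffAt, Ψ, contMDiffAt_iff_contDiffAt.2 hΨ.contDiffAt, h1,
    h2⟩

theorem isLocalIso_add_right (c a : ℂ × ℂ) : IsLocalIso (fun z : ℂ × ℂ => z + c) a :=
  isLocalIso_of_analyticAt (Ψ := fun z => z - c) (analyticAt_id.add analyticAt_const)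
    (analyticAt_id.sub analyticAt_const) (by simp) (by simp)

theorem IsLocalIso.analyticAt {Φ : ℂ × ℂ → ℂ × ℂ} {a : ℂ × ℂ} (h : IsLocalIso Φ a) :
    AnalyticAt ℂ Φ a :=
  (contMDiffAt_iff_contDiffAt.1 h.1).analyticAt

theorem IsLocalIso.jacDet_ne_zero {Φ : ℂ × ℂ → ℂ × ℂ} {a : ℂ × ℂ} (h : IsLocalIso Φ a) :
    jacDet Φ a ≠ 0 := by
  obtain ⟨Ψ, hΨ, e, -, h2⟩ := h.exists_inverse
  intro hj
  have := jacDet_comp h.analyticAt.differentiableAt hΨ.analyticAt.differentiableAt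
  rw [hj, mul_zero, jacDet_congr (Q := fun w => w) h2, jacDet_id] at this
  exact one_ne_zero this

theorem IsLocalIso.isGermBihol {Φ : ℂ × ℂ → ℂ × ℂ} (h : IsLocalIso Φ 0) (h0 : Φ 0 = 0) :
    IsGermBihol Φ :=
  ⟨h.analyticAt, h0, h.jacDet_ne_zero⟩

theorem IsGermBihol.isLocalIso {Φ : ℂ × ℂ → ℂ × ℂ} (h : IsGermBihol Φ) : IsLocalIso Φ 0 := by
  obtain ⟨Ψ, hΨ, h1, h2⟩ := h.exists_inverse
  exact isLocalIso_of_analyticAt h.analyticAt (by rw [h.map_zero]; exact hΨ.analyticAt)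
    (by rw [h.map_zero]; exact h1) h2

theorem isLocalIso_chart_symm {ψ : OpenPartialHomeomorph M (ℂ × ℂ)}
    (hψ : ψ ∈ IsManifold.maximalAtlas 𝓘(ℂ, ℂ × ℂ) (⊤ : WithTop ℕ∞) M) {w : ℂ × ℂ}
    (hw : w ∈ ψ.target) : IsLocalIso ψ.symm w := by
  have hs := ψ.map_target hw
  refine ⟨contMDiffAt_symm_of_mem_maximalAtlas hψ hw, ψ, contMDiffAt_of_mem_maximalAtlas hψ hs,
    ?_, ?_⟩
  · filter_upwards [ψ.open_source.mem_nhds hs] with y hy using ψ.left_inv hy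
  · filter_upwards [ψ.open_target.mem_nhds hw] with y hy using ψ.right_inv hy

end LocalIso

/-! ### Local parametrizations of surfaces -/

section LocalParam

variable {M N : Type*} [TopologicalSpace M] [ChartedSpace (ℂ × ℂ) M]
  [TopologicalSpace N] [ChartedSpace (ℂ × ℂ) N]

/-- `s` is a germ at the origin of a holomorphic parametrization of a neighbourhood of `q`. -/
def IsLocalParam (s : ℂ × ℂ → M) (q : M) : Prop :=
  s 0 = q ∧ IsLocalIso s 0

theorem isLocalParam_chart {ψ : OpenPartialHomeomorph M (ℂ × ℂ)}
    (hψ : ψ ∈ IsManifold.maximalAtlas 𝓘(ℂ, ℂ × ℂ) (⊤ : WithTop ℕ∞) M) {w : ℂ × ℂ}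
    (hw : w ∈ ψ.target) : IsLocalParam (fun z => ψ.symm (z + w)) (ψ.symm w) :=
  ⟨by simp, (isLocalIso_chart_symm hψ hw).comp (isLocalIso_add_right w 0) (zero_add w)⟩

theorem IsLocalParam.comp_bihol {s : ℂ × ℂ → M} {q : M} (hs : IsLocalParam s q)
    {Φ : ℂ × ℂ → ℂ × ℂ} (hΦ : IsGermBihol Φ) : IsLocalParam (fun z => s (Φ z)) q :=
  ⟨by simp only [hΦ.map_zero, hs.1], hs.2.comp hΦ.isLocalIso hΦ.map_zero⟩

theorem IsLocalParam.map {s : ℂ × ℂ → M} {q : M} (hs : IsLocalParam s q) {f : M → N}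
    (hf : IsLocalIso f q) : IsLocalParam (fun z => f (s z)) (f q) :=
  ⟨congrArg f hs.1, hf.comp hs.2 hs.1⟩

theorem IsLocalParam.exists_eq_comp {s s' : ℂ × ℂ → M} {q : M} (hs : IsLocalParam s q)
    (hs' : IsLocalParam s' q) : ∃ Φ, IsGermBihol Φ ∧ s' =ᶠ[𝓝 0] fun z => s (Φ z) := by
  obtain ⟨r, hr, hr0, h1, -⟩ := hs.2.exists_inverse
  rw [hs.1] at hr hr0 h1
  refine ⟨fun z => r (s' z), (hr.comp hs'.2 hs'.1).isGermBihol (by rw [hs'.1, hr0]), ?_⟩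
  have ht := hs'.2.continuousAt.tendsto
  rw [hs'.1] at ht
  filter_upwards [ht.eventually h1] with z hz
  rw [hz]

theorem IsLocalParam.exists_lift {f : M → N} {q : M} (hf : IsLocalIso f q) {s : ℂ × ℂ → N}
    (hs : IsLocalParam s (f q)) : ∃ s', IsLocalParam s' q ∧ s =ᶠ[𝓝 0] fun z => f (s' z) := by
  obtain ⟨g, hg, hg0, h1, -⟩ := hf.exists_inverse
  refine ⟨fun z => g (s z), ?_, ?_⟩
  · have := hs.map hg
    rwa [hg0] at this
  · have ht := hs.2.continuousAt.tendsto
    rw [hs.1] at ht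
    filter_upwards [ht.eventually h1] with z hz
    rw [hz]

theorem IsLocalParam.continuousAt_of_comp {Z : Type*} [TopologicalSpace Z] {s : ℂ × ℂ → M}
    {q : M} (hs : IsLocalParam s q) {f : M → Z} (h : ContinuousAt (fun z => f (s z)) 0) : ContinuousAt f q := by
  obtain ⟨r, hr, hr0, h1, -⟩ := hs.2.exists_inverse
  rw [hs.1] at hr hr0 h1
  have h2 : ContinuousAt (fun x => f (s (r x))) q :=
    ContinuousAt.comp (f := r) (g := fun z => f (s z)) (by rwa [hr0]) hr.continuousAt
  exact h2.congr (h1.mono fun x hx => by simp only [hx])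

end LocalParam

/-! ### Lifting biholomorphisms to the blow-up -/

section Lifting

/-- A biholomorphic germ lifts to a biholomorphic germ between the blown up planes. -/
theorem IsGermBihol.exists_lift_blowUpMap {κ : ℂ × ℂ → ℂ × ℂ} (hκ : IsGermBihol κ) :
    ∃ κ', IsGermBihol κ' ∧
      ((∃ c, (fun z => κ (blowUpMap z)) =ᶠ[𝓝 0] fun z => linMap 1 0 c 1 (blowUpMap (κ' z))) ∨
        (fun z => κ (blowUpMap z)) =ᶠ[𝓝 0] fun z => Prod.swap (blowUpMap (κ' z))) := by
  -- In the chart κ becomes (x a, x b), with (a(0), b(0)) the image of the horizontal direction. If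
  -- a(0) ≠ 0 this direction has slope c = b(0) / a(0), and the lift is (x a, b / a - c).
  have key : ∀ κ : ℂ × ℂ → ℂ × ℂ, IsGermBihol κ → (fderiv ℂ κ 0 (1, 0)).1 ≠ 0 →
      ∃ κ' c, IsGermBihol κ' ∧ c * (fderiv ℂ κ 0 (1, 0)).1 = (fderiv ℂ κ 0 (1, 0)).2 ∧
        (fun z => κ (blowUpMap z)) =ᶠ[𝓝 0] fun z => linMap 1 0 c 1 (blowUpMap (κ' z)) := by
    intro κ hκ hne
    have hA : AnalyticAt ℂ (fun z => κ (blowUpMap z)) 0 :=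
      hκ.analyticAt.comp_zero (analyticAt_blowUpMap 0) blowUpMap_zero
    have h0 : ∀ y : ℂ, κ (blowUpMap (0, y)) = 0 := by
      intro y
      have : blowUpMap (0, y) = 0 := by simp [blowUpMap]
      rw [this, hκ.map_zero]
    obtain ⟨a, ha, ea⟩ := exists_eq_fst_mul hA.fst_comp
      (Eventually.of_forall fun y => by rw [h0]; rfl)
    obtain ⟨b, hb, eb⟩ := exists_eq_fst_mul hA.snd_comp
      (Eventually.of_forall fun y => by rw [h0]; rfl)
    have hfd : fderiv ℂ (fun z => κ (blowUpMap z)) 0 (1, 0) = fderiv ℂ κ 0 (1, 0) := by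
      have h1 : fderiv ℂ (fun z => κ (blowUpMap z)) 0 =
          (fderiv ℂ κ (blowUpMap 0)).comp (fderiv ℂ blowUpMap 0) :=
        fderiv_comp 0 (by rw [blowUpMap_zero]; exact hκ.analyticAt.differentiableAt)
          (analyticAt_blowUpMap 0).differentiableAt
      rw [h1, blowUpMap_zero, ContinuousLinearMap.comp_apply, blowUpMap_eq, fderiv_chartBlowUp]
      simp
    have hval : ∀ u : ℂ × ℂ → ℂ, AnalyticAt ℂ u 0 →
        fderiv ℂ (fun z : ℂ × ℂ => z.1 * u z) 0 (1, 0) = u 0 := by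
      intro u hu
      rw [fderiv_fun_mul differentiableAt_fst hu.differentiableAt]
      simp [fderiv_fst]
    have ha0 : a 0 = (fderiv ℂ κ 0 (1, 0)).1 := by
      have e : (fun z => (κ (blowUpMap z)).1) =ᶠ[𝓝 0] fun z => z.1 * a z := ea
      rw [← hval a ha, ← hfd, ← e.fderiv_eq, fderiv.fst hA.differentiableAt]
      rfl
    have hb0 : b 0 = (fderiv ℂ κ 0 (1, 0)).2 := by
      have e : (fun z => (κ (blowUpMap z)).2) =ᶠ[𝓝 0] fun z => z.1 * b z := eb
      rw [← hval b hb, ← hfd, ← e.fderiv_eq, fderiv.snd hA.differentiableAt]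
      rfl
    rw [← ha0] at hne
    set c := b 0 / a 0 with hc
    have hκ' : AnalyticAt ℂ (fun z => (z.1 * a z, b z / a z - c)) 0 :=
      (analyticAt_fst.mul ha).prod ((hb.div ha hne).sub analyticAt_const)
    have e : (fun z => κ (blowUpMap z)) =ᶠ[𝓝 0]
        fun z => linMap 1 0 c 1 (blowUpMap (z.1 * a z, b z / a z - c)) := by
      filter_upwards [ea, eb, ha.continuousAt.eventually_ne hne] with z h1 h2 h3
      refine Prod.ext (h1.trans ?_) (h2.trans ?_)
      · simp only [linMap, blowUpMap]; ring
      · simp only [linMap, blowUpMap]; field_simp; ring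
    set κ' : ℂ × ℂ → ℂ × ℂ := fun z => (z.1 * a z, b z / a z - c) with hκ'_def
    have h00 : κ' 0 = 0 := by simp [hκ'_def, hc]
    refine ⟨κ', c, ⟨hκ', h00, fun hj => ?_⟩, by rw [← ha0, ← hb0, hc, div_mul_cancel₀ _ hne], e⟩
    have e' : (fun z => κ (blowUpMap z)) =ᶠ[𝓝 0] fun z => chartBlowUp 1 0 c 1 (κ' z) := by
      filter_upwards [e] with z hz
      rw [hz, linMap_blowUpMap]
    -- Each chart has Jacobian x in its own coordinates; comparing the two factorizations and
    -- cancelling x gives the Jacobian of the lift.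
    have hjac : ∀ᶠ z in 𝓝 0, jacDet κ (blowUpMap z) = a z * jacDet κ' z := by
      refine eventually_eq_of_mul_left (h := fun z : ℂ × ℂ => z.1) analyticAt_fst
        (hκ.analyticAt.jacDet.comp_zero (analyticAt_blowUpMap 0) blowUpMap_zero)
        (ha.mul hκ'.jacDet) ?_ not_eventually_fst_eq_zero
      filter_upwards [e'.eventuallyEq_nhds, hκ'.eventually_analyticAt,
        tendsto_blowUpMap.eventually hκ.analyticAt.eventually_analyticAt] with z h1 h2 h3
      have h4 := jacDet_congr h1
      rw [jacDet_comp (analyticAt_blowUpMap z).differentiableAt h3.differentiableAt,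
        jacDet_comp (P := chartBlowUp 1 0 c 1) h2.differentiableAt
          (analyticAt_chartBlowUp _ _ _ _ _).differentiableAt, jacDet_chartBlowUp,
        blowUpMap_eq, jacDet_chartBlowUp] at h4
      rw [blowUpMap_eq]
      have h5 : (κ' z).1 = z.1 * a z := rfl
      rw [h5] at h4
      linear_combination h4
    have := hjac.self_of_nhds
    rw [hj, mul_zero, blowUpMap_zero] at this
    exact hκ.jacDet_ne_zero this
  by_cases h1 : (fderiv ℂ κ 0 (1, 0)).1 = 0
  · have hsw := isGermBihol_swap.comp hκ
    have hd : fderiv ℂ (fun z => Prod.swap (κ z)) 0 (1, 0) = (fderiv ℂ κ 0 (1, 0)).swap := by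
      have : (fun z => Prod.swap (κ z)) = fun z => ((κ z).2, (κ z).1) := rfl
      rw [this, DifferentiableAt.fderiv_prodMk hκ.analyticAt.snd_comp.differentiableAt
        hκ.analyticAt.fst_comp.differentiableAt, fderiv.fst hκ.analyticAt.differentiableAt,
        fderiv.snd hκ.analyticAt.differentiableAt]
      rfl
    have h2 : (fderiv ℂ κ 0 (1, 0)).2 ≠ 0 := by
      intro h2
      refine hκ.jacDet_ne_zero ?_
      rw [jacDet, h1, h2]; ring
    obtain ⟨κ', c, hκ', hc, e⟩ := key _ hsw (by rw [hd]; exact h2)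
    -- After the swap the image direction is exactly horizontal, so no shear is left.
    have hc0 : c = 0 := by
      rw [hd, Prod.fst_swap, Prod.snd_swap, h1] at hc
      exact (mul_eq_zero.1 hc).resolve_right h2
    refine ⟨κ', hκ', Or.inr ?_⟩
    filter_upwards [e] with z hz
    have h3 := congrArg Prod.swap hz
    rw [Prod.swap_swap] at h3
    rw [h3, hc0]
    simp [linMap]
  · obtain ⟨κ', c, hκ', -, e⟩ := key κ hκ h1
    exact ⟨κ', hκ', Or.inl ⟨c, e⟩⟩

end Lifting

/-! ### From blow-ups of surfaces to towers of germs -/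

section BlowUp

variable {X Y : ComplexSurface} {σ : Y → X} {p : X}

theorem IsBlowUp.isLocalIso (hσ : IsBlowUp σ p) {q : Y} (hq : σ q ≠ p) : IsLocalIso σ q :=
  (hσ.isLocalDiffeomorphAt q hq).isLocalIso

/-- The blow-up read in local parametrizations. -/
theorem IsBlowUp.exists_param (hσ : IsBlowUp σ p) : ∃ s₀ : ℂ × ℂ → X, IsLocalParam s₀ p ∧
    (∀ c, ∃ q s, σ q = p ∧ IsLocalParam s q ∧
      (fun z => σ (s z)) =ᶠ[𝓝 0] fun z => s₀ (linMap 1 0 c 1 (blowUpMap z))) ∧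
    (∃ q s, σ q = p ∧ IsLocalParam s q ∧
      (fun z => σ (s z)) =ᶠ[𝓝 0] fun z => s₀ (Prod.swap (blowUpMap z))) ∧
    ∀ q, σ q = p → ∃ s L, IsLocalParam s q ∧ IsGermBihol L ∧
      (fun z => σ (s z)) =ᶠ[𝓝 0] fun z => s₀ (L (blowUpMap z)) := by
  obtain ⟨φ, hφ, ψ₁, hψ₁, ψ₂, hψ₂, hp, hp0, hsrc, ht₁, ht₂, hm₁, hm₂, -, -⟩ := hσ.model
  have h0 : (0 : ℂ × ℂ) ∈ φ.target := by rw [← hp0]; exact φ.map_source hp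
  have hs0 : φ.symm 0 = p := by rw [← hp0]; exact φ.left_inv hp
  have hv₁ : ∀ w ∈ ψ₁.target, σ (ψ₁.symm w) = φ.symm (w.1, w.1 * w.2) := by
    intro w hw
    have h1 := ψ₁.map_target hw
    have h2 : σ (ψ₁.symm w) ∈ φ.source := by
      have : ψ₁.symm w ∈ σ ⁻¹' φ.source := by rw [hsrc]; exact Or.inl h1
      exact this
    have h3 := hm₁ _ h1
    rw [ψ₁.right_inv hw] at h3
    rw [← h3, φ.left_inv h2]
  have hv₂ : ∀ w ∈ ψ₂.target, σ (ψ₂.symm w) = φ.symm (w.1 * w.2, w.2) := by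
    intro w hw
    have h1 := ψ₂.map_target hw
    have h2 : σ (ψ₂.symm w) ∈ φ.source := by
      have : ψ₂.symm w ∈ σ ⁻¹' φ.source := by rw [hsrc]; exact Or.inr h1
      exact this
    have h3 := hm₂ _ h1
    rw [ψ₂.right_inv hw] at h3
    rw [← h3, φ.left_inv h2]
  have hc₁ : ∀ c : ℂ, (0, c) ∈ ψ₁.target := by
    intro c
    rw [ht₁]
    simpa [← Prod.zero_eq_mk] using h0
  have hc₂ : ∀ c : ℂ, (c, 0) ∈ ψ₂.target := by
    intro c
    rw [ht₂]
    simpa [← Prod.zero_eq_mk] using h0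
  have hp₁ : ∀ c : ℂ, IsLocalParam (fun z => ψ₁.symm (z + (0, c))) (ψ₁.symm (0, c)) := fun c =>
    isLocalParam_chart hψ₁ (hc₁ c)
  have hp₂ : ∀ c : ℂ, IsLocalParam (fun z : ℂ × ℂ => ψ₂.symm (z.swap + (c, 0)))
      (ψ₂.symm (c, 0)) := fun c => (isLocalParam_chart hψ₂ (hc₂ c)).comp_bihol isGermBihol_swap
  have he₁ : ∀ c : ℂ, (fun z => σ (ψ₁.symm (z + (0, c)))) =ᶠ[𝓝 0]
      fun z => φ.symm (linMap 1 0 c 1 (blowUpMap z)) := by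
    intro c
    have hcont : Tendsto (fun z : ℂ × ℂ => z + (0, c)) (𝓝 0) (𝓝 (0, c)) := by
      have : Continuous fun z : ℂ × ℂ => z + (0, c) := by fun_prop
      simpa using this.tendsto 0
    filter_upwards [hcont.eventually (ψ₁.open_target.mem_nhds (hc₁ c))] with z hz
    rw [hv₁ _ hz]
    congr 1
    simp only [linMap, blowUpMap, Prod.fst_add, Prod.snd_add]
    ext <;> ring
  have he₂ : ∀ c : ℂ, (fun z : ℂ × ℂ => σ (ψ₂.symm (z.swap + (c, 0)))) =ᶠ[𝓝 0]
      fun z => φ.symm (Prod.swap (linMap 1 0 c 1 (blowUpMap z))) := by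
    intro c
    have hcont : Tendsto (fun z : ℂ × ℂ => z.swap + (c, 0)) (𝓝 0) (𝓝 (c, 0)) := by
      have : Continuous fun z : ℂ × ℂ => z.swap + (c, 0) := by fun_prop
      simpa using this.tendsto 0
    filter_upwards [hcont.eventually (ψ₂.open_target.mem_nhds (hc₂ c))] with z hz
    rw [hv₂ _ hz]
    congr 1
    simp only [linMap, blowUpMap, Prod.fst_add, Prod.snd_add, Prod.swap]
    ext <;> ring
  have hlin : ∀ c : ℂ, IsGermBihol (linMap 1 0 c 1) := fun c => isGermBihol_linMap (by simp)
  refine ⟨φ.symm, ?_, fun c => ⟨_, _, ?_, hp₁ c, he₁ c⟩, ⟨_, _, ?_, hp₂ 0, ?_⟩, fun q hq => ?_⟩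
  · simpa [hs0] using isLocalParam_chart hφ h0
  · rw [hv₁ _ (hc₁ c)]
    simpa [← Prod.zero_eq_mk] using hs0
  · rw [hv₂ _ (hc₂ 0)]
    simpa [← Prod.zero_eq_mk] using hs0
  · simpa [linMap] using he₂ 0
  · have hq' : q ∈ ψ₁.source ∪ ψ₂.source := by
      rw [← hsrc, mem_preimage, hq]; exact hp
    obtain h1 | h1 := hq'
    · have h2 := hm₁ q h1
      rw [hq, hp0] at h2
      have h3 : (ψ₁ q).1 = 0 := (congrArg Prod.fst h2).symm
      have h4 : ψ₁.symm (0, (ψ₁ q).2) = q := by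
        rw [← h3, Prod.mk.eta, ψ₁.left_inv h1]
      have h5 := hp₁ (ψ₁ q).2
      rw [h4] at h5
      exact ⟨_, _, h5, hlin _, he₁ _⟩
    · have h2 := hm₂ q h1
      rw [hq, hp0] at h2
      have h3 : (ψ₂ q).2 = 0 := (congrArg Prod.snd h2).symm
      have h4 : ψ₂.symm ((ψ₂ q).1, 0) = q := by
        rw [← h3, Prod.mk.eta, ψ₂.left_inv h1]
      have h5 := hp₂ (ψ₂ q).1
      rw [h4] at h5
      exact ⟨_, _, h5, isGermBihol_swap.comp (hlin _), he₂ _⟩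

/-- Continuity is not part of the definition; over p it is read off from the local expression of σ.
-/
theorem IsBlowUp.continuous (hσ : IsBlowUp σ p) : Continuous σ := by
  refine continuous_iff_continuousAt.2 fun q => ?_
  by_cases hq : σ q = p
  · obtain ⟨s₀, hs₀, -, -, h⟩ := hσ.exists_param
    obtain ⟨s, L, hs, hL, e⟩ := h q hq
    refine hs.continuousAt_of_comp (ContinuousAt.congr ?_ e.symm)
    have h1 : ContinuousAt (fun z => L (blowUpMap z)) 0 :=
      (hL.analyticAt.comp_zero (analyticAt_blowUpMap 0) blowUpMap_zero).continuousAt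
    refine ContinuousAt.comp (f := fun z => L (blowUpMap z)) (g := s₀) ?_ h1
    simp only [blowUpMap_zero, hL.map_zero]
    exact hs₀.2.continuousAt
  · exact (hσ.isLocalIso hq).continuousAt

/-- Every germ of map obtained from a germ at `p` by a coordinate change and a standard blow-up
parametrizes the blow-up. -/
theorem IsBlowUp.exists_param_comp (hσ : IsBlowUp σ p) {s : ℂ × ℂ → X} (hs : IsLocalParam s p)
    {κ : ℂ × ℂ → ℂ × ℂ} (hκ : IsGermBihol κ) : ∃ q s', σ q = p ∧ IsLocalParam s' q ∧
      (fun z => s (κ (blowUpMap z))) =ᶠ[𝓝 0] fun z => σ (s' z) := by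
  obtain ⟨s₀, hs₀, h₁, h₂, -⟩ := hσ.exists_param
  obtain ⟨Φ, hΦ, e⟩ := hs₀.exists_eq_comp hs
  have ht : Tendsto (fun z => κ (blowUpMap z)) (𝓝 0) (𝓝 0) := hκ.tendsto.comp tendsto_blowUpMap
  obtain ⟨κ', hκ', ⟨c, e'⟩ | e'⟩ := (hΦ.comp hκ).exists_lift_blowUpMap
  · obtain ⟨q, s', hq, hs', e''⟩ := h₁ c
    refine ⟨q, _, hq, hs'.comp_bihol hκ', ?_⟩
    filter_upwards [ht.eventually e, e', hκ'.tendsto.eventually e''] with z a1 a2 a3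
    rw [a1, a2, a3]
  · obtain ⟨q, s', hq, hs', e''⟩ := h₂
    refine ⟨q, _, hq, hs'.comp_bihol hκ', ?_⟩
    filter_upwards [ht.eventually e, e', hκ'.tendsto.eventually e''] with z a1 a2 a3
    rw [a1, a2, a3]

/-- The germs of the map `π` along `π⁻¹(0)`, read in all local parametrizations. -/
def fibreGerms {X : ComplexSurface} (π : X → ℂ × ℂ) : Set (ℂ × ℂ → ℂ × ℂ) :=
  {F | ∃ q s, π q = 0 ∧ IsLocalParam s q ∧ F =ᶠ[𝓝 0] fun z => π (s z)}

theorem IsBlowUp.fibreGerms_mem {π : X → ℂ × ℂ} (hp : π p = 0) (hσ : IsBlowUp σ p)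
    {F : ℂ × ℂ → ℂ × ℂ} {s : ℂ × ℂ → X} (hs : IsLocalParam s p)
    (e : F =ᶠ[𝓝 0] fun z => π (s z)) {κ Φ : ℂ × ℂ → ℂ × ℂ} (hκ : IsGermBihol κ)
    (hΦ : IsGermBihol Φ) : (fun z => F (κ (blowUpMap (Φ z)))) ∈ fibreGerms (π ∘ σ) := by
  obtain ⟨q, s', hq, hs', e'⟩ := hσ.exists_param_comp hs hκ
  refine ⟨q, _, by rw [Function.comp_apply, hq, hp], hs'.comp_bihol hΦ, ?_⟩
  have ht : Tendsto (fun z => κ (blowUpMap z)) (𝓝 0) (𝓝 0) := hκ.tendsto.comp tendsto_blowUpMap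
  filter_upwards [hΦ.tendsto.eventually (ht.eventually e), hΦ.tendsto.eventually e'] with z h1 h2
  rw [h1, h2]
  rfl

/-- Points off the exceptional curve keep their germs since σ is a local biholomorphism there.
Points on it are read in a standard chart over p, and every such chart parametrizes some point over
p. -/
theorem IsBlowUpComposition.germTower {X : ComplexSurface} {π : X → ℂ × ℂ}
    (h : IsBlowUpComposition X π) : GermTower (fibreGerms π) := by
  induction h with
  | neighbourhood hdiff _ _ =>
    refine GermTower.base ?_
    rintro F ⟨q, s, hq, hs, e⟩
    have h1 := hs.map (hdiff q).isLocalIso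
    exact (h1.2.congr e).isGermBihol (by rw [e.self_of_nhds, h1.1, hq])
  | @blowUp X Y π σ p hπ hp hσ ih =>
    refine GermTower.step ih ?_ ?_
    · rintro F ⟨q, s, hq, hs, e⟩
      by_cases hqp : σ q = p
      · right
        obtain ⟨s₀, hs₀, -, -, h⟩ := hσ.exists_param
        obtain ⟨s', L, hs', hL, e'⟩ := h q hqp
        obtain ⟨Φ, hΦ, e''⟩ := hs'.exists_eq_comp hs
        have hm := hs₀.comp_bihol hL
        refine ⟨fun z => π (s₀ (L z)), ⟨p, _, hp, hm, EventuallyEq.rfl⟩, fun κ Ψ hκ hΨ =>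
          hσ.fibreGerms_mem hp hm EventuallyEq.rfl hκ hΨ, Φ, hΦ, ?_⟩
        filter_upwards [e, e'', hΦ.tendsto.eventually e'] with z h1 h2 h3
        rw [h1, Function.comp_apply, h2, h3]
      · exact Or.inl ⟨σ q, _, hq, hs.map (hσ.isLocalIso hqp), e⟩
    · rintro F ⟨q, s, hq, hs, e⟩
      by_cases hqp : q = p
      · subst hqp
        exact Or.inr fun κ Φ hκ hΦ => hσ.fibreGerms_mem hp hs e hκ hΦ
      · left
        obtain ⟨q', hq', rfl⟩ := hσ.bijOn.surjOn hqp
        obtain ⟨s', hs', e'⟩ := hs.exists_lift (hσ.isLocalIso hqp)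
        refine ⟨q', s', hq, hs', ?_⟩
        filter_upwards [e, e'] with z h1 h2
        rw [h1, h2]
        rfl

theorem IsBlowUpComposition.isLocalIso {X : ComplexSurface} {π : X → ℂ × ℂ}
    (h : IsBlowUpComposition X π) : ∀ q, π q ≠ 0 → IsLocalIso π q := by
  induction h with
  | neighbourhood hdiff _ _ => exact fun q _ => (hdiff q).isLocalIso
  | @blowUp X Y π σ p hπ hp hσ ih =>
    intro q hq
    have hqp : σ q ≠ p := fun h => hq (by rw [Function.comp_apply, h, hp])
    exact (ih (σ q) hq).comp (hσ.isLocalIso hqp) rfl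

theorem IsBlowUpComposition.continuous {X : ComplexSurface} {π : X → ℂ × ℂ}
    (h : IsBlowUpComposition X π) : Continuous π := by
  induction h with
  | neighbourhood hdiff _ _ =>
    exact continuous_iff_continuousAt.2 fun q => (hdiff q).isLocalIso.continuousAt
  | blowUp hπ hp hσ ih => exact ih.comp hσ.continuous

/-- The preferred parametrization of a neighbourhood of a point of a surface. -/
theorem isLocalParam_chartAt {X : ComplexSurface} (q : X) :
    IsLocalParam (fun z => (chartAt (ℂ × ℂ) q).symm (z + coords q)) q := by
  have := isLocalParam_chart (IsManifold.chart_mem_maximalAtlas (I := 𝓘(ℂ, ℂ × ℂ))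
    (n := (⊤ : WithTop ℕ∞)) q) (mem_chart_target (ℂ × ℂ) q)
  rwa [(chartAt (ℂ × ℂ) q).left_inv (mem_chart_source _ q)] at this

end BlowUp

/-! ### Translation of a base point to the origin -/

section Translation

theorem tendsto_add_right_zero (c : ℂ × ℂ) :
    Tendsto (fun z : ℂ × ℂ => z + c) (𝓝 0) (𝓝 c) := by
  have : Continuous fun z : ℂ × ℂ => z + c := by fun_prop
  simpa using this.tendsto 0

theorem tendsto_sub_right_zero (c : ℂ × ℂ) :
    Tendsto (fun z : ℂ × ℂ => z - c) (𝓝 c) (𝓝 0) := by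
  have : Continuous fun z : ℂ × ℂ => z - c := by fun_prop
  simpa using this.tendsto c

theorem AnalyticAt.comp_add_right {E : Type*} [NormedAddCommGroup E] [NormedSpace ℂ E]
    {u : ℂ × ℂ → E} {c : ℂ × ℂ} (hu : AnalyticAt ℂ u c) :
    AnalyticAt ℂ (fun z => u (z + c)) 0 :=
  hu.comp_of_eq (f := fun z : ℂ × ℂ => z + c) (analyticAt_id.add analyticAt_const) (zero_add c)

theorem AnalyticAt.comp_sub_right {E : Type*} [NormedAddCommGroup E] [NormedSpace ℂ E]
    {u : ℂ × ℂ → E} {c : ℂ × ℂ} (hu : AnalyticAt ℂ u 0) :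
    AnalyticAt ℂ (fun z => u (z - c)) c :=
  hu.comp_of_eq (f := fun z : ℂ × ℂ => z - c) (analyticAt_id.sub analyticAt_const) (sub_self c)

theorem pullbackForm_comp_add_right (P : ℂ × ℂ → ℂ × ℂ) (ω : ℂ × ℂ → (ℂ × ℂ →L[ℂ] ℂ))
    (c z : ℂ × ℂ) : pullbackForm (fun w => P (w + c)) ω z = pullbackForm P ω (z + c) := by
  simp only [pullbackForm, fderiv_comp_add_right]

theorem dCoeff_comp_add_right (Ω : ℂ × ℂ → (ℂ × ℂ →L[ℂ] ℂ)) (c z : ℂ × ℂ) :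
    dCoeff (fun w => Ω (w + c)) z = dCoeff Ω (z + c) := by
  simp only [dCoeff, extDeriv]
  rw [fderiv_comp_add_right (f := fun w => ContinuousAlternatingMap.ofSubsingleton ℂ (ℂ × ℂ) ℂ
    (0 : Fin 1) (Ω w))]

theorem IsReducedGerm.comp_sub_right {h : ℂ × ℂ → ℂ} {c : ℂ × ℂ} (H : IsReducedGerm h 0) :
    IsReducedGerm (fun z => h (z - c)) c := by
  refine ⟨H.1.comp_sub_right, fun u hu hd => ?_⟩
  obtain ⟨k, hk, e⟩ := hd
  have := H.2 (fun z => u (z + c)) hu.comp_add_right ⟨fun z => k (z + c), hk.comp_add_right, by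
    filter_upwards [(tendsto_add_right_zero c).eventually e] with z hz
    simpa using hz⟩
  simpa using this

theorem IsLogarithmicAt.of_comp_add_right {η : ℂ × ℂ → (ℂ × ℂ →L[ℂ] ℂ)} {g : ℂ × ℂ → ℂ}
    {c : ℂ × ℂ} (H : IsLogarithmicAt (fun z => η (z + c)) (fun z => g (z + c)) 0) :
    IsLogarithmicAt η g c := by
  obtain ⟨hη, hg, hg0, h, α, γ, hh, hα, hγ, e⟩ := H
  refine ⟨by simpa using hη.comp_sub_right (c := c), by simpa using hg.comp_sub_right (c := c),
    fun h0 => hg0 ((tendsto_add_right_zero c).eventually h0), fun z => h (z - c),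
    fun z => α (z - c), fun z => γ (z - c), hh.comp_sub_right, hα.comp_sub_right,
    hγ.comp_sub_right, ?_⟩
  filter_upwards [(tendsto_sub_right_zero c).eventually e] with z hz hgz
  rw [sub_add_cancel] at hz
  obtain ⟨h1, h2⟩ := hz hgz
  refine ⟨h1, ?_⟩
  rw [← h2, dCoeff_comp_add_right (fun w => (g w)⁻¹ • η w), sub_add_cancel]

theorem IsFoliationForm.comp_add_right {τ : ℂ × ℂ → (ℂ × ℂ →L[ℂ] ℂ)} {c : ℂ × ℂ}
    (hτ : IsFoliationForm τ c) : IsFoliationForm (fun z => τ (z + c)) 0 := by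
  refine ⟨hτ.1.comp_add_right, ?_⟩
  have h1 := hτ.2
  rw [eventually_nhdsWithin_iff] at h1 ⊢
  filter_upwards [(tendsto_add_right_zero c).eventually h1] with z hz hz0
  exact hz (by simpa using hz0)

theorem IsReducedFoliation.comp_add_right {τ : ℂ × ℂ → (ℂ × ℂ →L[ℂ] ℂ)} {c : ℂ × ℂ}
    (hτ : AnalyticAt ℂ τ c) (h : IsReducedFoliation τ c) :
    IsReducedFoliation (fun z => τ (z + c)) 0 := by
  have hT := isLocalIso_add_right c 0
  have h0 : (0 : ℂ × ℂ) + c = c := zero_add c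
  refine IsReducedFoliation.pullbackForm (u := fun _ => 1) hT.analyticAt hT.jacDet_ne_zero
    (by simpa using hτ) analyticAt_const one_ne_zero (Eventually.of_forall fun z => ?_)
    (by simpa using h)
  have h2 : fderiv ℂ (fun w : ℂ × ℂ => w + c) z = ContinuousLinearMap.id ℂ (ℂ × ℂ) := by
    rw [fderiv_add_const]; exact fderiv_fun_id
  refine form_ext ?_ ?_ <;> simp [_root_.pullbackForm, h2]

end Translation

/-! ### Forms tangent to a reduced curve are logarithmic -/

section Logarithmic

/-- A form `τ` tangent to the reduced curve `h = 0` gives logarithmic forms `k τ / h`. -/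
theorem isLogarithmicAt_of_invariant {η τ : ℂ × ℂ → (ℂ × ℂ →L[ℂ] ℂ)} {f g h k : ℂ × ℂ → ℂ}
    {a : ℂ × ℂ} (hη : AnalyticAt ℂ η a) (hf : AnalyticAt ℂ f a)
    (hf0 : ¬ ∀ᶠ z in 𝓝 a, f z = 0) (hτ : AnalyticAt ℂ τ a) (hg : AnalyticAt ℂ g a)
    (hk : AnalyticAt ℂ k a) (hh : IsReducedGerm h a) (hd : GermDvd h (wedgeCoeff τ h) a)
    (e : ∀ᶠ z in 𝓝 a, η z = g z • τ z) (e' : ∀ᶠ z in 𝓝 a, g z * h z = k z * f z) :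
    IsLogarithmicAt η f a := by
  obtain ⟨θ, hθ, eθ⟩ := hd
  -- The pole of order two in d(k τ / h) is - k dh ∧ τ / h² = k θ / h, by invariance of h; hence h
  -- d(k τ / h) is dk ∧ τ + k θ + k dτ in coefficients.
  refine ⟨hη, hf, hf0, h, fun z => k z • τ z,
    fun z => -wedgeCoeff τ k z + k z * θ z +
      k z * (fderiv ℂ τ z (1, 0) (0, 1) - fderiv ℂ τ z (0, 1) (1, 0)), hh, hk.smul hτ,
    ((hτ.wedgeCoeff hk).neg.add (hk.mul hθ)).add
      (hk.mul ((hτ.fderiv_apply (1, 0)).form_apply (0, 1) |>.sub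
        ((hτ.fderiv_apply (0, 1)).form_apply (1, 0)))), ?_⟩
  filter_upwards [e.eventually_nhds, e'.eventually_nhds, eθ, hτ.eventually_analyticAt,
    hk.eventually_analyticAt, hh.1.eventually_analyticAt, hf.eventually_analyticAt,
    hg.eventually_analyticAt] with z h1 h2 h3 h4 h5 h6 h7 h8 hfz
  have hs : AnalyticAt ℂ (fun w => g w * (f w)⁻¹) z := h8.mul (h7.inv hfz)
  have hΩ : (fun w => (f w)⁻¹ • η w) =ᶠ[𝓝 z] fun w => (g w * (f w)⁻¹) • τ w := by
    filter_upwards [h1] with w hw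
    refine form_ext ?_ ?_ <;>
    · simp only [hw, smul_apply, smul_eq_mul]
      ring
  -- Where f ≠ 0, k is g h / f, so differentiating it accounts for the derivative of g / f.
  have hk' : k =ᶠ[𝓝 z] fun w => g w * (f w)⁻¹ * h w := by
    filter_upwards [h2, h7.continuousAt.eventually_ne hfz] with w hw hfw
    field_simp
    linear_combination -hw
  have hkz := hk'.self_of_nhds
  constructor
  · refine form_ext ?_ ?_ <;>
    · simp only [h1.self_of_nhds, smul_apply, smul_eq_mul, hkz]
      ring
  have hΩd : AnalyticAt ℂ (fun w => (g w * (f w)⁻¹) • τ w) z := hs.smul h4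
  have hd1 : fderiv ℂ (fun w => (f w)⁻¹ • η w) z = _ := hΩ.fderiv_eq.trans
    (fderiv_fun_smul hs.differentiableAt h4.differentiableAt)
  have hd2 : fderiv ℂ k z = _ := hk'.fderiv_eq.trans
    (fderiv_fun_mul hs.differentiableAt h6.differentiableAt)
  rw [dCoeff_eq _ _ (hΩd.congr hΩ.symm).differentiableAt, hd1]
  simp only [wedgeCoeff, hd2] at h3 ⊢
  simp only [add_apply, smul_apply,
    ContinuousLinearMap.smulRight_apply, smul_eq_mul, hkz]
  linear_combination (g z * (f z)⁻¹) * h3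

end Logarithmic

/-! ### Logarithmicity on and off the fibre over the origin -/

section Resolution

variable {ω : ℂ × ℂ → (ℂ × ℂ →L[ℂ] ℂ)} {X : ComplexSurface} {π : X → ℂ × ℂ}

theorem inChart_mem_fibreGerms {q : X} (hq : π q = 0) :
    (fun z => inChart π q (z + coords q)) ∈ fibreGerms π :=
  ⟨q, _, hq, isLocalParam_chartAt q, EventuallyEq.rfl⟩

/-- A resolution provides one reduced saturation in the preferred chart at each point. Any other
saturation, in any parametrization, differs from it by a coordinate change and a unit, which
preserve reducedness. -/
theorem IsResolution.hasSeparatrixBounds (hω : IsFoliationForm ω 0) (hπ : IsResolution ω π) :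
    HasSeparatrixBounds ω (fibreGerms π) := by
  have hT := hπ.1.germTower
  rintro F hF τ hsat
  have hF' := hF
  obtain ⟨q, s, hq, hs, e⟩ := hF
  obtain ⟨Φ, hΦ, eΦ⟩ := (isLocalParam_chartAt q).exists_eq_comp hs
  obtain ⟨τ₀, ⟨hτ₀, g₀, hg₀, e₀⟩, hred⟩ := hπ.2 q hq
  obtain ⟨hτ, g, hg, eg⟩ := hsat
  set F₀ : ℂ × ℂ → ℂ × ℂ := fun z => inChart π q (z + coords q) with hF₀
  set τ₁ : ℂ × ℂ → (ℂ × ℂ →L[ℂ] ℂ) := fun z => τ₀ (z + coords q) with hτ₁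
  have hτ₁F : IsFoliationForm τ₁ 0 := hτ₀.comp_add_right
  obtain ⟨hF₀A, -⟩ := hT.analyticAt_and_map_zero F₀ (inChart_mem_fibreGerms hq)
  have e₁ : ∀ᶠ z in 𝓝 0, pullbackForm F₀ ω z = g₀ (z + coords q) • τ₁ z := by
    filter_upwards [(tendsto_add_right_zero (coords q)).eventually e₀] with z hz
    rw [hF₀, pullbackForm_comp_add_right, hz]
  have e₂ := eventually_pullbackForm_comp (g := fun z => g₀ (z + coords q)) hF₀A hΦ.analyticAt
    hΦ.map_zero e₁
  have e₃ : F =ᶠ[𝓝 0] fun z => F₀ (Φ z) := by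
    filter_upwards [e, eΦ] with z h1 h2
    rw [h1, h2]
    rfl
  have e₄ : ∀ᶠ z in 𝓝 0, g z • τ z = g₀ (Φ z + coords q) • pullbackForm Φ τ₁ z := by
    filter_upwards [eg, e₂, pullbackForm_congr (τ := ω) (σ := ω) e₃
      (e₃.mono fun z hz => by rw [hz])] with z h1 h2 h3
    rw [← h1, h3, h2]
  obtain ⟨u, hu, hu0, eu⟩ := hτ.exists_unit (hτ₁F.pullbackForm hΦ) hg
    (IsSaturation.not_eventually_zero (hT.pullbackForm_not_eventually_zero hω hF') eg) e₄
  have hΦ0 := hΦ.map_zero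
  refine IsReducedFoliation.separatrixBound hτ.1 (IsReducedFoliation.pullbackForm hΦ.analyticAt
    hΦ.jacDet_ne_zero ?_ hu hu0 eu ?_)
  · rw [hΦ0]; exact hτ₁F.1
  · rw [hΦ0]; exact hred.comp_add_right hτ₀.1

theorem IsResolution.isLogarithmicPullbackAt_of_eq_zero (hω : IsFoliationForm ω 0)
    (hnd : IsNonDicritical ω) {f : ℂ × ℂ → ℂ} (hf : IsInvariantCurveEquation ω f)
    (hπ : IsResolution ω π) {q : X} (hq : π q = 0) : IsLogarithmicPullbackAt π ω f q := by
  have hT := hπ.1.germTower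
  have hF := inChart_mem_fibreGerms hq
  obtain ⟨hFA, hF0⟩ := hT.analyticAt_and_map_zero _ hF
  obtain ⟨τ, g, h, k, hτ, hg, hk, hh, hd, e, e'⟩ :=
    hT.hasReducedPullback hω hnd hf (hπ.hasSeparatrixBounds hω) _ hF
  refine IsLogarithmicAt.of_comp_add_right ?_
  simp only [← pullbackForm_comp_add_right]
  exact isLogarithmicAt_of_invariant (hFA.pullbackForm (by rw [hF0]; exact hω.1))
    (hf.1.1.comp_zero hFA hF0)
    (hT.not_eventually_comp _ hF f hf.1.1 hf.1.not_eventually_zero) hτ.1 hg hk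
    hh.isReducedGerm hd e e'

/-- Where `F` is a local biholomorphism and the curve `f = 0` is smooth, `F^* (ω / f)` is
logarithmic. -/
theorem isLogarithmicAt_of_isLocalIso {f : ℂ × ℂ → ℂ} {F : ℂ × ℂ → ℂ × ℂ} {a b : ℂ × ℂ}
    (hF : IsLocalIso F a) (hb : F a = b) (hω : AnalyticAt ℂ ω b) (hf : AnalyticAt ℂ f b)
    (hs : f b ≠ 0 ∨ fderiv ℂ f b ≠ 0) (hd : GermDvd f (wedgeCoeff ω f) b) :
    IsLogarithmicAt (pullbackForm F ω) (fun z => f (F z)) a := by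
  subst hb
  have hFA := hF.analyticAt
  have hη : AnalyticAt ℂ (pullbackForm F ω) a := hFA.pullbackForm hω
  have hfF : AnalyticAt ℂ (fun z => f (F z)) a := hf.comp hFA
  have hs' : f (F a) ≠ 0 ∨ fderiv ℂ (fun z => f (F z)) a ≠ 0 := by
    refine hs.imp_right fun h1 h2 => h1 ?_
    have h3 : fderiv ℂ (fun z => f (F z)) a = (fderiv ℂ f (F a)).comp (fderiv ℂ F a) :=
      fderiv_comp a hf.differentiableAt hFA.differentiableAt
    rw [h2] at h3
    obtain ⟨L, hL⟩ := exists_equiv_of_jacDet_ne_zero hF.jacDet_ne_zero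
    rw [← hL] at h3
    refine ContinuousLinearMap.ext fun x => ?_
    simpa using (congrArg (fun M : ℂ × ℂ →L[ℂ] ℂ => M (L.symm x)) h3).symm
  have hR := isReducedGerm_of_smooth hfF hs'
  obtain ⟨k, hk, e⟩ := hd
  refine isLogarithmicAt_of_invariant (g := fun _ => 1) (h := fun z => f (F z)) (k := fun _ => 1)
    hη hfF ?_ hη analyticAt_const analyticAt_const hR ⟨fun z => jacDet F z * k (F z),
      hFA.jacDet.mul (hk.comp hFA), ?_⟩ (Eventually.of_forall fun z => form_ext (by simp) (by simp))
      (Eventually.of_forall fun z => rfl)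
  · intro h0
    obtain h1 | h1 := hs'
    · exact h1 h0.self_of_nhds
    · refine h1 ?_
      have : (fun z => f (F z)) =ᶠ[𝓝 a] fun _ => 0 := h0
      rw [this.fderiv_eq, fderiv_fun_const]
      rfl
  · filter_upwards [hFA.continuousAt.tendsto.eventually e, hFA.eventually_analyticAt,
      hFA.continuousAt.tendsto.eventually hf.eventually_analyticAt] with z h1 h2 h3
    rw [wedgeCoeff_pullbackForm h2.differentiableAt h3.differentiableAt, h1]
    ring

theorem IsBlowUpComposition.isLogarithmicPullbackAt_of_ne_zero (hπ : IsBlowUpComposition X π)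
    {f : ℂ × ℂ → ℂ} {q : X} (hq : π q ≠ 0) (hω : AnalyticAt ℂ ω (π q))
    (hf : AnalyticAt ℂ f (π q)) (hs : f (π q) ≠ 0 ∨ fderiv ℂ f (π q) ≠ 0)
    (hd : GermDvd f (wedgeCoeff ω f) (π q)) : IsLogarithmicPullbackAt π ω f q := by
  refine isLogarithmicAt_of_isLocalIso ?_ ?_ hω hf hs hd
  · have h1 := isLocalIso_chart_symm (IsManifold.chart_mem_maximalAtlas (I := 𝓘(ℂ, ℂ × ℂ))
      (n := (⊤ : WithTop ℕ∞)) q) (mem_chart_target (ℂ × ℂ) q)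
    exact (hπ.isLocalIso q hq).comp h1 ((chartAt (ℂ × ℂ) q).left_inv (mem_chart_source _ q))
  · exact congrArg π ((chartAt (ℂ × ℂ) q).left_inv (mem_chart_source _ q))

end Resolution

end

theorem mainTheorem5
    (ω : ℂ × ℂ → (ℂ × ℂ →L[ℂ] ℂ)) (hω : IsFoliationForm ω 0) (hnd : IsNonDicritical ω)
    (f : ℂ × ℂ → ℂ) (hf : IsInvariantCurveEquation ω f)
    (X : ComplexSurface) (π : X → ℂ × ℂ) (hπ : IsResolution ω π) :
    ∃ V : Set X, IsOpen V ∧ π ⁻¹' {0} ⊆ V ∧ ∀ q ∈ V, IsLogarithmicPullbackAt π ω f q := by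
  obtain ⟨k, hk, e⟩ := hf.2.2
  -- V is the preimage of a neighbourhood U of 0 where all data are holomorphic, f divides ω ∧ df,
  -- and f = 0 is smooth off 0. Outside the fibre π is then a local biholomorphism to a point where
  -- f itself serves as h.
  obtain ⟨U, hU, hUo, h0⟩ := eventually_nhds_iff.1 (hω.1.eventually_analyticAt.and
    (hf.1.1.eventually_analyticAt.and (hk.eventually_analyticAt.and (e.eventually_nhds.and
      hf.1.hasIsolatedCurveSing.eventually_smooth))))
  refine ⟨π ⁻¹' U, hUo.preimage hπ.1.continuous, fun q hq => ?_, fun q hq => ?_⟩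
  · rw [mem_preimage, mem_singleton_iff] at hq
    rwa [mem_preimage, hq]
  · by_cases hq0 : π q = 0
    · exact hπ.isLogarithmicPullbackAt_of_eq_zero hω hnd hf hq0
    · obtain ⟨h1, h2, h3, h4, h5⟩ := hU _ hq
      exact hπ.1.isLogarithmicPullbackAt_of_ne_zero hq0 h1 h2 (h5 hq0) ⟨k, h3, h4⟩
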